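/- **Conventions.** QPT means a uniform polynomial-size family of quantum circuits over a fixed finite universal gate set. For an adversary with parties indexed by $i$, the circuit of the $i$-th party is produced by a polynomial-time machine from $(1^\lambda,1^i)$. "$n,k=\mathrm{poly}$" means that $n,k:\mathbb N\to\mathbb N$ are bounded above by polynomials in $\lambda$. A function $\mathrm{negl}$ is negligible if $|\mathrm{negl}(\lambda)|<\lambda^{c}$ for every $c<0$ and all large $\lambda$. **Balanced binary function (BBF).** A BBF consists of QPT procedures $\mathsf{Sample}(1^\lambda)$, which outputs a description $f$, and a deterministic $\mathsf{Eval}$, which computes $f(x)\in\{0,1\}$ for $x\in\{0,1\}^{\ell(\lambda)}$, such that $|\Pr[f(x)=0]-\Pr[f(x)=1]|$ is negligible for sampled $f$ and uniform $x$. **Copy protection.** A copy-protection scheme $\mathsf{QCP}$ for a BBF consists of QPT procedures $\mathcal{P}rotect$ and $\mathcal{E}val$ such that if $\rho_f\gets\mathcal{P}rotect(f)$ then $\mathcal{E}val(\rho_f,x)=f(x)$ with certainty, for every $f$ that $\mathsf{Sample}$ may output and every $x$. **FLIP-QCP.** In the game with parameters $n,k$, the challenger samples $f$ and uniform bits $b_1,\dots,b_{n+k}$,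 and gives $n$ independent copies $\rho_f$ to a pirate. The pirate creates a joint state $\sigma_1,\dots,\sigma_{n+k}$. The $i$-th freeloader gets $\sigma_i$ and an oracle which, without input, returns $(r,f(r)\oplus b_i)$ for a fresh uniform $r\in\{0,1\}^\ell$, and outputs a bit $b_i'$. The output of the game is $\#\{i: b_i'=b_i\}$. $\mathsf{QCP}$ is $\mathsf{FLIP\text{-}QCP}^{n,k}$ secure if every QPT adversary has expected output at most $n+k/2+\mathrm{negl}(\lambda)$. It is $\mathsf{FLIP\text{-}QCP}$ secure if this holds for all $n,k=\mathrm{poly}$. **UD-qCPA.** For an uncloneable decryptors scheme with key generation, decryptor generation, encryption and (classical and quantum) decryption, the challenger generates a key $\mathsf{sk}$ and uniform bits $b_1,\dots,b_{n+k}$, and gives $n$ decryptors to a pirate. The pirate, who has quantum access to $\mathsf{Enc}_{\mathsf{sk}}$ (each query samples fresh randomness $r$ and applies $|m,x\rangle\mapsto|m,x\oplus \mathsf{Enc}_{\mathsf{sk}}(m;r)\rangle$), creates states $\sigma_1,\dots,\sigma_{n+k}$ and pairs of classical plaintexts $(m_0^i,m_1^i)$ with $|m_0^i|=|m_1^i|$.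 The $i$-th distinguisher gets $\sigma_i$ and $c_i\gets\mathsf{Enc}_{\mathsf{sk}}(m^i_{b_i})$, has the same quantum oracle access, and outputs a bit $\beta_i$. The output of the game is $\#\{i:\beta_i=b_i\}$. $\mathsf{UD\text{-}qCPA}^{n,k}$ and $\mathsf{UD\text{-}qCPA}$ security are defined by the same bound $n+k/2+\mathrm{negl}(\lambda)$ as above. **The scheme.** Given a copy-protection scheme $\mathsf{QCP}$ for a BBF, let $\mathsf{1UD}^{\mathsf{cpa}}$ be the bit encryption scheme with key generation $\mathsf{Sample}$, decryptor generation $\mathcal{P}rotect$, encryption $\mathsf{Enc}_f(b)=(r,b\oplus f(r))$ for uniform $r\in\{0,1\}^{\ell}$, classical decryption $(r,\hat b)\mapsto \hat b\oplus f(r)$ and quantum decryption $(\rho,(r,\hat b))\mapsto\hat b\oplus\mathcal{E}val(\rho,r)$. Its bit-by-bit extension encrypts and decrypts the bits of a message of arbitrary length one after the other, independently, under the same key (resp. with the same decryptor). **Proposition.** 1. For all $n,k=\mathrm{poly}$ with $n(\lambda)\ge 1$ for all $\lambda$: if $\mathsf{QCP}$ is $\mathsf{FLIP\text{-}QCP}^{n,k}$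 secure, then the bit-by-bit extension of $\mathsf{1UD}^{\mathsf{cpa}}$ is $\mathsf{UD\text{-}qCPA}^{n,k}$ secure. 2. If $\mathsf{QCP}$ is $\mathsf{FLIP\text{-}QCP}$ secure, then the bit-by-bit extension of $\mathsf{1UD}^{\mathsf{cpa}}$ is $\mathsf{UD\text{-}qCPA}$ secure. -/

import Mathlib

open scoped symmDiff

namespace QCrypto

/-! ### Asymptotics -/

/-- A function is negligible if it is eventually smaller than every inverse power of `l`. -/
def Negligible (f : ℕ → ℝ) : Prop :=
  ∀ c : ℝ, c < 0 → ∀ᶠ l : ℕ in Filter.atTop, |f l| < (l : ℝ) ^ c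

/-- `f = poly(l)`: `f` is bounded above by a polynomial. -/
def PolyBounded (f : ℕ → ℕ) : Prop :=
  ∃ p : Polynomial ℕ, ∀ l, f l ≤ p.eval l

/-! ### Circuits -/

/-- The elementary gates (a fixed finite universal set: Clifford + T, with Toffoli), acting on
qubits labelled by elements of `α`. -/
inductive Gate (α : Type) where
  | H (q : α)
  | T (q : α)
  | Tinv (q : α)
  | X (q : α)
  | CX (c t : α)
  | CCX (c d t : α)

namespace Gate

/-- Relabelling of the qubits of a gate. -/
def map {α β : Type} (e : α → β) : Gate α → Gate β
  | H q => H (e q)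
  | T q => T (e q)
  | Tinv q => Tinv (e q)
  | X q => X (e q)
  | CX c t => CX (e c) (e t)
  | CCX c d t => CCX (e c) (e d) (e t)

/-- The inverse gate. -/
def inv {α : Type} : Gate α → Gate α
  | T q => Tinv q
  | Tinv q => T q
  | g => g

end Gate

/-- A wire of a procedure whose registers have kinds in `κ`: a register (a kind and an index)
together with a position in that register. -/
abbrev Wire (κ : Type) := κ × ℕ × ℕ

/-- One operation of an oracle circuit: an elementary gate, or an oracle call. The call
`query len src tgt` takes as its input the first `len` qubits of the register `src`; the answer is
XORed into the register `tgt`. -/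
inductive Op (κ : Type) where
  | gate (g : Gate (Wire κ))
  | query (len : ℕ) (src tgt : κ × ℕ)

/-- A circuit is a list of operations, in order of application. Its size is the length of the
list. -/
abbrev Circuit (κ : Type) := List (Op κ)

/-- The inverse circuit. -/
def Circuit.inv {κ : Type} (C : Circuit κ) : Circuit κ :=
  (C.map fun
    | Op.gate g => Op.gate g.inv
    | o => o).reverse

/-- Relabelling the wires of the elementary gates of an oracle-free circuit. -/
def Circuit.relabel {κ κ' : Type} (e : Wire κ → Wire κ') (C : Circuit κ) : Circuit κ' :=
  C.filterMap fun
    | Op.gate g => some (Op.gate (g.map e))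
    | Op.query _ _ _ => none

/-! ### Uniformity: a machine that writes circuits -/

/-- Programs of a classical machine with finitely many unary counters and stacks of numbers, and
with a write-only output tape on which it writes the operations of a circuit one after the other.
The operation in `emit o` names counters where the emitted operation has numbers. -/
inductive Prog (κ : Type) where
  | skip
  | zero (x : ℕ)
  | succ (x : ℕ)
  | pred (x : ℕ)
  | copy (x y : ℕ)
  | push (s x : ℕ)
  | pop (x s : ℕ)
  | emit (o : Op κ)
  | seq (p q : Prog κ)
  | ifz (x : ℕ) (p q : Prog κ)
  | loop (x : ℕ) (p : Prog κ)

/-- The memory of the machine. -/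
structure Mem where
  var : ℕ → ℕ
  stk : ℕ → List ℕ

/-- Assign `v` to the counter `x`. -/
def Mem.setVar (s : Mem) (x v : ℕ) : Mem :=
  { s with var := Function.update s.var x v }

/-- Assign `L` to the stack `x`. -/
def Mem.setStk (s : Mem) (x : ℕ) (L : List ℕ) : Mem :=
  { s with stk := Function.update s.stk x L }

/-- Initial memory: the counters `0, 1, …` hold the inputs, everything else is empty. -/
def Mem.start (inputs : List ℕ) : Mem where
  var := fun x => inputs.getD x 0
  stk := fun _ => []

/-- Replace the counter names in an operation by the contents of the counters. -/
def Op.fill {κ : Type} (v : ℕ → ℕ) : Op κ → Op κ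
  | Op.gate g => Op.gate (g.map fun w => (w.1, v w.2.1, v w.2.2))
  | Op.query x src tgt => Op.query (v x) (src.1, v src.2) (tgt.1, v tgt.2)

/-- `Exec p s s' C t`: started in memory `s`, the program `p` halts in memory `s'` after `t` steps
and has then written the circuit `C`. -/
inductive Exec {κ : Type} : Prog κ → Mem → Mem → Circuit κ → ℕ → Prop
  | skip (s : Mem) : Exec .skip s s [] 1
  | zero (s : Mem) (x : ℕ) : Exec (.zero x) s (s.setVar x 0) [] 1
  | succ (s : Mem) (x : ℕ) : Exec (.succ x) s (s.setVar x (s.var x + 1)) [] 1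
  | pred (s : Mem) (x : ℕ) : Exec (.pred x) s (s.setVar x (s.var x - 1)) [] 1
  | copy (s : Mem) (x y : ℕ) : Exec (.copy x y) s (s.setVar x (s.var y)) [] 1
  | push (s : Mem) (a x : ℕ) : Exec (.push a x) s (s.setStk a (s.var x :: s.stk a)) [] 1
  | pop (s : Mem) (x a : ℕ) :
      Exec (.pop x a) s ((s.setVar x ((s.stk a).headD 0)).setStk a (s.stk a).tail) [] 1
  | emit (s : Mem) (o : Op κ) : Exec (.emit o) s s [o.fill s.var] 1
  | seq {p q : Prog κ} {s s' s'' : Mem} {C C' : Circuit κ} {t t' : ℕ} :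
      Exec p s s' C t → Exec q s' s'' C' t' → Exec (.seq p q) s s'' (C ++ C') (t + t' + 1)
  | ifz_zero {p q : Prog κ} {s s' : Mem} {C : Circuit κ} {t x : ℕ} :
      s.var x = 0 → Exec p s s' C t → Exec (.ifz x p q) s s' C (t + 1)
  | ifz_pos {p q : Prog κ} {s s' : Mem} {C : Circuit κ} {t x : ℕ} :
      s.var x ≠ 0 → Exec q s s' C t → Exec (.ifz x p q) s s' C (t + 1)
  | loop_done {p : Prog κ} {s : Mem} {x : ℕ} :
      s.var x = 0 → Exec (.loop x p) s s [] 1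
  | loop_step {p : Prog κ} {s s' s'' : Mem} {C C' : Circuit κ} {t t' x : ℕ} :
      s.var x ≠ 0 → Exec p s s' C t → Exec (.loop x p) s' s'' C' t' →
        Exec (.loop x p) s s'' (C ++ C') (t + t' + 1)

/-- Quantum polynomial time: a polynomial-time machine writes the circuit `C l` on input `1^l`. -/
def QPT {κ : Type} (C : ℕ → Circuit κ) : Prop :=
  ∃ (p : Prog κ) (b : Polynomial ℕ), ∀ l, ∃ s t,
    Exec p (Mem.start [l]) s (C l) t ∧ t ≤ b.eval l

/-- The same for circuits with an additional index: a polynomial-time machine writes the circuit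
`C l i` on input `(1^l, 1^i)`. -/
def IndexedQPT {κ : Type} (C : ℕ → ℕ → Circuit κ) : Prop :=
  ∃ (p : Prog κ) (b : Polynomial ℕ), ∀ l i, ∃ s t,
    Exec p (Mem.start [l, i]) s (C l i) t ∧ t ≤ b.eval (l + i)

/-- A polynomial-time machine computes `1^(f l)` from `1^l` (and leaves it in counter `0`). -/
def PolyTimeLength (f : ℕ → ℕ) : Prop :=
  ∃ (p : Prog Empty) (b : Polynomial ℕ), ∀ l, ∃ s t,
    Exec p (Mem.start [l]) s [] t ∧ s.var 0 = f l ∧ t ≤ b.eval l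

/-! ### States and the action of circuits

The memory consists of qubits labelled by `α`, all but finitely many of which are in state `|0⟩`.
A computational basis state is the finite set of the qubits that are in state `|1⟩`. -/

/-- (Possibly unnormalized) pure states. -/
abbrev State (α : Type) := Finset α →₀ ℂ

section
variable {α κ : Type} [DecidableEq α] [DecidableEq κ]

/-- The computational basis state `|S⟩`. -/
noncomputable def ket (S : Finset α) : State α := Finsupp.single S 1

/-- The action of a gate on a basis state. A controlled gate whose target is also one of its
controls is not a legal gate, and acts as the identity. -/
noncomputable def Gate.onKet : Gate α → Finset α → State α
  | .H q, S => ((Real.sqrt 2 : ℂ))⁻¹ •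
      (ket (S.erase q) + (if q ∈ S then (-1 : ℂ) else 1) • ket (insert q S))
  | .T q, S => (if q ∈ S then Complex.exp (Real.pi / 4 * Complex.I) else 1) • ket S
  | .Tinv q, S => (if q ∈ S then Complex.exp (-(Real.pi / 4 * Complex.I)) else 1) • ket S
  | .X q, S => ket (S ∆ {q})
  | .CX c t, S => ket (if c ≠ t ∧ c ∈ S then S ∆ {t} else S)
  | .CCX c d t, S => ket (if c ≠ t ∧ d ≠ t ∧ c ∈ S ∧ d ∈ S then S ∆ {t} else S)

/-- The action of a gate on states, by linearity. -/
noncomputable def Gate.apply (g : Gate α) : State α →ₗ[ℂ] State α :=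
  Finsupp.linearCombination ℂ g.onKet

/-- The probability that measuring `ψ` in the computational basis gives an `S` with `P S`. -/
noncomputable def prob (ψ : State α) (P : Finset α → Prop) : ℝ :=
  open Classical in ψ.sum fun S a => if P S then ‖a‖ ^ 2 else 0

/-- The average over uniformly random strings of `m` bits. -/
noncomputable def avgBits (m : ℕ) (K : List Bool → ℝ) : ℝ :=
  (∑ r : Fin m → Bool, K (List.ofFn r)) / 2 ^ m

/-- Measurement of the classical information `R` (a function of the computational basis state),
followed by a continuation `K` whose value depends on the outcome and on the (unnormalized)
post-measurement state. Since the values of the games below are quadratic in the state, adding up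
over the outcomes gives the expected value. -/
noncomputable def measure {β : Type} (R : Finset α → β) (K : β → State α → ℝ) (ψ : State α) : ℝ :=
  open Classical in ∑ y ∈ ψ.support.image R, K y (ψ.filter fun S => R S = y)

/-- The contents of the first `n` qubits of the register `r`. -/
def readBits (r : ℕ → α) (n : ℕ) (S : Finset α) : List Bool :=
  (List.range n).map fun j => decide (r j ∈ S)

/-- The number of leading ones in the register `r`. -/
def readLen (r : ℕ → α) (S : Finset α) : ℕ :=
  ((List.range S.card).takeWhile fun j => decide (r j ∈ S)).length

/-- Strings of arbitrary length are kept in a pair of registers: `data` holds the bits of the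
string, `len` its length in unary. -/
def readStr (len data : ℕ → α) (S : Finset α) : List Bool :=
  readBits data (readLen len S) S

/-- The qubits of the register `r` at which the string `s` has a one. -/
def ones (r : ℕ → α) (s : List Bool) : Finset α :=
  ((Finset.range s.length).filter fun j => s.getD j false = true).image r

/-- XOR the string `s` into the register `r`. -/
def xorBits (r : ℕ → α) (s : List Bool) (S : Finset α) : Finset α :=
  S ∆ ones r s

/-- Write a string of arbitrary length into a pair of registers (initially empty). -/
def writeStr (len data : ℕ → α) (s : List Bool) (S : Finset α) : Finset α :=
  xorBits data s (xorBits len (List.replicate s.length true) S)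

/-- A randomized classical function `m ↦ fn m r`; on inputs of length `L` the random string `r`
consists of `coins L` uniformly random bits. -/
structure Oracle where
  coins : ℕ → ℕ
  fn : List Bool → List Bool → List Bool

/-- The register `r` of a procedure whose wires are placed in the memory by `e`. -/
def regAt (e : Wire κ → α) (r : κ × ℕ) : ℕ → α := fun j => e (r.1, r.2, j)

/-- The map `|m, x⟩ ↦ |m, x ⊕ f(m)⟩` on basis states, with `m` the first `len` qubits of `src` and
`x` in the register `tgt`. (If both registers are the same, the call is illegal and does
nothing.) -/
def queryMap (e : Wire κ → α) (len : ℕ) (src tgt : κ × ℕ) (f : List Bool → List Bool)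
    (S : Finset α) : Finset α :=
  if src = tgt then S else xorBits (regAt e tgt) (f (readBits (regAt e src) len S)) S

/-- Run an oracle-free circuit, with its wires placed in the memory by `e`. (Without an oracle,
oracle calls do nothing.) -/
noncomputable def exec (e : Wire κ → α) : Circuit κ → State α → State α
  | [], ψ => ψ
  | .gate g :: C, ψ => exec e C ((g.map e).apply ψ)
  | .query _ _ _ :: C, ψ => exec e C ψ

/-- Run a circuit with quantum access to the randomized oracle `O`, and then continue with `K`; the
result is the expected value. Each oracle call samples a fresh random string `r` and applies the
unitary `|m, x⟩ ↦ |m, x ⊕ O(m; r)⟩`. -/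
noncomputable def execWith (O : Oracle) (e : Wire κ → α) :
    Circuit κ → (State α → ℝ) → State α → ℝ
  | [], K, ψ => K ψ
  | .gate g :: C, K, ψ => execWith O e C K ((g.map e).apply ψ)
  | .query len src tgt :: C, K, ψ => avgBits (O.coins len) fun r =>
      execWith O e C K (Finsupp.mapDomain (queryMap e len src tgt fun m => O.fn m r) ψ)

end

/-! ### Balanced binary functions and copy protection -/

/-- Registers of a sampling procedure; it outputs a string. -/
inductive SampleReg where
  | outLen | outData | work (c : ℕ)
  deriving DecidableEq

/-- Registers of a procedure that takes a key and outputs a quantum state in register `out`. -/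
inductive ProtReg where
  | keyLen | keyData | out | work (c : ℕ)
  deriving DecidableEq

/-- Registers of the classical evaluation procedure. -/
inductive EvalReg where
  | keyLen | keyData | input | output | work (c : ℕ)
  deriving DecidableEq

/-- Registers of the evaluation procedure for protected programs. -/
inductive ProgReg where
  | state | input | output | work (c : ℕ)
  deriving DecidableEq

/-- The string output by a sampling procedure, when its wires are placed in the memory by `e`. -/
def readKey {α : Type} [DecidableEq α] (e : Wire SampleReg → α) (S : Finset α) : List Bool :=
  readStr (regAt e (.outLen, 0)) (regAt e (.outData, 0)) S

/-- Write a key into the input registers of a procedure placed by `e`. -/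
def writeKey {α : Type} [DecidableEq α] (e : Wire ProtReg → α) (f : List Bool) (S : Finset α) :
    Finset α :=
  writeStr (regAt e (.keyLen, 0)) (regAt e (.keyData, 0)) f S

/-- The final state of a sampling circuit; its output is obtained by a measurement. -/
noncomputable def sampleState (C : Circuit SampleReg) : State (Wire SampleReg) :=
  exec id C (ket ∅)

/-- `f` is a possible output of the sampling circuit `C`. -/
def IsOutput (C : Circuit SampleReg) (f : List Bool) : Prop :=
  ∃ S ∈ (sampleState C).support, readKey id S = f

/-- A balanced binary function: `sample` outputs (descriptions of) functions, and `evalC` evaluates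
them; `fn l f x` is the value at `x ∈ {0,1}^(len l)` of the function described by `f`. -/
structure BBF where
  len : ℕ → ℕ
  len_poly : PolyTimeLength len
  sample : ℕ → Circuit SampleReg
  sample_qpt : QPT sample
  evalC : ℕ → Circuit EvalReg
  eval_qpt : QPT evalC
  fn : ℕ → List Bool → List Bool → Bool
  eval_correct : ∀ l f x, IsOutput (sample l) f → x.length = len l →
    prob (exec id (evalC l) (ket (xorBits (regAt id (EvalReg.input, 0)) x
        (writeStr (regAt id (EvalReg.keyLen, 0)) (regAt id (EvalReg.keyData, 0)) f ∅))))
      (fun S => decide ((EvalReg.output, 0, 0) ∈ S) = fn l f x) = 1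
  balanced : Negligible fun l =>
    |(avgBits (len l) fun x => prob (sampleState (sample l)) fun S => fn l (readKey id S) x = false)
      - (avgBits (len l) fun x =>
          prob (sampleState (sample l)) fun S => fn l (readKey id S) x = true)|

/-- The wires of the evaluation procedure in the joint memory with the protection procedure: its
input `state` is the output register of the latter. -/
def programWire : Wire ProgReg → Wire ProtReg ⊕ Wire ProgReg
  | (.state, 0, j) => .inl (.out, 0, j)
  | w => .inr w

/-- A copy protection scheme for a balanced binary function: evaluating the protected program
`protect f` at `x` gives `f x` with certainty. -/
structure CopyProtection (B : BBF) where
  protect : ℕ → Circuit ProtReg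
  protect_qpt : QPT protect
  evalC : ℕ → Circuit ProgReg
  eval_qpt : QPT evalC
  correct : ∀ l f x, IsOutput (B.sample l) f → x.length = B.len l →
    prob (exec programWire (evalC l)
        (Finsupp.mapDomain (xorBits (regAt programWire (.input, 0)) x)
          (exec Sum.inl (protect l) (ket (writeKey Sum.inl f ∅)))))
      (fun S => decide (programWire (.output, 0, 0) ∈ S) = B.fn l f x) = 1

/-! ### Uncloneable decryptors -/

/-- Registers of a quantum decryption procedure; it takes a decryptor and a ciphertext, and outputs
a string. -/
inductive DecReg where
  | state | cipher | outLen | outData | work (c : ℕ)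
  deriving DecidableEq

/-- The five procedures of an uncloneable decryptors scheme. `enc l sk m r` is the encryption of
`m` with random bits `r`, of which there are `coins l |m|`; its length is `cipherLen l |m|`.
The circuit `decC l L` decrypts ciphertexts of length `L` by means of a decryptor. (The security
game below makes sense for any such procedures, so that their efficiency is not recorded here.) -/
structure UDScheme where
  keyGen : ℕ → Circuit SampleReg
  decGen : ℕ → Circuit ProtReg
  coins : ℕ → ℕ → ℕ
  cipherLen : ℕ → ℕ → ℕ
  enc : ℕ → List Bool → List Bool → List Bool → List Bool
  enc_length : ∀ l sk m r, r.length = coins l m.length →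
    (enc l sk m r).length = cipherLen l m.length
  dec : ℕ → List Bool → List Bool → List Bool
  decC : ℕ → ℕ → Circuit DecReg

/-- Wires of the evaluation procedure within the decryption procedure: its input is given by the
first `len` positions of the ciphertext. -/
def decWire (len : ℕ) : Wire ProgReg → Wire DecReg
  | (.state, w) => (.state, w)
  | (.input, 0, j) => if j < len then (.cipher, 0, j) else (.work 0, 0, j)
  | (.input, i + 1, j) => (.work 0, i + 1, j)
  | (.output, w) => (.outData, w)
  | (.work c, w) => (.work (c + 1), w)

/-- The bit encryption scheme: the key is a sampled function `f`, a decryptor is a protected copy of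
`f`, and the encryption of a bit `b` is `(r, b ⊕ f r)` with `r` uniformly random. (Only messages of
length `1` are of interest.) -/
def oneBitScheme (B : BBF) (Q : CopyProtection B) : UDScheme where
  keyGen := B.sample
  decGen := Q.protect
  coins := fun l _ => B.len l
  cipherLen := fun l _ => B.len l + 1
  enc := fun l sk m r => r ++ [xor (m.headD false) (B.fn l sk r)]
  enc_length := by intro l sk m r h; simp [h]
  dec := fun l sk c => [xor (c.getD (B.len l) false) (B.fn l sk (c.take (B.len l)))]
  decC := fun l _ => Circuit.relabel (decWire (B.len l)) (Q.evalC l) ++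
    [.gate (.CX (.cipher, 0, B.len l) (.outData, 0, 0)), .gate (.X (.outLen, 0, 0))]

/-- Encrypt the bits of a message one by one; `w` random bits are used for each of them. -/
def encBits (enc1 : List Bool → List Bool → List Bool) (w : ℕ) :
    List Bool → List Bool → List Bool
  | [], _ => []
  | b :: m, r => enc1 [b] (r.take w) ++ encBits enc1 w m (r.drop w)

theorem encBits_length {enc1 : List Bool → List Bool → List Bool} {w v : ℕ}
    (h : ∀ b r, r.length = w → (enc1 [b] r).length = v) (m r : List Bool)
    (hr : r.length = m.length * w) : (encBits enc1 w m r).length = m.length * v := by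
  induction m generalizing r with
  | nil => simp [encBits]
  | cons b m ih =>
    have h1 : (r.take w).length = w := by
      simp [hr, Nat.add_mul]
    have h2 : (r.drop w).length = m.length * w := by
      simp [hr, Nat.add_mul]
    simp only [encBits, List.length_append, h b _ h1, ih _ h2, List.length_cons]
    ring

/-- Wires of the decryption procedure for the `i`-th bit within the one for the whole message;
`v` is the length of the ciphertext of a bit. -/
def blockWire (v i : ℕ) : Wire DecReg → Wire DecReg
  | (.state, w) => (.state, w)
  | (.cipher, 0, j) => if j < v then (.cipher, 0, i * v + j) else (.work 0, 0, j)
  | (.cipher, a + 1, j) => (.work 0, a + 1, j)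
  | (.outLen, w) => (.work 1, w)
  | (.outData, w) => (.work 2, w)
  | (.work c, w) => (.work (c + 3), w)

/-- The bit-by-bit extension of a bit encryption scheme to messages of arbitrary length. In the
quantum decryption procedure the same decryptor is used for all bits in turn: the result of the
`i`-th decryption is copied to the output, and then that decryption is undone. -/
def UDScheme.ext (U : UDScheme) : UDScheme where
  keyGen := U.keyGen
  decGen := U.decGen
  coins := fun l L => L * U.coins l 1
  cipherLen := fun l L => L * U.cipherLen l 1
  enc := fun l sk m r => encBits (U.enc l sk) (U.coins l 1) m r
  enc_length := fun l sk m r h =>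
    encBits_length (fun b r' h' => U.enc_length l sk [b] r' h') m r h
  dec := fun l sk c => (List.range (c.length / U.cipherLen l 1)).flatMap fun i =>
    U.dec l sk ((c.drop (i * U.cipherLen l 1)).take (U.cipherLen l 1))
  decC := fun l L => (List.range (L / U.cipherLen l 1)).flatMap fun i =>
    let D := Circuit.relabel (blockWire (U.cipherLen l 1) i) (U.decC l (U.cipherLen l 1))
    D ++ [.gate (.CX (.work 2, 0, 0) (.outData, 0, i)), .gate (.X (.outLen, 0, i))] ++ D.inv

/-! ### The security games -/

/-- Registers of a pirate: `copy i` is the `i`-th state received from the challenger, the registers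
`state c` with index `i` are handed to the `i`-th party, and the pair of challenge plaintexts of the
`i`-th party, of common length, is output in `len`, `plain false`, `plain true` (with index `i`). -/
inductive PirateReg where
  | copy | state (c : ℕ) | len | plain (b : Bool) | work (c : ℕ)
  deriving DecidableEq

/-- Registers of a freeloader or distinguisher: the state received from the pirate is in the
registers `state c` (with index `0`), the challenge ciphertext in `chalLen`, `chalData`, and the
guess is output in the first qubit of `out`. -/
inductive PartyReg where
  | state (c : ℕ) | chalLen | chalData | out | work (c : ℕ)
  deriving DecidableEq

/-- The joint memory of a game: for the generation of the key, for each of the invocations of the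
protection (or decryptor generation) procedure, for the pirate, and for each party. -/
inductive Loc where
  | gen (w : Wire SampleReg)
  | prot (i : ℕ) (w : Wire ProtReg)
  | pirate (w : Wire PirateReg)
  | party (i : ℕ) (w : Wire PartyReg)
  deriving DecidableEq

/-- The part of the joint memory on which the pirate acts. -/
def pirateLoc : Wire PirateReg → Loc
  | (.copy, i, j) => .prot i (.out, 0, j)
  | (.state c, i, j) => .party i (.state c, 0, j)
  | w => .pirate w

/-- An adversary: a pirate, and parties (freeloaders or distinguishers) indexed by natural
numbers. -/
structure Adversary where
  pirate : ℕ → Circuit PirateReg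
  party : ℕ → ℕ → Circuit PartyReg

/-- The adversary is QPT. -/
def Adversary.IsQPT (A : Adversary) : Prop :=
  QPT A.pirate ∧ IndexedQPT A.party

/-- The challenger samples a key `f`, and creates `n` states from it by means of the circuit `P`,
independently of each other; the game then continues with `K`. -/
noncomputable def deal (G : Circuit SampleReg) (P : Circuit ProtReg) (n : ℕ)
    (K : List Bool → State Loc → ℝ) : ℝ :=
  measure (readKey Loc.gen)
    (fun f ψ => K f ((List.range n).foldl
      (fun φ i => exec (Loc.prot i) P (Finsupp.mapDomain (writeKey (Loc.prot i) f) φ)) ψ))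
    (exec Loc.gen G (ket ∅))

/-- The average over uniformly random bits `b₀, …, b_{N-1}`. -/
noncomputable def avgChoice (N : ℕ) (K : (Fin N → Bool) → ℝ) : ℝ :=
  (∑ b : Fin N → Bool, K b) / 2 ^ N

/-- Run the `N` parties, the `i`-th one with access to the oracle `O i`, and continue with `K`. -/
noncomputable def runParties (A : Adversary) (l N : ℕ) (O : Fin N → Oracle)
    (K : State Loc → ℝ) : State Loc → ℝ :=
  (List.finRange N).foldr (fun i K' => execWith (O i) (Loc.party i) (A.party l i) K') K

/-- The expected number of parties `i` whose output is `b i`, when all outputs are measured. -/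
noncomputable def score {N : ℕ} (b : Fin N → Bool) (ψ : State Loc) : ℝ :=
  ψ.sum fun S a => ‖a‖ ^ 2 *
    ((Finset.univ.filter fun i : Fin N =>
      decide (Loc.party i (.out, 0, 0) ∈ S) = b i).card : ℝ)

/-- `val` is at most `n + k/2`, up to a negligible function. -/
def SecureBound (n k : ℕ → ℕ) (val : ℕ → ℝ) : Prop :=
  ∃ ν : ℕ → ℝ, Negligible ν ∧ ∀ l, val l ≤ n l + k l / 2 + ν l

/-- The oracle that takes no input (it ignores it) and outputs `(r, f r ⊕ b)` with `r` uniformly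
random. -/
def flipOracle (B : BBF) (l : ℕ) (f : List Bool) (b : Bool) : Oracle where
  coins := fun _ => B.len l
  fn := fun _ r => r ++ [xor (B.fn l f r) b]

/-- The expected output of the flip detection game. -/
noncomputable def flipGame {B : BBF} (Q : CopyProtection B) (n k : ℕ) (A : Adversary) (l : ℕ) : ℝ :=
  deal (B.sample l) (Q.protect l) n fun f ψ => avgChoice (n + k) fun b =>
    runParties A l (n + k) (fun i => flipOracle B l f (b i)) (score b)
      (exec pirateLoc (A.pirate l) ψ)

/-- Flip detection security for `n` copies and `n + k` freeloaders. -/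
def CopyProtection.FlipSecureFor {B : BBF} (Q : CopyProtection B) (n k : ℕ → ℕ) : Prop :=
  ∀ A : Adversary, A.IsQPT → SecureBound n k fun l => flipGame Q (n l) (k l) A l

/-- Flip detection security. -/
def CopyProtection.FlipSecure {B : BBF} (Q : CopyProtection B) : Prop :=
  ∀ n k : ℕ → ℕ, PolyBounded n → PolyBounded k → Q.FlipSecureFor n k

/-- The encryption oracle. -/
def UDScheme.encOracle (U : UDScheme) (l : ℕ) (sk : List Bool) : Oracle where
  coins := U.coins l
  fn := U.enc l sk

/-- The pair of challenge plaintexts that the pirate outputs for the `i`-th party; they have the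
same length by construction. -/
def readPlaintexts (i : ℕ) (S : Finset Loc) : List Bool × List Bool :=
  let L := readLen (regAt pirateLoc (.len, i)) S
  (readBits (regAt pirateLoc (.plain false, i)) L S,
    readBits (regAt pirateLoc (.plain true, i)) L S)

/-- The `i`-th challenge: the plaintexts `(m₀, m₁)` are measured, and an encryption of `m_b` is
given to the `i`-th party. -/
noncomputable def UDScheme.challenge (U : UDScheme) (l : ℕ) (sk : List Bool) (i : ℕ) (b : Bool)
    (K : State Loc → ℝ) : State Loc → ℝ :=
  measure (readPlaintexts i) fun M φ =>
    let m := if b then M.2 else M.1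
    avgBits (U.coins l m.length) fun r =>
      K (Finsupp.mapDomain
        (writeStr (regAt (Loc.party i) (.chalLen, 0)) (regAt (Loc.party i) (.chalData, 0))
          (U.enc l sk m r)) φ)

/-- The expected output of the chosen plaintext game for uncloneable decryptors. -/
noncomputable def UDScheme.qcpaGame (U : UDScheme) (n k : ℕ) (A : Adversary) (l : ℕ) : ℝ :=
  deal (U.keyGen l) (U.decGen l) n fun sk ψ => avgChoice (n + k) fun b =>
    execWith (U.encOracle l sk) pirateLoc (A.pirate l)
      ((List.finRange (n + k)).foldr (fun (i : Fin (n + k)) K => U.challenge l sk i (b i) K)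
        (runParties A l (n + k) (fun _ => U.encOracle l sk) (score b))) ψ

/-- `UD-qCPA` security for `n` decryptors and `n + k` distinguishers. -/
def UDScheme.QCPASecureFor (U : UDScheme) (n k : ℕ → ℕ) : Prop :=
  ∀ A : Adversary, A.IsQPT → SecureBound n k fun l => U.qcpaGame (n l) (k l) A l

/-- `UD-qCPA` security. -/
def UDScheme.QCPASecure (U : UDScheme) : Prop :=
  ∀ n k : ℕ → ℕ, PolyBounded n → PolyBounded k → U.QCPASecureFor n k

end QCrypto

/-! The reduction loses nothing: from an adversary against the encryption scheme one builds an
adversary for flip detection such that the expected outputs of the two games agree, for every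
security parameter. An encryption of a bit m is (r, m ⊕ f(r)), so that queries can be answered
without the key, given a supply of pairs (r, f(r)) with uniform r. The pirate makes these pairs with
its first copy. Evaluation is correct with certainty; therefore computing f(r), copying the bit and
undoing the computation leaves the copy exactly as it was (`exec_compute`, `exec_evalSamples`), and
all n copies remain available to the simulated pirate. This is where n ≥ 1 is needed.

Each party gets two banks of pairs. One answers its queries. The other serves the challenge at the
positions where the two plaintexts agree: there the encrypted bit does not depend on b. Where they
differ, m_b = m_0 ⊕ b, so the answer (r, f(r) ⊕ b) of the flip oracle becomes an encryption of m_b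
when m_0 is added to its last bit. Hence the challenge bit of the i-th distinguisher is the hidden
bit of the i-th freeloader, and the guess can be passed on (`exec_prepare`,
`flipParty_eq_tapeStep`).

The circuits of the reduction are unitary apart from oracle calls: the strings r are prepared by
Hadamard gates, and the plaintexts are not measured. Both are justified by decoherence. The score is
diagonal in the computational basis, and the qubits in question serve only as controls afterwards,
so the value adds up over their contents (`Dec`, `hadamards`, `measure_const`). A superposition of
strings thus becomes an average over sets of qubits (`setAvg`); as every sample is used at most
once, this average is the same as fresh randomness for every query (`setAvg_resample`,
`setAvg_execTape`). The memory of the simulated game is embedded by `moveLoc` into that of the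
reduction, and the banks and the scratch space lie outside its range (`exec_sim`). The reduction
treats the parties one after the other, each with its challenge and its run, whereas the game gives
out all challenges before the first run; the two orders agree because a party does not touch the
challenges of the others (`encFold_eq`). The outcome is `flipGame_simulator`.

For parameters with n = 0 there is no copy that could fill the banks. A second reduction plays flip
detection with one copy and k + 1 freeloaders: the pirate fills the banks and hands its copy to an
additional freeloader, who evaluates f at the string of a single oracle answer and so finds its own
bit with certainty. The expected output is that of the encryption game plus one
(`flipGame_ownerSimulator`), and the bound 1 + k/2 + negl turns into k/2 + negl. Since n may vanish
for some parameters only, the second claim uses both reductions and the larger of the two errors.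

It remains that the reductions are uniform. `Does`, `Emits` and `Comp` form a calculus of
polynomial-time programs that leave the memory as they found it, up to one result counter. Its main
rule `Does.run` executes a given machine as a subroutine and replaces every operation that it writes
by a circuit. The functions n and k need not be computable: the circuits only use polynomial bounds
for them. -/

namespace QCrypto

variable {κ κ' : Type}

/-! ### Running programs inside a larger memory -/

theorem eval_le_eval (b : Polynomial ℕ) {m n : ℕ} (h : m ≤ n) : b.eval m ≤ b.eval n := by
  induction b using Polynomial.induction_on' with
  | add p q hp hq => simpa using add_le_add hp hq
  | monomial k a => simpa using Nat.mul_le_mul_left a (Nat.pow_le_pow_left h k)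

/-- The wires named in a gate. -/
def Gate.wires {α : Type} : Gate α → List α
  | H q => [q]
  | T q => [q]
  | Tinv q => [q]
  | X q => [q]
  | CX c t => [c, t]
  | CCX c d t => [c, d, t]

/-- The counters named in an operation. -/
def Op.names : Op κ → List ℕ
  | gate g => g.wires.flatMap fun w => [w.2.1, w.2.2]
  | query x src tgt => [x, src.2, tgt.2]

/-- Replace the counter names of an operation. -/
def Op.rename (e : ℕ → ℕ) (o : Op κ) : Op κ := o.fill e

theorem Op.fill_rename (e : ℕ → ℕ) (o : Op κ) (v : ℕ → ℕ) :
    (o.rename e).fill v = o.fill (v ∘ e) := by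
  rcases o with g | ⟨x, src, tgt⟩
  · cases g <;> simp [Op.fill, Gate.map, Op.rename]
  · simp [Op.fill, Op.rename]

/-- The operations that a program may write. -/
def Prog.ops : Prog κ → List (Op κ)
  | emit o => [o]
  | seq p q => p.ops ++ q.ops
  | ifz _ p q => p.ops ++ q.ops
  | loop _ p => p.ops
  | _ => []

/-- The counters and stacks named in a program are below `p.Below m`. -/
def Prog.Below (m : ℕ) : Prog κ → Prop
  | skip => True
  | zero x => x < m
  | succ x => x < m
  | pred x => x < m
  | copy x y => x < m ∧ y < m
  | push s x => s < m ∧ x < m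
  | pop x s => s < m ∧ x < m
  | emit o => ∀ x ∈ o.names, x < m
  | seq p q => p.Below m ∧ q.Below m
  | ifz x p q => x < m ∧ p.Below m ∧ q.Below m
  | loop x p => x < m ∧ p.Below m

theorem Prog.Below.mono {p : Prog κ} {m n : ℕ} (h : p.Below m) (hmn : m ≤ n) : p.Below n := by
  induction p with
  | emit o => exact fun x hx => (h x hx).trans_le hmn
  | seq p q hp hq => exact ⟨hp h.1, hq h.2⟩
  | ifz x p q hp hq => exact ⟨h.1.trans_le hmn, hp h.2.1, hq h.2.2⟩
  | loop x p hp => exact ⟨h.1.trans_le hmn, hp h.2⟩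
  | _ => simp only [Prog.Below] at h ⊢ <;> omega

/-- A program names finitely many cells. All cells from the bound on are free for a host program
that runs it; `m₀` allows a further lower bound to be met at the same time. -/
theorem Prog.exists_below (p : Prog κ) (m₀ : ℕ) : ∃ m, m₀ ≤ m ∧ p.Below m := by
  induction p with
  | skip => exact ⟨m₀, le_rfl, trivial⟩
  | zero x => exact ⟨m₀ + x + 1, by omega, by simp only [Below]; omega⟩
  | succ x => exact ⟨m₀ + x + 1, by omega, by simp only [Below]; omega⟩
  | pred x => exact ⟨m₀ + x + 1, by omega, by simp only [Below]; omega⟩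
  | copy x y => exact ⟨m₀ + x + y + 1, by omega, by simp only [Below]; omega⟩
  | push x y => exact ⟨m₀ + x + y + 1, by omega, by simp only [Below]; omega⟩
  | pop x y => exact ⟨m₀ + x + y + 1, by omega, by simp only [Below]; omega⟩
  | emit o =>
    refine ⟨m₀ + o.names.sum + 1, by omega, fun x hx => ?_⟩
    have := List.single_le_sum (fun _ _ => Nat.zero_le _) x hx
    omega
  | seq p q hp hq =>
    obtain ⟨a, ha, ha'⟩ := hp
    obtain ⟨b, hb, hb'⟩ := hq
    exact ⟨a + b, by omega, ha'.mono (by omega), hb'.mono (by omega)⟩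
  | ifz x p q hp hq =>
    obtain ⟨a, ha, ha'⟩ := hp
    obtain ⟨b, hb, hb'⟩ := hq
    exact ⟨a + b + x + 1, by omega, by omega, ha'.mono (by omega), hb'.mono (by omega)⟩
  | loop x p hp =>
    obtain ⟨a, ha, ha'⟩ := hp
    exact ⟨a + x + 1, by omega, by omega, ha'.mono (by omega)⟩

theorem Prog.Below.ops {p : Prog κ} {m : ℕ} (h : p.Below m) : ∀ o ∈ p.ops, ∀ x ∈ o.names, x < m := by
  induction p with
  | emit o => simpa [Prog.ops, Prog.Below] using h
  | seq p q hp hq =>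
    intro o ho
    rcases List.mem_append.1 ho with ho | ho
    exacts [hp h.1 o ho, hq h.2 o ho]
  | ifz x p q hp hq =>
    intro o ho
    rcases List.mem_append.1 ho with ho | ho
    exacts [hp h.2.1 o ho, hq h.2.2 o ho]
  | loop x p hp => exact fun o ho => hp h.2 o ho
  | _ => simp [Prog.ops]

/-- All numbers in the memory are at most `B`. -/
def Mem.Le (s : Mem) (B : ℕ) : Prop :=
  (∀ x, s.var x ≤ B) ∧ ∀ a, ∀ y ∈ s.stk a, y ≤ B

theorem Mem.Le.mono {s : Mem} {B B' : ℕ} (h : s.Le B) (hB : B ≤ B') : s.Le B' :=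
  ⟨fun x => (h.1 x).trans hB, fun a y hy => (h.2 a y hy).trans hB⟩

theorem Mem.Le.setVar {s : Mem} {B : ℕ} (h : s.Le B) {x v : ℕ} (hv : v ≤ B) :
    (s.setVar x v).Le B := by
  refine ⟨fun y => ?_, h.2⟩
  by_cases hy : y = x
  · subst hy; simpa [Mem.setVar] using hv
  · simpa [Mem.setVar, hy] using h.1 y

theorem Mem.Le.setStk {s : Mem} {B : ℕ} (h : s.Le B) {x : ℕ} {L : List ℕ} (hv : ∀ y ∈ L, y ≤ B) :
    (s.setStk x L).Le B := by
  refine ⟨h.1, fun a => ?_⟩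
  by_cases hy : a = x
  · subst hy; simpa [Mem.setStk] using hv
  · simpa [Mem.setStk, hy] using h.2 a

/-- Beyond `m` the memory is empty. -/
def Mem.Blank (m : ℕ) (s : Mem) : Prop := ∀ x, m ≤ x → s.var x = 0 ∧ s.stk x = []

theorem Mem.Blank.setVar {s : Mem} {m : ℕ} (h : s.Blank m) {x v : ℕ} (hx : x < m) :
    (s.setVar x v).Blank m := by
  intro y hy
  have : y ≠ x := by omega
  simpa [Mem.setVar, this] using h y hy

theorem Mem.Blank.setStk {s : Mem} {m : ℕ} (h : s.Blank m) {x : ℕ} {L : List ℕ} (hx : x < m) :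
    (s.setStk x L).Blank m := by
  intro y hy
  have : y ≠ x := by omega
  simpa [Mem.setStk, this] using h y hy

theorem Exec.length_le {p : Prog κ} {s s' : Mem} {C : Circuit κ} {t : ℕ} (h : Exec p s s' C t) :
    C.length ≤ t := by
  induction h <;> (try simp only [List.length_append, List.length_nil, List.length_singleton]) <;>
    omega

theorem Exec.blank {p : Prog κ} {s s' : Mem} {C : Circuit κ} {t m : ℕ} (h : Exec p s s' C t)
    (hp : p.Below m) (hs : s.Blank m) : s'.Blank m := by
  induction h with
  | skip => exact hs
  | zero | succ | pred => exact hs.setVar hp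
  | copy => exact hs.setVar hp.1
  | push => exact hs.setStk hp.1
  | pop => exact (hs.setVar hp.2).setStk hp.1
  | emit => exact hs
  | seq _ _ h1 h2 => exact h2 hp.2 (h1 hp.1 hs)
  | ifz_zero _ _ h1 => exact h1 hp.2.1 hs
  | ifz_pos _ _ h1 => exact h1 hp.2.2 hs
  | loop_done => exact hs
  | loop_step _ _ _ h1 h2 => exact h2 hp (h1 hp.2 hs)

/-- A step raises a counter by at most one, and stacks only receive contents of counters. Numbers
stay polynomial in this way, which keeps the running time of everything that is computed from them
polynomial. -/
theorem Exec.le {p : Prog κ} {s s' : Mem} {C : Circuit κ} {t B : ℕ} (h : Exec p s s' C t)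
    (hs : s.Le B) : s'.Le (B + t) := by
  induction h generalizing B with
  | skip => exact hs.mono (by omega)
  | zero => exact (hs.setVar (by omega)).mono (by omega)
  | succ s x =>
    have := hs.1 x
    exact (hs.mono (by omega)).setVar (by omega)
  | pred s x =>
    have := hs.1 x
    exact (hs.mono (by omega)).setVar (by omega)
  | copy s x y =>
    have := hs.1 y
    exact (hs.mono (by omega)).setVar (by omega)
  | push s a x =>
    refine (hs.setStk fun y hy => ?_).mono (Nat.le_succ B)
    rcases List.mem_cons.1 hy with rfl | hy
    exacts [hs.1 x, hs.2 a y hy]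
  | pop s x a =>
    refine ((hs.setVar ?_).setStk fun y hy => hs.2 a y (List.mem_of_mem_tail hy)).mono
      (Nat.le_succ B)
    cases h : s.stk a with
    | nil => simp
    | cons y L => exact hs.2 a y (by simp [h])
  | emit => exact hs.mono (by omega)
  | seq _ _ h1 h2 => exact (h2 (h1 hs)).mono (by omega)
  | ifz_zero _ _ h1 => exact (h1 hs).mono (by omega)
  | ifz_pos _ _ h1 => exact (h1 hs).mono (by omega)
  | loop_done => exact hs.mono (by omega)
  | loop_step _ _ _ h1 h2 => exact (h2 (h1 hs)).mono (by omega)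

theorem Exec.stk_length_le {p : Prog κ} {s s' : Mem} {C : Circuit κ} {t : ℕ}
    (h : Exec p s s' C t) (a : ℕ) : (s'.stk a).length ≤ (s.stk a).length + t := by
  induction h with
  | push s b x =>
    by_cases hb : a = b
    · subst hb; simp [Mem.setStk]
    · simp [Mem.setStk, hb]
  | pop s x b =>
    by_cases hb : a = b
    · subst hb; simp [Mem.setStk]; omega
    · simp [Mem.setStk, Mem.setVar, hb]
  | zero | succ | pred | copy => simp [Mem.setVar]
  | skip | emit | loop_done => simp
  | seq _ _ h1 h2 => omega
  | ifz_zero _ _ h1 => omega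
  | ifz_pos _ _ h1 => omega
  | loop_step _ _ _ h1 h2 => omega

/-- All positions named in an operation of a circuit are bounded. -/
def Op.Bounded (V : ℕ) : Op κ → Prop
  | gate g => ∀ w ∈ g.wires, w.2.1 ≤ V ∧ w.2.2 ≤ V
  | query x src tgt => x ≤ V ∧ src.2 ≤ V ∧ tgt.2 ≤ V

theorem Op.bounded_fill {o : Op κ} {v : ℕ → ℕ} {V : ℕ} (h : ∀ x, v x ≤ V) :
    (o.fill v).Bounded V := by
  rcases o with g | ⟨x, src, tgt⟩
  · cases g <;> simp [Op.fill, Op.Bounded, Gate.map, Gate.wires, h]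
  · simp [Op.fill, Op.Bounded, h]

theorem Op.Bounded.mono {o : Op κ} {V W : ℕ} (h : o.Bounded V) (hVW : V ≤ W) : o.Bounded W := by
  rcases o with g | ⟨x, src, tgt⟩
  · exact fun w hw => ⟨(h w hw).1.trans hVW, (h w hw).2.trans hVW⟩
  · exact ⟨h.1.trans hVW, h.2.1.trans hVW, h.2.2.trans hVW⟩

theorem Exec.bounded {p : Prog κ} {s s' : Mem} {C : Circuit κ} {t B : ℕ} (h : Exec p s s' C t)
    (hs : s.Le B) : ∀ o ∈ C, o.Bounded (B + t) := by
  induction h generalizing B with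
  | emit s o =>
    intro o' ho'
    rw [List.mem_singleton.1 ho']
    exact Op.bounded_fill fun x => (hs.1 x).trans (by omega)
  | seq e1 _ h1 h2 =>
    intro o ho
    rcases List.mem_append.1 ho with ho | ho
    · exact (h1 hs o ho).mono (by omega)
    · exact (h2 (e1.le hs) o ho).mono (by omega)
  | ifz_zero _ _ h1 => exact fun o ho => (h1 hs o ho).mono (by omega)
  | ifz_pos _ _ h1 => exact fun o ho => (h1 hs o ho).mono (by omega)
  | loop_step _ e1 _ h1 h2 =>
    intro o ho
    rcases List.mem_append.1 ho with ho | ho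
    · exact (h1 hs o ho).mono (by omega)
    · exact (h2 (e1.le hs) o ho).mono (by omega)
  | _ => simp

theorem Mem.start_le (L : List ℕ) : (Mem.start L).Le L.sum := by
  refine ⟨fun x => ?_, by simp [Mem.start]⟩
  by_cases h : x < L.length
  · simpa [Mem.start, h] using List.single_le_sum (fun _ _ => Nat.zero_le _) _ (L.getElem_mem h)
  · simp [Mem.start, List.getD, List.getElem?_eq_none (not_lt.1 h)]

/-- Write the memory `s` into the part `e` of the memory `base`. -/
noncomputable def Mem.over (e : ℕ → ℕ) (base s : Mem) : Mem where
  var := Function.extend e s.var base.var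
  stk := Function.extend e s.stk base.stk

theorem extend_update {β : Type} {e : ℕ → ℕ} (he : e.Injective) (f g : ℕ → β) (x : ℕ) (v : β) :
    Function.extend e (Function.update f x v) g
      = Function.update (Function.extend e f g) (e x) v := by
  funext y
  by_cases hy : ∃ z, e z = y
  · obtain ⟨z, rfl⟩ := hy
    by_cases hz : z = x
    · subst hz; simp [he.extend_apply]
    · have : e z ≠ e x := fun h => hz (he h)
      simp [he.extend_apply, hz, this]
  · have : y ≠ e x := fun h => hy ⟨x, h.symm⟩
    simp [Function.extend_apply' _ _ _ hy, this]

theorem extend_comp_self {β : Type} {e : ℕ → ℕ} (g : ℕ → β) (he : e.Injective) :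
    Function.extend e (g ∘ e) g = g := by
  funext y
  by_cases hy : ∃ z, e z = y
  · obtain ⟨z, rfl⟩ := hy; simp [he.extend_apply]
  · simp [Function.extend_apply' _ _ _ hy]

theorem Mem.over_setVar {e : ℕ → ℕ} (he : e.Injective) (base s : Mem) (x v : ℕ) :
    Mem.over e base (s.setVar x v) = (Mem.over e base s).setVar (e x) v := by
  simp [Mem.over, Mem.setVar, extend_update he]

theorem Mem.over_setStk {e : ℕ → ℕ} (he : e.Injective) (base s : Mem) (x : ℕ) (v : List ℕ) :
    Mem.over e base (s.setStk x v) = (Mem.over e base s).setStk (e x) v := by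
  simp [Mem.over, Mem.setStk, extend_update he]

theorem Mem.over_var {e : ℕ → ℕ} (he : e.Injective) (base s : Mem) (x : ℕ) :
    (Mem.over e base s).var (e x) = s.var x := by simp [Mem.over, he.extend_apply]

theorem Mem.over_stk {e : ℕ → ℕ} (he : e.Injective) (base s : Mem) (x : ℕ) :
    (Mem.over e base s).stk (e x) = s.stk x := by simp [Mem.over, he.extend_apply]

/-- Rename the counters and stacks of a program, and replace the commands that write operations. -/
def Prog.expand (e : ℕ → ℕ) (H : Op κ → Prog κ') : Prog κ → Prog κ'
  | skip => skip
  | zero x => zero (e x)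
  | succ x => succ (e x)
  | pred x => pred (e x)
  | copy x y => copy (e x) (e y)
  | push s x => push (e s) (e x)
  | pop x s => pop (e x) (e s)
  | emit o => H o
  | seq p q => seq (p.expand e H) (q.expand e H)
  | ifz x p q => ifz (e x) (p.expand e H) (q.expand e H)
  | loop x p => loop (e x) (p.expand e H)

/-- By injectivity of `e` different cells stay different, so the renamed program runs in step with
the original one. The cells outside the range of `e` keep what `base` contains. -/
theorem Exec.rename {e : ℕ → ℕ} (he : e.Injective) (base : Mem) {p : Prog κ} {s s' : Mem}
    {C : Circuit κ} {t : ℕ} (h : Exec p s s' C t) :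
    Exec (p.expand e fun o => .emit (o.rename e)) (Mem.over e base s) (Mem.over e base s') C t := by
  induction h with
  | skip s => exact .skip _
  | zero s x =>
    rw [Mem.over_setVar he]
    exact .zero _ _
  | succ s x =>
    rw [Mem.over_setVar he, ← Mem.over_var he base s x]
    exact .succ _ _
  | pred s x =>
    rw [Mem.over_setVar he, ← Mem.over_var he base s x]
    exact .pred _ _
  | copy s x y =>
    rw [Mem.over_setVar he, ← Mem.over_var he base s y]
    exact .copy _ _ _
  | push s a x =>
    rw [Mem.over_setStk he, ← Mem.over_var he base s x, ← Mem.over_stk he base s a]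
    exact .push _ _ _
  | pop s x a =>
    rw [Mem.over_setStk he, Mem.over_setVar he, ← Mem.over_stk he base s a]
    exact .pop _ _ _
  | emit s o =>
    have h := Exec.emit (Mem.over e base s) (o.rename e)
    rwa [Op.fill_rename, show (Mem.over e base s).var ∘ e = s.var from
      funext fun x => Mem.over_var he base s x] at h
  | seq _ _ h1 h2 => exact .seq h1 h2
  | ifz_zero hx _ h1 => exact .ifz_zero (by rwa [Mem.over_var he]) h1
  | ifz_pos hx _ h1 => exact .ifz_pos (by rwa [Mem.over_var he]) h1
  | loop_done hx => exact .loop_done (by rwa [Mem.over_var he])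
  | loop_step hx _ _ h1 h2 => exact .loop_step (by rwa [Mem.over_var he]) h1 h2

/-- Replace the operations of a circuit by circuits that depend on the position. -/
def Circuit.subst (F : ℕ → Op κ → Circuit κ') : ℕ → Circuit κ → Circuit κ'
  | _, [] => []
  | k, o :: C => F k o ++ Circuit.subst F (k + 1) C

theorem Circuit.subst_append (F : ℕ → Op κ → Circuit κ') (k : ℕ) (C D : Circuit κ) :
    Circuit.subst F k (C ++ D) = Circuit.subst F k C ++ Circuit.subst F (k + C.length) D := by
  induction C generalizing k with
  | nil => simp [Circuit.subst]
  | cons o C ih =>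
    simp only [List.cons_append, Circuit.subst, ih, List.append_assoc, List.length_cons]
    rw [show k + 1 + C.length = k + (C.length + 1) by omega]

/-- Induction on the run. The private memory `base k` of the host records that `k` operations have
been treated; a handler has to advance this count, write its circuit, and leave the memory of the
simulated program alone. The number `V` bounds all counters and counts that occur, so that one bound
`τ` for the handlers suffices and the total time is at most `t * (τ + 1)`. -/
theorem Exec.expand {e : ℕ → ℕ} (he : e.Injective) {H : Op κ → Prog κ'}
    {F : ℕ → Op κ → Circuit κ'} {base : ℕ → Mem} {τ m V : ℕ}
    {p : Prog κ} {s s' : Mem} {C : Circuit κ} {t B k : ℕ} (h : Exec p s s' C t) (hp : p.Below m)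
    (hs : s.Blank m) (hB : s.Le B) (hV : B + t ≤ V) (hk : k + t ≤ V)
    (hH : ∀ o ∈ p.ops, ∀ k s, k ≤ V → s.Blank m → s.Le V → ∃ t', t' ≤ τ ∧
      Exec (H o) (Mem.over e (base k) s) (Mem.over e (base (k + 1)) s) (F k (o.fill s.var)) t') :
    ∃ t', t' ≤ t * (τ + 1) ∧ Exec (p.expand e H) (Mem.over e (base k) s)
      (Mem.over e (base (k + C.length)) s') (Circuit.subst F k C) t' := by
  induction h generalizing B k with
  | skip s => exact ⟨1, by omega, .skip _⟩
  | zero s x =>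
    refine ⟨1, by omega, ?_⟩
    rw [Mem.over_setVar he]
    exact .zero _ _
  | succ s x =>
    refine ⟨1, by omega, ?_⟩
    rw [Mem.over_setVar he, ← Mem.over_var he (base k) s x]
    exact .succ _ _
  | pred s x =>
    refine ⟨1, by omega, ?_⟩
    rw [Mem.over_setVar he, ← Mem.over_var he (base k) s x]
    exact .pred _ _
  | copy s x y =>
    refine ⟨1, by omega, ?_⟩
    rw [Mem.over_setVar he, ← Mem.over_var he (base k) s y]
    exact .copy _ _ _
  | push s a x =>
    refine ⟨1, by omega, ?_⟩
    rw [Mem.over_setStk he, ← Mem.over_var he (base k) s x, ← Mem.over_stk he (base k) s a]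
    exact .push _ _ _
  | pop s x a =>
    refine ⟨1, by omega, ?_⟩
    rw [Mem.over_setStk he, Mem.over_setVar he, ← Mem.over_stk he (base k) s a]
    exact .pop _ _ _
  | emit s o =>
    obtain ⟨t', ht', h'⟩ := hH o (by simp [Prog.ops]) k s (by omega) hs (hB.mono (by omega))
    exact ⟨t', by omega, by simpa [Circuit.subst, Prog.expand] using h'⟩
  | @seq p q s s1 s2 C D t1 t2 e1 e2 h1 h2 =>
    obtain ⟨u1, hu1, f1⟩ := h1 hp.1 hs hB (by omega) (k := k) (by omega)
      fun o ho => hH o (List.mem_append_left _ ho)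
    obtain ⟨u2, hu2, f2⟩ := h2 hp.2 (e1.blank hp.1 hs) (e1.le hB) (by omega)
      (k := k + C.length) (by have := e1.length_le; omega)
      fun o ho => hH o (List.mem_append_right _ ho)
    refine ⟨u1 + u2 + 1, by nlinarith, ?_⟩
    rw [Circuit.subst_append, List.length_append, ← Nat.add_assoc]
    exact .seq f1 f2
  | @ifz_zero p q s s1 C t1 x hx e1 h1 =>
    obtain ⟨u1, hu1, f1⟩ := h1 hp.2.1 hs hB (by omega) (k := k) (by omega)
      fun o ho => hH o (List.mem_append_left _ ho)
    exact ⟨u1 + 1, by nlinarith, .ifz_zero (by rwa [Mem.over_var he]) f1⟩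
  | @ifz_pos p q s s1 C t1 x hx e1 h1 =>
    obtain ⟨u1, hu1, f1⟩ := h1 hp.2.2 hs hB (by omega) (k := k) (by omega)
      fun o ho => hH o (List.mem_append_right _ ho)
    exact ⟨u1 + 1, by nlinarith, .ifz_pos (by rwa [Mem.over_var he]) f1⟩
  | @loop_done p s x hx =>
    exact ⟨1, by omega, .loop_done (by rwa [Mem.over_var he])⟩
  | @loop_step p s s1 s2 C D t1 t2 x hx e1 e2 h1 h2 =>
    obtain ⟨u1, hu1, f1⟩ := h1 hp.2 hs hB (by omega) (k := k) (by omega) hH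
    obtain ⟨u2, hu2, f2⟩ := h2 hp (e1.blank hp.2 hs) (e1.le hB) (by omega)
      (k := k + C.length) (by have := e1.length_le; omega) hH
    refine ⟨u1 + u2 + 1, by nlinarith, ?_⟩
    rw [Circuit.subst_append, List.length_append, ← Nat.add_assoc]
    exact .loop_step (by rwa [Mem.over_var he]) f1 f2

theorem Exec.cast {p : Prog κ} {s s₁ s₂ : Mem} {C D : Circuit κ} {t : ℕ} (h : Exec p s s₁ C t)
    (hs : s₁ = s₂) (hC : C = D) : Exec p s s₂ D t := hs ▸ hC ▸ h

theorem Exec.cast' {p : Prog κ} {s s₁ s₂ : Mem} {C : Circuit κ} {t : ℕ} (h : Exec p s₁ s C t)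
    (hs : s₁ = s₂) : Exec p s₂ s C t := hs ▸ h

/-- A loop that counts down. -/
theorem Exec.countdown {p : Prog κ} {x τ : ℕ} (M : ℕ → Mem) (D : ℕ → Circuit κ) (h0 : (M 0).var x = 0)
    (n : ℕ) (hM : ∀ j < n, (M (j + 1)).var x ≠ 0)
    (hp : ∀ j < n, ∃ t, t ≤ τ ∧ Exec p (M (j + 1)) (M j) (D (j + 1)) t) :
    ∃ t, t ≤ n * (τ + 1) + 1 ∧
      Exec (.loop x p) (M n) (M 0) ((List.range n).flatMap fun j => D (n - j)) t := by
  induction n with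
  | zero => exact ⟨1, by omega, .loop_done h0⟩
  | succ n ih =>
    obtain ⟨t, ht, h⟩ := ih (fun j hj => hM j (by omega)) fun j hj => hp j (by omega)
    obtain ⟨t', ht', h'⟩ := hp n (by omega)
    refine ⟨t' + t + 1, by nlinarith, ?_⟩
    rw [List.range_succ_eq_map]
    simpa [List.flatMap_map, Nat.succ_eq_add_one] using Exec.loop_step (hM n (by omega)) h' h

end QCrypto
namespace QCrypto

variable {κ κ' Γ Γ' : Type}

/-! ### Families of circuits written by programs that leave the memory as they found it -/

/-- The contents of the counters when the first ones hold the values `xs`. -/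
def env (xs : List (Γ → ℕ)) (γ : Γ) (x : ℕ) : ℕ := (xs.map (· γ)).getD x 0

/-- The sum of the counters. -/
def sz (xs : List (Γ → ℕ)) (γ : Γ) : ℕ := (xs.map (· γ)).sum

theorem env_of_le {xs : List (Γ → ℕ)} {γ : Γ} {x : ℕ} (h : xs.length ≤ x) : env xs γ x = 0 := by
  simp [env, h]

theorem env_append_left {xs ys : List (Γ → ℕ)} {γ : Γ} {x : ℕ} (h : x < xs.length) :
    env (xs ++ ys) γ x = env xs γ x := by
  simp [env, h, List.getElem?_append]

theorem env_append_right (xs ys : List (Γ → ℕ)) (γ : Γ) (x : ℕ) :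
    env (xs ++ ys) γ (xs.length + x) = env ys γ x := by
  simp [env, List.getElem?_append]

theorem env_append_singleton (xs : List (Γ → ℕ)) (f : Γ → ℕ) (γ : Γ) :
    env (xs ++ [f]) γ = Function.update (env xs γ) xs.length (f γ) := by
  funext x
  rcases lt_trichotomy x xs.length with h | h | h
  · simp [env_append_left h, h.ne]
  · subst h; simp [env]
  · rw [env_of_le (by simp; omega), Function.update_of_ne (by omega), env_of_le h.le]

theorem env_comap (π : Γ' → Γ) (xs : List (Γ → ℕ)) (γ : Γ') :
    env (xs.map (· ∘ π)) γ = env xs (π γ) := by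
  funext x; simp [env, Function.comp_def]

theorem sz_comap (π : Γ' → Γ) (xs : List (Γ → ℕ)) (γ : Γ') :
    sz (xs.map (· ∘ π)) γ = sz xs (π γ) := by
  simp [sz, Function.comp_def]

theorem sz_append (xs ys : List (Γ → ℕ)) (γ : Γ) : sz (xs ++ ys) γ = sz xs γ + sz ys γ := by
  simp [sz]

theorem sz_singleton (f : Γ → ℕ) (γ : Γ) : sz [f] γ = f γ := by simp [sz]

theorem sz_pair (f g : Γ → ℕ) (γ : Γ) : sz [f, g] γ = f γ + g γ := by simp [sz]

theorem le_sz {xs : List (Γ → ℕ)} {f : Γ → ℕ} (hf : f ∈ xs) (γ : Γ) : f γ ≤ sz xs γ :=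
  List.single_le_sum (fun _ _ => Nat.zero_le _) _ (List.mem_map.2 ⟨f, hf, rfl⟩)

/-- With the values `xs` in the counters, a polynomial-time program computes `f` into the next
counter and writes the circuit `C`. -/
def Does (xs : List (Γ → ℕ)) (f : Γ → ℕ) (C : Γ → Circuit κ) : Prop :=
  ∃ (p : Prog κ) (b : Polynomial ℕ), ∀ γ, f γ ≤ b.eval (sz xs γ) ∧
    ∀ k : ℕ → List ℕ, (∀ a, xs.length ≤ a → k a = []) → ∃ t, t ≤ b.eval (sz xs γ) ∧
      Exec p ⟨env xs γ, k⟩ ⟨Function.update (env xs γ) xs.length (f γ), k⟩ (C γ) t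

/-- A polynomial-time program writes the circuit `C`. -/
def Emits (xs : List (Γ → ℕ)) (C : Γ → Circuit κ) : Prop := Does xs (fun _ => 0) C

/-- A polynomial-time program computes `f`. -/
def Comp (κ : Type) (xs : List (Γ → ℕ)) (f : Γ → ℕ) : Prop := Does xs f fun _ => ([] : Circuit κ)

theorem update_env_zero (xs : List (Γ → ℕ)) (γ : Γ) :
    Function.update (env xs γ) xs.length 0 = env xs γ :=
  Function.update_eq_self_iff.2 (env_of_le le_rfl).symm

theorem Does.comap {xs : List (Γ → ℕ)} {f : Γ → ℕ} {C : Γ → Circuit κ} (h : Does xs f C)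
    (π : Γ' → Γ) : Does (xs.map (· ∘ π)) (f ∘ π) (C ∘ π) := by
  obtain ⟨p, b, h⟩ := h
  refine ⟨p, b, fun γ => ?_⟩
  simpa only [env_comap, sz_comap, List.length_map, Function.comp_apply] using h (π γ)

/-- The cells behind `xs` are the result and the scratch space of the program. Renaming moves them
behind `ys`. -/
theorem Does.weaken {xs : List (Γ → ℕ)} {f : Γ → ℕ} {C : Γ → Circuit κ} (h : Does xs f C)
    (ys : List (Γ → ℕ)) : Does (xs ++ ys) f C := by
  obtain ⟨p, b, h⟩ := h
  let e : ℕ → ℕ := fun x => if x < xs.length then x else x + ys.length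
  have he : e.Injective := by
    intro x y hxy
    simp only [e] at hxy
    split_ifs at hxy <;> omega
  refine ⟨p.expand e fun o => .emit (o.rename e), b, fun γ => ?_⟩
  have hb : b.eval (sz xs γ) ≤ b.eval (sz (xs ++ ys) γ) :=
    eval_le_eval b (by simp [sz_append])
  refine ⟨(h γ).1.trans hb, fun k hk => ?_⟩
  obtain ⟨t, ht, h⟩ := (h γ).2 (k ∘ e) fun a ha => hk _ (by simp [e, not_lt.2 ha, ha])
  have hv : env xs γ = env (xs ++ ys) γ ∘ e := by
    funext x
    by_cases hx : x < xs.length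
    · simp [e, hx, env_append_left hx]
    · simp only [e, hx, Function.comp, if_false]
      rw [env_of_le (not_lt.1 hx), env_of_le (by simp; omega)]
  have h' := h.rename he ⟨env (xs ++ ys) γ, k⟩
  simp only [Mem.over, extend_update he] at h'
  rw [hv, extend_comp_self _ he, extend_comp_self _ he] at h'
  refine ⟨t, ht.trans hb, ?_⟩
  simpa [e] using h'

theorem Does.congr {xs : List (Γ → ℕ)} {f g : Γ → ℕ} {C D : Γ → Circuit κ} (h : Does xs f C)
    (hf : ∀ γ, f γ = g γ) (hC : ∀ γ, C γ = D γ) : Does xs g D := by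
  obtain rfl : f = g := funext hf
  obtain rfl : C = D := funext hC
  exact h

/-- The first program leaves its value in the cell right behind `xs`, where the second one expects
its additional input. The result of the second program is one cell too far to the right; it is
copied back over that input, and its own cell is cleared. -/
theorem Does.bind {xs : List (Γ → ℕ)} {f g : Γ → ℕ} {C : Γ → Circuit κ} (hf : Comp κ xs f)
    (h : Does (xs ++ [f]) g C) : Does xs g C := by
  obtain ⟨p, b, hp⟩ := hf
  obtain ⟨q, c, hq⟩ := h
  refine ⟨.seq p (.seq q (.seq (.copy xs.length (xs.length + 1)) (.zero (xs.length + 1)))),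
    b + c.comp (.X + b) + 5, fun γ => ?_⟩
  have hc : c.eval (sz (xs ++ [f]) γ) ≤ c.eval (sz xs γ + b.eval (sz xs γ)) :=
    eval_le_eval c (by have := (hp γ).1; simp [sz_append, sz_singleton]; omega)
  refine ⟨?_, fun k hk => ?_⟩
  · have := (hq γ).1
    simp; omega
  obtain ⟨t, ht, h1⟩ := (hp γ).2 k hk
  obtain ⟨t', ht', h2⟩ := (hq γ).2 k fun a ha => hk a (by simp at ha; omega)
  rw [← env_append_singleton] at h1
  refine ⟨_, ?_, (Exec.seq h1 (.seq h2 (.seq (.copy _ _ _) (.zero _ _)))).cast ?_ (by simp)⟩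
  · simp; omega
  · simp only [Mem.setVar, env_append_singleton, List.length_append, List.length_singleton]
    congr 1
    funext x
    rcases eq_or_ne x xs.length with rfl | h1
    · simp
    · rcases eq_or_ne x (xs.length + 1) with rfl | h2
      · simp [env_of_le]
      · simp [h1, h2]

theorem Emits.append {xs : List (Γ → ℕ)} {f : Γ → ℕ} {C D : Γ → Circuit κ} (hC : Emits xs C)
    (hD : Does xs f D) : Does xs f fun γ => C γ ++ D γ := by
  obtain ⟨p, b, hp⟩ := hC
  obtain ⟨q, c, hq⟩ := hD
  refine ⟨.seq p q, b + c + 1, fun γ => ⟨by have := (hq γ).1; simp; omega, fun k hk => ?_⟩⟩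
  obtain ⟨t, ht, h1⟩ := (hp γ).2 k hk
  obtain ⟨t', ht', h2⟩ := (hq γ).2 k hk
  rw [update_env_zero] at h1
  exact ⟨_, by simp; omega, .seq h1 h2⟩

theorem Emits.nil (xs : List (Γ → ℕ)) : Emits xs fun _ => ([] : Circuit κ) := by
  refine ⟨.skip, 1, fun γ => ⟨by simp, fun k _ => ⟨1, by simp, ?_⟩⟩⟩
  rw [update_env_zero]
  exact .skip _

theorem Does.ite {xs : List (Γ → ℕ)} {c f g : Γ → ℕ} {C D : Γ → Circuit κ} (hc : Comp κ xs c)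
    (hC : Does xs f C) (hD : Does xs g D) :
    Does xs (fun γ => if c γ = 0 then f γ else g γ) fun γ => if c γ = 0 then C γ else D γ := by
  refine Does.bind hc ?_
  obtain ⟨p, b, hp⟩ := hC.weaken [c]
  obtain ⟨q, d, hq⟩ := hD.weaken [c]
  refine ⟨.ifz xs.length p q, b + d + 1, fun γ => ?_⟩
  by_cases h0 : c γ = 0
  · refine ⟨by have := (hp γ).1; simp [h0]; omega, fun k hk => ?_⟩
    obtain ⟨t, ht, h1⟩ := (hp γ).2 k hk
    refine ⟨t + 1, by simp; omega, ?_⟩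
    simp only [h0, if_true]
    exact .ifz_zero (by simp [env, h0]) h1
  · refine ⟨by have := (hq γ).1; simp [h0]; omega, fun k hk => ?_⟩
    obtain ⟨t, ht, h1⟩ := (hq γ).2 k hk
    refine ⟨t + 1, by simp; omega, ?_⟩
    simp only [h0, if_false]
    exact .ifz_pos (by simp [env, h0]) h1

theorem Comp.const (xs : List (Γ → ℕ)) (a : ℕ) : Comp κ xs fun _ => a := by
  induction a with
  | zero => exact Emits.nil xs
  | succ a ih =>
    obtain ⟨p, b, hp⟩ := ih
    refine ⟨.seq p (.succ xs.length), b + 2, fun γ => ⟨?_, fun k hk => ?_⟩⟩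
    · have : a ≤ _ := (hp γ).1
      simp; omega
    obtain ⟨t, ht, h1⟩ := (hp γ).2 k hk
    exact ⟨_, by simp; omega, (Exec.seq h1 (.succ _ _)).cast (by simp [Mem.setVar]) rfl⟩

theorem Comp.var {xs : List (Γ → ℕ)} {f : Γ → ℕ} (hf : f ∈ xs) : Comp κ xs f := by
  obtain ⟨i, hi, rfl⟩ := List.getElem_of_mem hf
  refine ⟨.copy xs.length i, .X + 1, fun γ => ⟨?_, fun k hk => ⟨1, by simp, ?_⟩⟩⟩
  · have := le_sz hf γ
    simp; omega
  · have : env xs γ i = xs[i] γ := by simp [env, hi]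
    rw [← this]
    exact .copy _ _ _

/-- Repeat a basic command that acts on the result counter. -/
theorem Comp.iter {xs : List (Γ → ℕ)} {f g : Γ → ℕ} (c : ℕ → Prog κ) (u : ℕ → ℕ)
    (hc : ∀ x s, Exec (c x) s (s.setVar x (u (s.var x))) [] 1) (hu : ∀ a, u a ≤ a + 1)
    (hf : Comp κ xs f) (hg : Comp κ xs g) : Comp κ xs fun γ => u^[g γ] (f γ) := by
  obtain ⟨p, b, hp⟩ := hf
  obtain ⟨q, d, hq⟩ := hg.weaken [f]
  have hit : ∀ j a, u^[j] a ≤ a + j := by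
    intro j
    induction j with
    | zero => simp
    | succ j ih => intro a; rw [Function.iterate_succ_apply]; have := ih (u a); have := hu a; omega
  refine ⟨.seq p (.seq q (.loop (xs.length + 1) (.seq (.pred (xs.length + 1)) (c xs.length)))),
    b + 5 * d.comp (.X + b) + 5, fun γ => ?_⟩
  have hcc : d.eval (sz (xs ++ [f]) γ) ≤ d.eval (sz xs γ + b.eval (sz xs γ)) :=
    eval_le_eval d (by have := (hp γ).1; simp [sz_append, sz_singleton]; omega)
  have hgb := (hq γ).1
  refine ⟨?_, fun k hk => ?_⟩
  · have := (hp γ).1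
    have := hit (g γ) (f γ)
    simp; omega
  obtain ⟨t, ht, h1⟩ := (hp γ).2 k hk
  obtain ⟨t', ht', h2⟩ := (hq γ).2 k fun a ha => hk a (by simp at ha; omega)
  rw [← env_append_singleton] at h1
  obtain ⟨t'', ht'', h3⟩ := Exec.countdown (κ := κ) (p := .seq (.pred (xs.length + 1)) (c xs.length)) (x := xs.length + 1)
    (τ := 3) (fun j => ⟨Function.update (Function.update (env xs γ) xs.length (u^[g γ - j] (f γ))) (xs.length + 1) j, k⟩)
    (fun _ => []) (by simp) (g γ) (fun j _ => by simp) fun j hj => ⟨_, le_rfl,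
      (Exec.seq (.pred _ _) (hc _ _)).cast (by
        simp only [Mem.setVar]
        congr 1
        funext x
        rcases eq_or_ne x xs.length with rfl | h1
        · have : g γ - j = (g γ - (j + 1)) + 1 := by omega
          simp [this, Function.iterate_succ_apply']
        · rcases eq_or_ne x (xs.length + 1) with rfl | h2
          · simp
          · simp [h1, h2]) rfl⟩
  refine ⟨_, ?_, (Exec.seq h1 (.seq h2 (h3.cast' ?_))).cast ?_ (by simp)⟩
  · simp; omega
  · simp [env_append_singleton]
  · congr 1
    funext x
    rcases eq_or_ne x (xs.length + 1) with rfl | h2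
    · simp [env_of_le]
    · simp [h2]

theorem Comp.add {xs : List (Γ → ℕ)} {f g : Γ → ℕ} (hf : Comp κ xs f) (hg : Comp κ xs g) :
    Comp κ xs fun γ => f γ + g γ := by
  refine (Comp.iter (fun x => .succ x) (· + 1) (fun x s => .succ s x) (by simp) hf hg).congr
    (fun γ => ?_) fun _ => rfl
  simp

theorem Comp.sub {xs : List (Γ → ℕ)} {f g : Γ → ℕ} (hf : Comp κ xs f) (hg : Comp κ xs g) :
    Comp κ xs fun γ => f γ - g γ := by
  refine (Comp.iter (fun x => .pred x) (· - 1) (fun x s => .pred s x) (by intro; omega) hf hg).congr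
    (fun γ => ?_) fun _ => rfl
  generalize g γ = j
  induction j with
  | zero => rfl
  | succ j ih => rw [Function.iterate_succ_apply', ih]; omega

/-- Repeated addition. Cell `xs.length + 1` counts down from `f γ`; when it holds `j`, the
accumulator in cell `xs.length` holds `(f γ - j) * g γ`. The next sum is computed in cell `xs.length
+ 2` and copied back. -/
theorem Comp.mul {xs : List (Γ → ℕ)} {f g : Γ → ℕ} (hf : Comp κ xs f) (hg : Comp κ xs g) :
    Comp κ xs fun γ => f γ * g γ := by
  obtain ⟨p, b, hp⟩ := hf.weaken [fun _ => 0]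
  obtain ⟨r, c, hr⟩ := hg
  have hstep : Comp κ (xs.map (· ∘ Prod.fst) ++ [fun γ => γ.2.1, fun γ => γ.2.2])
      fun γ : Γ × ℕ × ℕ => γ.2.1 + g γ.1 :=
    .add (.var (by simp)) ((Does.comap ⟨r, c, hr⟩ Prod.fst).weaken _)
  obtain ⟨q, d, hq⟩ := hstep
  have hz : ∀ γ, sz (xs ++ [fun _ => 0]) γ = sz xs γ := by simp [sz]
  have hw : ∀ γ i j, env (xs.map (· ∘ Prod.fst) ++ [fun γ => γ.2.1, fun γ => γ.2.2]) (γ, i, j)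
      = Function.update (Function.update (env xs γ) xs.length i) (xs.length + 1) j := by
    intro γ i j
    rw [show ([fun γ => γ.2.1, fun γ => γ.2.2] : List (Γ × ℕ × ℕ → ℕ))
      = [fun γ => γ.2.1] ++ [fun γ => γ.2.2] from rfl, ← List.append_assoc, env_append_singleton,
      env_append_singleton, env_comap]
    simp
  refine ⟨.seq p (.loop (xs.length + 1) (.seq q (.seq (.copy xs.length (xs.length + 2)) (.seq (.zero (xs.length + 2))
    (.pred (xs.length + 1)))))), b * c + b + b * (d.comp (.X + b * c + b) + 7) + 7, fun γ => ?_⟩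
  have hfb := (hp γ).1
  rw [hz] at hfb
  have hgb := (hr γ).1
  have hm : f γ * g γ ≤ b.eval (sz xs γ) * c.eval (sz xs γ) := Nat.mul_le_mul hfb hgb
  refine ⟨?_, fun k hk => ?_⟩
  · simp; omega
  obtain ⟨t, ht, h1⟩ := (hp γ).2 k fun a ha => hk a (by simp at ha; omega)
  rw [hz] at ht
  rw [env_append_singleton, update_env_zero] at h1
  obtain ⟨t', ht', h2⟩ := Exec.countdown (κ := κ) (p := .seq q (.seq (.copy xs.length (xs.length + 2))
      (.seq (.zero (xs.length + 2)) (.pred (xs.length + 1))))) (x := xs.length + 1)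
    (τ := d.eval (sz xs γ + b.eval (sz xs γ) * c.eval (sz xs γ) + b.eval (sz xs γ)) + 6)
    (fun j => ⟨Function.update (Function.update (env xs γ) xs.length ((f γ - j) * g γ)) (xs.length + 1) j, k⟩)
    (fun _ => []) (by simp) (f γ) (fun j _ => by simp) fun j hj => by
      obtain ⟨u, hu, h⟩ := (hq (γ, (f γ - (j + 1)) * g γ, j + 1)).2 k
        fun a ha => hk a (by simp at ha; omega)
      have hle : d.eval (sz (xs.map (· ∘ Prod.fst) ++ [fun γ => γ.2.1, fun γ => γ.2.2])
          (γ, (f γ - (j + 1)) * g γ, j + 1))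
          ≤ d.eval (sz xs γ + b.eval (sz xs γ) * c.eval (sz xs γ) + b.eval (sz xs γ)) := by
        refine eval_le_eval d ?_
        rw [sz_append, sz_comap]
        have : (f γ - (j + 1)) * g γ ≤ f γ * g γ := Nat.mul_le_mul_right _ (by omega)
        rw [sz_pair]
        dsimp only
        omega
      rw [hw] at h
      refine ⟨_, ?_, (Exec.seq h (.seq (.copy _ _ _) (.seq (.zero _ _) (.pred _ _)))).cast ?_
        (by simp)⟩
      · omega
      · simp only [Mem.setVar, List.length_append, List.length_map, List.length_cons,
          List.length_nil]
        congr 1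
        funext x
        rcases eq_or_ne x xs.length with rfl | h1
        · have : f γ - j = (f γ - (j + 1)) + 1 := by omega
          simp [this]; ring
        · rcases eq_or_ne x (xs.length + 1) with rfl | h2
          · simp
          · rcases eq_or_ne x (xs.length + 2) with rfl | h3
            · simp [env_of_le]
            · simp [h1, h2, h3]
  have h3 := Exec.seq h1 (h2.cast' ?_)
  · refine ⟨_, ?_, h3.cast ?_ (by simp)⟩
    · have : f γ * (d.eval (sz xs γ + b.eval (sz xs γ) * c.eval (sz xs γ) + b.eval (sz xs γ)) + 6 + 1)
        ≤ b.eval (sz xs γ) *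
          (d.eval (sz xs γ + b.eval (sz xs γ) * c.eval (sz xs γ) + b.eval (sz xs γ)) + 7) :=
        Nat.mul_le_mul_right _ hfb
      simp; omega
    · congr 1
      funext x
      rcases eq_or_ne x (xs.length + 1) with rfl | h2
      · simp [env_of_le]
      · simp [h2]
  · simp [update_env_zero]

theorem Comp.polynomial {xs : List (Γ → ℕ)} {f : Γ → ℕ} (hf : Comp κ xs f) (b : Polynomial ℕ) :
    Comp κ xs fun γ => b.eval (f γ) := by
  induction b using Polynomial.induction_on' with
  | add p q hp hq => exact (hp.add hq).congr (by simp) fun _ => rfl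
  | monomial k a =>
    induction k with
    | zero => exact (Comp.const xs a).congr (by simp) fun _ => rfl
    | succ k ih => exact (ih.mul hf).congr (by intro; simp [pow_succ, mul_assoc]) fun _ => rfl

/-- Two cells run in opposite directions: the index read by the body goes up, while the number of
remaining rounds goes down, since a loop of the machine can only test for zero. -/
theorem Emits.loop {xs : List (Γ → ℕ)} {f : Γ → ℕ} {C : Γ × ℕ → Circuit κ} (hf : Comp κ xs f)
    (hC : Emits (xs.map (· ∘ Prod.fst) ++ [Prod.snd]) C) :
    Emits xs fun γ => (List.range (f γ)).flatMap fun j => C (γ, j) := by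
  obtain ⟨p, b, hp⟩ := hf.weaken [fun _ => 0]
  obtain ⟨q, d, hq⟩ := (hC.comap (Γ' := (Γ × ℕ) × ℕ) Prod.fst).weaken [Prod.snd]
  have hz : ∀ γ, sz (xs ++ [fun _ => 0]) γ = sz xs γ := by simp [sz]
  have hw : ∀ γ i j, env ((xs.map (· ∘ Prod.fst) ++ [Prod.snd]).map (· ∘ Prod.fst) ++ [Prod.snd])
        ((γ, i), j) = Function.update (Function.update (env xs γ) xs.length i) (xs.length + 1) j := by
    intro γ i j
    rw [env_append_singleton, env_comap, env_append_singleton, env_comap]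
    simp
  refine ⟨.seq p (.seq (.loop (xs.length + 1) (.seq q (.seq (.succ xs.length) (.pred (xs.length + 1))))) (.zero xs.length)),
    b + b * (d.comp (.X + 2 * b) + 5) + 5, fun γ => ?_⟩
  have hfb := (hp γ).1
  rw [hz] at hfb
  refine ⟨by simp, fun k hk => ?_⟩
  obtain ⟨t, ht, h1⟩ := (hp γ).2 k fun a ha => hk a (by simp at ha; omega)
  rw [hz] at ht
  rw [env_append_singleton, update_env_zero] at h1
  obtain ⟨t', ht', h2⟩ := Exec.countdown (κ := κ) (p := .seq q (.seq (.succ xs.length) (.pred (xs.length + 1))))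
    (x := xs.length + 1) (τ := d.eval (sz xs γ + 2 * b.eval (sz xs γ)) + 4)
    (fun j => ⟨Function.update (Function.update (env xs γ) xs.length (f γ - j)) (xs.length + 1) j, k⟩)
    (fun j => C (γ, f γ - j)) (by simp) (f γ) (fun j _ => by simp) fun j hj => by
      obtain ⟨u, hu, h⟩ := (hq ((γ, f γ - (j + 1)), j + 1)).2 k
        fun a ha => hk a (by simp at ha; omega)
      have hle : d.eval (sz ((xs.map (· ∘ Prod.fst) ++ [Prod.snd]).map (· ∘ Prod.fst) ++ [Prod.snd])
          ((γ, f γ - (j + 1)), j + 1)) ≤ d.eval (sz xs γ + 2 * b.eval (sz xs γ)) := by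
        refine eval_le_eval d ?_
        rw [sz_append, sz_comap, sz_append, sz_comap]
        rw [sz_singleton, sz_singleton]
        dsimp only
        omega
      simp only [Function.comp_apply, update_env_zero] at h
      rw [hw] at h
      refine ⟨_, ?_, (Exec.seq h (.seq (.succ _ _) (.pred _ _))).cast ?_ (by simp)⟩
      · omega
      · simp only [Mem.setVar]
        congr 1
        funext x
        rcases eq_or_ne x xs.length with rfl | h1
        · have : f γ - j = (f γ - (j + 1)) + 1 := by omega
          simp [this]
        · rcases eq_or_ne x (xs.length + 1) with rfl | h2
          · simp
          · simp [h1, h2]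
  have h3 := Exec.seq h1 ((Exec.seq h2 (.zero _ xs.length)).cast' ?_)
  · refine ⟨_, ?_, h3.cast ?_ ?_⟩
    · have : f γ * (d.eval (sz xs γ + 2 * b.eval (sz xs γ)) + 4 + 1)
        ≤ b.eval (sz xs γ) * (d.eval (sz xs γ + 2 * b.eval (sz xs γ)) + 5) :=
        Nat.mul_le_mul_right _ hfb
      simp; omega
    · simp only [Mem.setVar]
      congr 1
      funext x
      rcases eq_or_ne x xs.length with rfl | h1
      · simp
      · rcases eq_or_ne x (xs.length + 1) with rfl | h2
        · simp [env_of_le]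
        · simp [h1, h2]
    · simp only [List.append_nil, List.nil_append]
      refine List.flatMap_congr fun j hj => ?_
      rw [List.mem_range] at hj
      rw [show f γ - (f γ - j) = j by omega]
  · simp [update_env_zero]

theorem Does.bindAll {xs fs : List (Γ → ℕ)} {g : Γ → ℕ} {C : Γ → Circuit κ}
    (hf : ∀ f ∈ fs, Comp κ xs f) (h : Does (xs ++ fs) g C) : Does xs g C := by
  induction fs generalizing xs with
  | nil => simpa using h
  | cons f fs ih =>
    refine Does.bind (hf f (by simp)) (ih (fun f' hf' => ?_) (by simpa using h))
    exact Does.weaken (hf f' (by simp [hf'])) _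

theorem Emits.op {xs : List (Γ → ℕ)} (o : Op κ) (fs : List (Γ → ℕ))
    (hf : ∀ f ∈ fs, Comp κ xs f) : Emits xs fun γ => [o.fill (env fs γ)] := by
  refine Does.bindAll hf ⟨.emit (o.rename (xs.length + ·)), 1, fun γ => ⟨by simp, fun k _ =>
    ⟨1, by simp, ?_⟩⟩⟩
  rw [update_env_zero]
  have h := Exec.emit ⟨env (xs ++ fs) γ, k⟩ (o.rename (xs.length + ·))
  rwa [Op.fill_rename, show env (xs ++ fs) γ ∘ (xs.length + ·) = env fs γ from
    funext fun x => env_append_right xs fs γ x] at h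

/-- A wire of a family of circuits: a kind, and functions that give index and position. -/
abbrev WireFam (κ Γ : Type) := κ × (Γ → ℕ) × (Γ → ℕ)

/-- The value of a family of wires. -/
def WireFam.at (w : WireFam κ Γ) (γ : Γ) : Wire κ := (w.1, w.2.1 γ, w.2.2 γ)

/-- Index and position are computed in polynomial time. -/
def WireFam.Ok (xs : List (Γ → ℕ)) (w : WireFam κ Γ) : Prop :=
  Comp κ xs w.2.1 ∧ Comp κ xs w.2.2

theorem Emits.gate {ι : Type} {xs : List (Γ → ℕ)} (g : Gate ι) (w : ι → WireFam κ Γ)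
    (hw : ∀ q ∈ g.wires, (w q).Ok xs) :
    Emits xs fun γ => [Op.gate (g.map fun q => (w q).at γ)] := by
  cases g with
  | H q =>
    refine (Emits.op (xs := xs) (.gate (.H ((w q).1, 0, 1))) [(w q).2.1, (w q).2.2] ?_).congr
      (fun _ => rfl) fun γ => by simp [Op.fill, Gate.map, env, WireFam.at]
    simpa [Gate.wires, WireFam.Ok] using hw
  | T q =>
    refine (Emits.op (xs := xs) (.gate (.T ((w q).1, 0, 1))) [(w q).2.1, (w q).2.2] ?_).congr
      (fun _ => rfl) fun γ => by simp [Op.fill, Gate.map, env, WireFam.at]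
    simpa [Gate.wires, WireFam.Ok] using hw
  | Tinv q =>
    refine (Emits.op (xs := xs) (.gate (.Tinv ((w q).1, 0, 1))) [(w q).2.1, (w q).2.2] ?_).congr
      (fun _ => rfl) fun γ => by simp [Op.fill, Gate.map, env, WireFam.at]
    simpa [Gate.wires, WireFam.Ok] using hw
  | X q =>
    refine (Emits.op (xs := xs) (.gate (.X ((w q).1, 0, 1))) [(w q).2.1, (w q).2.2] ?_).congr
      (fun _ => rfl) fun γ => by simp [Op.fill, Gate.map, env, WireFam.at]
    simpa [Gate.wires, WireFam.Ok] using hw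
  | CX c t =>
    refine (Emits.op (xs := xs) (.gate (.CX ((w c).1, 0, 1) ((w t).1, 2, 3)))
      [(w c).2.1, (w c).2.2, (w t).2.1, (w t).2.2] ?_).congr
      (fun _ => rfl) fun γ => by simp [Op.fill, Gate.map, env, WireFam.at]
    simpa [Gate.wires, WireFam.Ok, and_assoc] using hw
  | CCX c d t =>
    refine (Emits.op (xs := xs) (.gate (.CCX ((w c).1, 0, 1) ((w d).1, 2, 3) ((w t).1, 4, 5)))
      [(w c).2.1, (w c).2.2, (w d).2.1, (w d).2.2, (w t).2.1, (w t).2.2] ?_).congr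
      (fun _ => rfl) fun γ => by simp [Op.fill, Gate.map, env, WireFam.at]
    simpa [Gate.wires, WireFam.Ok, and_assoc] using hw

end QCrypto
namespace QCrypto

variable {κ κ' Γ Γ' : Type}

/-! ### Transforming the circuits of a family -/

/-- Set `c` counters to zero, starting with `a`. -/
def Prog.zeros (a : ℕ) : ℕ → Prog κ
  | 0 => skip
  | c + 1 => seq (zero (a + c)) (Prog.zeros a c)

theorem Exec.zeros (a c : ℕ) (s : Mem) : Exec (κ := κ) (.zeros a c) s
    ⟨fun x => if a ≤ x ∧ x < a + c then 0 else s.var x, s.stk⟩ [] (2 * c + 1) := by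
  induction c generalizing s with
  | zero => exact (Exec.skip s).cast (by
      refine congrArg₂ Mem.mk (funext fun x => ?_) rfl; rw [if_neg (by omega)]) rfl
  | succ c ih =>
    have h := Exec.seq (.zero s (a + c)) (ih (s.setVar (a + c) 0))
    rw [show 1 + (2 * c + 1) + 1 = 2 * (c + 1) + 1 by ring] at h
    refine h.cast ?_ rfl
    simp only [Mem.setVar]
    congr 1
    funext x
    rcases eq_or_ne x (a + c) with rfl | hx
    · simp
    · rw [Function.update_of_ne hx]
      exact if_congr (by omega) rfl rfl

/-- Copy `c` counters. -/
def Prog.copies (a b : ℕ) : ℕ → Prog κ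
  | 0 => skip
  | c + 1 => seq (copy (a + c) (b + c)) (Prog.copies a b c)

theorem Exec.copies (a b c : ℕ) (s : Mem) (h : b + c ≤ a) : Exec (κ := κ) (.copies a b c) s
    ⟨fun x => if a ≤ x ∧ x < a + c then s.var (b + (x - a)) else s.var x, s.stk⟩ []
    (2 * c + 1) := by
  induction c generalizing s with
  | zero => exact (Exec.skip s).cast (by
      refine congrArg₂ Mem.mk (funext fun x => ?_) rfl; rw [if_neg (by omega)]) rfl
  | succ c ih =>
    have h := Exec.seq (.copy s (a + c) (b + c)) (ih (s.setVar (a + c) (s.var (b + c))) (by omega))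
    rw [show 1 + (2 * c + 1) + 1 = 2 * (c + 1) + 1 by ring] at h
    refine h.cast ?_ rfl
    simp only [Mem.setVar]
    congr 1
    funext x
    rcases eq_or_ne x (a + c) with rfl | hx
    · simp
    · rw [Function.update_of_ne hx]
      by_cases h1 : a ≤ x ∧ x < a + c
      · rw [if_pos h1, if_pos (by omega), Function.update_of_ne (by omega)]
      · rw [if_neg h1, if_neg (by omega)]

/-- Empty `c` stacks, starting with `a`, of length at most the contents of the counter `z`. -/
def Prog.clear (z x y a : ℕ) : ℕ → Prog κ
  | 0 => skip
  | c + 1 => seq (seq (copy x z) (seq (loop x (seq (pop y (a + c)) (pred x))) (zero y)))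
      (Prog.clear z x y a c)

/-- There is no test for an empty stack. A stack is emptied by popping as often as the counter `z`
says, where a pop from an empty stack does no harm; `x` counts the pops and `y` receives the numbers
that are thrown away. -/
theorem Exec.clear {z x y : ℕ} (hxy : x ≠ y) (hxz : x ≠ z) (hyz : y ≠ z) (a c : ℕ) (s : Mem)
    (hx : s.var x = 0) (hy : s.var y = 0) (hs : ∀ b, a ≤ b → b < a + c → (s.stk b).length ≤ s.var z) :
    ∃ t, t ≤ c * (4 * s.var z + 8) + 1 ∧ Exec (κ := κ) (.clear z x y a c) s
    ⟨s.var, fun b => if a ≤ b ∧ b < a + c then [] else s.stk b⟩ [] t := by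
  induction c generalizing s with
  | zero => exact ⟨1, by omega, (Exec.skip s).cast (by
      refine congrArg₂ Mem.mk rfl (funext fun x => ?_); rw [if_neg (by omega)]) rfl⟩
  | succ c ih =>
    obtain ⟨t, ht, h⟩ := ih (s.setStk (a + c) []) hx hy (by
      intro b hb hb'
      simp only [Mem.setStk]
      rw [Function.update_of_ne (by omega)]
      exact hs b hb (by omega))
    -- The content of `y` after `j` pops: the number popped last, and zero before the first pop or
    -- when the stack has run out.
    let pp : ℕ → ℕ := fun j => if j = 0 then 0 else ((s.stk (a + c)).drop (j - 1)).headD 0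
    obtain ⟨t', ht', h'⟩ := Exec.countdown (κ := κ) (p := .seq (.pop y (a + c)) (.pred x)) (x := x)
      (τ := 3) (fun j => ⟨Function.update (Function.update s.var x j) y (pp (s.var z - j)),
        Function.update s.stk (a + c) ((s.stk (a + c)).drop (s.var z - j))⟩) (fun _ => [])
      (by simp [hxy]) (s.var z) (fun j _ => by simp [hxy]) fun j hj => ⟨_, le_rfl,
        (Exec.seq (.pop _ _ _) (.pred _ _)).cast (by
          have e1 : s.var z - j = s.var z - (j + 1) + 1 := by omega
          simp only [Mem.setVar, Mem.setStk, Function.update_self, Function.update_idem]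
          congr 1
          · funext w
            rcases eq_or_ne w x with rfl | h1
            · simp [hxy]
            · rcases eq_or_ne w y with rfl | h2
              · simp [h1, pp, e1]
              · simp [h1, h2]
          · rw [e1, List.tail_drop]) rfl⟩
    refine ⟨_, ?_, (Exec.seq (.seq (.copy _ _ _) (.seq (h'.cast' ?_) (.zero _ _)))
      (h.cast' ?_)).cast ?_ (by simp)⟩
    · have : (s.setStk (a + c) []).var z = s.var z := rfl
      rw [this] at ht
      nlinarith
    · simp only [Mem.setVar]
      congr 1
      · funext w
        rcases eq_or_ne w y with rfl | h2
        · simp [hxy.symm, pp, hy]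
        · simp [h2]
      · simp
    · simp only [Mem.setVar, Mem.setStk]
      congr 1
      · funext w
        rcases eq_or_ne w y with rfl | h2
        · simp [hy]
        · rcases eq_or_ne w x with rfl | h1
          · simp [h2, hx]
          · simp [h2, h1]
      · rw [Nat.sub_zero, List.drop_eq_nil_of_le (hs _ (by omega) (by omega))]
    · simp only [Mem.setStk]
      congr 1
      funext b
      rcases eq_or_ne b (a + c) with rfl | hb
      · simp
      · rw [Function.update_of_ne hb]
        exact if_congr (by omega) rfl rfl

/-! ### Running a given machine as a subroutine -/

theorem Comp.sum {xs : List (Γ → ℕ)} {fs : List (Γ → ℕ)} (h : ∀ f ∈ fs, Comp κ xs f) :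
    Comp κ xs (sz fs) := by
  induction fs with
  | nil => exact Comp.const xs 0
  | cons f fs ih =>
    exact ((h f (by simp)).add (ih fun g hg => h g (by simp [hg]))).congr
      (fun γ => by simp [sz]) fun _ => rfl

/-- The inputs `ins` and a bound `T` for the running time are computed first. Then come a cell for
the number of operations treated so far, and the cells of `p`. The inputs are copied into the latter
and `p` is run, with a handler in place of each command that writes an operation. Its result is
saved and its cells are cleared: the stacks are no longer than the running time, so that `T` pops
empty each of them. In this way the subroutine leaves no traces, which `Does` requires. -/
theorem Does.run {xs ins : List (Γ → ℕ)} (hins : ∀ f ∈ ins, Comp κ' xs f) {p : Prog κ}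
    {b : Polynomial ℕ} {C : Γ → Circuit κ} {r : Γ → ℕ}
    (h : ∀ γ, ∃ s t, Exec p (Mem.start (ins.map (· γ))) s (C γ) t ∧ s.var 0 = r γ ∧
      t ≤ b.eval (sz ins γ))
    (F : Γ → ℕ → Op κ → Circuit κ')
    (hF : ∀ (o : Op κ) (ys : List (Γ × ℕ × (ℕ → ℕ) → ℕ)),
      Comp κ' (xs.map (· ∘ Prod.fst) ++ ys) (fun γ => γ.2.1) →
      (∀ y ∈ o.names, Comp κ' (xs.map (· ∘ Prod.fst) ++ ys) fun γ => γ.2.2 y) →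
      Emits (xs.map (· ∘ Prod.fst) ++ ys) fun γ => F γ.1 γ.2.1 (o.fill γ.2.2)) :
    Does xs r fun γ => Circuit.subst (F γ) 0 (C γ) := by
  classical
  let T : Γ → ℕ := fun γ => b.eval (sz ins γ)
  have hT : Comp κ' xs T := (Comp.sum hins).polynomial b
  refine Does.bindAll (fs := ins ++ [T]) (by
    intro f hf
    rcases List.mem_append.1 hf with hf | hf
    · exact hins f hf
    · rw [List.mem_singleton.1 hf]; exact hT) ?_
  set zs := xs ++ (ins ++ [T]) with hzs
  obtain ⟨m, hm, hpm⟩ := p.exists_below (ins.length + 2)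
  -- For a handler, the number of operations treated so far and the first `m` counters of `p` are
  -- additional inputs; all names in operations of `p` are among these counters.
  let ws : List (Γ × ℕ × (ℕ → ℕ) → ℕ) := (fun γ => γ.2.1) :: (List.range m).map fun y γ => γ.2.2 y
  have handler : ∀ o, o ∈ p.ops → Emits (zs.map (· ∘ Prod.fst) ++ ws)
      fun γ => F γ.1 γ.2.1 (o.fill γ.2.2) := by
    intro o ho
    have := hF o ((ins ++ [T]).map (· ∘ Prod.fst) ++ ws) (.var (by simp [ws])) fun y hy =>
      .var (by
        have := hpm.ops o ho y hy
        simp only [ws, List.mem_append, List.mem_cons, List.mem_map, List.mem_range]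
        exact Or.inr (Or.inr (Or.inr ⟨y, this, rfl⟩)))
    simpa [hzs] using this
  have : Nonempty (Prog κ') := ⟨.skip⟩
  choose! H bo hH using handler
  have hws : ∀ γ k v, env ws (γ, k, v) = fun x => if x = 0 then k else if x - 1 < m then v (x - 1)
      else 0 := by
    intro γ k v
    funext x
    cases x with
    | zero => simp [env, ws]
    | succ x =>
      by_cases hx : x < m
      · simp [env, ws, hx]
      · simp [env, ws, hx]
  have hwsl : ws.length = m + 1 := by simp [ws]
  have hwsz : ∀ γ k v V, k ≤ V → (∀ x, v x ≤ V) → sz ws (γ, k, v) ≤ V + m * V := by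
    intro γ k v V hk hv
    have : ((List.range m).map v).sum ≤ m * V := by
      have := List.sum_le_card_nsmul ((List.range m).map v) V (by simpa using fun a _ => hv a)
      simpa using this
    have h0 : sz ws (γ, k, v) = k + ((List.range m).map v).sum := by
      simp [sz, ws, Function.comp_def]
    omega
  set n := zs.length with hn
  have hnT : n = xs.length + ins.length + 1 := by simp [hn, hzs]; ring
  let e : ℕ → ℕ := fun y => n + 1 + y
  have he : e.Injective := fun x y h => by simpa [e] using h
  have hext : ∀ {β : Type} (f g : ℕ → β) (x : ℕ),
      Function.extend e f g x = if n + 1 ≤ x then f (x - (n + 1)) else g x := by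
    intro β f g x
    split_ifs with hx
    · obtain ⟨y, rfl⟩ := Nat.exists_eq_add_of_le hx
      rw [show n + 1 + y = e y from rfl, he.extend_apply]
      simp [e]
    · rw [Function.extend_apply']
      rintro ⟨y, rfl⟩
      exact hx (by simp [e])
  have henvz : ∀ γ x, n ≤ x → env zs γ x = 0 := fun γ x hx => env_of_le hx
  -- There are finitely many handlers, so the sum of their bounds serves for all of them. Its
  -- argument accounts for the inputs `zs`, the count, and `m` counters, each of the last two kinds
  -- being at most `sz zs γ`.
  let bo' : Polynomial ℕ := (p.ops.map bo).sum.comp (.X + (.X + (m : Polynomial ℕ) * .X)) + 2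
  refine ⟨.seq (.copies (n + 1) xs.length ins.length)
    (.seq (p.expand e fun o => .seq (H o) (.succ n)) (.seq (.copy n (n + 1))
      (.seq (.zeros (n + 1) m) (.clear (n - 1) (n + 1) (n + 2) (n + 1) m)))),
    .X + 2 * (ins.length : Polynomial ℕ) + .X * (bo' + 1) + 2 * (m : Polynomial ℕ)
      + (m : Polynomial ℕ) * (4 * .X + 8) + 10, fun γ => ?_⟩
  obtain ⟨s, t, hp, hr, ht⟩ := h γ
  have hz : sz zs γ = sz xs γ + (sz ins γ + T γ) := by
    simp [hzs, sz_append, sz_singleton]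
  have hstart := Mem.start_le (ins.map (· γ))
  have hle := hp.le hstart
  have htT : t ≤ T γ := ht
  have hsum : (ins.map (· γ)).sum = sz ins γ := rfl
  have hV : (ins.map (· γ)).sum + t ≤ sz zs γ := by omega
  have hblank : (Mem.start (ins.map (· γ))).Blank m := by
    intro x hx
    refine ⟨?_, rfl⟩
    simp [Mem.start, List.getElem?_eq_none (show ins.length ≤ x by omega)]
  have hblank' := hp.blank hpm hblank
  constructor
  · rw [← hr]
    have := hle.1 0
    simp
    omega
  intro k hk
  -- The memory of the host with the memory of `p` written into it is exactly the environment in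
  -- which the handlers run.
  have hbase : ∀ j s, s.Blank m → Mem.over e ⟨Function.update (env zs γ) n j, k⟩ s
      = ⟨env (zs.map (· ∘ Prod.fst) ++ ws) (γ, j, s.var), Function.extend e s.stk k⟩ := by
    intro j s hs
    simp only [Mem.over]
    congr 1
    funext x
    rw [hext]
    rcases lt_trichotomy x n with hx | rfl | hx
    · rw [if_neg (by omega), Function.update_of_ne hx.ne,
        env_append_left (xs := zs.map (· ∘ Prod.fst)) (by simpa using hx), env_comap]
    · have := env_append_right (zs.map (· ∘ Prod.fst)) ws (γ, j, s.var) 0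
      rw [hws] at this
      simp only [List.length_map, Nat.add_zero, ← hn] at this
      rw [this]
      simp
    · obtain ⟨y, rfl⟩ := Nat.exists_eq_add_of_lt hx
      have := env_append_right (zs.map (· ∘ Prod.fst)) ws (γ, j, s.var) (y + 1)
      rw [hws] at this
      simp only [List.length_map, ← hn] at this
      rw [if_pos (by omega), show n + y + 1 = n + (y + 1) by ring, this]
      rw [if_neg (by omega), show n + (y + 1) - (n + 1) = y by omega, Nat.add_sub_cancel]
      split_ifs with hy
      · rfl
      · exact (hs y (not_lt.1 hy)).1
  obtain ⟨t', ht', h'⟩ := Exec.expand he (H := fun o => .seq (H o) (.succ n)) (F := F γ)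
    (base := fun j => ⟨Function.update (env zs γ) n j, k⟩) (τ := bo'.eval (sz zs γ))
    (V := sz zs γ) (k := 0) hp hpm hblank hstart hV (by omega) (by
      intro o ho j s hj hs hsV
      rw [hbase j s hs]
      obtain ⟨u, hu, hu'⟩ := (hH o ho (γ, j, s.var)).2 (Function.extend e s.stk k) (by
        intro a ha
        simp [hwsl] at ha
        rw [hext, if_pos (by omega)]
        exact (hs _ (by omega)).2)
      rw [update_env_zero] at hu'
      refine ⟨_, ?_, (Exec.seq hu' (.succ _ n)).cast ?_ (by simp)⟩
      · have h1 : (bo o).eval (sz (zs.map (· ∘ Prod.fst) ++ ws) (γ, j, s.var))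
            ≤ (bo o).eval (sz zs γ + (sz zs γ + m * sz zs γ)) := by
          refine eval_le_eval _ ?_
          rw [sz_append, sz_comap]
          exact Nat.add_le_add_left (hwsz _ _ _ _ hj hsV.1) _
        have h2 : ∀ x, (bo o).eval x ≤ (p.ops.map bo).sum.eval x := by
          intro x
          rw [← Polynomial.coe_evalRingHom, map_list_sum]
          exact List.single_le_sum (fun _ _ => Nat.zero_le _) _
            (List.mem_map.2 ⟨bo o, List.mem_map.2 ⟨o, ho, rfl⟩, rfl⟩)
        have h3 := h2 (sz zs γ + (sz zs γ + m * sz zs γ))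
        simp [bo']
        omega
      · rw [← hbase j s hs]
        simp only [Mem.setVar, Mem.over]
        congr 1
        funext x
        rw [hext, hext]
        rcases eq_or_ne x n with rfl | hx
        · simp
        · simp only [Function.update_of_ne hx]
          rw [hext, Function.update_of_ne hx])
  have h1 := Exec.copies (κ := κ') (n + 1) xs.length ins.length ⟨env zs γ, k⟩ (by omega)
  set s2 : Mem := ⟨Function.update (env zs γ) n (r γ), Function.extend e s.stk k⟩ with hs2
  have hs2T : s2.var (n - 1) = T γ := by
    simp only [hs2]
    rw [Function.update_of_ne (by omega), hzs, show n - 1 = xs.length + (ins.length + 0) by omega,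
      env_append_right, env_append_right]
    simp [env]
  obtain ⟨t3, ht3, h3⟩ := Exec.clear (κ := κ') (z := n - 1) (x := n + 1) (y := n + 2) (by omega)
    (by omega) (by omega) (n + 1) m s2 (by simp [hs2, henvz]) (by simp [hs2, henvz]) (by
      intro a ha ha'
      rw [hs2T]
      simp only [hs2, hext]
      rw [if_pos ha]
      have := hp.stk_length_le (a - (n + 1))
      simp [Mem.start] at this
      omega)
  rw [hs2T] at ht3
  have h2 := Exec.zeros (κ := κ') (n + 1) m ⟨Function.update (Function.extend e s.var
    (Function.update (env zs γ) n (0 + (C γ).length))) n (s.var 0), Function.extend e s.stk k⟩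
  refine ⟨_, ?_, (Exec.seq h1 (.seq (h'.cast' ?_) (.seq (.copy _ _ _)
    (.seq (h2.cast' ?_) (h3.cast' ?_))))).cast ?_ (by simp)⟩
  · have h5 : t * (bo'.eval (sz zs γ) + 1) ≤ sz zs γ * (bo'.eval (sz zs γ) + 1) :=
      Nat.mul_le_mul_right _ (by omega)
    have h6 : m * (4 * T γ + 8) ≤ m * (4 * sz zs γ + 8) := Nat.mul_le_mul_left _ (by omega)
    simp
    omega
  · simp only [Mem.over, Mem.start]
    refine congrArg₂ Mem.mk (funext fun x => ?_) (funext fun x => ?_)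
    · rw [hext]
      by_cases hx : n + 1 ≤ x
      · rw [if_pos hx]
        obtain ⟨y, rfl⟩ := Nat.exists_eq_add_of_le hx
        by_cases hy : y < ins.length
        · rw [if_pos (by omega), hzs, env_append_right, Nat.add_sub_cancel_left,
            env_append_left hy]
          rfl
        · rw [if_neg (by omega), Nat.add_sub_cancel_left, henvz _ _ (by omega)]
          simp [List.getElem?_eq_none (not_lt.1 hy)]
      · rw [if_neg hx, if_neg (by omega)]
        rcases eq_or_ne x n with rfl | h
        · simp [henvz]
        · rw [Function.update_of_ne h]
    · rw [hext]
      split_ifs with hx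
      · exact (hk x (by omega)).symm
      · rfl
  · simp only [Mem.over, Mem.setVar]
    rw [hext, if_pos le_rfl, Nat.sub_self]
  · simp only [hs2]
    refine congrArg₂ Mem.mk (funext fun x => ?_) rfl
    rw [hr]
    rcases eq_or_ne x n with rfl | h
    · simp
    · rw [Function.update_of_ne h, Function.update_of_ne h, hext, Function.update_of_ne h]
      split_ifs with h7 h8
      · exact henvz γ x (by omega)
      · rw [henvz γ x (by omega), (hblank' (x - (n + 1)) (by omega)).1]
      · rfl
  · simp only [hs2]
    refine congrArg₂ Mem.mk rfl (funext fun x => ?_)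
    rw [hext]
    split_ifs with h7
    · exact (hk x (by omega)).symm
    · rw [(hblank' (x - (n + 1)) (by omega)).2, hk x (by omega)]
    · rfl

theorem Does.emits {xs : List (Γ → ℕ)} {f : Γ → ℕ} {C : Γ → Circuit κ} (h : Does xs f C) :
    Emits xs C := by
  obtain ⟨p, b, h⟩ := h
  refine ⟨.seq p (.zero xs.length), b + 2, fun γ => ⟨by simp, fun k hk => ?_⟩⟩
  obtain ⟨t, ht, h⟩ := (h γ).2 k hk
  exact ⟨_, by simp; omega, (Exec.seq h (.zero _ _)).cast (by simp [Mem.setVar]) (by simp)⟩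

theorem Emits.of_qpt {xs : List (Γ → ℕ)} {f : Γ → ℕ} {C : ℕ → Circuit κ} (h : QPT C)
    (hf : Comp κ' xs f) (F : Γ → ℕ → Op κ → Circuit κ')
    (hF : ∀ (o : Op κ) (ys : List (Γ × ℕ × (ℕ → ℕ) → ℕ)),
      Comp κ' (xs.map (· ∘ Prod.fst) ++ ys) (fun γ => γ.2.1) →
      (∀ y ∈ o.names, Comp κ' (xs.map (· ∘ Prod.fst) ++ ys) fun γ => γ.2.2 y) →
      Emits (xs.map (· ∘ Prod.fst) ++ ys) fun γ => F γ.1 γ.2.1 (o.fill γ.2.2)) :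
    Emits xs fun γ => Circuit.subst (F γ) 0 (C (f γ)) := by
  obtain ⟨p, b, h⟩ := h
  choose s t h using h
  refine (Does.run (ins := [f]) (by simpa using hf) (p := p) (b := b) (C := fun γ => C (f γ))
    (r := fun γ => (s (f γ)).var 0) (fun γ => ⟨s (f γ), t (f γ), (h (f γ)).1, rfl, ?_⟩) F hF).emits
  rw [sz_singleton]
  exact (h (f γ)).2

theorem Emits.of_indexedQPT {xs : List (Γ → ℕ)} {f g : Γ → ℕ} {C : ℕ → ℕ → Circuit κ}
    (h : IndexedQPT C) (hf : Comp κ' xs f) (hg : Comp κ' xs g) (F : Γ → ℕ → Op κ → Circuit κ')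
    (hF : ∀ (o : Op κ) (ys : List (Γ × ℕ × (ℕ → ℕ) → ℕ)),
      Comp κ' (xs.map (· ∘ Prod.fst) ++ ys) (fun γ => γ.2.1) →
      (∀ y ∈ o.names, Comp κ' (xs.map (· ∘ Prod.fst) ++ ys) fun γ => γ.2.2 y) →
      Emits (xs.map (· ∘ Prod.fst) ++ ys) fun γ => F γ.1 γ.2.1 (o.fill γ.2.2)) :
    Emits xs fun γ => Circuit.subst (F γ) 0 (C (f γ) (g γ)) := by
  obtain ⟨p, b, h⟩ := h
  choose s t h using h
  refine (Does.run (ins := [f, g]) (by simpa using ⟨hf, hg⟩) (p := p) (b := b)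
    (C := fun γ => C (f γ) (g γ)) (r := fun γ => (s (f γ) (g γ)).var 0)
    (fun γ => ⟨s (f γ) (g γ), t (f γ) (g γ), (h (f γ) (g γ)).1, rfl, ?_⟩) F hF).emits
  rw [sz_pair]
  exact (h (f γ) (g γ)).2

theorem Comp.of_polyTimeLength {xs : List (Γ → ℕ)} {f : Γ → ℕ} {len : ℕ → ℕ}
    (h : PolyTimeLength len) (hf : Comp κ xs f) : Comp κ xs fun γ => len (f γ) := by
  obtain ⟨p, b, h⟩ := h
  choose s t h using h
  refine (Does.run (ins := [f]) (by simpa using hf) (p := p) (b := b) (C := fun γ => [])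
    (r := fun γ => len (f γ)) (fun γ => ⟨s (f γ), t (f γ), (h (f γ)).1, (h (f γ)).2.1, ?_⟩)
    (fun _ _ _ => []) fun o ys _ _ => Emits.nil _).congr (fun _ => rfl) fun _ => rfl
  rw [sz_singleton]
  exact (h (f γ)).2.2

theorem Emits.qpt {C : ℕ → Circuit κ} (h : Emits [id] C) : QPT C := by
  obtain ⟨p, b, h⟩ := h
  refine ⟨p, b, fun l => ?_⟩
  obtain ⟨t, ht, h⟩ := (h l).2 (fun _ => []) fun _ _ => rfl
  exact ⟨_, t, h, by simpa [sz] using ht⟩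

theorem Emits.indexedQPT {C : ℕ × ℕ → Circuit κ} (h : Emits [Prod.fst, Prod.snd] C) :
    IndexedQPT fun l i => C (l, i) := by
  obtain ⟨p, b, h⟩ := h
  refine ⟨p, b, fun l i => ?_⟩
  obtain ⟨t, ht, h⟩ := (h (l, i)).2 (fun _ => []) fun _ _ => rfl
  exact ⟨_, t, h, by simpa [sz] using ht⟩

/-! ### Polynomial bounds for the circuits of uniform families -/

/-- The circuit has length at most `V` and all its positions are at most `V`. -/
def Circuit.Bounded (V : ℕ) (C : Circuit κ) : Prop := C.length ≤ V ∧ ∀ o ∈ C, o.Bounded V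

theorem Circuit.Bounded.mono {V W : ℕ} {C : Circuit κ} (h : C.Bounded V) (hVW : V ≤ W) :
    C.Bounded W := ⟨h.1.trans hVW, fun o ho => (h.2 o ho).mono hVW⟩

/-- Every operation costs a step, and the positions in it are contents of counters, which start at
`l` and grow by at most one per step. -/
theorem QPT.bounded {C : ℕ → Circuit κ} (h : QPT C) :
    ∃ V : Polynomial ℕ, ∀ l, (C l).Bounded (V.eval l) := by
  obtain ⟨p, b, h⟩ := h
  refine ⟨.X + b, fun l => ?_⟩
  obtain ⟨s, t, h, ht⟩ := h l
  refine ⟨h.length_le.trans (by simp; omega), fun o ho => ?_⟩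
  refine (h.bounded (Mem.start_le _) o ho).mono ?_
  simp; omega

theorem IndexedQPT.bounded {C : ℕ → ℕ → Circuit κ} (h : IndexedQPT C) :
    ∃ V : Polynomial ℕ, ∀ l i, (C l i).Bounded (V.eval (l + i)) := by
  obtain ⟨p, b, h⟩ := h
  refine ⟨.X + b, fun l i => ?_⟩
  obtain ⟨s, t, h, ht⟩ := h l i
  refine ⟨h.length_le.trans (by simp; omega), fun o ho => ?_⟩
  refine (h.bounded (Mem.start_le _) o ho).mono ?_
  simp; omega

/-! ### Gates, oracle calls and loops in uniform families -/

theorem Comp.lift {xs : List (Γ → ℕ)} {f : Γ → ℕ} (h : Comp κ xs f) :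
    Comp κ (xs.map (· ∘ Prod.fst) ++ [Prod.snd]) fun γ : Γ × ℕ => f γ.1 :=
  Does.weaken (Does.comap h Prod.fst) _

theorem Comp.under {xs : List (Γ → ℕ)} {f : Γ → ℕ} (h : Comp κ xs f) (ys : List (Γ × Γ' → ℕ)) :
    Comp κ (xs.map (· ∘ Prod.fst) ++ ys) fun γ : Γ × Γ' => f γ.1 :=
  Does.weaken (Does.comap h Prod.fst) _

theorem Comp.last (xs : List (Γ → ℕ)) :
    Comp κ (xs.map (· ∘ Prod.fst) ++ [Prod.snd]) fun γ : Γ × ℕ => γ.2 :=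
  .var (by simp)

theorem Emits.cx {xs : List (Γ → ℕ)} {k₁ k₂ : κ} {i₁ j₁ i₂ j₂ : Γ → ℕ} (h₁ : Comp κ xs i₁)
    (h₂ : Comp κ xs j₁) (h₃ : Comp κ xs i₂) (h₄ : Comp κ xs j₂) :
    Emits xs fun γ => [Op.gate (.CX (k₁, i₁ γ, j₁ γ) (k₂, i₂ γ, j₂ γ))] :=
  Emits.gate (.CX (k₁, i₁, j₁) (k₂, i₂, j₂)) id (by
    simp [Gate.wires, WireFam.Ok, h₁, h₂, h₃, h₄])

theorem Emits.ccx {xs : List (Γ → ℕ)} {k₁ k₂ k₃ : κ} {i₁ j₁ i₂ j₂ i₃ j₃ : Γ → ℕ}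
    (h₁ : Comp κ xs i₁) (h₂ : Comp κ xs j₁) (h₃ : Comp κ xs i₂) (h₄ : Comp κ xs j₂)
    (h₅ : Comp κ xs i₃) (h₆ : Comp κ xs j₃) :
    Emits xs fun γ => [Op.gate (.CCX (k₁, i₁ γ, j₁ γ) (k₂, i₂ γ, j₂ γ) (k₃, i₃ γ, j₃ γ))] :=
  Emits.gate (.CCX (k₁, i₁, j₁) (k₂, i₂, j₂) (k₃, i₃, j₃)) id (by
    simp [Gate.wires, WireFam.Ok, h₁, h₂, h₃, h₄, h₅, h₆])

theorem Emits.x {xs : List (Γ → ℕ)} {k : κ} {i j : Γ → ℕ} (h₁ : Comp κ xs i)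
    (h₂ : Comp κ xs j) : Emits xs fun γ => [Op.gate (.X (k, i γ, j γ))] :=
  Emits.gate (.X (k, i, j)) id (by simp [Gate.wires, WireFam.Ok, h₁, h₂])

theorem Emits.h {xs : List (Γ → ℕ)} {k : κ} {i j : Γ → ℕ} (h₁ : Comp κ xs i)
    (h₂ : Comp κ xs j) : Emits xs fun γ => [Op.gate (.H (k, i γ, j γ))] :=
  Emits.gate (.H (k, i, j)) id (by simp [Gate.wires, WireFam.Ok, h₁, h₂])

theorem Emits.query {xs : List (Γ → ℕ)} {k₁ k₂ : κ} {n i₁ i₂ : Γ → ℕ} (h₁ : Comp κ xs n)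
    (h₂ : Comp κ xs i₁) (h₃ : Comp κ xs i₂) :
    Emits xs fun γ => [Op.query (n γ) (k₁, i₁ γ) (k₂, i₂ γ)] :=
  (Emits.op (.query 0 (k₁, 1) (k₂, 2)) [n, i₁, i₂] (by simp [h₁, h₂, h₃])).congr (fun _ => rfl)
    fun γ => by simp [Op.fill, env]

theorem Emits.loop' {xs : List (Γ → ℕ)} {f : Γ → ℕ} {C : Γ → ℕ → Circuit κ} (hf : Comp κ xs f)
    (hC : Emits (xs.map (· ∘ Prod.fst) ++ [Prod.snd]) fun γ : Γ × ℕ => C γ.1 γ.2) :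
    Emits xs fun γ => (List.range (f γ)).flatMap (C γ) := Emits.loop hf hC

end QCrypto
namespace QCrypto

variable {κ κ' Γ Γ' : Type}

/-! ### The circuits of the reduction -/

/-- Relabelling of wires by kinds, with a shift of the index. -/
def shiftWire (rk : κ → κ') (sh : κ → ℕ) (w : Wire κ) : Wire κ' :=
  (rk w.1, w.2.1 + sh w.1, w.2.2)

/-- Answer an encryption query by means of the samples `a, a + 1, …` of a bank; the random strings
of the bank are in register `(kr, 0)` and the values of the function in `(ka, 0)`. -/
def simQuery (rk : κ → κ') (sh : κ → ℕ) (kr ka : κ') (ℓ a len : ℕ) (src tgt : κ × ℕ) :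
    Circuit κ' :=
  (List.range len).flatMap fun j =>
    ((List.range ℓ).flatMap fun t => [.gate (.CX (kr, 0, (a + j) * ℓ + t)
      (rk tgt.1, tgt.2 + sh tgt.1, j * (ℓ + 1) + t))]) ++
    ([.gate (.CX (ka, 0, a + j) (rk tgt.1, tgt.2 + sh tgt.1, j * (ℓ + 1) + ℓ))] ++
    [.gate (.CX (rk src.1, src.2 + sh src.1, j)
      (rk tgt.1, tgt.2 + sh tgt.1, j * (ℓ + 1) + ℓ))])

open Classical in
/-- Simulate the `k`-th operation of a circuit; for each of them there are `V` samples. -/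
noncomputable def simOp (rk : κ → κ') (sh : κ → ℕ) (kr ka : κ') (ℓ V k : ℕ) : Op κ → Circuit κ'
  | .gate g => [.gate (g.map (shiftWire rk sh))]
  | .query len src tgt => if src = tgt then [] else simQuery rk sh kr ka ℓ (k * V) len src tgt

theorem Emits.simQuery {xs : List (Γ → ℕ)} (rk : κ → κ') (sh : κ → ℕ) (kr ka : κ') (k₁ k₂ : κ)
    {ℓ a len i₁ i₂ : Γ → ℕ} (hℓ : Comp κ' xs ℓ) (ha : Comp κ' xs a) (hlen : Comp κ' xs len)
    (h₁ : Comp κ' xs i₁) (h₂ : Comp κ' xs i₂) :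
    Emits xs fun γ => QCrypto.simQuery rk sh kr ka (ℓ γ) (a γ) (len γ) (k₁, i₁ γ) (k₂, i₂ γ) := by
  refine Emits.loop' hlen (Emits.append (Emits.loop' hℓ.lift ?_) (Emits.append ?_ ?_))
  · exact Emits.cx (k₁ := kr) (k₂ := rk k₂) (.const _ 0)
      (((ha.lift.lift.add (Comp.last _).lift).mul hℓ.lift.lift).add (.last _))
      (h₂.lift.lift.add (.const _ (sh k₂)))
      (((Comp.last _).lift.mul (hℓ.lift.lift.add (.const _ 1))).add (.last _))
  · exact Emits.cx (k₁ := ka) (k₂ := rk k₂) (.const _ 0) (ha.lift.add (.last _))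
      (h₂.lift.add (.const _ (sh k₂)))
      (((Comp.last _).mul (hℓ.lift.add (.const _ 1))).add hℓ.lift)
  · exact Emits.cx (k₁ := rk k₁) (k₂ := rk k₂) (h₁.lift.add (.const _ (sh k₁))) (.last _)
      (h₂.lift.add (.const _ (sh k₂)))
      (((Comp.last _).mul (hℓ.lift.add (.const _ 1))).add hℓ.lift)

theorem Emits.simOp {xs : List (Γ → ℕ)} (rk : κ → κ') (sh : κ → ℕ) (kr ka : κ') (o : Op κ)
    {ℓ V k : Γ → ℕ} {w : Γ → ℕ → ℕ} (hℓ : Comp κ' xs ℓ) (hV : Comp κ' xs V) (hk : Comp κ' xs k)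
    (hw : ∀ y ∈ o.names, Comp κ' xs fun γ => w γ y) :
    Emits xs fun γ => QCrypto.simOp rk sh kr ka (ℓ γ) (V γ) (k γ) (o.fill (w γ)) := by
  classical
  rcases o with g | ⟨x, ⟨k₁, y⟩, ⟨k₂, z⟩⟩
  · refine (Emits.gate g (fun q => (rk q.1, fun γ => w γ q.2.1 + sh q.1, fun γ => w γ q.2.2))
      fun q hq => ⟨Comp.add (hw _ ?_) (.const _ _), hw _ ?_⟩).congr (fun _ => rfl) fun γ => ?_
    · simp only [Op.names, List.mem_flatMap]; exact ⟨q, hq, by simp⟩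
    · simp only [Op.names, List.mem_flatMap]; exact ⟨q, hq, by simp⟩
    · cases g <;> rfl
  · have hx := hw x (by simp [Op.names])
    have hy := hw y (by simp [Op.names])
    have hz := hw z (by simp [Op.names])
    have h1 := Emits.simQuery rk sh kr ka k₁ k₂ hℓ (hk.mul hV) hx hy hz
    by_cases hkk : k₁ = k₂
    · subst hkk
      -- Equality of the two indices is decided by a test for zero: both truncated differences
      -- vanish exactly when the indices agree.
      refine (Does.ite (f := fun _ => 0) (g := fun _ => 0) ((hy.sub hz).add (hz.sub hy))
        (Emits.nil xs) h1).congr (fun _ => by simp) fun γ => ?_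
      simp only [Op.fill, QCrypto.simOp, Prod.mk.injEq, true_and]
      exact if_congr (by omega) rfl rfl
    · refine h1.congr (fun _ => rfl) fun γ => ?_
      simp [Op.fill, QCrypto.simOp, hkk]

/-! ### Relabelled circuits and their inverses -/

/-- A relabelled circuit as a substitution. -/
def relabelOp (e : Wire κ → Wire κ') : Op κ → Circuit κ'
  | .gate g => [.gate (g.map e)]
  | .query _ _ _ => []

theorem Circuit.relabel_eq (e : Wire κ → Wire κ') (C : Circuit κ) :
    Circuit.relabel e C = C.flatMap (relabelOp e) := by
  induction C with
  | nil => rfl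
  | cons o C ih =>
    rcases o with g | ⟨x, src, tgt⟩
    · simpa [Circuit.relabel, relabelOp] using ih
    · simpa [Circuit.relabel, relabelOp] using ih

theorem Circuit.subst_const (G : Op κ → Circuit κ') (k : ℕ) (C : Circuit κ) :
    Circuit.subst (fun _ => G) k C = C.flatMap G := by
  induction C generalizing k with
  | nil => rfl
  | cons o C ih => simp [Circuit.subst, ih]

theorem Circuit.subst_single (G : Op κ → Circuit κ') (C : Circuit κ) (k m : ℕ) :
    Circuit.subst (fun i o => if i = k + m then G o else []) k C = (C[m]?).elim [] G := by
  induction C generalizing k m with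
  | nil => rfl
  | cons o C ih =>
    cases m with
    | zero =>
      have : ∀ (j : ℕ) (D : Circuit κ), k < j →
          Circuit.subst (fun i o => if i = k + 0 then G o else []) j D = [] := by
        intro j D
        induction D generalizing j with
        | nil => simp [Circuit.subst]
        | cons o D ihD =>
          intro hj
          simp only [Circuit.subst, ihD (j + 1) (by omega)]
          rw [if_neg (by omega), List.nil_append]
      have := this (k + 1) C (by omega)
      simp only [Nat.add_zero] at this
      simp [Circuit.subst, this]
    | succ m =>
      have := ih (k + 1) m
      simp only [Circuit.subst]
      rw [if_neg (by omega), show k + (m + 1) = k + 1 + m by ring, this]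
      simp

/-- A machine writes `C` from front to back only. The reversed circuit is obtained by going through
all of `C` once for every position, counted from the end, and keeping only the operation found
there. Positions beyond the length of `C` contribute nothing, so any upper bound `n` for the length
will do. -/
theorem Circuit.reverse_flatMap (G : Op κ → Circuit κ') (C : Circuit κ) {n : ℕ}
    (h : C.length ≤ n) : C.reverse.flatMap G = (List.range n).flatMap fun j =>
      Circuit.subst (fun i o => if i = n - 1 - j then G o else []) 0 C := by
  have h1 : ∀ m, Circuit.subst (fun i o => if i = m then G o else []) 0 C = (C[m]?).elim [] G := by
    intro m
    simpa using Circuit.subst_single G C 0 m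
  simp only [h1]
  have h2 : ∀ n, ((List.range n).reverse.flatMap fun m => (C[m]?).elim [] G)
      = (C.take n).reverse.flatMap G := by
    intro n
    induction n with
    | zero => simp
    | succ n ih =>
      rw [List.range_succ, List.reverse_append, List.take_add_one, List.reverse_append]
      simp only [List.reverse_cons, List.reverse_nil, List.nil_append, List.flatMap_append, ih,
        List.flatMap_cons, List.flatMap_nil, List.append_nil]
      congr 1
      cases C[n]? <;> simp
  have h3 := h2 n
  rw [List.take_of_length_le h] at h3
  have h4 : (List.range n).reverse = (List.range n).map (n - 1 - ·) := by
    refine List.ext_getElem (by simp) fun i h5 h6 => ?_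
    simp
  rw [← h3, h4, List.flatMap_map]

theorem Circuit.inv_relabel (e : Wire κ → Wire κ') (C : Circuit κ) :
    (Circuit.relabel e C).inv = C.reverse.flatMap fun o => (relabelOp e o).inv := by
  rw [Circuit.relabel_eq]
  induction C with
  | nil => rfl
  | cons o C ih =>
    simp only [List.flatMap_cons, List.reverse_cons, List.flatMap_append, List.flatMap_nil,
      List.append_nil, ← ih]
    simp [Circuit.inv]

/-- Relabelling of wires by kinds; for some of the kinds, registers of positive index are moved out
of the way. -/
def placeWire (rk : κ → κ') (z : κ → Bool) (N : ℕ) (w : Wire κ) : Wire κ' :=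
  (rk w.1, w.2.1 + (if z w.1 then N * (1 - (1 - w.2.1)) else 0), w.2.2)

/-- In truncated arithmetic `1 - (1 - x)` is the indicator of `x ≠ 0`; the shift of the registers of
positive index takes this form because it is then a term that the machine can compute. -/
theorem Emits.placeGate {xs : List (Γ → ℕ)} (rk : κ → κ') (z : κ → Bool) {N : Γ → ℕ}
    (hN : Comp κ' xs N) (g : Gate (Wire κ)) {w : Γ → ℕ → ℕ}
    (hw : ∀ y ∈ (Op.gate g).names, Comp κ' xs fun γ => w γ y) :
    Emits xs fun γ => [Op.gate ((g.map fun q => (q.1, w γ q.2.1, w γ q.2.2)).map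
      (placeWire rk z (N γ)))] := by
  refine (Emits.gate g (fun q => (rk q.1, fun γ => w γ q.2.1 +
    (if z q.1 then N γ * (1 - (1 - w γ q.2.1)) else 0), fun γ => w γ q.2.2))
    fun q hq => ⟨?_, hw _ ?_⟩).congr (fun _ => rfl) fun γ => ?_
  · have h1 := hw q.2.1 (by simp only [Op.names, List.mem_flatMap]; exact ⟨q, hq, by simp⟩)
    cases z q.1
    · exact h1.add (.const _ _)
    · exact h1.add (hN.mul ((Comp.const _ _).sub ((Comp.const _ _).sub h1)))
  · simp only [Op.names, List.mem_flatMap]; exact ⟨q, hq, by simp⟩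
  · cases g <;> rfl

theorem Gate.map_inv {α β : Type} (e : α → β) (g : Gate α) : g.inv.map e = (g.map e).inv := by
  cases g <;> rfl

theorem Emits.relabelOp {xs : List (Γ → ℕ)} (rk : κ → κ') (z : κ → Bool) {N : Γ → ℕ}
    (hN : Comp κ' xs N) (o : Op κ) {w : Γ → ℕ → ℕ}
    (hw : ∀ y ∈ o.names, Comp κ' xs fun γ => w γ y) :
    Emits xs (fun γ => QCrypto.relabelOp (placeWire rk z (N γ)) (o.fill (w γ))) ∧
    Emits xs (fun γ => Circuit.inv (QCrypto.relabelOp (placeWire rk z (N γ)) (o.fill (w γ)))) := by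
  rcases o with g | ⟨x, src, tgt⟩
  · refine ⟨Emits.placeGate rk z hN g hw, ?_⟩
    refine (Emits.placeGate rk z hN g.inv (w := w) ?_).congr (fun _ => rfl) fun γ => ?_
    · cases g <;> exact hw
    · cases g <;> rfl
  · exact ⟨Emits.nil _, Emits.nil _⟩

theorem Emits.relabel {xs : List (Γ → ℕ)} (rk : κ → κ') (z : κ → Bool) {N f : Γ → ℕ}
    (hN : Comp κ' xs N) (hf : Comp κ' xs f) {C : ℕ → Circuit κ} (h : QPT C) :
    Emits xs (fun γ => Circuit.relabel (placeWire rk z (N γ)) (C (f γ))) := by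
  refine (Emits.of_qpt h hf (fun γ _ => QCrypto.relabelOp (placeWire rk z (N γ))) ?_).congr
    (fun _ => rfl) fun γ => ?_
  · intro o _ _ hw
    exact (Emits.relabelOp rk z (hN.under _) o hw).1
  · rw [Circuit.relabel_eq, Circuit.subst_const]

theorem Emits.relabel_inv {xs : List (Γ → ℕ)} (rk : κ → κ') (z : κ → Bool) {N f : Γ → ℕ}
    (hN : Comp κ' xs N) (hf : Comp κ' xs f) {C : ℕ → Circuit κ} (h : QPT C) :
    Emits xs (fun γ => (Circuit.relabel (placeWire rk z (N γ)) (C (f γ))).inv) := by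
  obtain ⟨V, hV⟩ := h.bounded
  have hT := hf.polynomial V
  refine (Emits.loop' hT (C := fun γ j => Circuit.subst
    (fun i o => if i = V.eval (f γ) - 1 - j then
      (QCrypto.relabelOp (placeWire rk z (N γ)) o).inv else []) 0 (C (f γ))) ?_).congr
    (fun _ => rfl) fun γ => ?_
  · refine (Emits.of_qpt h hf.lift (fun γ i o => if i = V.eval (f γ.1) - 1 - γ.2 then
      (QCrypto.relabelOp (placeWire rk z (N γ.1)) o).inv else []) ?_)
    intro o ys hk hw
    have h1 : Comp κ' ((xs.map (· ∘ Prod.fst) ++ [Prod.snd]).map (· ∘ Prod.fst) ++ ys)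
        fun γ : (Γ × ℕ) × ℕ × (ℕ → ℕ) => V.eval (f γ.1.1) - 1 - γ.1.2 :=
      ((hT.lift.under _).sub (.const _ _)).sub ((Comp.last _).under _)
    refine (Does.ite (f := fun _ => 0) (g := fun _ => 0) ((hk.sub h1).add (h1.sub hk))
      (Emits.relabelOp rk z (N := fun γ => N γ.1.1)
        (hN.lift.under _) o hw).2 (Emits.nil _)).congr
      (fun _ => by simp) fun γ => if_congr (by omega) rfl rfl
  · rw [Circuit.inv_relabel, Circuit.reverse_flatMap _ _ (hV _).1]

/-- A pair of kinds and an index: a bank of samples `(r, f r)`. -/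
abbrev Bank := PirateReg × PirateReg × ℕ

/-- The banks of samples: one for the pirate, and two for each party. -/
def banks (N s : ℕ) : List Bank :=
  [(.work 0, .work 1, 0)] ++ (List.range N).flatMap fun i =>
    [(.state 0, .state 1, i + s)] ++ [(.state 2, .state 3, i + s)]

/-- Uniformly random strings in a bank of `M` samples. -/
def randomBank (ℓ M : ℕ) (ρ : Bank) : Circuit PirateReg :=
  (List.range (M * ℓ)).flatMap fun p => [.gate (.H (ρ.1, ρ.2.2, p))]

/-- The kinds of the registers of the evaluation procedure, run by the pirate. -/
def evalKind : ProgReg → PirateReg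
  | .state => .copy
  | .input => .work 2
  | .output => .work 3
  | .work c => .work (2 * c + 4)

/-- The wires of the evaluation procedure, run by the pirate on the first copy. -/
def evalWire (N : ℕ) : Wire ProgReg → Wire PirateReg :=
  placeWire evalKind (fun k => decide (k = .state)) N

/-- Copy the `a`-th string of a bank into the input register of the evaluation procedure. -/
def copyInput (ℓ : ℕ) (ρ : Bank) (a : ℕ) : Circuit PirateReg :=
  (List.range ℓ).flatMap fun t => [.gate (.CX (ρ.1, ρ.2.2, a * ℓ + t) (.work 2, 0, t))]

/-- Evaluate the function at the `a`-th string of a bank. -/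
def evalSample (N ℓ : ℕ) (E : Circuit ProgReg) (ρ : Bank) (a : ℕ) : Circuit PirateReg :=
  copyInput ℓ ρ a ++ (Circuit.relabel (evalWire N) E ++
    ([.gate (.CX (.work 3, 0, 0) (ρ.2.1, ρ.2.2, a))] ++
      ((Circuit.relabel (evalWire N) E).inv ++ copyInput ℓ ρ a)))

/-- Evaluate the function at all strings of a bank. -/
def evalBank (N ℓ M : ℕ) (E : Circuit ProgReg) (ρ : Bank) : Circuit PirateReg :=
  (List.range M).flatMap fun a => evalSample N ℓ E ρ a

/-- Kinds of the registers of a simulated pirate. -/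
def pirateKind : PirateReg → PirateReg
  | .copy => .copy
  | .state c => .state (c + 7)
  | .len => .state 4
  | .plain false => .state 5
  | .plain true => .state 6
  | .work c => .work (2 * c + 5)

/-- Shift of the index of the registers of a simulated pirate. -/
def pirateShift (s : ℕ) : PirateReg → ℕ
  | .work _ => 0
  | _ => s

/-- Hand the first copy over to the first party. -/
def handOver (V : ℕ) : Circuit PirateReg :=
  ((List.range V).flatMap fun j => [.gate (.CX (.copy, 0, j) (.state 0, 0, j))]) ++
    (List.range V).flatMap fun j => [.gate (.CX (.state 0, 0, j) (.copy, 0, j))]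

/-- The circuit of the simulated pirate. -/
noncomputable def simPirate (s ℓ V : ℕ) (C : Circuit PirateReg) : Circuit PirateReg :=
  Circuit.subst (simOp pirateKind (pirateShift s) (.work 0) (.work 1) ℓ V) 0 C

/-- Kinds of the registers of a simulated party. -/
def partyKind : PartyReg → PartyReg
  | .state c => .state (c + 7)
  | .work c => .work (c + 6)
  | k => k

/-- The circuit of a simulated party. -/
noncomputable def simParty (ℓ V : ℕ) (C : Circuit PartyReg) : Circuit PartyReg :=
  Circuit.subst (simOp partyKind (fun _ => 0) (.state 0) (.state 1) ℓ V) 0 C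

/-- The oracle calls for a challenge of at most `m` blocks. -/
def flipQueries (m : ℕ) : Circuit PartyReg :=
  (List.range m).flatMap fun j => [.query 0 (.work 0, 0) (.work 1, j)]

/-- Find out whether the plaintexts have a `j`-th bit and whether these bits are different. -/
def blockFlags (j : ℕ) : Circuit PartyReg :=
  [.gate (.CCX (.work 2, 0, j) (.state 4, 0, j) (.work 2, 0, j + 1))] ++
  ([.gate (.CCX (.work 2, 0, j + 1) (.state 5, 0, j) (.work 4, 0, j))] ++
  ([.gate (.CCX (.work 2, 0, j + 1) (.state 6, 0, j) (.work 4, 0, j))] ++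
  ([.gate (.CX (.work 2, 0, j + 1) (.work 5, 0, j))] ++
  [.gate (.CX (.work 4, 0, j) (.work 5, 0, j))])))

/-- Write the `j`-th block of the challenge. -/
def blockData (ℓ j : ℕ) : Circuit PartyReg :=
  ((List.range (ℓ + 1)).flatMap fun t =>
    [.gate (.CX (.work 2, 0, j + 1) (.chalLen, 0, j * (ℓ + 1) + t))]) ++
  (((List.range (ℓ + 1)).flatMap fun t =>
    [.gate (.CCX (.work 4, 0, j) (.work 1, j, t) (.chalData, 0, j * (ℓ + 1) + t))]) ++
  (((List.range ℓ).flatMap fun t =>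
    [.gate (.CCX (.work 5, 0, j) (.state 2, 0, j * ℓ + t) (.chalData, 0, j * (ℓ + 1) + t))]) ++
  ([.gate (.CCX (.work 5, 0, j) (.state 3, 0, j) (.chalData, 0, j * (ℓ + 1) + ℓ))] ++
  [.gate (.CCX (.work 2, 0, j + 1) (.state 5, 0, j) (.chalData, 0, j * (ℓ + 1) + ℓ))])))

/-- Prepare a challenge of at most `m` blocks. -/
def prepare (ℓ m : ℕ) : Circuit PartyReg :=
  flipQueries m ++ ([.gate (.X (.work 2, 0, 0))] ++
    ((List.range m).flatMap blockFlags ++ (List.range m).flatMap (blockData ℓ)))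

/-- Kinds of the registers of the evaluation procedure, run by the party that gets a copy. -/
def ownerKind : ProgReg → PartyReg
  | .state => .state 0
  | .input => .work 2
  | .output => .work 3
  | .work c => .work (c + 4)

/-- The party that gets a copy. -/
def owner (ℓ : ℕ) (E : Circuit ProgReg) : Circuit PartyReg :=
  [.query 0 (.work 0, 0) (.work 1, 0)] ++
  (((List.range ℓ).flatMap fun t => [.gate (.CX (.work 1, 0, t) (.work 2, 0, t))]) ++
  (Circuit.relabel (placeWire ownerKind (fun _ => false) 0) E ++
  ([.gate (.CX (.work 3, 0, 0) (.out, 0, 0))] ++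
  ((Circuit.relabel (placeWire ownerKind (fun _ => false) 0) E).inv ++
  (((List.range ℓ).flatMap fun t => [.gate (.CX (.work 1, 0, t) (.work 2, 0, t))]) ++
  [.gate (.CX (.work 1, 0, ℓ) (.out, 0, 0))])))))

/-! ### Uniformity of the circuits of the reduction -/

theorem Emits.randomBank {xs : List (Γ → ℕ)} {ℓ M i : Γ → ℕ} (k k' : PirateReg)
    (hℓ : Comp PirateReg xs ℓ) (hM : Comp PirateReg xs M) (hi : Comp PirateReg xs i) :
    Emits xs fun γ => QCrypto.randomBank (ℓ γ) (M γ) (k, k', i γ) :=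
  Emits.loop' (hM.mul hℓ) (Emits.h hi.lift (.last _))

theorem Emits.copyInput {xs : List (Γ → ℕ)} {ℓ i a : Γ → ℕ} (k k' : PirateReg)
    (hℓ : Comp PirateReg xs ℓ) (hi : Comp PirateReg xs i) (ha : Comp PirateReg xs a) :
    Emits xs fun γ => QCrypto.copyInput (ℓ γ) (k, k', i γ) (a γ) :=
  Emits.loop' hℓ (Emits.cx hi.lift ((ha.lift.mul hℓ.lift).add (.last _)) (.const _ _) (.last _))

theorem Emits.evalBank {xs : List (Γ → ℕ)} {ℓ M N f i : Γ → ℕ} (k k' : PirateReg)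
    (hℓ : Comp PirateReg xs ℓ) (hM : Comp PirateReg xs M) (hN : Comp PirateReg xs N)
    (hf : Comp PirateReg xs f) (hi : Comp PirateReg xs i) {E : ℕ → Circuit ProgReg} (hE : QPT E) :
    Emits xs fun γ => QCrypto.evalBank (N γ) (ℓ γ) (M γ) (E (f γ)) (k, k', i γ) :=
  Emits.loop' hM (Emits.append (Emits.copyInput k k' hℓ.lift hi.lift (.last _))
    (Emits.append (Emits.relabel _ _ hN.lift hf.lift hE)
    (Emits.append (Emits.cx (.const _ _) (.const _ _) hi.lift (.last _))
    (Emits.append (Emits.relabel_inv _ _ hN.lift hf.lift hE)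
      (Emits.copyInput k k' hℓ.lift hi.lift (.last _))))))

theorem Emits.banks {xs : List (Γ → ℕ)} {N : Γ → ℕ} (s : ℕ) (hN : Comp PirateReg xs N)
    {C : Γ → Bank → Circuit PirateReg}
    (h0 : Emits xs fun γ => C γ (.work 0, .work 1, 0))
    (h1 : Emits (xs.map (· ∘ Prod.fst) ++ [Prod.snd])
      fun γ : Γ × ℕ => C γ.1 (.state 0, .state 1, γ.2 + s))
    (h2 : Emits (xs.map (· ∘ Prod.fst) ++ [Prod.snd])
      fun γ : Γ × ℕ => C γ.1 (.state 2, .state 3, γ.2 + s)) :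
    Emits xs fun γ => (QCrypto.banks (N γ) s).flatMap (C γ) := by
  refine (h0.append (Emits.loop' hN (C := fun γ i => C γ (.state 0, .state 1, i + s) ++
    C γ (.state 2, .state 3, i + s)) (h1.append h2))).congr (fun _ => rfl) fun γ => ?_
  simp [QCrypto.banks, List.flatMap_assoc]

theorem Emits.handOver {xs : List (Γ → ℕ)} {V : Γ → ℕ} (hV : Comp PirateReg xs V) :
    Emits xs fun γ => QCrypto.handOver (V γ) :=
  Emits.append (Emits.loop' hV (Emits.cx (.const _ _) (.last _) (.const _ _) (.last _)))
    (Emits.loop' hV (Emits.cx (.const _ _) (.last _) (.const _ _) (.last _)))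

theorem Emits.prepare {xs : List (Γ → ℕ)} {ℓ m : Γ → ℕ} (hℓ : Comp PartyReg xs ℓ)
    (hm : Comp PartyReg xs m) : Emits xs fun γ => QCrypto.prepare (ℓ γ) (m γ) := by
  have c0 : ∀ {Γ : Type} {xs : List (Γ → ℕ)} (a : ℕ), Comp PartyReg xs fun _ => a :=
    fun a => Comp.const _ a
  have hj := Comp.last (κ := PartyReg) xs
  have hj1 := hj.add (c0 1)
  refine Emits.append (Emits.loop' hm (Emits.query (c0 0) (c0 0) hj))
    (Emits.append (Emits.x (c0 0) (c0 0)) (Emits.append (Emits.loop' hm ?_) (Emits.loop' hm ?_)))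
  · exact Emits.append (Emits.ccx (c0 0) hj (c0 0) hj (c0 0) hj1)
      (Emits.append (Emits.ccx (c0 0) hj1 (c0 0) hj (c0 0) hj)
      (Emits.append (Emits.ccx (c0 0) hj1 (c0 0) hj (c0 0) hj)
      (Emits.append (Emits.cx (c0 0) hj1 (c0 0) hj) (Emits.cx (c0 0) hj (c0 0) hj))))
  · have hℓ1 := hℓ.lift.add (c0 1)
    have ht := Comp.last (κ := PartyReg) (xs.map (· ∘ Prod.fst) ++ [Prod.snd])
    have hp := (hj.lift.mul hℓ1.lift).add ht
    have hp' := (hj.mul hℓ1).add hℓ.lift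
    exact Emits.append (Emits.loop' hℓ1 (Emits.cx (c0 0) hj1.lift (c0 0) hp))
      (Emits.append (Emits.loop' hℓ1 (Emits.ccx (c0 0) hj.lift hj.lift ht (c0 0) hp))
      (Emits.append (Emits.loop' hℓ.lift (Emits.ccx (c0 0) hj.lift (c0 0)
        ((hj.lift.mul hℓ.lift.lift).add ht) (c0 0) hp))
      (Emits.append (Emits.ccx (c0 0) hj (c0 0) hj (c0 0) hp')
        (Emits.ccx (c0 0) hj1 (c0 0) hj (c0 0) hp'))))

theorem Emits.owner {xs : List (Γ → ℕ)} {ℓ f : Γ → ℕ} (hℓ : Comp PartyReg xs ℓ)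
    (hf : Comp PartyReg xs f) {E : ℕ → Circuit ProgReg} (hE : QPT E) :
    Emits xs fun γ => QCrypto.owner (ℓ γ) (E (f γ)) := by
  have hcopy : Emits xs fun γ => (List.range (ℓ γ)).flatMap fun t =>
      [Op.gate (.CX (PartyReg.work 1, 0, t) (PartyReg.work 2, 0, t))] :=
    Emits.loop' hℓ (Emits.cx (.const _ _) (.last _) (.const _ _) (.last _))
  exact Emits.append (Emits.query (.const _ _) (.const _ _) (.const _ _))
    (Emits.append hcopy (Emits.append (Emits.relabel _ _ (.const _ 0) hf hE)
    (Emits.append (Emits.cx (.const _ _) (.const _ _) (.const _ _) (.const _ _))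
    (Emits.append (Emits.relabel_inv _ _ (.const _ 0) hf hE) (Emits.append hcopy
      (Emits.cx (.const _ _) hℓ (.const _ _) (.const _ _)))))))

theorem Emits.simPirate {xs : List (Γ → ℕ)} (s : ℕ) {ℓ V f : Γ → ℕ} (hℓ : Comp PirateReg xs ℓ)
    (hV : Comp PirateReg xs V) (hf : Comp PirateReg xs f) {C : ℕ → Circuit PirateReg}
    (hC : QPT C) : Emits xs fun γ => QCrypto.simPirate s (ℓ γ) (V γ) (C (f γ)) :=
  Emits.of_qpt hC hf (fun γ => QCrypto.simOp pirateKind (pirateShift s) (.work 0) (.work 1)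
    (ℓ γ) (V γ)) fun o _ hk hw => Emits.simOp _ _ _ _ o (hℓ.under _)
      (hV.under _) hk hw

theorem Emits.simParty {xs : List (Γ → ℕ)} {ℓ V f g : Γ → ℕ} (hℓ : Comp PartyReg xs ℓ)
    (hV : Comp PartyReg xs V) (hf : Comp PartyReg xs f) (hg : Comp PartyReg xs g)
    {C : ℕ → ℕ → Circuit PartyReg} (hC : IndexedQPT C) :
    Emits xs fun γ => QCrypto.simParty (ℓ γ) (V γ) (C (f γ) (g γ)) :=
  Emits.of_indexedQPT hC hf hg (fun γ => QCrypto.simOp partyKind (fun _ => 0) (.state 0) (.state 1)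
    (ℓ γ) (V γ)) fun o _ hk hw => Emits.simOp _ _ _ _ o (hℓ.under _)
      (hV.under _) hk hw

/-- The pirate of the reduction. -/
noncomputable def flipPirate (s N ℓ V M : ℕ) (E : Circuit ProgReg) (D C : Circuit PirateReg) :
    Circuit PirateReg :=
  (banks N s).flatMap (randomBank ℓ M) ++ ((banks N s).flatMap (evalBank N ℓ M E) ++
    (D ++ simPirate s ℓ V C))

/-- The parties of the reduction that simulate a distinguisher. -/
noncomputable def flipParty (ℓ V m : ℕ) (C : Circuit PartyReg) : Circuit PartyReg :=
  prepare ℓ m ++ simParty ℓ V C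

theorem Emits.flipPirate {xs : List (Γ → ℕ)} (s : ℕ) {N ℓ V M f : Γ → ℕ}
    (hN : Comp PirateReg xs N) (hℓ : Comp PirateReg xs ℓ) (hV : Comp PirateReg xs V)
    (hM : Comp PirateReg xs M) (hf : Comp PirateReg xs f) {E : ℕ → Circuit ProgReg} (hE : QPT E)
    {C : ℕ → Circuit PirateReg} (hC : QPT C) {D : Γ → Circuit PirateReg} (hD : Emits xs D) :
    Emits xs fun γ => QCrypto.flipPirate s (N γ) (ℓ γ) (V γ) (M γ) (E (f γ)) (D γ) (C (f γ)) := by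
  have hi : Comp PirateReg (xs.map (· ∘ Prod.fst) ++ [Prod.snd]) fun γ => γ.2 + s :=
    (Comp.last _).add (.const _ _)
  refine Emits.append (Emits.banks s hN ?_ ?_ ?_) (Emits.append (Emits.banks s hN ?_ ?_ ?_)
    (Emits.append hD (Emits.simPirate s hℓ hV hf hC)))
  · exact Emits.randomBank _ _ hℓ hM (.const _ _)
  · exact Emits.randomBank _ _ hℓ.lift hM.lift hi
  · exact Emits.randomBank _ _ hℓ.lift hM.lift hi
  · exact Emits.evalBank _ _ hℓ hM hN hf (.const _ _) hE
  · exact Emits.evalBank _ _ hℓ.lift hM.lift hN.lift hf.lift hi hE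
  · exact Emits.evalBank _ _ hℓ.lift hM.lift hN.lift hf.lift hi hE

theorem Emits.flipParty {xs : List (Γ → ℕ)} {ℓ V m f g : Γ → ℕ} (hℓ : Comp PartyReg xs ℓ)
    (hV : Comp PartyReg xs V) (hm : Comp PartyReg xs m) (hf : Comp PartyReg xs f)
    (hg : Comp PartyReg xs g) {C : ℕ → ℕ → Circuit PartyReg} (hC : IndexedQPT C) :
    Emits xs fun γ => QCrypto.flipParty (ℓ γ) (V γ) (m γ) (C (f γ) (g γ)) :=
  Emits.append (Emits.prepare hℓ hm) (Emits.simParty hℓ hV hf hg hC)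

end QCrypto
namespace QCrypto

/-! ### The action of gates on states -/

set_option linter.unusedSectionVars false

section
variable {α β : Type}

/-- The target of a gate. -/
def Gate.target : Gate α → α
  | H q => q
  | T q => q
  | Tinv q => q
  | X q => q
  | CX _ t => t
  | CCX _ _ t => t

theorem Gate.map_map {γ : Type} (e : α → β) (e' : β → γ) (g : Gate α) :
    (g.map e).map e' = g.map (e' ∘ e) := by cases g <;> rfl

theorem Gate.wires_map (e : α → β) (g : Gate α) : (g.map e).wires = g.wires.map e := by
  cases g <;> rfl

theorem Gate.target_map (e : α → β) (g : Gate α) : (g.map e).target = e g.target := by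
  cases g <;> rfl

theorem Gate.target_mem_wires (g : Gate α) : g.target ∈ g.wires := by
  cases g <;> simp [Gate.wires, Gate.target]

end

section
variable {α β κ κ' : Type} [DecidableEq α] [DecidableEq β]

theorem Gate.apply_ket (g : Gate α) (S : Finset α) : g.apply (ket S) = g.onKet S := by
  simp [Gate.apply, ket]

theorem Gate.apply_single (g : Gate α) (S : Finset α) (a : ℂ) :
    g.apply (Finsupp.single S a) = a • g.onKet S := by
  simp [Gate.apply]

theorem insert_eq_symmDiff (S : Finset α) (q : α) :
    insert q S = if q ∈ S then S else S ∆ {q} := by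
  ext x; by_cases hx : x = q <;> split_ifs <;> simp_all [Finset.mem_symmDiff]

theorem erase_eq_symmDiff (S : Finset α) (q : α) :
    S.erase q = if q ∈ S then S ∆ {q} else S := by
  ext x; by_cases hx : x = q <;> split_ifs <;> simp_all [Finset.mem_symmDiff]

/-- The linear map `|S⟩ ↦ c S |J S⟩`. -/
noncomputable def weigh (J : Finset α → Finset β) (c : Finset α → ℂ) : State α →ₗ[ℂ] State β :=
  Finsupp.linearCombination ℂ fun S => Finsupp.single (J S) (c S)

theorem weigh_ket (J : Finset α → Finset β) (c : Finset α → ℂ) (S : Finset α) :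
    weigh J c (ket S) = c S • ket (J S) := by
  simp [weigh, ket]

theorem mapDomain_eq_weigh (J : Finset α → Finset β) (ψ : State α) :
    Finsupp.mapDomain J ψ = weigh J (fun _ => 1) ψ := by
  simp [weigh, Finsupp.linearCombination_apply, Finsupp.mapDomain]

open Classical in
theorem filter_eq_weigh (P : Finset α → Prop) [DecidablePred P] (ψ : State α) :
    ψ.filter P = weigh id (fun S => if P S then 1 else 0) ψ := by
  induction ψ using Finsupp.induction_linear with
  | zero => rw [map_zero]; exact Finsupp.filter_zero _
  | add f g hf hg => rw [map_add, ← hf, ← hg, Finsupp.filter_add]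
  | single S a =>
    by_cases h : P S <;> simp [weigh, h]

/-- The map `|S⟩ ↦ c S |J S⟩` carries the wires in `W`, renamed by `φ`, along unchanged. -/
structure Carries (φ : α → β) (W : α → Prop) (J : Finset α → Finset β) (c : Finset α → ℂ) :
    Prop where
  inj : ∀ p q, W p → W q → φ p = φ q → p = q
  mem : ∀ S q, W q → (φ q ∈ J S ↔ q ∈ S)
  toggle : ∀ S q, W q → J (S ∆ {q}) = J S ∆ {φ q}
  coef : ∀ S q, W q → c (S ∆ {q}) = c S

/-- Gates act by testing single qubits and by toggling single qubits. A map on basis states that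
respects tests and toggles of the wires in `W`, with a weight that toggling them does not change,
therefore commutes with the gates on these wires. Embeddings of memories, flips of other qubits and
projections to the outcomes of a measurement are all of this kind, which is why weights are allowed.
-/
theorem Carries.apply {φ : α → β} {W : α → Prop} {J : Finset α → Finset β} {c : Finset α → ℂ}
    (h : Carries φ W J c) (g : Gate α) (hg : ∀ q ∈ g.wires, W q) (ψ : State α) :
    weigh J c (g.apply ψ) = (g.map φ).apply (weigh J c ψ) := by
  have key : ∀ S, weigh J c (g.onKet S) = c S • (g.map φ).onKet (J S) := by
    intro S
    rcases g with q | q | q | q | ⟨a, t⟩ | ⟨a, b, t⟩ <;> simp only [Gate.wires] at hg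
    · have hq : W q := hg q (by simp)
      simp only [Gate.onKet, Gate.map, insert_eq_symmDiff, erase_eq_symmDiff, h.mem S q hq]
      by_cases hqS : q ∈ S
      · simp only [hqS, if_true, map_smul, map_add, weigh_ket, h.toggle S q hq, h.coef S q hq]
        simp only [smul_add, smul_smul]
        congr 2 <;> ring
      · simp only [hqS, if_false, map_smul, map_add, weigh_ket, h.toggle S q hq, h.coef S q hq]
        simp only [smul_add, smul_smul]
        congr 2 <;> ring
    · have hq : W q := hg q (by simp)
      simp only [Gate.onKet, Gate.map, h.mem S q hq, map_smul, weigh_ket, smul_smul]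
      congr 1; ring
    · have hq : W q := hg q (by simp)
      simp only [Gate.onKet, Gate.map, h.mem S q hq, map_smul, weigh_ket, smul_smul]
      congr 1; ring
    · have hq : W q := hg q (by simp)
      simp only [Gate.onKet, Gate.map, weigh_ket, h.toggle S q hq, h.coef S q hq]
    · have ha : W a := hg a (by simp)
      have ht : W t := hg t (by simp)
      have e1 : φ a ≠ φ t ↔ a ≠ t :=
        not_congr ⟨h.inj a t ha ht, fun x => by rw [x]⟩
      simp only [Gate.onKet, Gate.map, weigh_ket, h.mem S a ha, e1]
      split_ifs <;> simp [h.toggle S t ht, h.coef S t ht]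
    · have ha : W a := hg a (by simp)
      have hb : W b := hg b (by simp)
      have ht : W t := hg t (by simp)
      have e1 : φ a ≠ φ t ↔ a ≠ t :=
        not_congr ⟨h.inj a t ha ht, fun x => by rw [x]⟩
      have e2 : φ b ≠ φ t ↔ b ≠ t :=
        not_congr ⟨h.inj b t hb ht, fun x => by rw [x]⟩
      simp only [Gate.onKet, Gate.map, weigh_ket, h.mem S a ha, h.mem S b hb, e1, e2]
      split_ifs <;> simp [h.toggle S t ht, h.coef S t ht]
  induction ψ using Finsupp.induction_linear with
  | zero => simp
  | add f g hf hg => simp only [map_add, hf, hg]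
  | single S a =>
    have h1 : Finsupp.single S a = a • ket S := by simp [ket]
    rw [h1]
    simp only [map_smul, Gate.apply_ket, key, weigh_ket]

/-- All gates of the circuit act on wires with property `P`. -/
def Circuit.On (P : Wire κ → Prop) (C : Circuit κ) : Prop :=
  ∀ g, Op.gate g ∈ C → ∀ q ∈ g.wires, P q

theorem Circuit.On.append {P : Wire κ → Prop} {C D : Circuit κ} (hC : C.On P) (hD : D.On P) :
    Circuit.On P (C ++ D) := fun g hg => (List.mem_append.1 hg).elim (hC g) (hD g)

theorem Circuit.On.flatMap {ι : Type} {P : Wire κ → Prop} {L : List ι} {F : ι → Circuit κ}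
    (h : ∀ i ∈ L, (F i).On P) : Circuit.On P (L.flatMap F) := by
  intro g hg
  obtain ⟨i, hi, hgi⟩ := List.mem_flatMap.1 hg
  exact h i hi g hgi

theorem Circuit.On.single {P : Wire κ → Prop} {g : Gate (Wire κ)} (h : ∀ q ∈ g.wires, P q) :
    Circuit.On P [Op.gate g] := by
  intro g' hg'
  simp only [List.mem_singleton, Op.gate.injEq] at hg'
  exact hg' ▸ h

theorem Circuit.On.mono {P P' : Wire κ → Prop} {C : Circuit κ} (h : C.On P)
    (hP : ∀ q, P q → P' q) : C.On P' := fun g hg q hq => hP q (h g hg q hq)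

theorem Circuit.On.relabel {e : Wire κ → Wire κ'} {P : Wire κ' → Prop} {C : Circuit κ}
    (h : C.On fun q => P (e q)) : Circuit.On P (Circuit.relabel e C) := by
  intro g hg q hq
  simp only [Circuit.relabel, List.mem_filterMap] at hg
  obtain ⟨o, ho, hog⟩ := hg
  rcases o with g' | _
  · simp only [Option.some.injEq, Op.gate.injEq] at hog
    subst hog
    rw [Gate.wires_map, List.mem_map] at hq
    obtain ⟨q', hq', rfl⟩ := hq
    exact h g' ho q' hq'
  · simp at hog

theorem Circuit.On.inv {P : Wire κ → Prop} {C : Circuit κ} (h : C.On P) : C.inv.On P := by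
  intro g hg q hq
  simp only [Circuit.inv, List.mem_reverse, List.mem_map] at hg
  obtain ⟨o, ho, hog⟩ := hg
  rcases o with g' | _
  · simp only [Op.gate.injEq] at hog
    subst hog
    refine h g' ho q ?_
    cases g' <;> exact hq
  · simp at hog

/-! ### The action of circuits -/

theorem exec_append (e : Wire κ → α) (C D : Circuit κ) (ψ : State α) :
    exec e (C ++ D) ψ = exec e D (exec e C ψ) := by
  induction C generalizing ψ with
  | nil => rfl
  | cons o C ih => rcases o with g | _ <;> exact ih _

/-- The action of a circuit as a linear map. -/
noncomputable def execL (e : Wire κ → α) (C : Circuit κ) : State α →ₗ[ℂ] State α where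
  toFun := exec e C
  map_add' ψ φ := by
    induction C generalizing ψ φ with
    | nil => rfl
    | cons o C ih =>
      rcases o with g | _
      · simp only [exec, map_add, ih]
      · exact ih _ _
  map_smul' c ψ := by
    induction C generalizing ψ with
    | nil => rfl
    | cons o C ih =>
      rcases o with g | _
      · simp only [exec, map_smul, ih]
      · exact ih _

theorem execL_apply (e : Wire κ → α) (C : Circuit κ) (ψ : State α) : execL e C ψ = exec e C ψ :=
  rfl

theorem exec_zero (e : Wire κ → α) (C : Circuit κ) : exec e C (0 : State α) = 0 :=
  map_zero (execL e C)

theorem Carries.exec {φ : α → β} {W : α → Prop} {J : Finset α → Finset β} {c : Finset α → ℂ}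
    (h : Carries φ W J c) (e : Wire κ → α) {C : Circuit κ} (hC : C.On fun q => W (e q))
    (ψ : State α) : weigh J c (exec e C ψ) = QCrypto.exec (φ ∘ e) C (weigh J c ψ) := by
  induction C generalizing ψ with
  | nil => rfl
  | cons o C ih =>
    have hC' : Circuit.On (fun q => W (e q)) C := fun g hg => hC g (List.mem_cons_of_mem _ hg)
    rcases o with g | _
    · simp only [QCrypto.exec]
      rw [ih hC', h.apply, Gate.map_map]
      intro q hq
      rw [Gate.wires_map, List.mem_map] at hq
      obtain ⟨q', hq', rfl⟩ := hq
      exact hC g (List.mem_cons_self ..) q' hq'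
    · exact ih hC' ψ

theorem exec_relabel (e : Wire κ' → α) (r : Wire κ → Wire κ') (C : Circuit κ) (ψ : State α) :
    exec e (Circuit.relabel r C) ψ = exec (e ∘ r) C ψ := by
  induction C generalizing ψ with
  | nil => rfl
  | cons o C ih =>
    rcases o with g | _
    · have h1 : Circuit.relabel r (Op.gate g :: C) = Op.gate (g.map r) :: Circuit.relabel r C := rfl
      rw [h1]
      simp only [exec, Gate.map_map, ih]
    · exact ih _

/-- The wires of a gate other than its target are controls. All statements below about qubits that
are never written to go back to this. -/
theorem Gate.support_apply (g : Gate α) (ψ : State α) {T : Finset α}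
    (hT : T ∈ (g.apply ψ).support) :
    ∃ S ∈ ψ.support, ∀ q, q ≠ g.target → (q ∈ T ↔ q ∈ S) := by
  have h1 : ∀ S, T ∈ (g.onKet S).support → ∀ q, q ≠ g.target → (q ∈ T ↔ q ∈ S) := by
    intro S h q hq
    have hk : ∀ (a : ℂ) (S' : Finset α), T ∈ (a • ket S').support → T = S' := by
      intro a S' h'
      have := Finsupp.support_smul h'
      simpa [ket, Finsupp.support_single] using this
    rcases g with p | p | p | p | ⟨a, t⟩ | ⟨a, b, t⟩ <;>
      simp only [Gate.onKet, Gate.target] at h hq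
    · have h2 := Finsupp.support_smul h
      rcases Finset.mem_union.1 (Finsupp.support_add h2) with h3 | h3
      · rw [hk 1 _ (by rwa [one_smul])]; simp [hq]
      · rw [hk _ _ h3]; simp [hq]
    · rw [hk _ _ h]
    · rw [hk _ _ h]
    · rw [hk 1 _ (by rwa [one_smul])]; simp [hq, Finset.mem_symmDiff]
    · rw [hk 1 _ (by rwa [one_smul])]; split_ifs <;> simp [hq, Finset.mem_symmDiff]
    · rw [hk 1 _ (by rwa [one_smul])]; split_ifs <;> simp [hq, Finset.mem_symmDiff]
  rw [Gate.apply, Finsupp.linearCombination_apply] at hT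
  obtain ⟨S, hS, hTS⟩ := Finset.mem_biUnion.1 (Finsupp.support_sum hT)
  exact ⟨S, hS, h1 S (Finsupp.support_smul hTS)⟩

theorem Gate.inv_apply (g : Gate α) (ψ : State α) : g.inv.apply (g.apply ψ) = ψ := by
  have key : ∀ S, g.inv.apply (g.onKet S) = ket S := by
    intro S
    rcases g with q | q | q | q | ⟨a, t⟩ | ⟨a, b, t⟩ <;>
      simp only [Gate.inv, Gate.onKet, map_smul, map_add, Gate.apply_ket]
    · have h2 : ((Real.sqrt 2 : ℂ))⁻¹ * ((Real.sqrt 2 : ℂ))⁻¹ = 2⁻¹ := by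
        rw [← mul_inv, ← Complex.ofReal_mul, Real.mul_self_sqrt (by norm_num)]; norm_num
      by_cases hq : q ∈ S
      · have e1 : insert q (S.erase q) = S := Finset.insert_erase hq
        simp only [hq, if_true, Finset.mem_erase, ne_eq, not_true_eq_false, false_and, if_false,
          Finset.erase_idem, e1, Finset.insert_eq_of_mem hq, one_smul]
        rw [show ∀ (a : ℂ) (x y : State α), a • (a • (x + y) + (-1 : ℂ) • a • (x + (-1 : ℂ) • y))
          = (2 * (a * a)) • y from fun a x y => by module, h2]
        norm_num
      · have e1 : (insert q S).erase q = S := Finset.erase_insert hq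
        simp only [hq, if_false, Finset.mem_insert_self, if_true, Finset.erase_eq_of_notMem hq,
          e1, Finset.insert_idem, one_smul]
        rw [show ∀ (a : ℂ) (x y : State α), a • (a • (x + y) + a • (x + (-1 : ℂ) • y))
          = (2 * (a * a)) • x from fun a x y => by module, h2]
        norm_num
    · rw [smul_smul]
      split_ifs
      · rw [← Complex.exp_add]; simp
      · simp
    · rw [smul_smul]
      split_ifs
      · rw [← Complex.exp_add]; simp
      · simp
    · rw [symmDiff_symmDiff_cancel_right]
    · by_cases h : a ≠ t ∧ a ∈ S
      · have : a ∈ S ∆ {t} := by simp [Finset.mem_symmDiff, h.1, h.2]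
        simp [h.1, h.2, this, symmDiff_symmDiff_cancel_right]
      · simp [h]
    · by_cases h : a ≠ t ∧ b ≠ t ∧ a ∈ S ∧ b ∈ S
      · have ha : a ∈ S ∆ {t} := by simp [Finset.mem_symmDiff, h.1, h.2.2.1]
        have hb : b ∈ S ∆ {t} := by simp [Finset.mem_symmDiff, h.2.1, h.2.2.2]
        rw [if_pos h, if_pos ⟨h.1, h.2.1, ha, hb⟩, symmDiff_symmDiff_cancel_right]
      · rw [if_neg h, if_neg h]
  induction ψ using Finsupp.induction_linear with
  | zero => simp
  | add f g hf hg => simp only [map_add, hf, hg]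
  | single S a =>
    rw [Gate.apply_single, map_smul, key]
    simp [ket]

theorem exec_inv (e : Wire κ → α) (C : Circuit κ) (ψ : State α) :
    exec e C.inv (exec e C ψ) = ψ := by
  induction C generalizing ψ with
  | nil => rfl
  | cons o C ih =>
    have h1 : Circuit.inv (o :: C) = Circuit.inv C ++ Circuit.inv [o] := by simp [Circuit.inv]
    rw [h1, exec_append]
    rcases o with g | _
    · simp only [exec]
      rw [ih]
      simp only [Circuit.inv, List.map_cons, List.map_nil, List.reverse_cons, List.reverse_nil,
        List.nil_append, exec, Gate.map_inv, Gate.inv_apply]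
    · simp only [exec]
      rw [ih]
      rfl

/-! ### Norms -/

/-- The square of the norm of a state. -/
noncomputable def normSq (ψ : State α) : ℝ := ψ.sum fun _ a => ‖a‖ ^ 2

theorem normSq_eq_sum {ψ : State α} {U : Finset (Finset α)} (h : ψ.support ⊆ U) :
    normSq ψ = ∑ S ∈ U, ‖ψ S‖ ^ 2 :=
  Finsupp.sum_of_support_subset _ h _ (by simp)

theorem normSq_mapDomain {J : Finset α → Finset β} (hJ : Function.Injective J) (ψ : State α) :
    normSq (Finsupp.mapDomain J ψ) = normSq ψ :=
  Finsupp.sum_mapDomain_index_inj hJ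

theorem normSq_ket (S : Finset α) : normSq (ket S) = 1 := by
  simp [normSq, ket]

/-- Gates that permute the basis states or multiply them by phases preserve the sum of squares
termwise. For the Hadamard gate the parallelogram law is applied to the two amplitudes at `S` and `S
∆ {q}`. -/
theorem Gate.normSq_apply (g : Gate α) (ψ : State α) : normSq (g.apply ψ) = normSq ψ := by
  have hmap : ∀ J : Finset α → Finset α, Function.Involutive J → (∀ S, g.onKet S = ket (J S)) →
      normSq (g.apply ψ) = normSq ψ := by
    intro J hJ h
    rw [← normSq_mapDomain hJ.injective ψ, Gate.apply, Finsupp.linearCombination_apply,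
      Finsupp.mapDomain]
    simp [h, ket]
  have hphase : ∀ c : Finset α → ℂ, (∀ S, ‖c S‖ = 1) → (∀ S, g.onKet S = c S • ket S) →
      normSq (g.apply ψ) = normSq ψ := by
    intro c hc h
    have h1 : g.apply ψ = ψ.sum fun S a => Finsupp.single S (a * c S) := by
      rw [Gate.apply, Finsupp.linearCombination_apply]
      simp [h, ket]
    have h2 : ∀ S, (g.apply ψ) S = ψ S * c S := by
      intro S
      rw [h1, Finsupp.sum_apply, Finsupp.sum]
      simp only [Finsupp.single_apply]
      rw [Finset.sum_ite_eq']
      split_ifs with h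
      · rfl
      · rw [Finsupp.notMem_support_iff.1 h, zero_mul]
    have h3 : (g.apply ψ).support ⊆ ψ.support := by
      intro S
      simp only [Finsupp.mem_support_iff, h2]
      exact fun h => left_ne_zero_of_mul h
    rw [normSq_eq_sum h3, normSq_eq_sum subset_rfl]
    simp [h2, hc]
  rcases g with q | q | q | q | ⟨a, t⟩ | ⟨a, b, t⟩
  -- A finite set that contains both supports and is closed under toggling `q`. Summing over it
  -- twice, the second time after toggling, pairs the amplitudes without a choice of
  -- representatives.
  · set U : Finset (Finset α) :=
      (ψ.support ∪ ((Gate.H q).apply ψ).support) ∪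
        (ψ.support ∪ ((Gate.H q).apply ψ).support).image (· ∆ {q}) with hU
    have hUi : ∀ S ∈ U, S ∆ {q} ∈ U := by
      intro S hS
      rcases Finset.mem_union.1 hS with h | h
      · exact Finset.mem_union_right _ (Finset.mem_image_of_mem _ h)
      · obtain ⟨S', h', rfl⟩ := Finset.mem_image.1 h
        rw [symmDiff_symmDiff_cancel_right]
        exact Finset.mem_union_left _ h'
    have hval : ∀ S, ((Gate.H q).apply ψ) S = ((Real.sqrt 2 : ℂ))⁻¹ *
        (if q ∈ S then ψ (S ∆ {q}) - ψ S else ψ S + ψ (S ∆ {q})) := by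
      intro S
      clear hU hUi U hmap hphase
      induction ψ using Finsupp.induction_linear with
      | zero => simp
      | add f g hf hg =>
        rw [map_add, Finsupp.add_apply, hf, hg]
        simp only [Finsupp.add_apply]
        split_ifs <;> ring
      | single T a =>
        rw [Gate.apply_single]
        simp only [Gate.onKet, ket, Finsupp.smul_apply, Finsupp.add_apply, Finsupp.single_apply,
          smul_eq_mul, insert_eq_symmDiff, erase_eq_symmDiff]
        have e1 : T = S ∆ {q} ↔ T ∆ {q} = S := by
          constructor
          · rintro rfl; exact symmDiff_symmDiff_cancel_right _ _
          · rintro rfl; exact (symmDiff_symmDiff_cancel_right _ _).symm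
        have e2 : ∀ R : Finset α, R ∆ {q} ≠ R := by
          intro R h
          have : q ∈ R ∆ {q} ↔ q ∈ R := by rw [h]
          by_cases hq : q ∈ R <;> simp [Finset.mem_symmDiff, hq] at this
        simp only [e1]
        by_cases h1 : T = S
        · subst h1
          by_cases hq : q ∈ T <;> simp [hq, e2]
          all_goals ring
        · by_cases h2 : T ∆ {q} = S
          · have hq : q ∈ S ↔ q ∉ T := by
              rw [← h2]; by_cases h : q ∈ T <;> simp [Finset.mem_symmDiff, h]
            by_cases hqT : q ∈ T <;> simp [hq, hqT, h1, h2]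
            all_goals ring
          · by_cases hqT : q ∈ T <;> simp [hqT, h1, h2]
    have hin : ∀ f : Finset α → ℝ, ∑ S ∈ U, f (S ∆ {q}) = ∑ S ∈ U, f S := fun f =>
      Finset.sum_nbij' (· ∆ {q}) (· ∆ {q}) hUi hUi
        (fun S _ => symmDiff_symmDiff_cancel_right _ _)
        (fun S _ => symmDiff_symmDiff_cancel_right _ _) (fun S _ => rfl)
    rw [normSq_eq_sum (U := U) (ψ := (Gate.H q).apply ψ) fun S hS =>
        Finset.mem_union_left _ (Finset.mem_union_right _ hS),
      normSq_eq_sum (U := U) (ψ := ψ) fun S hS =>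
        Finset.mem_union_left _ (Finset.mem_union_left _ hS)]
    have h2 : ∑ S ∈ U, (‖((Gate.H q).apply ψ) S‖ ^ 2 + ‖((Gate.H q).apply ψ) (S ∆ {q})‖ ^ 2)
        = ∑ S ∈ U, (‖ψ S‖ ^ 2 + ‖ψ (S ∆ {q})‖ ^ 2) := by
      refine Finset.sum_congr rfl fun S _ => ?_
      have hq : q ∈ S ∆ {q} ↔ q ∉ S := by
        by_cases h : q ∈ S <;> simp [Finset.mem_symmDiff, h]
      have hn : ‖((Real.sqrt 2 : ℂ))⁻¹‖ ^ 2 = 2⁻¹ := by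
        rw [norm_inv, inv_pow, Complex.norm_real, Real.norm_eq_abs, sq_abs, Real.sq_sqrt]
        norm_num
      have par : ∀ x y : ℂ, ‖x + y‖ ^ 2 + ‖x - y‖ ^ 2 = 2 * (‖x‖ ^ 2 + ‖y‖ ^ 2) := by
        intro x y
        have := parallelogram_law_with_norm ℝ x y
        nlinarith
      rw [hval, hval, symmDiff_symmDiff_cancel_right]
      by_cases h : q ∈ S
      · simp only [h, hq, if_true, not_true_eq_false, if_false, norm_mul, mul_pow, hn]
        have := par (ψ (S ∆ {q})) (ψ S)
        linarith
      · simp only [h, hq, if_false, not_false_eq_true, if_true, norm_mul, mul_pow, hn]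
        have := par (ψ S) (ψ (S ∆ {q}))
        linarith
    rw [Finset.sum_add_distrib, Finset.sum_add_distrib,
      hin fun S => ‖((Gate.H q).apply ψ) S‖ ^ 2, hin fun S => ‖ψ S‖ ^ 2] at h2
    linarith
  · refine hphase (fun S => if q ∈ S then Complex.exp (Real.pi / 4 * Complex.I) else 1) ?_
      fun S => rfl
    intro S; split_ifs
    · rw [show (Real.pi / 4 * Complex.I : ℂ) = ((Real.pi / 4 : ℝ) : ℂ) * Complex.I by push_cast; ring,
        Complex.norm_exp_ofReal_mul_I]
    · simp
  · refine hphase (fun S => if q ∈ S then Complex.exp (-(Real.pi / 4 * Complex.I)) else 1) ?_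
      fun S => rfl
    intro S; split_ifs
    · rw [show (-(Real.pi / 4 * Complex.I) : ℂ) = ((-(Real.pi / 4) : ℝ) : ℂ) * Complex.I by
        push_cast; ring, Complex.norm_exp_ofReal_mul_I]
    · simp
  · exact hmap (· ∆ {q}) (fun S => symmDiff_symmDiff_cancel_right _ _) fun S => rfl
  · refine hmap (fun S => if a ≠ t ∧ a ∈ S then S ∆ {t} else S) (fun S => ?_) fun S => rfl
    by_cases h : a ≠ t ∧ a ∈ S
    · have : a ∈ S ∆ {t} := by simp [Finset.mem_symmDiff, h.1, h.2]
      simp [h.1, h.2, this, symmDiff_symmDiff_cancel_right]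
    · simp [h]
  · refine hmap (fun S => if a ≠ t ∧ b ≠ t ∧ a ∈ S ∧ b ∈ S then S ∆ {t} else S) (fun S => ?_)
      fun S => rfl
    by_cases h : a ≠ t ∧ b ≠ t ∧ a ∈ S ∧ b ∈ S
    · have ha : a ∈ S ∆ {t} := by simp [Finset.mem_symmDiff, h.1, h.2.2.1]
      have hb : b ∈ S ∆ {t} := by simp [Finset.mem_symmDiff, h.2.1, h.2.2.2]
      simp only [if_pos h, if_pos (show a ≠ t ∧ b ≠ t ∧ a ∈ S ∆ {t} ∧ b ∈ S ∆ {t} from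
        ⟨h.1, h.2.1, ha, hb⟩), symmDiff_symmDiff_cancel_right]
    · simp only [if_neg h]

theorem normSq_exec (e : Wire κ → α) (C : Circuit κ) (ψ : State α) :
    normSq (exec e C ψ) = normSq ψ := by
  induction C generalizing ψ with
  | nil => rfl
  | cons o C ih =>
    rcases o with g | _
    · simp only [exec, ih, Gate.normSq_apply]
    · exact ih ψ

end
/-! ### Averages over sets of qubits -/

section
variable {α κ : Type} [DecidableEq α]

/-- The average over the subsets of `X`. -/
noncomputable def setAvg (X : Finset α) (F : Finset α → ℝ) : ℝ :=
  (∑ A ∈ X.powerset, F A) / 2 ^ X.card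

theorem setAvg_congr {X : Finset α} {F G : Finset α → ℝ} (h : ∀ A ⊆ X, F A = G A) :
    setAvg X F = setAvg X G := by
  rw [setAvg, setAvg, Finset.sum_congr rfl fun A hA => h A (Finset.mem_powerset.1 hA)]

theorem setAvg_const (X : Finset α) (c : ℝ) : setAvg X (fun _ => c) = c := by
  simp [setAvg, Finset.card_powerset]

theorem setAvg_empty (F : Finset α → ℝ) : setAvg ∅ F = F ∅ := by simp [setAvg]

theorem setAvg_sum {ι : Type*} (X : Finset α) (s : Finset ι) (F : ι → Finset α → ℝ) :
    (setAvg X fun A => ∑ i ∈ s, F i A) = ∑ i ∈ s, setAvg X (F i) := by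
  simp only [setAvg, ← Finset.sum_div]
  rw [Finset.sum_comm]

theorem setAvg_div (X : Finset α) (F : Finset α → ℝ) (c : ℝ) :
    (setAvg X fun A => F A / c) = setAvg X F / c := by
  simp only [setAvg, ← Finset.sum_div, div_right_comm]

theorem setAvg_avgBits (X : Finset α) (m : ℕ) (F : Finset α → List Bool → ℝ) :
    (setAvg X fun A => avgBits m (F A)) = avgBits m fun r => setAvg X fun A => F A r := by
  simp only [avgBits, setAvg_div, setAvg_sum]

theorem setAvg_insert {X : Finset α} {q : α} (hq : q ∉ X) (F : Finset α → ℝ) :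
    setAvg (insert q X) F = (setAvg X F + setAvg X fun A => F (insert q A)) / 2 := by
  rw [setAvg, Finset.sum_powerset_insert hq, Finset.card_insert_of_notMem hq, setAvg, setAvg,
    ← add_div, div_div, pow_succ]

theorem setAvg_union {X Y : Finset α} (h : Disjoint X Y) (F : Finset α → ℝ) :
    setAvg (X ∪ Y) F = setAvg X fun A => setAvg Y fun B => F (A ∪ B) := by
  induction Y using Finset.induction_on generalizing F with
  | empty => simp [setAvg_empty]
  | insert q Y hq ih =>
    have h1 := Finset.disjoint_insert_right.1 h
    rw [Finset.union_insert, setAvg_insert (by simp [h1.1, hq]), ih h1.2, ih h1.2]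
    simp only [setAvg_insert hq, setAvg_div, Finset.union_insert]
    congr 1
    simp only [setAvg, Finset.sum_add_distrib, add_div]

/-- `G` does not depend on the qubits in `Y`. -/
def Insens {γ : Sort*} (Y : α → Prop) (G : Finset α → γ) : Prop :=
  ∀ β β' : Finset α, (∀ q, ¬ Y q → (q ∈ β ↔ q ∈ β')) → G β = G β'

theorem readBits_eq_ofFn (r : ℕ → α) (m : ℕ) (S : Finset α) :
    readBits r m S = List.ofFn fun i : Fin m => decide (r i ∈ S) := by
  refine List.ext_getElem (by simp [readBits]) fun i h1 h2 => ?_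
  simp [readBits]

theorem length_readBits (r : ℕ → α) (m : ℕ) (S : Finset α) : (readBits r m S).length = m := by
  simp [readBits]

/-- XORing a fixed string into the wires `r i` permutes the subsets of `X` and is not noticed by
`G`. So the left side does not change if the string that is read is replaced by its XOR with any
fixed string, hence not if that string is averaged over; and the XOR of a given string with a
uniform one is uniform. This is how stored random bits that are used only once become fresh coins.
-/
theorem setAvg_resample {X : Finset α} {r : ℕ → α} {m : ℕ}
    (hr : ∀ i < m, ∀ j < m, r i = r j → i = j) (hX : ∀ i < m, r i ∈ X)
    {G : Finset α → List Bool → ℝ} (hG : Insens (fun q => ∃ i < m, q = r i) G) :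
    (setAvg X fun β => G β (readBits r m β)) = setAvg X fun β => avgBits m (G β) := by
  set T : (Fin m → Bool) → Finset α := fun s =>
    (Finset.univ.filter fun i : Fin m => s i = true).image fun i : Fin m => r i.val with hT
  have hTX : ∀ s, T s ⊆ X := by
    intro s q hq
    obtain ⟨i, -, rfl⟩ := Finset.mem_image.1 hq
    exact hX i i.2
  have hmem : ∀ s (i : Fin m), r i ∈ T s ↔ s i = true := by
    intro s i
    simp only [hT, Finset.mem_image, Finset.mem_filter, Finset.mem_univ, true_and]
    constructor
    · rintro ⟨j, hj, hji⟩
      have := Fin.ext (hr j j.2 i i.2 hji)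
      rwa [this] at hj
    · exact fun h => ⟨i, h, rfl⟩
  have hshift : ∀ s : Fin m → Bool, (setAvg X fun β => G β (readBits r m β)) =
      setAvg X fun β => G β (List.ofFn fun i : Fin m => xor (decide (r i ∈ β)) (s i)) := by
    intro s
    unfold setAvg
    congr 1
    refine Finset.sum_nbij' (· ∆ T s) (· ∆ T s) ?_ ?_ ?_ ?_ ?_
    · intro β hβ
      rw [Finset.mem_powerset] at hβ ⊢
      exact (symmDiff_le_sup (a := β) (b := T s)).trans (sup_le hβ (hTX s))
    · intro β hβ
      rw [Finset.mem_powerset] at hβ ⊢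
      exact (symmDiff_le_sup (a := β) (b := T s)).trans (sup_le hβ (hTX s))
    · intro β _; exact symmDiff_symmDiff_cancel_right _ _
    · intro β _; exact symmDiff_symmDiff_cancel_right _ _
    · intro β _
      have h1 : G β = G (β ∆ T s) := hG _ _ fun q hq => by
        have : q ∉ T s := fun h => by
          obtain ⟨i, -, rfl⟩ := Finset.mem_image.1 h
          exact hq ⟨i, i.2, rfl⟩
        simp [Finset.mem_symmDiff, this]
      rw [h1, readBits_eq_ofFn]
      congr 2
      funext i
      have := hmem s i
      by_cases h2 : r i ∈ β <;> by_cases h3 : s i = true <;>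
        simp_all [Finset.mem_symmDiff]
  -- For fixed `β` the XOR with the string read from `β` is an involution of the strings, so the
  -- average over `s` is not affected by it.
  have havg : ∀ β, avgBits m (G β) = avgBits m fun s =>
      G β (List.ofFn fun i : Fin m => xor (decide (r i ∈ β)) (s.getD i false)) := by
    intro β
    unfold avgBits
    congr 1
    have hinv : Function.Involutive fun (s : Fin m → Bool) (i : Fin m) =>
        xor (decide (r i ∈ β)) (s i) := by
      intro s; funext i; simp
    rw [← hinv.bijective.sum_comp]
    refine Finset.sum_congr rfl fun s _ => ?_
    congr 2
    funext i
    simp [List.getD]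
  simp only [havg]
  rw [setAvg_avgBits]
  have : ∀ K : List Bool → ℝ, ∀ c, (∀ s : Fin m → Bool, c = K (List.ofFn s)) →
      c = avgBits m K := by
    intro K c h
    simp [avgBits, ← h]
  refine this _ _ fun s => ?_
  rw [hshift s]
  congr 1
  funext β
  congr 2
  funext i
  simp [List.getD]

theorem avgBits_eq_setAvg {r : ℕ → α} {m : ℕ} (hr : ∀ i < m, ∀ j < m, r i = r j → i = j)
    (K : List Bool → ℝ) :
    avgBits m K = setAvg ((Finset.range m).image r) fun β => K (readBits r m β) := by
  rw [setAvg_resample (G := fun _ => K) hr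
    (fun i hi => Finset.mem_image_of_mem _ (Finset.mem_range.2 hi)) (fun _ _ _ => rfl),
    setAvg_const]

theorem avgBits_const (m : ℕ) (c : ℝ) : avgBits m (fun _ => c) = c := by
  simp [avgBits]

theorem avgBits_add (m : ℕ) (F G : List Bool → ℝ) :
    avgBits m (fun r => F r + G r) = avgBits m F + avgBits m G := by
  simp [avgBits, Finset.sum_add_distrib, add_div]

theorem avgBits_mul (m : ℕ) (c : ℝ) (F : List Bool → ℝ) :
    avgBits m (fun r => c * F r) = c * avgBits m F := by
  simp [avgBits, ← Finset.mul_sum, mul_div_assoc]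

theorem avgBits_sum {ι : Type*} (m : ℕ) (s : Finset ι) (F : ι → List Bool → ℝ) :
    avgBits m (fun r => ∑ i ∈ s, F i r) = ∑ i ∈ s, avgBits m (F i) := by
  simp only [avgBits, ← Finset.sum_div]
  rw [Finset.sum_comm]

/-! ### Adding sets of qubits -/

/-- Flip the qubits in `X`. -/
noncomputable def flip (X : Finset α) (ψ : State α) : State α :=
  Finsupp.mapDomain (· ∆ X) ψ

theorem flip_flip (X Y : Finset α) (ψ : State α) : flip Y (flip X ψ) = flip (X ∆ Y) ψ := by
  unfold flip
  rw [← Finsupp.mapDomain_comp]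
  congr 1
  funext S
  exact symmDiff_assoc _ _ _

theorem flip_empty (ψ : State α) : flip ∅ ψ = ψ := by
  unfold flip
  have : (fun S : Finset α => S ∆ ∅) = id := funext fun S => symmDiff_bot S
  rw [this, Finsupp.mapDomain_id]

theorem flip_add (X : Finset α) (ψ φ : State α) : flip X (ψ + φ) = flip X ψ + flip X φ :=
  Finsupp.mapDomain_add

theorem mem_support_flip {X : Finset α} {ψ : State α} {T : Finset α} :
    T ∈ (flip X ψ).support ↔ T ∆ X ∈ ψ.support := by
  have hinj : Function.Injective fun S : Finset α => S ∆ X := symmDiff_left_injective X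
  rw [flip, Finsupp.mapDomain_support_of_injective hinj, Finset.mem_image]
  constructor
  · rintro ⟨S, hS, rfl⟩
    rwa [symmDiff_symmDiff_cancel_right]
  · exact fun h => ⟨_, h, symmDiff_symmDiff_cancel_right _ _⟩

theorem mapDomain_eq_flip {J : Finset α → Finset α} {X : Finset α} {ψ : State α}
    (h : ∀ S ∈ ψ.support, J S = S ∆ X) : Finsupp.mapDomain J ψ = flip X ψ :=
  Finsupp.mapDomain_congr h

theorem flip_exec (e : Wire κ → α) {C : Circuit κ} {X : Finset α}
    (hC : C.On fun q => e q ∉ X) (ψ : State α) : exec e C (flip X ψ) = flip X (exec e C ψ) := by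
  have h : Carries id (fun q => q ∉ X) (· ∆ X) (fun _ => (1 : ℂ)) :=
    ⟨fun _ _ _ _ h => h, fun S q hq => by simp [Finset.mem_symmDiff, hq],
      fun S q _ => by simp only [id]; exact symmDiff_right_comm _ _ _,
      fun _ _ _ => rfl⟩
  have := h.exec e hC ψ
  rw [← mapDomain_eq_weigh, ← mapDomain_eq_weigh] at this
  exact this.symm

/-! ### Decoherence -/

/-- The value of `K` adds up over states that are distinguished by the qubits in `D`. -/
def Dec (D : α → Prop) (K : State α → ℝ) : Prop :=
  ∀ ψ φ : State α, (∀ S ∈ ψ.support, ∀ T ∈ φ.support, ∃ q, D q ∧ ¬ (q ∈ S ↔ q ∈ T)) →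
    K (ψ + φ) = K ψ + K φ

/-- The value of `K` is quadratic in the state. -/
def Quad (K : State α → ℝ) : Prop := ∀ (c : ℂ) (ψ : State α), K (c • ψ) = ‖c‖ ^ 2 * K ψ

theorem Quad.zero {K : State α → ℝ} (h : Quad K) : K 0 = 0 := by
  have := h 0 0
  simpa using this

theorem Dec.sum {ι : Type*} {D : α → Prop} {K : State α → ℝ} (h : Dec D K) (h0 : K 0 = 0)
    (s : Finset ι) (ψ : ι → State α) (hψ : ∀ i ∈ s, ∀ j ∈ s, i ≠ j → ∀ S ∈ (ψ i).support,
      ∀ T ∈ (ψ j).support, ∃ q, D q ∧ ¬ (q ∈ S ↔ q ∈ T)) :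
    K (∑ i ∈ s, ψ i) = ∑ i ∈ s, K (ψ i) := by
  classical
  induction s using Finset.induction_on with
  | empty => simpa using h0
  | insert a s ha ih =>
    rw [Finset.sum_insert ha, Finset.sum_insert ha, ← ih fun i hi j hj =>
      hψ i (Finset.mem_insert_of_mem hi) j (Finset.mem_insert_of_mem hj)]
    refine h _ _ fun S hS T hT => ?_
    obtain ⟨j, hj, hTj⟩ := Finset.mem_biUnion.1 (Finsupp.support_finsetSum hT)
    exact hψ a (Finset.mem_insert_self ..) j (Finset.mem_insert_of_mem hj)
      (fun h => ha (h ▸ hj)) S hS T hTj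

/-- Qubits in `D` are at most controls of the gate, so basis states that differ in one of them still
do so afterwards. -/
theorem Dec.gate {D : α → Prop} {K : State α → ℝ} (h : Dec D K) {g : Gate α}
    (hg : ¬ D g.target) : Dec D fun ψ => K (g.apply ψ) := by
  intro ψ φ hd
  simp only [map_add]
  refine h _ _ fun S hS T hT => ?_
  obtain ⟨S', hS', h1⟩ := g.support_apply ψ hS
  obtain ⟨T', hT', h2⟩ := g.support_apply φ hT
  obtain ⟨q, hq, hne⟩ := hd S' hS' T' hT'
  have hqt : q ≠ g.target := fun e => hg (e ▸ hq)
  exact ⟨q, hq, by rwa [h1 q hqt, h2 q hqt]⟩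

theorem Dec.mapDomain {D : α → Prop} {K : State α → ℝ} (h : Dec D K) {J : Finset α → Finset α}
    (hJ : ∀ S q, D q → (q ∈ J S ↔ q ∈ S)) : Dec D fun ψ => K (Finsupp.mapDomain J ψ) := by
  intro ψ φ hd
  simp only [Finsupp.mapDomain_add]
  refine h _ _ fun S hS T hT => ?_
  obtain ⟨S', hS', rfl⟩ := Finset.mem_image.1 (Finsupp.mapDomain_support hS)
  obtain ⟨T', hT', rfl⟩ := Finset.mem_image.1 (Finsupp.mapDomain_support hT)
  obtain ⟨q, hq, hne⟩ := hd S' hS' T' hT'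
  exact ⟨q, hq, by rwa [hJ S' q hq, hJ T' q hq]⟩

/-- All operations of the circuit write to wires with property `P` only. -/
def Circuit.Writes (P : Wire κ → Prop) (C : Circuit κ) : Prop :=
  (∀ g, Op.gate g ∈ C → P g.target) ∧ ∀ x src tgt, Op.query x src tgt ∈ C → ∀ j, P (tgt.1, tgt.2, j)

theorem Circuit.Writes.append {P : Wire κ → Prop} {C D : Circuit κ} (hC : C.Writes P)
    (hD : D.Writes P) : Circuit.Writes P (C ++ D) :=
  ⟨fun g hg => (List.mem_append.1 hg).elim (hC.1 g) (hD.1 g),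
    fun x src tgt h => (List.mem_append.1 h).elim (hC.2 x src tgt) (hD.2 x src tgt)⟩

theorem Circuit.Writes.flatMap {ι : Type} {P : Wire κ → Prop} {L : List ι} {F : ι → Circuit κ}
    (h : ∀ i ∈ L, (F i).Writes P) : Circuit.Writes P (L.flatMap F) := by
  constructor
  · intro g hg
    obtain ⟨i, hi, hgi⟩ := List.mem_flatMap.1 hg
    exact (h i hi).1 g hgi
  · intro x src tgt hg
    obtain ⟨i, hi, hgi⟩ := List.mem_flatMap.1 hg
    exact (h i hi).2 x src tgt hgi

theorem Circuit.Writes.gate {P : Wire κ → Prop} {g : Gate (Wire κ)} (h : P g.target) :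
    Circuit.Writes P [Op.gate g] := by
  refine ⟨fun g' hg' => ?_, fun x src tgt h => by simp at h⟩
  simp only [List.mem_singleton, Op.gate.injEq] at hg'
  exact hg' ▸ h

theorem Circuit.Writes.query {P : Wire κ → Prop} {x : ℕ} {src tgt : κ × ℕ}
    (h : ∀ j, P (tgt.1, tgt.2, j)) : Circuit.Writes P [Op.query x src tgt] := by
  refine ⟨fun g hg => by simp at hg, fun x src tgt h' => ?_⟩
  simp only [List.mem_singleton, Op.query.injEq] at h'
  obtain ⟨-, -, rfl⟩ := h'
  exact h

theorem Circuit.Writes.mono {P P' : Wire κ → Prop} {C : Circuit κ} (h : C.Writes P)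
    (hP : ∀ q, P q → P' q) : C.Writes P' :=
  ⟨fun g hg => hP _ (h.1 g hg), fun x src tgt h' j => hP _ (h.2 x src tgt h' j)⟩

theorem Circuit.Writes.tail {P : Wire κ → Prop} {o : Op κ} {C : Circuit κ}
    (h : Circuit.Writes P (o :: C)) : C.Writes P :=
  ⟨fun g hg => h.1 g (List.mem_cons_of_mem _ hg),
    fun x src tgt hg => h.2 x src tgt (List.mem_cons_of_mem _ hg)⟩

theorem Circuit.On.tail {P : Wire κ → Prop} {o : Op κ} {C : Circuit κ}
    (h : Circuit.On P (o :: C)) : C.On P := fun g hg => h g (List.mem_cons_of_mem _ hg)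

/-- The circuit makes no oracle calls. -/
def Circuit.NoQuery (C : Circuit κ) : Prop := ∀ x src tgt, Op.query x src tgt ∉ C

theorem Circuit.NoQuery.append {C D : Circuit κ} (hC : C.NoQuery) (hD : D.NoQuery) :
    Circuit.NoQuery (C ++ D) := fun x src tgt h =>
  (List.mem_append.1 h).elim (hC x src tgt) (hD x src tgt)

theorem Circuit.NoQuery.flatMap {ι : Type} {L : List ι} {F : ι → Circuit κ}
    (h : ∀ i ∈ L, (F i).NoQuery) : Circuit.NoQuery (L.flatMap F) := by
  intro x src tgt hg
  obtain ⟨i, hi, hgi⟩ := List.mem_flatMap.1 hg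
  exact h i hi x src tgt hgi

theorem Circuit.NoQuery.gate (g : Gate (Wire κ)) : Circuit.NoQuery [Op.gate g] := by
  intro x src tgt h; simp at h

theorem Circuit.On.writes {P : Wire κ → Prop} {C : Circuit κ} (h : C.On P) (hC : C.NoQuery) :
    C.Writes P :=
  ⟨fun g hg => h g hg _ g.target_mem_wires, fun x src tgt h' => absurd h' (hC x src tgt)⟩

theorem Dec.exec {D : α → Prop} {K : State α → ℝ} (h : Dec D K) {e : Wire κ → α}
    {C : Circuit κ} (hC : C.Writes fun q => ¬ D (e q)) : Dec D fun ψ => K (exec e C ψ) := by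
  induction C with
  | nil => exact h
  | cons o C ih =>
    rcases o with g | _
    · refine Dec.gate (g := g.map e) (ih hC.tail) ?_
      rw [Gate.target_map]
      exact hC.1 g (List.mem_cons_self ..)
    · exact ih hC.tail

theorem Quad.exec {K : State α → ℝ} (h : Quad K) (e : Wire κ → α) (C : Circuit κ) :
    Quad fun ψ => K (exec e C ψ) := by
  intro c ψ
  have := map_smul (execL e C) c ψ
  simp only [execL_apply] at this
  simp only [this, h c]

/-! ### Runs with an oracle -/

section
variable [DecidableEq κ]

theorem execWith_append (O : Oracle) (e : Wire κ → α) (C D : Circuit κ) (K : State α → ℝ) :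
    execWith O e (C ++ D) K = execWith O e C (execWith O e D K) := by
  funext ψ
  induction C generalizing ψ with
  | nil => rfl
  | cons o C ih => rcases o with g | _ <;> simp only [List.cons_append, execWith, ih]

theorem execWith_noQuery (O : Oracle) (e : Wire κ → α) {C : Circuit κ} (h : C.NoQuery)
    (K : State α → ℝ) : execWith O e C K = fun ψ => K (exec e C ψ) := by
  funext ψ
  induction C generalizing ψ with
  | nil => rfl
  | cons o C ih =>
    have hC : Circuit.NoQuery C := fun x src tgt h' => h x src tgt (List.mem_cons_of_mem _ h')
    rcases o with g | ⟨x, src, tgt⟩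
    · simp only [execWith, exec, ih hC]
    · exact absurd (List.mem_cons_self ..) (h x src tgt)

theorem execWith_add (O : Oracle) (e : Wire κ → α) (C : Circuit κ) (K K' : State α → ℝ)
    (ψ : State α) : execWith O e C (fun φ => K φ + K' φ) ψ =
      execWith O e C K ψ + execWith O e C K' ψ := by
  induction C generalizing ψ with
  | nil => rfl
  | cons o C ih => rcases o with g | _ <;> simp only [execWith, ih, avgBits_add]

theorem ones_subset (r : ℕ → α) (s : List Bool) {q : α} (h : q ∈ ones r s) : ∃ j, q = r j := by
  obtain ⟨j, -, rfl⟩ := Finset.mem_image.1 h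
  exact ⟨j, rfl⟩

theorem mem_queryMap {e : Wire κ → α} {len : ℕ} {src tgt : κ × ℕ} {f : List Bool → List Bool}
    {S : Finset α} {q : α} (hq : ∀ j, q ≠ regAt e tgt j) :
    q ∈ queryMap e len src tgt f S ↔ q ∈ S := by
  unfold queryMap
  split_ifs
  · rfl
  · have : q ∉ ones (regAt e tgt) (f (readBits (regAt e src) len S)) := fun h =>
      (ones_subset _ _ h).elim fun j hj => hq j hj
    simp [xorBits, Finset.mem_symmDiff, this]

theorem Dec.execWith {D : α → Prop} {K : State α → ℝ} (h : Dec D K) (O : Oracle)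
    {e : Wire κ → α} {C : Circuit κ} (hC : C.Writes fun q => ¬ D (e q)) :
    Dec D (execWith O e C K) := by
  induction C with
  | nil => exact h
  | cons o C ih =>
    rcases o with g | ⟨len, src, tgt⟩
    · refine Dec.gate (g := g.map e) (ih hC.tail) ?_
      rw [Gate.target_map]
      exact hC.1 g (List.mem_cons_self ..)
    · intro ψ φ hd
      simp only [QCrypto.execWith]
      rw [← avgBits_add]
      congr 1
      funext r
      refine Dec.mapDomain (ih hC.tail) (fun S q hq => ?_) ψ φ hd
      refine mem_queryMap fun j hj => ?_
      exact hC.2 len src tgt (List.mem_cons_self ..) j (by rw [hj] at hq; exact hq)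

theorem Quad.execWith {K : State α → ℝ} (h : Quad K) (O : Oracle) (e : Wire κ → α)
    (C : Circuit κ) : Quad (execWith O e C K) := by
  intro c ψ
  induction C generalizing ψ with
  | nil => exact h c ψ
  | cons o C ih =>
    rcases o with g | ⟨len, src, tgt⟩
    · simp only [QCrypto.execWith, map_smul, ih]
    · simp only [QCrypto.execWith, Finsupp.mapDomain_smul, ih, avgBits_mul]

theorem queryMap_involutive (e : Wire κ → α) (he : Function.Injective e) (len : ℕ)
    (src tgt : κ × ℕ) (f : List Bool → List Bool) :
    Function.Involutive (queryMap e len src tgt f) := by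
  intro S
  by_cases h : src = tgt
  · simp [queryMap, h]
  · have h1 : readBits (regAt e src) len (queryMap e len src tgt f S) =
        readBits (regAt e src) len S := by
      unfold readBits
      refine List.map_congr_left fun j _ => ?_
      refine decide_eq_decide.2 (mem_queryMap fun j' hj' => ?_)
      have := he hj'
      simp only [Prod.mk.injEq] at this
      exact h (Prod.ext this.1 this.2.1)
    unfold queryMap at h1 ⊢
    simp only [h, if_false] at h1 ⊢
    rw [h1]
    exact symmDiff_symmDiff_cancel_right _ _

theorem execWith_normSq (O : Oracle) (e : Wire κ → α) (he : Function.Injective e)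
    (C : Circuit κ) (ψ : State α) : execWith O e C normSq ψ = normSq ψ := by
  induction C generalizing ψ with
  | nil => rfl
  | cons o C ih =>
    rcases o with g | ⟨len, src, tgt⟩
    · simp only [execWith, ih, Gate.normSq_apply]
    · simp only [execWith, ih, normSq_mapDomain (Function.Involutive.injective (queryMap_involutive e he _ _ _ _)),
        avgBits_const]

end

/-! ### Measurements and uniform superpositions -/

theorem measure_eq_sum {β : Type} [DecidableEq β] {R : Finset α → β} {K : β → State α → ℝ}
    (h0 : ∀ y, K y 0 = 0) {ψ : State α} {Y : Finset β} (hY : ∀ S ∈ ψ.support, R S ∈ Y) :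
    measure R K ψ = ∑ y ∈ Y, K y (ψ.filter fun S => R S = y) := by
  classical
  unfold measure
  have h1 : ∑ y ∈ ψ.support.image R, K y (ψ.filter fun S => R S = y) =
      ∑ y ∈ Y, K y (ψ.filter fun S => R S = y) := by
    refine Finset.sum_subset (fun y hy => ?_) fun y _ hy => ?_
    · obtain ⟨S, hS, rfl⟩ := Finset.mem_image.1 hy
      exact hY S hS
    · rw [(Finsupp.filter_eq_zero_iff _ _).2, h0]
      intro S hS
      by_contra hne
      exact hy (Finset.mem_image.2 ⟨S, Finsupp.mem_support_iff.2 hne, hS⟩)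
  rw [← h1]
  refine Finset.sum_congr (by ext; simp) fun y _ => ?_
  congr!

theorem sum_filter_eq {β : Type} [DecidableEq β] (R : Finset α → β) (ψ : State α) :
    ∑ y ∈ ψ.support.image R, ψ.filter (fun S => R S = y) = ψ := by
  classical
  ext S
  rw [Finsupp.finsetSum_apply]
  simp only [Finsupp.filter_apply]
  rw [Finset.sum_ite_eq]
  split_ifs with h
  · rfl
  · by_contra hne
    exact h (Finset.mem_image_of_mem _ (Finsupp.mem_support_iff.2 (Ne.symm hne)))

/-- Deferred measurement. Components with different outcomes differ at a qubit in `D`, so `K` adds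
up over them by itself, and measuring or not measuring makes no difference to the value. -/
theorem measure_const {β : Type} {D : α → Prop} {K : State α → ℝ} (hK : Dec D K) (h0 : K 0 = 0)
    {R : Finset α → β} (hR : ∀ S T : Finset α, (∀ q, D q → (q ∈ S ↔ q ∈ T)) → R S = R T)
    (ψ : State α) : measure R (fun _ => K) ψ = K ψ := by
  classical
  rw [measure_eq_sum (Y := ψ.support.image R) (fun _ => h0) fun S hS =>
    Finset.mem_image_of_mem _ hS, ← hK.sum h0, sum_filter_eq]
  intro y _ y' _ hy S hS T hT
  by_contra hne
  push Not at hne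
  rw [Finsupp.support_filter, Finset.mem_filter] at hS hT
  exact hy (hS.2.symm.trans ((hR S T hne).trans hT.2))

theorem measure_congr {β : Type} {R : Finset α → β} {K K' : β → State α → ℝ} {ψ : State α}
    (h : ∀ S₀ ∈ ψ.support, ∀ φ : State α, (∀ S ∈ φ.support, R S = R S₀ ∧ S ∈ ψ.support) →
      K (R S₀) φ = K' (R S₀) φ) :
    measure R K ψ = measure R K' ψ := by
  classical
  unfold measure
  refine Finset.sum_congr rfl fun y hy => ?_
  obtain ⟨S₀, hS₀, rfl⟩ := Finset.mem_image.1 hy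
  refine h S₀ hS₀ _ fun S hS => ?_
  rw [Finsupp.support_filter, Finset.mem_filter] at hS
  exact ⟨hS.2, hS.1⟩

theorem measure_setAvg {β γ : Type} [DecidableEq γ] (R : Finset α → β) (X : Finset γ)
    (K : Finset γ → β → State α → ℝ) (ψ : State α) :
    (setAvg X fun A => measure R (K A) ψ) =
      measure R (fun y φ => setAvg X fun A => K A y φ) ψ := by
  unfold measure
  rw [setAvg_sum]

theorem measure_avgBits {β : Type} (R : Finset α → β) (m : ℕ)
    (K : List Bool → β → State α → ℝ) (ψ : State α) :
    (avgBits m fun r => measure R (K r) ψ) =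
      measure R (fun y φ => avgBits m fun r => K r y φ) ψ := by
  unfold measure
  rw [avgBits_sum]

/-- A Hadamard gate turns a qubit in state zero into an equal superposition of both values. As the
qubit lies in `D`, the value is the sum of the values of both branches, and the squared amplitude
gives each of them the weight 1/2; hence a uniform superposition may be replaced by a uniformly
random set of flips. -/
theorem hadamards (e : Wire κ → α) (L : List (Wire κ)) (hL : (L.map e).Nodup)
    {K : State α → ℝ} {D : α → Prop} (hK : Dec D K) (hQ : Quad K) (hD : ∀ q ∈ L, D (e q))
    (ψ : State α) (hψ : ∀ S ∈ ψ.support, ∀ q ∈ L, e q ∉ S) :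
    K (exec e (L.map fun q => Op.gate (.H q)) ψ) =
      setAvg (L.map e).toFinset fun β => K (flip β ψ) := by
  induction L generalizing ψ with
  | nil => simp [exec, setAvg_empty, flip_empty]
  | cons q L ih =>
    rw [List.map_cons, List.nodup_cons] at hL
    have hqD := hD q (List.mem_cons_self ..)
    have hq : e q ∉ (L.map e).toFinset := by simpa using hL.1
    have hD' : ∀ p ∈ L, D (e p) := fun p hp => hD p (List.mem_cons_of_mem _ hp)
    have hH : (Gate.H (e q)).apply ψ = ((Real.sqrt 2 : ℂ))⁻¹ • (ψ + flip {e q} ψ) := by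
      have h1 : ψ + flip {e q} ψ =
          ψ.sum fun S a => Finsupp.single S a + Finsupp.single (S ∆ {e q}) a := by
        rw [Finsupp.sum_add, Finsupp.sum_single]; rfl
      rw [h1, Gate.apply, Finsupp.linearCombination_apply, Finsupp.smul_sum]
      refine Finset.sum_congr rfl fun S hS => ?_
      have hqS := hψ S hS q (List.mem_cons_self ..)
      simp only [Gate.onKet, hqS, if_false, one_smul, insert_eq_symmDiff, erase_eq_symmDiff, ket,
        smul_add, Finsupp.smul_single, smul_eq_mul, mul_one]
      congr 2 <;> ring
    -- The remaining Hadamard gates act on other qubits, so that `e q` still separates the two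
    -- branches when `K` is applied.
    have hK' : Dec (fun p => p = e q) fun φ => K (exec e (L.map fun q => Op.gate (.H q)) φ) := by
      refine Dec.exec (D := fun p => p = e q) (fun φ φ' h => hK φ φ' fun S hS T hT => ?_) ?_
      · obtain ⟨p, rfl, hp⟩ := h S hS T hT
        exact ⟨e q, hqD, hp⟩
      · refine ⟨fun g hg => ?_, fun x src tgt h => by simp at h⟩
        obtain ⟨p, hp, hpg⟩ := List.mem_map.1 hg
        simp only [Op.gate.injEq] at hpg
        subst hpg
        intro h
        exact hL.1 (List.mem_map.2 ⟨p, hp, h⟩)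
    have hQ' := hQ.exec e (L.map fun q => Op.gate (.H q))
    have e1 := hQ' ((Real.sqrt 2 : ℂ))⁻¹ (ψ + flip {e q} ψ)
    have e2 := hK' ψ (flip {e q} ψ) fun S hS T hT => by
      rw [mem_support_flip] at hT
      refine ⟨e q, rfl, ?_⟩
      have h1 := hψ S hS q (List.mem_cons_self ..)
      have h2 := hψ _ hT q (List.mem_cons_self ..)
      simp only [Finset.mem_symmDiff, Finset.mem_singleton, not_true_eq_false, and_false, true_and,
        false_or, not_not] at h2
      simp [h1, h2]
    simp only at e1 e2
    simp only [List.map_cons, exec, Gate.map, List.toFinset_cons]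
    rw [hH, e1, e2, ih hL.2 hD', ih hL.2 hD', setAvg_insert hq]
    · have hn : ‖((Real.sqrt 2 : ℂ))⁻¹‖ ^ 2 = 2⁻¹ := by
        rw [norm_inv, inv_pow, Complex.norm_real, Real.norm_eq_abs, sq_abs, Real.sq_sqrt]
        norm_num
      rw [hn, inv_mul_eq_div]
      congr 2
      refine setAvg_congr fun A hA => ?_
      rw [flip_flip]
      congr 2
      rw [symmDiff_comm, insert_eq_symmDiff, if_neg fun h => hq (hA h)]
    · intro S hS p hp hpS
      rw [mem_support_flip] at hS
      refine hψ _ hS p (List.mem_cons_of_mem _ hp) ?_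
      have : e p ≠ e q := fun h => hL.1 (List.mem_map.2 ⟨p, hp, h⟩)
      simp [Finset.mem_symmDiff, this, hpS]
    · exact fun S hS p hp => hψ S hS p (List.mem_cons_of_mem _ hp)

end
section
variable {α β γ κ κ' : Type} [DecidableEq α] [DecidableEq β] [DecidableEq γ]

theorem symmDiff_none (S : Finset α) : S ∆ ∅ = S := symmDiff_bot S

theorem exec_congr {e e' : Wire κ → α} {C : Circuit κ} (h : C.On fun q => e q = e' q)
    (ψ : State α) : exec e C ψ = exec e' C ψ := by
  induction C generalizing ψ with
  | nil => rfl
  | cons o C ih =>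
    rcases o with g | _
    · have hg : g.map e = g.map e' := by
        have := h g (List.mem_cons_self ..)
        cases g <;> simp_all [Gate.map, Gate.wires]
      simp only [exec, hg, ih h.tail]
    · exact ih h.tail ψ

theorem support_exec {P : α → Prop} {e : Wire κ → α} {C : Circuit κ}
    (hC : ∀ g, Op.gate g ∈ C → P (e g.target)) {ψ : State α} {T : Finset α}
    (hT : T ∈ (exec e C ψ).support) :
    ∃ S ∈ ψ.support, ∀ q, ¬ P q → (q ∈ T ↔ q ∈ S) := by
  induction C generalizing ψ with
  | nil => exact ⟨T, hT, fun _ _ => Iff.rfl⟩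
  | cons o C ih =>
    rcases o with g | _
    · obtain ⟨S', hS', h1⟩ := ih (fun g hg => hC g (List.mem_cons_of_mem _ hg)) hT
      obtain ⟨S, hS, h2⟩ := Gate.support_apply _ _ hS'
      refine ⟨S, hS, fun q hq => (h1 q hq).trans (h2 q fun h => hq ?_)⟩
      rw [h, Gate.target_map]
      exact hC g (List.mem_cons_self ..)
    · exact ih (fun g hg => hC g (List.mem_cons_of_mem _ hg)) hT

/-! ### Embedding a memory into a larger one -/

/-- Rename the qubits by `φ`, and add the qubits in `A`. -/
noncomputable def emb (φ : α → β) (A : Finset β) (ψ : State α) : State β :=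
  Finsupp.mapDomain (fun S => S.image φ ∆ A) ψ

theorem mem_emb {φ : α → β} (hφ : Function.Injective φ) {A : Finset β} {S : Finset α} {q : α}
    (hq : φ q ∉ A) : φ q ∈ S.image φ ∆ A ↔ q ∈ S := by
  simp [Finset.mem_symmDiff, hq, hφ.eq_iff]

theorem mem_emb' {φ : α → β} {A : Finset β} {S : Finset α} {q : β}
    (hq : ∀ w, q ≠ φ w) : q ∈ S.image φ ∆ A ↔ q ∈ A := by
  have : q ∉ S.image φ := fun h => by
    obtain ⟨w, -, h⟩ := Finset.mem_image.1 h
    exact hq w h.symm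
  simp [Finset.mem_symmDiff, this]

theorem emb_carries {φ : α → β} (hφ : Function.Injective φ) (A : Finset β) :
    Carries φ (fun q => φ q ∉ A) (fun S => S.image φ ∆ A) (fun _ => (1 : ℂ)) := by
  refine ⟨fun _ _ _ _ h => hφ h, fun S q hq => mem_emb hφ hq, fun S q _ => ?_, fun _ _ _ => rfl⟩
  rw [Finset.image_symmDiff _ _ hφ, Finset.image_singleton]
  exact symmDiff_right_comm _ _ _

theorem emb_exec {φ : α → β} (hφ : Function.Injective φ) {A : Finset β} {e : Wire κ → α}
    {C : Circuit κ} (hC : C.On fun q => φ (e q) ∉ A) (ψ : State α) :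
    exec (φ ∘ e) C (emb φ A ψ) = emb φ A (exec e C ψ) := by
  have := (emb_carries hφ A).exec e hC ψ
  rw [← mapDomain_eq_weigh, ← mapDomain_eq_weigh] at this
  exact this.symm

theorem emb_gate {φ : α → β} (hφ : Function.Injective φ) {A : Finset β} {g : Gate α}
    (hg : ∀ q ∈ g.wires, φ q ∉ A) (ψ : State α) :
    (g.map φ).apply (emb φ A ψ) = emb φ A (g.apply ψ) := by
  have := (emb_carries hφ A).apply g hg ψ
  rw [← mapDomain_eq_weigh, ← mapDomain_eq_weigh] at this
  exact this.symm

theorem flip_emb (φ : α → β) (A X : Finset β) (ψ : State α) :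
    flip X (emb φ A ψ) = emb φ (A ∆ X) ψ := by
  unfold flip emb
  rw [← Finsupp.mapDomain_comp]
  congr 1
  funext S
  exact symmDiff_assoc _ _ _

theorem emb_flip {φ : α → β} (hφ : Function.Injective φ) (A : Finset β) (X : Finset α)
    (ψ : State α) : emb φ A (flip X ψ) = emb φ (A ∆ X.image φ) ψ := by
  unfold flip emb
  rw [← Finsupp.mapDomain_comp]
  congr 1
  funext S
  simp only [Function.comp, Finset.image_symmDiff _ _ hφ]
  rw [symmDiff_assoc, symmDiff_comm (X.image φ)]

theorem emb_mapDomain {φ : α → β} {A : Finset β} {J : Finset α → Finset α}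
    {J' : Finset β → Finset β} {ψ : State α}
    (h : ∀ S ∈ ψ.support, J' (S.image φ ∆ A) = (J S).image φ ∆ A) :
    Finsupp.mapDomain J' (emb φ A ψ) = emb φ A (Finsupp.mapDomain J ψ) := by
  unfold emb
  rw [← Finsupp.mapDomain_comp, ← Finsupp.mapDomain_comp]
  exact Finsupp.mapDomain_congr h

theorem emb_emb (φ : α → β) (χ : β → γ) (hχ : Function.Injective χ) (A : Finset β) (B : Finset γ)
    (ψ : State α) : emb χ B (emb φ A ψ) = emb (χ ∘ φ) (A.image χ ∆ B) ψ := by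
  unfold emb
  rw [← Finsupp.mapDomain_comp]
  congr 1
  funext S
  simp only [Function.comp, Finset.image_symmDiff _ _ hχ, Finset.image_image]
  exact symmDiff_assoc _ _ _

theorem emb_ket (φ : α → β) (A : Finset β) (S : Finset α) :
    emb φ A (ket S) = ket (S.image φ ∆ A) := by
  simp [emb, ket]

theorem mem_support_emb {φ : α → β} {A : Finset β} {ψ : State α} {T : Finset β}
    (h : T ∈ (emb φ A ψ).support) : ∃ S ∈ ψ.support, T = S.image φ ∆ A := by
  obtain ⟨S, hS, rfl⟩ := Finset.mem_image.1 (Finsupp.mapDomain_support h)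
  exact ⟨S, hS, rfl⟩

theorem emb_injective {φ : α → β} (hφ : Function.Injective φ) (A : Finset β) :
    Function.Injective fun S : Finset α => S.image φ ∆ A := fun _ _ h =>
  Finset.image_injective hφ (symmDiff_left_injective A h)

/-! ### Product states and evaluation with certainty -/

/-- Combinations of product states, with `π` on the qubits in the range of `ι`, and with a basis
state on the other ones, among which those with property `W` are in state zero. -/
noncomputable def spread (ι : α → β) (W : β → Prop) (π : State α) : Submodule ℂ (State β) :=
  Submodule.span ℂ {ψ | ∃ S, (∀ q ∈ S, ¬ W q) ∧ ψ = emb ι S π}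

theorem spread_mono {ι : α → β} {W W' : β → Prop} {π : State α} (h : ∀ q, W' q → W q) :
    spread ι W π ≤ spread ι W' π :=
  Submodule.span_mono fun _ ⟨S, hS, hψ⟩ => ⟨S, fun q hq hw => hS q hq (h q hw), hψ⟩

theorem emb_eq_sum (ι : α → β) (S : Finset β) (π : State α) :
    emb ι S π = π.sum fun A a => a • flip (A.image ι) (ket S) := by
  unfold emb Finsupp.mapDomain
  refine Finset.sum_congr rfl fun A _ => ?_
  simp [flip, ket, symmDiff_comm S]

/-- A generator is a combination of flips, inside the range of `ι`, of a single basis state. A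
circuit that avoids this range commutes with the flips, so it acts on the basis state alone, and it
cannot set qubits in `W` because it does not act on them. -/
theorem exec_mem_spread {ι : α → β} {W : β → Prop} {π : State α} {e : Wire κ → β}
    {C : Circuit κ} (hC : C.On fun q => (∀ w, e q ≠ ι w) ∧ ¬ W (e q))
    {ψ : State β} (hψ : ψ ∈ spread ι W π) : exec e C ψ ∈ spread ι W π := by
  rw [← execL_apply]
  refine Submodule.span_induction (p := fun ψ _ => execL e C ψ ∈ spread ι W π) ?_ ?_ ?_ ?_ hψ
  · rintro _ ⟨S, hS, rfl⟩
    have h1 : exec e C (emb ι S π) = (exec e C (ket S)).sum fun T a => a • emb ι T π := by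
      rw [emb_eq_sum, ← execL_apply, map_finsuppSum]
      simp only [map_smul, execL_apply]
      have h2 : ∀ A : Finset α, exec e C (flip (A.image ι) (ket S)) =
          (exec e C (ket S)).sum fun T a => a • flip (A.image ι) (ket T) := by
        intro A
        rw [flip_exec e (hC.mono fun q hq h => ?_)]
        · conv_lhs => rw [← Finsupp.sum_single (exec e C (ket S))]
          simp only [flip, Finsupp.sum, Finsupp.mapDomain_finsetSum, Finsupp.mapDomain_single, ket,
            Finsupp.smul_single, smul_eq_mul, mul_one]
        · obtain ⟨w, -, hw⟩ := Finset.mem_image.1 h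
          exact hq.1 w hw.symm
      simp only [h2, emb_eq_sum]
      simp only [Finsupp.sum, Finset.smul_sum]
      rw [Finset.sum_comm]
      refine Finset.sum_congr rfl fun T _ => Finset.sum_congr rfl fun A _ => smul_comm _ _ _
    rw [execL_apply, h1]
    refine Submodule.sum_mem _ fun T hT => Submodule.smul_mem _ _ (Submodule.subset_span
      ⟨T, fun q hq hw => ?_, rfl⟩)
    obtain ⟨S', hS', h3⟩ := support_exec (P := fun q => ¬ W q)
      (fun g hg => (hC g hg _ g.target_mem_wires).2) hT
    have : S' = S := by
      have h4 := Finsupp.support_single_subset hS'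
      simpa using h4
    rw [h3 q (not_not.2 hw), this] at hq
    exact hS q hq hw
  · simp
  · intro x y _ _ hx hy; rw [map_add]; exact Submodule.add_mem _ hx hy
  · intro a x _ hx; rw [map_smul]; exact Submodule.smul_mem _ _ hx

theorem flip_mem_spread {ι : α → β} {W : β → Prop} {π : State α} {X : Finset β}
    (hX : ∀ q ∈ X, ¬ W q) {ψ : State β} (hψ : ψ ∈ spread ι W π) : flip X ψ ∈ spread ι W π := by
  have h : ∀ ψ : State β, flip X ψ = Finsupp.lmapDomain ℂ ℂ (· ∆ X) ψ := fun _ => rfl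
  rw [h]
  refine Submodule.span_induction
    (p := fun ψ _ => Finsupp.lmapDomain ℂ ℂ (· ∆ X) ψ ∈ spread ι W π) ?_ ?_ ?_ ?_ hψ
  · rintro _ ⟨S, hS, rfl⟩
    rw [← h, flip_emb]
    refine Submodule.subset_span ⟨_, fun q hq => ?_, rfl⟩
    rcases Finset.mem_symmDiff.1 hq with h | h
    exacts [hS q h.1, hX q h.1]
  · simp
  · intro x y _ _ hx hy; rw [map_add]; exact Submodule.add_mem _ hx hy
  · intro a x _ hx; rw [map_smul]; exact Submodule.smul_mem _ _ hx

/-- The circuit `U`, on input `x`, computes `f x` with certainty. -/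
def Certain (e : Wire κ → α) (U : Circuit κ) (inp : ℕ → α) (o : α) (l : ℕ) (f : List Bool → Bool)
    (ψ : State α) : Prop :=
  ∀ x : List Bool, x.length = l → ∀ S ∈ (exec e U (flip (ones inp x) ψ)).support,
    (o ∈ S ↔ f x = true)

theorem image_ones (φ : α → β) (r : ℕ → α) (s : List Bool) :
    (ones r s).image φ = ones (φ ∘ r) s := by
  simp [ones, Finset.image_image]

/-- Certainty is a condition on the support of the final state and so passes to linear combinations.
On a generator, the range of `ι` contains a faithful copy of `π` because `W` keeps the additional
basis state away from it, and the circuit runs inside that copy. The remaining qubits may be in any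
state. -/
theorem Certain.of_mem_spread {ι : α → β} (hι : Function.Injective ι) {W : β → Prop}
    {π : State α} (hW : ∀ w, W (ι w)) {e : Wire κ → α} {U : Circuit κ} {inp : ℕ → α} {o : α}
    {l : ℕ} {f : List Bool → Bool} (h : Certain e U inp o l f π) {e' : Wire κ → β}
    (he : U.On fun q => e' q = ι (e q)) {ψ : State β} (hψ : ψ ∈ spread ι W π) :
    Certain e' U (ι ∘ inp) (ι o) l f ψ := by
  intro x hx
  rw [exec_congr (e' := ι ∘ e) he]
  refine Submodule.span_induction (p := fun ψ _ => ∀ S ∈ (exec (ι ∘ e) U (flip (ones (ι ∘ inp) x)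
    ψ)).support, (ι o ∈ S ↔ f x = true)) ?_ ?_ ?_ ?_ hψ
  · rintro _ ⟨S, hS, rfl⟩ T hT
    have hn : ∀ w, ι w ∉ S := fun w hw => hS _ hw (hW w)
    rw [flip_emb, ← image_ones, ← emb_flip hι, emb_exec hι (fun _ _ _ _ => hn _)] at hT
    obtain ⟨A, hA, rfl⟩ := mem_support_emb hT
    rw [mem_emb hι (hn o)]
    exact h x hx A hA
  · intro S hS
    have : flip (ones (ι ∘ inp) x) (0 : State β) = 0 := Finsupp.mapDomain_zero
    rw [this, exec_zero] at hS
    simp at hS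
  · intro φ φ' _ _ h1 h2 S hS
    rw [flip_add, ← execL_apply, map_add] at hS
    rcases Finset.mem_union.1 (Finsupp.support_add hS) with h3 | h3
    exacts [h1 S h3, h2 S h3]
  · intro a φ _ h1 S hS
    have : flip (ones (ι ∘ inp) x) (a • φ) = a • flip (ones (ι ∘ inp) x) φ :=
      Finsupp.mapDomain_smul ..
    rw [this, ← execL_apply, map_smul] at hS
    exact h1 S (Finsupp.support_smul hS)

/-! ### Copying bits -/

theorem mem_ones {r : ℕ → α} (hr : Function.Injective r) {s : List Bool} {j : ℕ} :
    r j ∈ ones r s ↔ s.getD j false = true := by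
  unfold ones
  rw [Finset.mem_image]
  constructor
  · rintro ⟨i, hi, hij⟩
    rw [← hr hij]
    exact (Finset.mem_filter.1 hi).2
  · intro h
    refine ⟨j, Finset.mem_filter.2 ⟨Finset.mem_range.2 ?_, h⟩, rfl⟩
    by_contra hj
    rw [List.getD_eq_default _ _ (not_lt.1 hj)] at h
    exact absurd h (by simp)

theorem ones_nil (r : ℕ → α) : ones r [] = ∅ := by simp [ones]

theorem ones_append {r : ℕ → α} (hr : Function.Injective r) (s t : List Bool) :
    ones r (s ++ t) = ones r s ∆ ones (fun j => r (s.length + j)) t := by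
  have hr' : Function.Injective fun j => r (s.length + j) := fun i j h => by
    have := hr h; omega
  ext q
  rw [Finset.mem_symmDiff]
  by_cases hq : ∃ j, q = r j
  · obtain ⟨j, rfl⟩ := hq
    rw [mem_ones hr, mem_ones hr]
    by_cases hj : j < s.length
    · have : r j ∉ ones (fun j => r (s.length + j)) t := fun h => by
        obtain ⟨i, hi⟩ := ones_subset _ _ h
        have := hr hi
        omega
      rw [List.getD_append _ _ _ _ hj]
      simp only [this, not_false_eq_true, and_true, false_and, or_false]
    · have h1 : s.getD j false = false := List.getD_eq_default _ _ (not_lt.1 hj)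
      obtain ⟨i, rfl⟩ := Nat.exists_eq_add_of_le (not_lt.1 hj)
      have h2 : r (s.length + i) ∈ ones (fun j => r (s.length + j)) t ↔ t.getD i false = true :=
        mem_ones (r := fun j => r (s.length + j)) hr'
      rw [List.getD_append_right _ _ _ _ (by omega), h1, h2, Nat.add_sub_cancel_left]
      simp
  · have h1 : q ∉ ones r (s ++ t) := fun h => hq (ones_subset _ _ h)
    have h2 : q ∉ ones r s := fun h => hq (ones_subset _ _ h)
    have h3 : q ∉ ones (fun j => r (s.length + j)) t := fun h =>
      (ones_subset _ _ h).elim fun j hj => hq ⟨_, hj⟩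
    simp [h1, h2, h3]

theorem ones_singleton (r : ℕ → α) (b : Bool) : ones r [b] = if b then {r 0} else ∅ := by
  cases b <;> simp [ones, Finset.filter_singleton]

/-- Bit-controlled flips whose controls are never targets. -/
theorem exec_copies (e : Wire κ → α) (G : ℕ → Gate (Wire κ)) (c : ℕ → Finset α → Bool)
    {r : ℕ → α} (hr : Function.Injective r)
    (hG : ∀ t S, ((G t).map e).onKet S = ket (S ∆ if c t S then {r t} else ∅))
    (hc : ∀ t S s, c t (S ∆ ones r s) = c t S) (n : ℕ) (ψ : State α) :
    exec e ((List.range n).flatMap fun t => [Op.gate (G t)]) ψ =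
      Finsupp.mapDomain (fun S => S ∆ ones r ((List.range n).map fun t => c t S)) ψ := by
  induction n with
  | zero => simp only [List.range_zero, List.flatMap_nil, exec, List.map_nil, ones_nil]
            exact (flip_empty ψ).symm
  | succ n ih =>
    rw [List.range_succ, List.flatMap_append, exec_append, ih]
    simp only [List.flatMap_cons, List.flatMap_nil, List.append_nil, exec]
    have h1 : ∀ φ : State α, ((G n).map e).apply φ =
        Finsupp.mapDomain (fun S => S ∆ if c n S then {r n} else ∅) φ := by
      intro φ
      rw [Gate.apply, Finsupp.linearCombination_apply, Finsupp.mapDomain]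
      simp [hG, ket]
    rw [h1, ← Finsupp.mapDomain_comp]
    congr 1
    funext S
    simp only [Function.comp, hc, List.map_append, List.map_cons, List.map_nil]
    rw [ones_append hr, symmDiff_assoc, ones_singleton]
    simp

theorem exec_copy (e : Wire κ → α) (c d : ℕ → Wire κ) (hd : Function.Injective fun t => e (d t))
    (hcd : ∀ i j, e (c i) ≠ e (d j)) (n : ℕ) (ψ : State α) :
    exec e ((List.range n).flatMap fun t => [Op.gate (.CX (c t) (d t))]) ψ =
      Finsupp.mapDomain (fun S => S ∆ ones (fun t => e (d t)) (readBits (fun t => e (c t)) n S))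
        ψ := by
  refine exec_copies e (fun t => .CX (c t) (d t)) (fun t S => decide (e (c t) ∈ S)) hd ?_ ?_ n ψ
  · intro t S
    simp only [Gate.map, Gate.onKet, ne_eq, hcd, not_false_eq_true, true_and]
    by_cases h : e (c t) ∈ S <;> simp [h, symmDiff_none]
  · intro t S s
    have : e (c t) ∉ ones (fun t => e (d t)) s := fun h =>
      (ones_subset _ _ h).elim fun j hj => hcd _ _ hj
    simp [Finset.mem_symmDiff, this]

theorem CX_apply_known {c t : α} (hct : c ≠ t) {b : Bool} {ψ : State α}
    (h : ∀ S ∈ ψ.support, (c ∈ S ↔ b = true)) :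
    (Gate.CX c t).apply ψ = flip (if b then {t} else ∅) ψ := by
  rw [Gate.apply, Finsupp.linearCombination_apply, flip, Finsupp.mapDomain]
  refine Finset.sum_congr rfl fun S hS => ?_
  have := h S hS
  cases b <;> simp_all [Gate.onKet, ket, symmDiff_none]

/-- Compute a bit that is known with certainty, copy it, and undo the computation. -/
theorem exec_compute (e : Wire κ → α) {cp U : Circuit κ} {o ans : Wire κ} {src : ℕ → α}
    {X : Finset α} {b : Bool} {n : ℕ} {x : List Bool} {ψ : State α}
    (hcp : ∀ φ : State α, (∀ S ∈ φ.support, readBits src n S = x) → exec e cp φ = flip X φ)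
    (hx : ∀ S ∈ ψ.support, readBits src n S = x)
    (hout : ∀ S ∈ (exec e U (flip X ψ)).support, (e o ∈ S ↔ b = true))
    (hU : U.On fun w => e w ≠ e ans) (ho : e o ≠ e ans) (hans : ∀ j, src j ≠ e ans)
    (hX : ∀ j, src j ∉ X) :
    exec e (cp ++ (U ++ ([.gate (.CX o ans)] ++ (U.inv ++ cp)))) ψ =
      flip (if b then {e ans} else ∅) ψ := by
  have h1 : U.inv.On fun w => e w ∉ (if b then {e ans} else ∅ : Finset α) := by
    refine Circuit.On.inv (hU.mono fun q hq => ?_)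
    cases b <;> simp [hq]
  simp only [exec_append]
  rw [hcp ψ hx]
  simp only [exec, Gate.map]
  -- As the output bit is certain, copying it amounts to flipping a fixed set of qubits that `U`
  -- does not touch. This flip commutes with `U.inv`, so the computation is undone exactly.
  rw [CX_apply_known ho hout, flip_exec e h1, exec_inv, flip_flip, hcp, flip_flip]
  · rw [symmDiff_comm X, symmDiff_symmDiff_cancel_right]
  · intro S hS
    rw [mem_support_flip] at hS
    rw [← hx _ hS]
    unfold readBits
    refine List.map_congr_left fun j _ => decide_eq_decide.2 ?_
    have : src j ∉ X ∆ (if b then {e ans} else ∅ : Finset α) := by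
      cases b <;> simp [Finset.mem_symmDiff, hX, hans]
    simp [Finset.mem_symmDiff, this]

end
section
variable {α β κ κ' : Type} [DecidableEq α] [DecidableEq β] [DecidableEq κ] [DecidableEq κ']

/-! ### Bit-by-bit encryption -/

/-- Encryption of a bit by means of the function `f`. -/
def bitEnc (f : List Bool → Bool) (m r : List Bool) : List Bool :=
  r ++ [xor (m.headD false) (f r)]

theorem encBits_eq (enc1 : List Bool → List Bool → List Bool) (w : ℕ) (m r : List Bool) :
    encBits enc1 w m r = (List.range m.length).flatMap fun j =>
      enc1 [m.getD j false] ((r.drop (j * w)).take w) := by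
  induction m generalizing r with
  | nil => rfl
  | cons b m ih =>
    rw [encBits, ih, List.length_cons, List.range_succ_eq_map, List.flatMap_cons,
      List.flatMap_map]
    simp only [Nat.zero_mul, List.drop_zero, List.getD_cons_zero]
    congr 1
    refine List.flatMap_congr fun j _ => ?_
    simp only [List.getD_cons_succ, List.drop_drop, Nat.succ_eq_add_one]
    rw [show w + j * w = (j + 1) * w by ring]

theorem readBits_take_drop (r : ℕ → α) {j w n : ℕ} (h : j < n) (S : Finset α) :
    ((readBits r (n * w) S).drop (j * w)).take w = readBits (fun t => r (j * w + t)) w S := by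
  have h1 : (j + 1) * w ≤ n * w := Nat.mul_le_mul_right _ h
  have h2 : (j + 1) * w = j * w + w := by ring
  refine List.ext_getElem ?_ fun i h3 h4 => ?_
  · simp [readBits]; omega
  · simp [readBits]

theorem encBits_readBits (f : List Bool → Bool) (w : ℕ) (m : List Bool) (r : ℕ → α)
    (S : Finset α) : encBits (bitEnc f) w m (readBits r (m.length * w) S) =
      (List.range m.length).flatMap fun j => readBits (fun t => r (j * w + t)) w S ++
        [xor (m.getD j false) (f (readBits (fun t => r (j * w + t)) w S))] := by
  rw [encBits_eq]
  refine List.flatMap_congr fun j hj => ?_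
  rw [readBits_take_drop r (List.mem_range.1 hj), bitEnc]
  rfl

/-! ### Simulation of encryption queries -/

theorem CX_apply {c t : α} (hct : c ≠ t) (ψ : State α) :
    (Gate.CX c t).apply ψ = Finsupp.mapDomain (fun S => S ∆ if c ∈ S then {t} else ∅) ψ := by
  rw [Gate.apply, Finsupp.linearCombination_apply, Finsupp.mapDomain]
  refine Finset.sum_congr rfl fun S _ => ?_
  by_cases h : c ∈ S <;> simp [Gate.onKet, ket, h, hct, symmDiff_none]

/-- The strings that a simulated query adds to its target. -/
def queryBlocks (R A s : ℕ → α) (ℓ a len : ℕ) (S : Finset α) : List Bool :=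
  (List.range len).flatMap fun j => readBits (fun t => R ((a + j) * ℓ + t)) ℓ S ++
    [xor (decide (s j ∈ S)) (decide (A (a + j) ∈ S))]

theorem length_flatMap_range {X : Type} (F : ℕ → List X) (n k : ℕ)
    (h : ∀ j < n, (F j).length = k) : ((List.range n).flatMap F).length = n * k := by
  induction n with
  | zero => simp
  | succ n ih =>
    rw [List.range_succ, List.flatMap_append, List.length_append,
      ih fun j hj => h j (by omega)]
    simp [h n (by omega)]
    ring

theorem readBits_symmDiff {r : ℕ → α} {n : ℕ} {S X : Finset α} (h : ∀ j, r j ∉ X) :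
    readBits r n (S ∆ X) = readBits r n S := by
  unfold readBits
  exact List.map_congr_left fun j _ => decide_eq_decide.2 (by simp [Finset.mem_symmDiff, h])

/-- None of the controls lies in the target register. The controlled flips therefore read the
original basis state throughout, and their effects add up to a single XOR. -/
theorem exec_simQuery (e : Wire κ' → α) (he : Function.Injective e) (rk : κ → κ') (sh : κ → ℕ)
    (kr ka : κ') (ℓ a len : ℕ) (src tgt : κ × ℕ)
    (hr : (kr, 0) ≠ (rk tgt.1, tgt.2 + sh tgt.1)) (ha : (ka, 0) ≠ (rk tgt.1, tgt.2 + sh tgt.1))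
    (hs : (rk src.1, src.2 + sh src.1) ≠ (rk tgt.1, tgt.2 + sh tgt.1)) (ψ : State α) :
    exec e (simQuery rk sh kr ka ℓ a len src tgt) ψ = Finsupp.mapDomain (fun S => S ∆
      ones (fun t => e (rk tgt.1, tgt.2 + sh tgt.1, t))
        (queryBlocks (fun p => e (kr, 0, p)) (fun p => e (ka, 0, p))
          (fun p => e (rk src.1, src.2 + sh src.1, p)) ℓ a len S)) ψ := by
  have hne : ∀ (k : κ' × ℕ) (p p' : ℕ), k ≠ (rk tgt.1, tgt.2 + sh tgt.1) →
      e (k.1, k.2, p) ≠ e (rk tgt.1, tgt.2 + sh tgt.1, p') := by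
    intro k p p' h h'
    have := he h'
    simp only [Prod.mk.injEq] at this
    exact h (Prod.ext this.1 this.2.1)
  have hinj : Function.Injective fun t => e (rk tgt.1, tgt.2 + sh tgt.1, t) := fun p p' h => by
    have := he h
    simpa using this
  induction len with
  | zero =>
    simp only [simQuery, queryBlocks, List.range_zero, List.flatMap_nil, exec, ones_nil]
    exact (flip_empty ψ).symm
  | succ n ih =>
    have h1 : simQuery rk sh kr ka ℓ a (n + 1) src tgt = simQuery rk sh kr ka ℓ a n src tgt ++
        (((List.range ℓ).flatMap fun t => [Op.gate (.CX (kr, 0, (a + n) * ℓ + t)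
          (rk tgt.1, tgt.2 + sh tgt.1, n * (ℓ + 1) + t))]) ++
        ([.gate (.CX (ka, 0, a + n) (rk tgt.1, tgt.2 + sh tgt.1, n * (ℓ + 1) + ℓ))] ++
        [.gate (.CX (rk src.1, src.2 + sh src.1, n)
          (rk tgt.1, tgt.2 + sh tgt.1, n * (ℓ + 1) + ℓ))])) := by
      simp [simQuery, List.range_succ]
    rw [h1, exec_append, ih, exec_append, exec_append, exec_copy e _ _
      (fun p p' h => by have := hinj h; omega) (fun i j => hne (kr, 0) _ _ hr)]
    simp only [exec, Gate.map]
    rw [CX_apply (hne (ka, 0) _ _ ha), CX_apply (hne (rk src.1, src.2 + sh src.1) _ _ hs)]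
    simp only [← Finsupp.mapDomain_comp]
    congr 1
    funext S
    simp only [Function.comp]
    have hmem : ∀ (k : κ' × ℕ) (p : ℕ), k ≠ (rk tgt.1, tgt.2 + sh tgt.1) → ∀ (r : ℕ → ℕ) s,
        e (k.1, k.2, p) ∉ ones (fun t => e (rk tgt.1, tgt.2 + sh tgt.1, r t)) s := by
      intro k p hk r s h
      obtain ⟨j, hj⟩ := ones_subset _ _ h
      exact hne k _ _ hk hj
    have hmem' : ∀ (k : κ' × ℕ) (p p' : ℕ), k ≠ (rk tgt.1, tgt.2 + sh tgt.1) →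
        ∀ (P : Prop) [Decidable P], e (k.1, k.2, p) ∉ (if P then {e (rk tgt.1, tgt.2 + sh tgt.1, p')} else ∅ : Finset α) := by
      intro k p p' hk P _ h
      split_ifs at h
      · exact hne k _ _ hk (Finset.mem_singleton.1 h)
      · simp at h
    have e1 : ∀ s, readBits (fun t => e (kr, 0, (a + n) * ℓ + t)) ℓ
        (S ∆ ones (fun t => e (rk tgt.1, tgt.2 + sh tgt.1, t)) s) =
        readBits (fun t => e (kr, 0, (a + n) * ℓ + t)) ℓ S := fun s =>
      readBits_symmDiff fun j => hmem (kr, 0) _ hr id _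
    have e2 : ∀ s L, e (ka, 0, a + n) ∈ (S ∆ ones (fun t => e (rk tgt.1, tgt.2 + sh tgt.1, t)) s) ∆
        ones (fun t => e (rk tgt.1, tgt.2 + sh tgt.1, n * (ℓ + 1) + t)) L ↔
        e (ka, 0, a + n) ∈ S := by
      intro s L
      have h1 := hmem (ka, 0) (a + n) ha (fun t => n * (ℓ + 1) + t) L
      have h2 := hmem (ka, 0) (a + n) ha id s
      simp only [id] at h2
      simp only [Finset.mem_symmDiff, h1, h2, not_false_eq_true, and_true, false_and, or_false]
    have e3 : ∀ s L (P : Prop) [Decidable P], e (rk src.1, src.2 + sh src.1, n) ∈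
        ((S ∆ ones (fun t => e (rk tgt.1, tgt.2 + sh tgt.1, t)) s) ∆
          ones (fun t => e (rk tgt.1, tgt.2 + sh tgt.1, n * (ℓ + 1) + t)) L) ∆
          (if P then {e (rk tgt.1, tgt.2 + sh tgt.1, n * (ℓ + 1) + ℓ)} else ∅ : Finset α) ↔
        e (rk src.1, src.2 + sh src.1, n) ∈ S := by
      intro s L P _
      have h1 := hmem (rk src.1, src.2 + sh src.1) n hs (fun t => n * (ℓ + 1) + t) L
      have h2 := hmem (rk src.1, src.2 + sh src.1) n hs id s
      have h3 := hmem' (rk src.1, src.2 + sh src.1) n (n * (ℓ + 1) + ℓ) hs P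
      simp only [id] at h2
      simp only [Finset.mem_symmDiff, h1, h2, h3, not_false_eq_true, and_true, false_and,
        or_false]
    simp only [e1, e2, e3]
    have hlen : (queryBlocks (fun p => e (kr, 0, p)) (fun p => e (ka, 0, p))
        (fun p => e (rk src.1, src.2 + sh src.1, p)) ℓ a n S).length = n * (ℓ + 1) :=
      length_flatMap_range _ _ _ fun j _ => by simp [length_readBits]
    have hsucc : queryBlocks (fun p => e (kr, 0, p)) (fun p => e (ka, 0, p))
        (fun p => e (rk src.1, src.2 + sh src.1, p)) ℓ a (n + 1) S =
        queryBlocks (fun p => e (kr, 0, p)) (fun p => e (ka, 0, p))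
          (fun p => e (rk src.1, src.2 + sh src.1, p)) ℓ a n S ++
        (readBits (fun t => e (kr, 0, (a + n) * ℓ + t)) ℓ S ++
          [xor (decide (e (rk src.1, src.2 + sh src.1, n) ∈ S))
            (decide (e (ka, 0, a + n) ∈ S))]) := by
      simp [queryBlocks, List.range_succ]
    rw [hsucc, ones_append hinj, ones_append (fun p p' h => by
      have := hinj h; omega), hlen, length_readBits, ones_singleton]
    simp only [symmDiff_assoc]
    congr 3
    by_cases h1 : e (ka, 0, a + n) ∈ S <;>
      by_cases h2 : e (rk src.1, src.2 + sh src.1, n) ∈ S <;>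
        simp [h1, h2, symmDiff_none]

/-! ### Executions with a fixed tape of random strings -/

/-- Run a circuit, where the `k`-th operation uses the random string `R k len` if it is a query of
length `len`. -/
noncomputable def execTape (e : Wire κ → α) (F : List Bool → List Bool → List Bool)
    (R : ℕ → ℕ → List Bool) : ℕ → Circuit κ → State α → State α
  | _, [], ψ => ψ
  | k, .gate g :: C, ψ => execTape e F R (k + 1) C ((g.map e).apply ψ)
  | k, .query len src tgt :: C, ψ => execTape e F R (k + 1) C
      (Finsupp.mapDomain (queryMap e len src tgt fun m => F m (R k len)) ψ)

theorem execTape_congr (e : Wire κ → α) (F : List Bool → List Bool → List Bool)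
    {R R' : ℕ → ℕ → List Bool} {k n V : ℕ}
    (h : ∀ k' ≥ k, k' < n → ∀ len ≤ V, R k' len = R' k' len)
    {C : Circuit κ} (hn : k + C.length ≤ n) (hC : ∀ o ∈ C, o.Bounded V) (ψ : State α) :
    execTape e F R k C ψ = execTape e F R' k C ψ := by
  induction C generalizing k ψ with
  | nil => rfl
  | cons o C ih =>
    have hC' : ∀ o ∈ C, o.Bounded V := fun o ho => hC o (List.mem_cons_of_mem _ ho)
    simp only [List.length_cons] at hn
    have h' : ∀ k' ≥ k + 1, k' < n → ∀ len ≤ V, R k' len = R' k' len := fun k' hk' =>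
      h k' (by omega)
    rcases o with g | ⟨len, src, tgt⟩
    · exact ih h' (by omega) hC' _
    · have hb := hC _ (List.mem_cons_self ..)
      simp only [Op.Bounded] at hb
      simp only [execTape, h k le_rfl (by omega) len hb.1]
      exact ih h' (by omega) hC' _

theorem support_execTape {P : α → Prop} {e : Wire κ → α} {F : List Bool → List Bool → List Bool}
    {R : ℕ → ℕ → List Bool} {k : ℕ} {C : Circuit κ}
    (hg : ∀ g, Op.gate g ∈ C → P (e g.target))
    (hq : ∀ len src tgt, Op.query len src tgt ∈ C → ∀ k m, m.length = len → ∀ q ∈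
      ones (regAt e tgt) (F m (R k len)), P q) {ψ : State α} {T : Finset α}
    (hT : T ∈ (execTape e F R k C ψ).support) :
    ∃ S ∈ ψ.support, ∀ q, ¬ P q → (q ∈ T ↔ q ∈ S) := by
  induction C generalizing k ψ with
  | nil => exact ⟨T, hT, fun _ _ => Iff.rfl⟩
  | cons o C ih =>
    have ih' := fun {k ψ} => ih (k := k) (ψ := ψ) (fun g h => hg g (List.mem_cons_of_mem _ h))
      (fun len src tgt h => hq len src tgt (List.mem_cons_of_mem _ h))
    rcases o with g | ⟨len, src, tgt⟩
    · obtain ⟨S', hS', h1⟩ := ih' hT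
      obtain ⟨S, hS, h2⟩ := Gate.support_apply _ _ hS'
      refine ⟨S, hS, fun q hq' => (h1 q hq').trans (h2 q fun h => hq' ?_)⟩
      rw [h, Gate.target_map]
      exact hg g (List.mem_cons_self ..)
    · obtain ⟨S', hS', h1⟩ := ih' hT
      obtain ⟨S, hS, rfl⟩ := Finset.mem_image.1 (Finsupp.mapDomain_support hS')
      refine ⟨S, hS, fun q hq' => (h1 q hq').trans ?_⟩
      unfold queryMap
      split_ifs
      · rfl
      · have : q ∉ ones (regAt e tgt) (F (readBits (regAt e src) len S) (R k len)) := fun h =>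
          hq' (hq len src tgt (List.mem_cons_self ..) k _ (length_readBits _ _ _) q h)
        simp [xorBits, Finset.mem_symmDiff, this]

/-- The simulation of a circuit by means of a bank of samples. -/
theorem exec_sim {φ : α → β} (hφ : Function.Injective φ) {eu : Wire κ → α} {ef : Wire κ' → β}
    (hef : Function.Injective ef) {rk : κ → κ'} {sh : κ → ℕ} {kr ka : κ'}
    (hcomm : ∀ w, ef (shiftWire rk sh w) = φ (eu w)) (heu : Function.Injective eu)
    (hkr : ∀ p w, ef (kr, 0, p) ≠ φ w) (hka : ∀ p w, ef (ka, 0, p) ≠ φ w)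
    {anc bt : Finset β} (hanc : ∀ w, φ w ∉ anc) {ℓ V : ℕ} {f : List Bool → Bool}
    (hR : ∀ p < V * V * ℓ, (ef (kr, 0, p) ∈ anc ↔ ef (kr, 0, p) ∈ bt))
    (hA : ∀ a < V * V, (ef (ka, 0, a) ∈ anc ↔
      f (readBits (fun t => ef (kr, 0, a * ℓ + t)) ℓ bt) = true))
    {C : Circuit κ} {k : ℕ} (hk : k + C.length ≤ V) (hC : ∀ o ∈ C, o.Bounded V) (ψ : State α) :
    exec ef (Circuit.subst (simOp rk sh kr ka ℓ V) k C) (emb φ anc ψ) =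
      emb φ anc (execTape eu (encBits (bitEnc f) ℓ)
        (fun k len => readBits (fun t => ef (kr, 0, k * V * ℓ + t)) (len * ℓ) bt) k C ψ) := by
  induction C generalizing k ψ with
  | nil => rfl
  | cons o C ih =>
    have hC' : ∀ o ∈ C, o.Bounded V := fun o ho => hC o (List.mem_cons_of_mem _ ho)
    have hk' : k + 1 + C.length ≤ V := by simp only [List.length_cons] at hk; omega
    have hkV : k + 1 ≤ V := by omega
    rw [Circuit.subst, exec_append]
    rcases o with g | ⟨len, src, tgt⟩
    · simp only [simOp, exec, execTape]
      rw [← ih hk' hC', ← emb_gate hφ fun q _ => hanc q, Gate.map_map, Gate.map_map,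
        show ef ∘ shiftWire rk sh = φ ∘ eu from funext hcomm]
    · simp only [execTape]
      rw [← ih hk' hC']
      congr 1
      have hb := hC _ (List.mem_cons_self ..)
      simp only [Op.Bounded] at hb
      simp only [simOp]
      -- An illegal call has no effect in the game, and the simulation writes no gates for it.
      by_cases hst : src = tgt
      · have hid : ∀ F : List Bool → List Bool, queryMap eu len src tgt F = id := fun F =>
          funext fun S => by simp [queryMap, hst]
        rw [if_pos hst, hid, Finsupp.mapDomain_id]
        rfl
      · rw [if_neg hst]
        have htgt : ∀ t, ef (rk tgt.1, tgt.2 + sh tgt.1, t) = φ (regAt eu tgt t) := fun t =>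
          hcomm (tgt.1, tgt.2, t)
        have hsrc : ∀ t, ef (rk src.1, src.2 + sh src.1, t) = φ (regAt eu src t) := fun t =>
          hcomm (src.1, src.2, t)
        rw [exec_simQuery ef hef]
        · refine emb_mapDomain fun S _ => ?_
          -- The `k`-th operation uses the samples from `k * V` on. Since `k < V` and `len ≤ V`,
          -- they lie in the bank, and different operations use different samples.
          have h1 : ∀ j < len, k * V + j < V * V := fun j hj => by
            have h2 : (k + 1) * V ≤ V * V := Nat.mul_le_mul_right _ hkV
            have h3 : (k + 1) * V = k * V + V := by ring
            omega
          have hblocks : queryBlocks (fun p => ef (kr, 0, p)) (fun p => ef (ka, 0, p))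
              (fun p => ef (rk src.1, src.2 + sh src.1, p)) ℓ (k * V) len (S.image φ ∆ anc) =
              encBits (bitEnc f) ℓ (readBits (regAt eu src) len S)
                (readBits (fun t => ef (kr, 0, k * V * ℓ + t)) (len * ℓ) bt) := by
            have h2 : (readBits (regAt eu src) len S).length = len := length_readBits _ _ _
            have henc := encBits_readBits f ℓ (readBits (regAt eu src) len S)
              (fun t => ef (kr, 0, k * V * ℓ + t)) bt
            rw [h2] at henc
            rw [henc]
            unfold queryBlocks
            refine List.flatMap_congr fun j hj => ?_
            have hj' := List.mem_range.1 hj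
            have h3 : readBits (fun t => ef (kr, 0, (k * V + j) * ℓ + t)) ℓ (S.image φ ∆ anc) =
                readBits (fun t => ef (kr, 0, k * V * ℓ + (j * ℓ + t))) ℓ bt := by
              unfold readBits
              refine List.map_congr_left fun t ht => ?_
              have ht' := List.mem_range.1 ht
              beta_reduce
              rw [show k * V * ℓ + (j * ℓ + t) = (k * V + j) * ℓ + t by ring]
              refine decide_eq_decide.2 ?_
              rw [mem_emb' fun w => hkr _ w, hR]
              calc (k * V + j) * ℓ + t < (k * V + j + 1) * ℓ := by
                    rw [Nat.add_mul (k * V + j) 1]; omega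
                _ ≤ V * V * ℓ := Nat.mul_le_mul_right _ (h1 j hj')
            rw [h3]
            congr 2
            have h4 : decide (ef (ka, 0, k * V + j) ∈ S.image φ ∆ anc) =
                f (readBits (fun t => ef (kr, 0, k * V * ℓ + (j * ℓ + t))) ℓ bt) := by
              have := hA (k * V + j) (h1 j hj')
              rw [Bool.eq_iff_iff, decide_eq_true_iff, mem_emb' fun w => hka _ w, this]
              simp only [Nat.add_mul, Nat.add_assoc]
            have h5 : decide (ef (rk src.1, src.2 + sh src.1, j) ∈ S.image φ ∆ anc) =
                (readBits (regAt eu src) len S).getD j false := by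
              rw [hsrc, show decide (φ (regAt eu src j) ∈ S.image φ ∆ anc) = decide (regAt eu src j ∈ S)
                from decide_eq_decide.2 (mem_emb hφ (hanc _))]
              simp [readBits, hj', List.getD]
            rw [h4, h5]
          rw [hblocks]
          simp only [queryMap, if_neg hst, xorBits, Finset.image_symmDiff _ _ hφ, image_ones, htgt]
          exact symmDiff_right_comm _ _ _
        · intro h
          refine hkr 0 (regAt eu tgt 0) ?_
          rw [← htgt 0]
          simp only [Prod.mk.injEq] at h
          rw [← h.1, ← h.2]
        · intro h
          refine hka 0 (regAt eu tgt 0) ?_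
          rw [← htgt 0]
          simp only [Prod.mk.injEq] at h
          rw [← h.1, ← h.2]
        · intro h
          simp only [Prod.mk.injEq] at h
          have h1 := htgt 0
          rw [← h.1, ← h.2, hsrc 0] at h1
          have := heu (hφ h1)
          simp only [Prod.mk.injEq] at this
          exact hst (Prod.ext this.1 this.2.1)

theorem execWith_setAvg {γ : Type} [DecidableEq γ] (O : Oracle) (e : Wire κ → α) (C : Circuit κ)
    (X : Finset γ) (K : Finset γ → State α → ℝ) (ψ : State α) :
    execWith O e C (fun φ => setAvg X fun b => K b φ) ψ =
      setAvg X fun b => execWith O e C (K b) ψ := by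
  induction C generalizing ψ with
  | nil => rfl
  | cons o C ih =>
    rcases o with g | ⟨len, src, tgt⟩
    · exact ih _
    · simp only [execWith, ih, setAvg_avgBits]

/-- The average over the tape. -/
theorem setAvg_execTape {X : Finset β} {R : ℕ → β} {V ℓ : ℕ}
    (hR : ∀ p < V * V * ℓ, ∀ p' < V * V * ℓ, R p = R p' → p = p')
    (hX : ∀ p < V * V * ℓ, R p ∈ X)
    (e : Wire κ → α) (F : List Bool → List Bool → List Bool) {K : Finset β → State α → ℝ}
    {C : Circuit κ} {k : ℕ} (hk : k + C.length ≤ V) (hC : ∀ o ∈ C, o.Bounded V)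
    (hK : Insens (fun q => ∃ p < V * V * ℓ, q = R p) K) (ψ : State α) :
    (setAvg X fun b => K b (execTape e F
      (fun k len => readBits (fun t => R (k * V * ℓ + t)) (len * ℓ) b) k C ψ)) =
    setAvg X fun b => execWith ⟨fun L => L * ℓ, F⟩ e C (K b) ψ := by
  induction C generalizing k ψ with
  | nil => rfl
  | cons o C ih =>
    have hC' : ∀ o ∈ C, o.Bounded V := fun o ho => hC o (List.mem_cons_of_mem _ ho)
    have hk' : k + 1 + C.length ≤ V := by simp only [List.length_cons] at hk; omega
    rcases o with g | ⟨len, src, tgt⟩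
    · simp only [execTape, execWith]
      exact ih hk' hC' _
    · have hb := hC _ (List.mem_cons_self ..)
      simp only [Op.Bounded] at hb
      have hlt : ∀ t < len * ℓ, k * V * ℓ + t < (k + 1) * V * ℓ := fun t ht => by
        have h1 : len * ℓ ≤ V * ℓ := Nat.mul_le_mul_right _ hb.1
        have h2 : (k + 1) * V * ℓ = k * V * ℓ + V * ℓ := by ring
        omega
      have hle : (k + 1) * V * ℓ ≤ V * V * ℓ :=
        Nat.mul_le_mul_right _ (Nat.mul_le_mul_right _ (by omega))
      simp only [execTape, execWith]
      -- The random bits of the present call are read here and nowhere later, so they can be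
      -- replaced by fresh coins.
      rw [setAvg_resample (r := fun t => R (k * V * ℓ + t)) (G := fun b r => K b (execTape e F
          (fun k len => readBits (fun t => R (k * V * ℓ + t)) (len * ℓ) b) (k + 1) C
            (Finsupp.mapDomain (queryMap e len src tgt fun m => F m r) ψ)))]
      · rw [setAvg_avgBits, setAvg_avgBits]
        congr 1
        funext r
        exact ih hk' hC' _
      · intro i hi j hj hij
        have := hR _ ((hlt i hi).trans_le hle) _ ((hlt j hj).trans_le hle) hij
        omega
      · exact fun i hi => hX _ ((hlt i hi).trans_le hle)
      · intro b b' hbb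
        funext r
        have h1 : K b = K b' := hK b b' fun q hq => hbb q fun ⟨i, hi, hqi⟩ =>
          hq ⟨_, (hlt i hi).trans_le hle, hqi⟩
        beta_reduce
        rw [h1]
        congr 1
        -- The later operations read from position `(k + 1) * V * ℓ` on, behind the bits that have
        -- been replaced.
        refine execTape_congr e F (V := V) (k := k + 1) (n := V) ?_ hk' hC' _
        intro k' hk1 hk2 len' hlen'
        unfold readBits
        refine List.map_congr_left fun t ht => decide_eq_decide.2 (hbb _ ?_)
        rintro ⟨i, hi, h2⟩
        have ht' := List.mem_range.1 ht
        have h3 : len' * ℓ ≤ V * ℓ := Nat.mul_le_mul_right _ hlen'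
        have h4 : (k' + 1) * V * ℓ ≤ V * V * ℓ :=
          Nat.mul_le_mul_right _ (Nat.mul_le_mul_right _ (by omega))
        have h5 : (k' + 1) * V * ℓ = k' * V * ℓ + V * ℓ := by ring
        have h6 : (k + 1) * V * ℓ ≤ k' * V * ℓ :=
          Nat.mul_le_mul_right _ (Nat.mul_le_mul_right _ (by omega))
        have h7 := hlt i hi
        have := hR _ (by omega) _ (by omega) h2
        omega

end
/-! ### The memory of the reduction -/

/-- The qubit that holds, in the reduction, a given qubit of the simulated game. -/
def moveLoc (s : ℕ) : Loc → Loc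
  | .gen w => .gen w
  | .prot i w => .prot (i + s) w
  | .party i w => .party (i + s) (shiftWire partyKind (fun _ => 0) w)
  | .pirate (.copy, w) => .pirate (.copy, w)
  | .pirate (.state c, w) => .pirate (.state c, w)
  | .pirate w => pirateLoc (shiftWire pirateKind (pirateShift s) w)

theorem moveLoc_pirateLoc (s : ℕ) (w : Wire PirateReg) :
    pirateLoc (shiftWire pirateKind (pirateShift s) w) = moveLoc s (pirateLoc w) := by
  rcases w with ⟨_ | c | _ | (_ | _) | c, i, j⟩ <;> rfl

theorem partyKind_injective : Function.Injective partyKind := by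
  rintro (c | _ | _ | _ | c) (c' | _ | _ | _ | c') h <;> simp_all [partyKind]

/-- Registers `copy` and `state` of the pirate are stored with the copies and with the parties, so
that the locations `pirate (.copy, _)` and `pirate (.state _, _)` are never used; they are mapped to
themselves only in order that the map be injective. -/
theorem moveLoc_injective (s : ℕ) : Function.Injective (moveLoc s) := by
  rintro (w | ⟨i, w⟩ | ⟨(_ | c | _ | (_ | _) | c), i, j⟩ | ⟨i, k, x, j⟩)
    (w' | ⟨i', w'⟩ | ⟨(_ | c' | _ | (_ | _) | c'), i', j'⟩ | ⟨i', k', x', j'⟩) h <;>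
  simp only [moveLoc, pirateLoc, shiftWire, pirateKind, pirateShift, Loc.gen.injEq,
    Loc.prot.injEq, Loc.pirate.injEq, Loc.party.injEq, Prod.mk.injEq, reduceCtorEq,
    PirateReg.work.injEq, PirateReg.state.injEq, false_and, and_false, true_and, and_true,
    Nat.add_right_cancel_iff, Nat.add_zero] at h ⊢ <;>
  first
  | exact h
  | (simp at h; done)
  | exact ⟨by omega, h.2⟩
  | exact ⟨h.1, partyKind_injective h.2.1, h.2.2⟩
  | (exfalso; obtain ⟨h1, h2, h3⟩ := h; revert h2; cases k <;> simp [partyKind])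
  | (exfalso; obtain ⟨h1, h2, h3⟩ := h; revert h2; cases k' <;> simp [partyKind])

theorem pirateLoc_injective : Function.Injective pirateLoc := by
  rintro ⟨(_ | c | _ | (_ | _) | c), i, j⟩ ⟨(_ | c' | _ | (_ | _) | c'), i', j'⟩ h <;>
    simp_all [pirateLoc]

theorem party_injective (i : ℕ) : Function.Injective (Loc.party i) := fun w w' h => by
  simpa using h

/-- The renaming leaves room for the reduction: of the registers of a party, `state 0` to `state 3`
hold the two banks and `work 0` to `work 5` are scratch space. The plaintexts come next, in `state
4` to `state 6`. -/
theorem party_ne_moveLoc {s i : ℕ} {w : Wire PartyReg}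
    (hw : match w.1 with | .state c => c < 4 | .work c => c < 6 | _ => False) (q : Loc) :
    Loc.party i w ≠ moveLoc s q := by
  intro h
  rcases w with ⟨k, x, j⟩
  rcases q with w' | ⟨i', w'⟩ | ⟨(_ | c' | _ | (_ | _) | c'), i', j'⟩ | ⟨i', k', x', j'⟩ <;>
  simp only [moveLoc, pirateLoc, shiftWire, pirateKind, pirateShift, Loc.party.injEq,
    reduceCtorEq, Prod.mk.injEq] at h
  · obtain ⟨-, rfl, -⟩ := h; simp at hw
  · obtain ⟨-, rfl, -⟩ := h; simp at hw
  · obtain ⟨-, rfl, -⟩ := h; simp at hw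
  · obtain ⟨-, rfl, -⟩ := h
    cases k' <;> simp [partyKind] at hw <;> omega

/-- The work registers of the simulated pirate are the odd ones from 5 on, those of the evaluation
procedure the even ones from 4 on. Registers 0 and 1 hold the bank of the pirate, registers 2 and 3
input and output of the evaluation. -/
theorem pirate_ne_moveLoc {s c : ℕ} (hc : c < 5) (w : ℕ × ℕ) (q : Loc) :
    Loc.pirate (.work c, w) ≠ moveLoc s q := by
  intro h
  rcases q with w' | ⟨i', w'⟩ | ⟨(_ | c' | _ | (_ | _) | c'), i', j'⟩ | ⟨i', k', x', j'⟩ <;>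
  simp only [moveLoc, pirateLoc, shiftWire, pirateKind, pirateShift, Loc.pirate.injEq,
    reduceCtorEq, Prod.mk.injEq, PirateReg.work.injEq, false_and] at h
  omega

/-! ### Classical circuits on basis states -/

section
variable {α : Type} [DecidableEq α]

/-- Membership as a bit. -/
def mb (q : α) (S : Finset α) : Bool := decide (q ∈ S)

/-- A set with at most one element. -/
def tog (b : Bool) (q : α) : Finset α := if b then {q} else ∅

theorem mb_eq_true {q : α} {S : Finset α} : mb q S = true ↔ q ∈ S := by simp [mb]

theorem mb_symmDiff (q : α) (S T : Finset α) : mb q (S ∆ T) = xor (mb q S) (mb q T) := by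
  by_cases h1 : q ∈ S <;> by_cases h2 : q ∈ T <;> simp [mb, Finset.mem_symmDiff, h1, h2]

theorem mb_tog (q t : α) (b : Bool) : mb q (tog b t) = (b && decide (q = t)) := by
  cases b <;> simp [mb, tog]

theorem tog_tog (b b' : Bool) (q : α) : tog b q ∆ tog b' q = tog (xor b b') q := by
  cases b <;> cases b' <;> simp [tog, symmDiff_none, symmDiff_comm (∅ : Finset α)]

theorem mb_ones_range {r : ℕ → α} (hr : Function.Injective r) (F : ℕ → Bool) (n j : ℕ) :
    mb (r j) (ones r ((List.range n).map F)) = (decide (j < n) && F j) := by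
  rw [Bool.eq_iff_iff, mb_eq_true, mem_ones hr]
  by_cases h : j < n <;> simp [h, List.getD]

theorem mb_ones {r : ℕ → α} (hr : Function.Injective r) (s : List Bool) (j : ℕ) :
    mb (r j) (ones r s) = s.getD j false := by
  rw [Bool.eq_iff_iff, mb_eq_true, mem_ones hr]

theorem mb_ones_of_ne {r : ℕ → α} {q : α} (h : ∀ j, q ≠ r j) (s : List Bool) :
    mb q (ones r s) = false := by
  rw [mb, decide_eq_false_iff_not]
  exact fun hq => (ones_subset _ _ hq).elim fun j hj => h j hj

theorem ones_range_succ {r : ℕ → α} (hr : Function.Injective r) (F : ℕ → Bool) (n : ℕ) :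
    ones r ((List.range (n + 1)).map F) = ones r ((List.range n).map F) ∆ tog (F n) (r n) := by
  rw [List.range_succ, List.map_append, ones_append hr]
  simp [ones_singleton, tog]

theorem ones_map_false (r : ℕ → α) (L : List ℕ) : ones r (L.map fun _ => false) = ∅ := by
  unfold ones
  rw [Finset.image_eq_empty, Finset.filter_eq_empty_iff]
  intro j _
  by_cases h : j < L.length <;> simp [List.getD, h]

theorem CX_ket {c t : α} (h : c ≠ t) (S : Finset α) :
    (Gate.CX c t).apply (ket S) = ket (S ∆ tog (mb c S) t) := by
  by_cases hc : c ∈ S <;> simp [Gate.apply_ket, Gate.onKet, tog, mb, h, hc, symmDiff_none]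

theorem CCX_ket {c d t : α} (h : c ≠ t) (h' : d ≠ t) (S : Finset α) :
    (Gate.CCX c d t).apply (ket S) = ket (S ∆ tog (mb c S && mb d S) t) := by
  by_cases hc : c ∈ S <;> by_cases hd : d ∈ S <;>
    simp [Gate.apply_ket, Gate.onKet, tog, mb, h, h', hc, hd, symmDiff_none]

theorem X_ket (t : α) (S : Finset α) : (Gate.X t).apply (ket S) = ket (S ∆ tog true t) := by
  simp [Gate.apply_ket, Gate.onKet, tog]

theorem exec_eq_flip {κ : Type} {e : Wire κ → α} {C : Circuit κ} {X : Finset α} {ψ : State α}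
    (h : ∀ S ∈ ψ.support, exec e C (ket S) = ket (S ∆ X)) : exec e C ψ = flip X ψ := by
  have h1 : ψ = ψ.sum fun S a => a • ket S := by
    conv_lhs => rw [← Finsupp.sum_single ψ]
    simp [ket]
  conv_lhs => rw [h1, ← execL_apply, map_finsuppSum]
  rw [flip, Finsupp.mapDomain]
  refine Finset.sum_congr rfl fun S hS => ?_
  beta_reduce
  rw [map_smul, execL_apply, h S hS]
  simp [ket]

end

/-! ### Preparation of a challenge -/

section
variable (p ℓ m L : ℕ) (m₀ m₁ : ℕ → Bool)

/-- The message has a `j`-th bit. -/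
def hasBit (L j : ℕ) : Bool := decide (j < L)

/-- The messages differ in the `j`-th bit. -/
def differ (L : ℕ) (m₀ m₁ : ℕ → Bool) (j : ℕ) : Bool := hasBit L j && xor (m₀ j) (m₁ j)

/-- The messages have the same `j`-th bit. -/
def agree (L : ℕ) (m₀ m₁ : ℕ → Bool) (j : ℕ) : Bool := xor (hasBit L j) (differ L m₀ m₁ j)

/-- The flags of the first `n` blocks. -/
def flagSet (n : ℕ) : Finset Loc :=
  ones (fun j => Loc.party p (.work 2, 0, j)) ((List.range (n + 1)).map fun j => decide (j ≤ L)) ∆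
    (ones (fun j => Loc.party p (.work 4, 0, j)) ((List.range n).map (differ L m₀ m₁)) ∆
      ones (fun j => Loc.party p (.work 5, 0, j)) ((List.range n).map (agree L m₀ m₁)))

theorem workReg_injective (k : PartyReg) (x : ℕ) :
    Function.Injective fun j => Loc.party p (k, x, j) := fun i j h => by simpa using h

theorem mb_flagSet_two (n j : ℕ) : mb (Loc.party p (.work 2, 0, j)) (flagSet p L m₀ m₁ n) =
    (decide (j < n + 1) && decide (j ≤ L)) := by
  rw [flagSet, mb_symmDiff, mb_symmDiff, mb_ones_range (workReg_injective p (.work 2) 0),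
    mb_ones_of_ne (by simp), mb_ones_of_ne (by simp)]
  simp

theorem mb_flagSet_four (n j : ℕ) : mb (Loc.party p (.work 4, 0, j)) (flagSet p L m₀ m₁ n) =
    (decide (j < n) && differ L m₀ m₁ j) := by
  rw [flagSet, mb_symmDiff, mb_symmDiff, mb_ones_range (workReg_injective p (.work 4) 0),
    mb_ones_of_ne (by simp), mb_ones_of_ne (by simp)]
  simp

theorem mb_flagSet_five (n j : ℕ) : mb (Loc.party p (.work 5, 0, j)) (flagSet p L m₀ m₁ n) =
    (decide (j < n) && agree L m₀ m₁ j) := by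
  rw [flagSet, mb_symmDiff, mb_symmDiff, mb_ones_range (workReg_injective p (.work 5) 0),
    mb_ones_of_ne (by simp), mb_ones_of_ne (by simp)]
  simp

theorem mb_flagSet_of_ne (n : ℕ) {q : Loc} (h : ∀ c j, q ≠ Loc.party p (.work c, 0, j)) :
    mb q (flagSet p L m₀ m₁ n) = false := by
  rw [flagSet, mb_symmDiff, mb_symmDiff, mb_ones_of_ne (h 2), mb_ones_of_ne (h 4),
    mb_ones_of_ne (h 5)]
  simp

variable {p ℓ m L m₀ m₁}

/-- The register `work 2` is a chain: its first qubit is set unconditionally, and each further one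
is the conjunction of its predecessor with the next qubit of the unary length. So `j + 1` is marked
exactly when there is a `j`-th bit. The qubits of the two plaintexts, cut off by this mark, are
added in `work 4`, and the complement of the result among the marked positions is put into `work 5`.
-/
theorem exec_flags {T : Finset Loc}
    (h4 : ∀ j ≤ L, mb (Loc.party p (.state 4, 0, j)) T = decide (j < L))
    (h5 : ∀ j < L, mb (Loc.party p (.state 5, 0, j)) T = m₀ j)
    (h6 : ∀ j < L, mb (Loc.party p (.state 6, 0, j)) T = m₁ j)
    (hw2 : ∀ j, mb (Loc.party p (.work 2, 0, j)) T = false)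
    (hw4 : ∀ j, mb (Loc.party p (.work 4, 0, j)) T = false) (n : ℕ) :
    exec (Loc.party p) ([.gate (.X (.work 2, 0, 0))] ++ (List.range n).flatMap blockFlags) (ket T) =
      ket (T ∆ flagSet p L m₀ m₁ n) := by
  rw [exec_append]
  simp only [exec, Gate.map, X_ket]
  induction n with
  | zero => simp [exec, flagSet, ones_nil, ones_singleton, tog, symmDiff_none]
  | succ n ih =>
    rw [List.range_succ, List.flatMap_append, exec_append, ih]
    simp only [List.flatMap_cons, List.flatMap_nil, List.append_nil, blockFlags, List.cons_append,
      List.nil_append, exec, Gate.map]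
    rw [CCX_ket (by simp) (by simp), CCX_ket (by simp) (by simp), CCX_ket (by simp) (by simp),
      CX_ket (by simp), CX_ket (by simp)]
    have s4 : mb (Loc.party p (.state 4, 0, n)) (flagSet p L m₀ m₁ n) = false :=
      mb_flagSet_of_ne _ _ _ _ _ (by simp)
    have s5 : mb (Loc.party p (.state 5, 0, n)) (flagSet p L m₀ m₁ n) = false :=
      mb_flagSet_of_ne _ _ _ _ _ (by simp)
    have s6 : mb (Loc.party p (.state 6, 0, n)) (flagSet p L m₀ m₁ n) = false :=
      mb_flagSet_of_ne _ _ _ _ _ (by simp)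
    -- Behind the first zero the contents of the length register are arbitrary. They have no
    -- influence, as the chain is already broken there.
    have e1 : (decide (n ≤ L) && mb (Loc.party p (.state 4, 0, n)) T) = hasBit L n := by
      by_cases h : n ≤ L
      · simp [h, h4 n h, hasBit]
      · have : ¬ n < L := by omega
        simp [h, this, hasBit]
    have e2 : (hasBit L n && mb (Loc.party p (.state 5, 0, n)) T) = (hasBit L n && m₀ n) := by
      by_cases h : n < L
      · rw [h5 n h]
      · simp [hasBit, h]
    have e3 : (hasBit L n && mb (Loc.party p (.state 6, 0, n)) T) = (hasBit L n && m₁ n) := by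
      by_cases h : n < L
      · rw [h6 n h]
      · simp [hasBit, h]
    simp only [mb_symmDiff, mb_tog, hw2, hw4, mb_flagSet_two, mb_flagSet_four, s4, s5, s6,
      Loc.party.injEq, Prod.mk.injEq, PartyReg.work.injEq, reduceCtorEq, false_and, and_false,
      decide_false, Bool.and_false, Bool.xor_false, Bool.false_xor, true_and, decide_true,
      Bool.and_true, lt_irrefl, Bool.false_and, Nat.lt_succ_self, Bool.true_and, e1, e2, e3,
      Nat.reduceEqDiff, Nat.succ_ne_self]
    rw [flagSet, flagSet, ones_range_succ (workReg_injective p (.work 2) 0) _ (n + 1),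
      ones_range_succ (workReg_injective p (.work 4) 0),
      ones_range_succ (workReg_injective p (.work 5) 0)]
    have f2 : (decide (n + 1 ≤ L)) = hasBit L n := by simp [hasBit]
    have f4 : differ L m₀ m₁ n = xor (hasBit L n && m₀ n) (hasBit L n && m₁ n) := by
      unfold differ; cases hasBit L n <;> simp
    have f5 : agree L m₀ m₁ n = xor (hasBit L n) (xor (hasBit L n && m₀ n) (hasBit L n && m₁ n)) := by
      rw [← f4]; rfl
    rw [f2, f4, f5, ← tog_tog (hasBit L n), ← tog_tog (hasBit L n && m₀ n) _
      (Loc.party p (.work 4, 0, n))]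
    congr 1
    simp only [symmDiff_assoc]
    congr 1
    ac_rfl

/-- The data written for the `j`-th block. -/
def blockBits (L : ℕ) (m₀ m₁ : ℕ → Bool) (fr : ℕ → List Bool) (fa : ℕ → Bool)
    (br : ℕ → List Bool) (ba : ℕ → Bool) (j : ℕ) : List Bool :=
  if differ L m₀ m₁ j then fr j ++ [xor (fa j) (m₀ j)] else br j ++ [xor (ba j) (m₀ j)]

/-- The flags choose between the answer of the oracle and the sample of the bank, and in both cases
the bit of the first plaintext is added. The number of blocks written is governed by the flags and
not by the circuit, whose size must not depend on the plaintexts. -/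
theorem exec_data {T : Finset Loc} {fr br : ℕ → List Bool} {fa ba : ℕ → Bool}
    (hfr : ∀ j, (fr j).length = ℓ) (hbr : ∀ j, (br j).length = ℓ)
    (h5 : ∀ j < L, mb (Loc.party p (.state 5, 0, j)) T = m₀ j)
    (hw2 : ∀ j < m, mb (Loc.party p (.work 2, 0, j + 1)) T = hasBit L j)
    (hw4 : ∀ j < m, mb (Loc.party p (.work 4, 0, j)) T = differ L m₀ m₁ j)
    (hw5 : ∀ j < m, mb (Loc.party p (.work 5, 0, j)) T = agree L m₀ m₁ j)
    (hw1 : ∀ j < m, ∀ t < ℓ + 1,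
      mb (Loc.party p (.work 1, j, t)) T = (fr j ++ [fa j]).getD t false)
    (hs2 : ∀ j < m, ∀ t < ℓ, mb (Loc.party p (.state 2, 0, j * ℓ + t)) T = (br j).getD t false)
    (hs3 : ∀ j < m, mb (Loc.party p (.state 3, 0, j)) T = ba j) {n : ℕ} (hn : n ≤ m) :
    exec (Loc.party p) ((List.range n).flatMap (blockData ℓ)) (ket T) =
      ket (T ∆ (ones (fun j => Loc.party p (.chalLen, 0, j))
          (List.replicate (min n L * (ℓ + 1)) true) ∆
        ones (fun j => Loc.party p (.chalData, 0, j))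
          ((List.range (min n L)).flatMap (blockBits L m₀ m₁ fr fa br ba)))) := by
  have il := workReg_injective p .chalLen 0
  have id' := workReg_injective p .chalData 0
  have hblk : ∀ j, (blockBits L m₀ m₁ fr fa br ba j).length = ℓ + 1 := by
    intro j; unfold blockBits; split_ifs <;> simp [hfr, hbr]
  induction n with
  | zero => simp [exec, ones_nil, symmDiff_none]
  | succ n ih =>
    rw [List.range_succ, List.flatMap_append, exec_append, ih (by omega)]
    set U := T ∆ (ones (fun j => Loc.party p (.chalLen, 0, j))
          (List.replicate (min n L * (ℓ + 1)) true) ∆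
        ones (fun j => Loc.party p (.chalData, 0, j))
          ((List.range (min n L)).flatMap (blockBits L m₀ m₁ fr fa br ba))) with hU
    have hnm : n < m := by omega
    have hout : ∀ (k : PartyReg), k ≠ .chalLen → k ≠ .chalData → ∀ x j,
        mb (Loc.party p (k, x, j)) U = mb (Loc.party p (k, x, j)) T := by
      intro k h1 h2 x j
      rw [hU, mb_symmDiff, mb_symmDiff, mb_ones_of_ne (by simp [h1]), mb_ones_of_ne (by simp [h2])]
      simp
    set il' := fun t => Loc.party p (.chalLen, 0, n * (ℓ + 1) + t) with hil'
    set id'' := fun t => Loc.party p (.chalData, 0, n * (ℓ + 1) + t) with hid''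
    have iil : Function.Injective il' := fun i j h => by
      have := il h; omega
    have iid : Function.Injective id'' := fun i j h => by
      have := id' h; omega
    have hne : ∀ (k : PartyReg), k ≠ .chalLen → k ≠ .chalData → ∀ x j S s s' s'' b b',
        mb (Loc.party p (k, x, j)) (S ∆ ones il' s) = mb (Loc.party p (k, x, j)) S ∧
        mb (Loc.party p (k, x, j)) (S ∆ ones id'' s') = mb (Loc.party p (k, x, j)) S ∧
        mb (Loc.party p (k, x, j)) (S ∆ tog b (id'' s'')) = mb (Loc.party p (k, x, j)) S ∧
        mb (Loc.party p (k, x, j)) (S ∆ tog b' (il' s'')) = mb (Loc.party p (k, x, j)) S := by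
      intro k h1 h2 x j S s s' s'' b b'
      refine ⟨?_, ?_, ?_, ?_⟩
      · rw [mb_symmDiff, mb_ones_of_ne (by simp [hil', h1])]; simp
      · rw [mb_symmDiff, mb_ones_of_ne (by simp [hid'', h2])]; simp
      · rw [mb_symmDiff, mb_tog]; simp [hid'', h2]
      · rw [mb_symmDiff, mb_tog]; simp [hil', h1]
    have hne1 := fun k h1 h2 x j S s => (hne k h1 h2 x j S s [] 0 true true).1
    have hne2 := fun k h1 h2 x j S s => (hne k h1 h2 x j S [] s 0 true true).2.1
    have hne3 := fun k h1 h2 x j S t b => (hne k h1 h2 x j S [] [] t b true).2.2.1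
    simp only [List.flatMap_cons, List.flatMap_nil, List.append_nil, blockData, exec_append]
    have c1 : ∀ S : Finset Loc, exec (Loc.party p) ((List.range (ℓ + 1)).flatMap fun t =>
        [.gate (.CX (.work 2, 0, n + 1) (.chalLen, 0, n * (ℓ + 1) + t))]) (ket S) =
        ket (S ∆ ones il' ((List.range (ℓ + 1)).map fun _ =>
          mb (Loc.party p (.work 2, 0, n + 1)) S)) := by
      intro S
      rw [exec_copies (Loc.party p) _ (fun t S => mb (Loc.party p (.work 2, 0, n + 1)) S) iil]
      · simp [ket]
      · intro t S
        rw [Gate.map, ← Gate.apply_ket, CX_ket (by simp)]; rfl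
      · intro t S s
        exact hne1 _ (by simp) (by simp) _ _ _ _
    have c2 : ∀ S : Finset Loc, exec (Loc.party p) ((List.range (ℓ + 1)).flatMap fun t =>
        [.gate (.CCX (.work 4, 0, n) (.work 1, n, t) (.chalData, 0, n * (ℓ + 1) + t))]) (ket S) =
        ket (S ∆ ones id'' ((List.range (ℓ + 1)).map fun t =>
          (mb (Loc.party p (.work 4, 0, n)) S && mb (Loc.party p (.work 1, n, t)) S))) := by
      intro S
      rw [exec_copies (Loc.party p) _ (fun t S => mb (Loc.party p (.work 4, 0, n)) S &&
        mb (Loc.party p (.work 1, n, t)) S) iid]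
      · simp [ket]
      · intro t S
        rw [Gate.map, ← Gate.apply_ket, CCX_ket (by simp) (by simp)]; rfl
      · intro t S s
        simp only [hne2 (.work 4) (by simp) (by simp), hne2 (.work 1) (by simp) (by simp)]
    have c3 : ∀ S : Finset Loc, exec (Loc.party p) ((List.range ℓ).flatMap fun t =>
        [.gate (.CCX (.work 5, 0, n) (.state 2, 0, n * ℓ + t)
          (.chalData, 0, n * (ℓ + 1) + t))]) (ket S) =
        ket (S ∆ ones id'' ((List.range ℓ).map fun t =>
          (mb (Loc.party p (.work 5, 0, n)) S && mb (Loc.party p (.state 2, 0, n * ℓ + t)) S))) := by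
      intro S
      rw [exec_copies (Loc.party p) _ (fun t S => mb (Loc.party p (.work 5, 0, n)) S &&
        mb (Loc.party p (.state 2, 0, n * ℓ + t)) S) iid]
      · simp [ket]
      · intro t S
        rw [Gate.map, ← Gate.apply_ket, CCX_ket (by simp) (by simp)]; rfl
      · intro t S s
        simp only [hne2 (.work 5) (by simp) (by simp), hne2 (.state 2) (by simp) (by simp)]
    rw [c1, c2, c3]
    simp only [exec, Gate.map]
    rw [CCX_ket (by simp) (by simp), CCX_ket (by simp) (by simp)]
    have hid0 : Loc.party p (.chalData, 0, n * (ℓ + 1) + ℓ) = id'' ℓ := rfl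
    rw [hid0]
    have ne1 : ∀ c : ℕ, PartyReg.work c ≠ .chalLen := by simp
    have ne2 : ∀ c : ℕ, PartyReg.work c ≠ .chalData := by simp
    have ne3 : ∀ c : ℕ, PartyReg.state c ≠ .chalLen := by simp
    have ne4 : ∀ c : ℕ, PartyReg.state c ≠ .chalData := by simp
    simp only [hne1 _ (ne1 _) (ne2 _), hne2 _ (ne1 _) (ne2 _), hne3 _ (ne1 _) (ne2 _),
      hne1 _ (ne3 _) (ne4 _), hne2 _ (ne3 _) (ne4 _), hne3 _ (ne3 _) (ne4 _),
      hout _ (ne1 _) (ne2 _), hout _ (ne3 _) (ne4 _), hw2 n hnm, hw4 n hnm, hw5 n hnm, hs3 n hnm]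
    have hm1 : ((List.range (ℓ + 1)).map fun t =>
        (differ L m₀ m₁ n && mb (Loc.party p (.work 1, n, t)) T)) =
        (List.range (ℓ + 1)).map fun t => (differ L m₀ m₁ n && (fr n ++ [fa n]).getD t false) :=
      List.map_congr_left fun t ht => by rw [hw1 n hnm t (List.mem_range.1 ht)]
    have hm2 : ((List.range ℓ).map fun t =>
        (agree L m₀ m₁ n && mb (Loc.party p (.state 2, 0, n * ℓ + t)) T)) =
        (List.range ℓ).map fun t => (agree L m₀ m₁ n && (br n).getD t false) :=
      List.map_congr_left fun t ht => by rw [hs2 n hnm t (List.mem_range.1 ht)]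
    have hlist : ∀ (s : List Bool), ((List.range s.length).map fun t => s.getD t false) = s := by
      intro s
      refine List.ext_getElem (by simp) fun i h1 h2 => ?_
      simp [List.getD, List.getElem?_eq_getElem h2]
    rw [hm1, hm2]
    by_cases hL : n < L
    · have hmin : min (n + 1) L = n + 1 := by omega
      have hmin' : min n L = n := by omega
      have hh : hasBit L n = true := by simp [hasBit, hL]
      rw [hmin'] at hU
      rw [hmin, List.range_succ (n := n), List.flatMap_append, ones_append id',
        length_flatMap_range _ n (ℓ + 1) fun j _ => hblk j, Nat.add_mul n 1, List.replicate_add,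
        ones_append il, List.length_replicate]
      simp only [List.flatMap_cons, List.flatMap_nil, List.append_nil, Nat.one_mul, h5 n hL, hh,
        Bool.true_and]
      have hrep : ((List.range (ℓ + 1)).map fun _ => true) = List.replicate (ℓ + 1) true := by
        simp
      have hX : ones id'' ((List.range (ℓ + 1)).map fun t =>
            (differ L m₀ m₁ n && (fr n ++ [fa n]).getD t false)) ∆
          (ones id'' ((List.range ℓ).map fun t => (agree L m₀ m₁ n && (br n).getD t false)) ∆
          (tog (agree L m₀ m₁ n && ba n) (id'' ℓ) ∆ tog (m₀ n) (id'' ℓ))) =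
          ones id'' (blockBits L m₀ m₁ fr fa br ba n) := by
        unfold blockBits
        cases hd : differ L m₀ m₁ n
        · have ha : agree L m₀ m₁ n = true := by simp [agree, hh, hd]
          have h1 := hlist (br n)
          rw [hbr] at h1
          simp only [ha, Bool.false_and, Bool.true_and, ones_map_false, h1, tog_tog]
          rw [if_neg (by simp), ones_append iid, hbr, ones_singleton]
          exact bot_symmDiff (ones id'' (br n) ∆ _)
        · have ha : agree L m₀ m₁ n = false := by simp [agree, hh, hd]
          have h1 := hlist (fr n ++ [fa n])
          rw [List.length_append, hfr, List.length_singleton] at h1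
          simp only [ha, Bool.false_and, Bool.true_and, ones_map_false, h1]
          rw [if_pos trivial, ones_append iid, ones_append iid, hfr, ones_singleton, ones_singleton,
            symmDiff_assoc]
          congr 1
          have e0 : ∀ Z : Finset Loc, (∅ : Finset Loc) ∆ Z = Z := bot_symmDiff
          have e1 : tog false (id'' ℓ) = ∅ := rfl
          rw [e1, e0, e0]
          exact tog_tog _ _ _
      rw [hrep, hU]
      have hX' := congrArg (fun Z => ket (T ∆ (ones (fun j => Loc.party p (.chalLen, 0, j))
          (List.replicate (n * (ℓ + 1)) true) ∆ ones (fun j => Loc.party p (.chalData, 0, j))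
          ((List.range n).flatMap (blockBits L m₀ m₁ fr fa br ba))) ∆
          (ones il' (List.replicate (ℓ + 1) true) ∆ Z))) hX
      beta_reduce at hX'
      refine Eq.trans (congrArg ket ?_) (hX'.trans (congrArg ket ?_))
      · simp only [symmDiff_assoc]
      · simp only [hil', hid'', symmDiff_assoc]
        congr 1
        ac_rfl
    -- Beyond the common length all flags vanish, and nothing is written.
    · have hmin : min (n + 1) L = min n L := by omega
      have hh : hasBit L n = false := by simp [hasBit, hL]
      have hd : differ L m₀ m₁ n = false := by simp [differ, hh]
      have ha : agree L m₀ m₁ n = false := by simp [agree, hh, hd]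
      rw [hmin]
      simp only [hh, hd, ha, Bool.false_and, ones_map_false, tog, if_neg Bool.false_ne_true,
        symmDiff_none]
      rfl

end
/-! ### The samples of a party -/

/-- The oracle of the flip detection game for the function `f` and the bit `b`. -/
def flipSamples (ℓ : ℕ) (f : List Bool → Bool) (b : Bool) : Oracle where
  coins := fun _ => ℓ
  fn := fun _ r => r ++ [xor (f r) b]

/-- The wires that receive the random strings of the first `n` samples. -/
def flipWires (p ℓ n : ℕ) : Finset Loc :=
  (Finset.range n).biUnion fun j => (Finset.range ℓ).image fun t => Loc.party p (.work 1, j, t)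

theorem mem_flipWires {p ℓ n : ℕ} {q : Loc} : q ∈ flipWires p ℓ n ↔
    ∃ j < n, ∃ t < ℓ, q = Loc.party p (.work 1, j, t) := by
  simp only [flipWires, Finset.mem_biUnion, Finset.mem_range, Finset.mem_image]
  constructor
  · rintro ⟨j, hj, t, ht, rfl⟩; exact ⟨j, hj, t, ht, rfl⟩
  · rintro ⟨j, hj, t, ht, rfl⟩; exact ⟨j, hj, t, ht, rfl⟩

/-- The random string of the `j`-th sample. -/
def flipString (p ℓ : ℕ) (γ : Finset Loc) (j : ℕ) : List Bool :=
  readBits (fun t => Loc.party p (.work 1, j, t)) ℓ γ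

/-- The contents of the registers of the first `n` samples. -/
def sampleSet (p ℓ : ℕ) (f : List Bool → Bool) (b : Bool) (γ : Finset Loc) : ℕ → Finset Loc
  | 0 => ∅
  | n + 1 => sampleSet p ℓ f b γ n ∆ ones (fun t => Loc.party p (.work 1, n, t))
      (flipString p ℓ γ n ++ [xor (f (flipString p ℓ γ n)) b])

theorem readBits_congr {α : Type} [DecidableEq α] {r r' : ℕ → α} {n : ℕ} {S T : Finset α}
    (h : ∀ j < n, (r j ∈ S ↔ r' j ∈ T)) : readBits r n S = readBits r' n T := by
  unfold readBits
  exact List.map_congr_left fun j hj => decide_eq_decide.2 (h j (List.mem_range.1 hj))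

theorem sampleSet_congr {p ℓ : ℕ} {f : List Bool → Bool} {b : Bool} {γ γ' : Finset Loc} {n : ℕ}
    (h : ∀ j < n, ∀ t < ℓ, (Loc.party p (.work 1, j, t) ∈ γ ↔ Loc.party p (.work 1, j, t) ∈ γ')) :
    sampleSet p ℓ f b γ n = sampleSet p ℓ f b γ' n := by
  induction n with
  | zero => rfl
  | succ n ih =>
    have : flipString p ℓ γ n = flipString p ℓ γ' n := readBits_congr (h n (by omega))
    rw [sampleSet, sampleSet, ih fun j hj => h j (by omega), this]

/-- The coins of the oracle are represented by the set of those wires that receive a one from the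
random strings. They can then be averaged together with the contents of the banks, which are sets of
wires as well. -/
theorem execWith_flipQueries (p ℓ n : ℕ) (f : List Bool → Bool) (b : Bool) (K : State Loc → ℝ)
    (ψ : State Loc) : execWith (flipSamples ℓ f b) (Loc.party p) (flipQueries n) K ψ =
      setAvg (flipWires p ℓ n) fun γ => K (flip (sampleSet p ℓ f b γ n) ψ) := by
  induction n generalizing K with
  | zero => simp [flipQueries, execWith, flipWires, setAvg_empty, sampleSet, flip_empty]
  | succ n ih =>
    have hinj : Function.Injective fun t => Loc.party p (.work 1, n, t) := workReg_injective _ _ _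
    have h1 : flipQueries (n + 1) = flipQueries n ++ [.query 0 (.work 0, 0) (.work 1, n)] := by
      simp [flipQueries, List.range_succ]
    have h2 : flipWires p ℓ (n + 1) = flipWires p ℓ n ∪
        (Finset.range ℓ).image fun t => Loc.party p (.work 1, n, t) := by
      rw [flipWires, Finset.range_add_one, Finset.biUnion_insert, Finset.union_comm]; rfl
    have hdisj : Disjoint (flipWires p ℓ n)
        ((Finset.range ℓ).image fun t => Loc.party p (.work 1, n, t)) := by
      rw [Finset.disjoint_left]
      intro q hq hq'
      obtain ⟨j, hj, t, ht, rfl⟩ := mem_flipWires.1 hq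
      obtain ⟨t', -, h⟩ := Finset.mem_image.1 hq'
      simp only [Loc.party.injEq, Prod.mk.injEq, true_and] at h
      omega
    rw [h1, execWith_append, ih, h2, setAvg_union hdisj]
    refine setAvg_congr fun A hA => ?_
    simp only [execWith]
    change avgBits ℓ _ = _
    rw [avgBits_eq_setAvg (r := fun t => Loc.party p (.work 1, n, t))
      fun i _ j _ h => hinj h]
    refine setAvg_congr fun D hD => ?_
    have hs : sampleSet p ℓ f b (A ∪ D) n = sampleSet p ℓ f b A n := by
      refine sampleSet_congr fun j hj t ht => ?_
      rw [Finset.mem_union, or_iff_left]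
      intro h
      obtain ⟨t', -, h'⟩ := Finset.mem_image.1 (hD h)
      simp only [Loc.party.injEq, Prod.mk.injEq, true_and] at h'
      omega
    have hf : flipString p ℓ (A ∪ D) n =
        readBits (fun t => Loc.party p (.work 1, n, t)) ℓ D := by
      refine readBits_congr fun t ht => ?_
      rw [Finset.mem_union, or_iff_right]
      intro h
      obtain ⟨j, hj, t', ht', h'⟩ := mem_flipWires.1 (hA h)
      simp only [Loc.party.injEq, Prod.mk.injEq, true_and] at h'
      omega
    rw [sampleSet, hs, hf, ← flip_flip]
    congr 1

theorem mb_sampleSet {p ℓ : ℕ} (f : List Bool → Bool) (b : Bool) (γ : Finset Loc) {n j : ℕ}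
    (hj : j < n) (t : ℕ) : mb (Loc.party p (.work 1, j, t)) (sampleSet p ℓ f b γ n) =
      (flipString p ℓ γ j ++ [xor (f (flipString p ℓ γ j)) b]).getD t false := by
  have h0 : ∀ n ≤ j, mb (Loc.party p (.work 1, j, t)) (sampleSet p ℓ f b γ n) = false := by
    intro n
    induction n with
    | zero => intro _; simp [sampleSet, mb]
    | succ n ih =>
      intro h
      rw [sampleSet, mb_symmDiff, ih (by omega), mb_ones_of_ne]
      · rfl
      · intro t' h'
        simp only [Loc.party.injEq, Prod.mk.injEq, true_and] at h'
        omega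
  induction n with
  | zero => omega
  | succ n ih =>
    rw [sampleSet, mb_symmDiff]
    by_cases h : j = n
    · subst h
      rw [h0 j le_rfl, mb_ones (r := fun t => Loc.party p (.work 1, j, t))
        (workReg_injective _ _ _)]
      simp
    · rw [ih (by omega), mb_ones_of_ne]
      · simp
      · intro t' h'
        simp only [Loc.party.injEq, Prod.mk.injEq, true_and] at h'
        omega

theorem mem_sampleSet {p ℓ : ℕ} {f : List Bool → Bool} {b : Bool} {γ : Finset Loc} {n : ℕ}
    {q : Loc} (h : q ∈ sampleSet p ℓ f b γ n) : ∃ j t, q = Loc.party p (.work 1, j, t) := by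
  induction n with
  | zero => simp [sampleSet] at h
  | succ n ih =>
    rw [sampleSet, Finset.mem_symmDiff] at h
    rcases h with h | h
    · exact ih h.1
    · obtain ⟨t, ht⟩ := ones_subset _ _ h.1
      exact ⟨n, t, ht⟩

theorem mem_flagSet {p L : ℕ} {m₀ m₁ : ℕ → Bool} {n : ℕ} {q : Loc}
    (h : q ∈ flagSet p L m₀ m₁ n) : ∃ c < 6, ∃ j, q = Loc.party p (.work c, 0, j) := by
  rw [flagSet, Finset.mem_symmDiff, Finset.mem_symmDiff] at h
  rcases h with h | ⟨h | h, -⟩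
  · obtain ⟨j, hj⟩ := ones_subset _ _ h.1
    exact ⟨2, by omega, j, hj⟩
  · obtain ⟨j, hj⟩ := ones_subset _ _ h.1
    exact ⟨4, by omega, j, hj⟩
  · obtain ⟨j, hj⟩ := ones_subset _ _ h.1
    exact ⟨5, by omega, j, hj⟩

/-! ### Reading plaintexts -/

/-- `readLen` looks at no more than `S.card` positions. That is enough: `r` is injective, so `S`
cannot contain more than `S.card` of its wires. -/
theorem readLen_spec {α : Type} [DecidableEq α] {r : ℕ → α} (hr : Function.Injective r)
    (S : Finset α) : (∀ j < readLen r S, r j ∈ S) ∧ r (readLen r S) ∉ S := by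
  have key : ∀ n, (∀ j < ((List.range n).takeWhile fun j => decide (r j ∈ S)).length, r j ∈ S) ∧
      (((List.range n).takeWhile fun j => decide (r j ∈ S)).length < n →
        r ((List.range n).takeWhile fun j => decide (r j ∈ S)).length ∉ S) ∧
      ((List.range n).takeWhile fun j => decide (r j ∈ S)).length ≤ n := by
    intro n
    induction n with
    | zero => simp
    | succ n ih =>
      obtain ⟨h1, h2, h3⟩ := ih
      rw [List.range_succ, List.takeWhile_append]
      split_ifs with h
      · rw [List.length_range] at h
        by_cases hn : r n ∈ S
        · simp only [List.length_append, List.length_range, List.takeWhile_cons, hn, decide_true,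
            if_true, List.takeWhile_nil, List.length_singleton]
          refine ⟨fun j hj => ?_, fun h => absurd h (by omega), le_rfl⟩
          by_cases hjn : j = n
          · exact hjn ▸ hn
          · exact h1 j (by omega)
        · simp only [List.length_append, List.length_range, List.takeWhile_cons, hn, decide_false,
            Bool.false_eq_true, if_false, List.length_nil, Nat.add_zero]
          exact ⟨fun j hj => h1 j (by omega), fun _ => by simpa using hn, by omega⟩
      · rw [List.length_range] at h
        exact ⟨h1, fun _ => h2 (by omega), by omega⟩
  obtain ⟨h1, h2, h3⟩ := key S.card
  refine ⟨h1, fun h => ?_⟩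
  by_cases hlt : readLen r S < S.card
  · exact h2 hlt h
  -- If the scan reached the end and the next wire were set too, then `S` would contain `S.card + 1`
  -- different wires.
  · have heq : readLen r S = S.card := le_antisymm h3 (not_lt.1 hlt)
    have : (Finset.range (S.card + 1)).image r ⊆ S := by
      intro q hq
      obtain ⟨j, hj, rfl⟩ := Finset.mem_image.1 hq
      rcases Nat.lt_succ_iff_lt_or_eq.1 (Finset.mem_range.1 hj) with h' | h'
      · exact h1 j (heq.symm ▸ h' : j < readLen r S)
      · rw [h', ← heq]; exact h
    have := Finset.card_le_card this
    rw [Finset.card_image_of_injective _ hr, Finset.card_range] at this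
    omega

theorem readLen_congr {α β : Type} [DecidableEq α] [DecidableEq β] {r : ℕ → α} {r' : ℕ → β}
    (hr : Function.Injective r) (hr' : Function.Injective r') {S : Finset α} {T : Finset β}
    (h : ∀ j, r j ∈ S ↔ r' j ∈ T) : readLen r S = readLen r' T := by
  obtain ⟨h1, h2⟩ := readLen_spec hr S
  obtain ⟨h3, h4⟩ := readLen_spec hr' T
  rcases lt_trichotomy (readLen r S) (readLen r' T) with hlt | heq | hgt
  · exact absurd ((h _).2 (h3 _ hlt)) h2
  · exact heq
  · exact absurd ((h _).1 (h1 _ hgt)) h4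

theorem regAt_injective {α κ : Type} {e : Wire κ → α} (he : Function.Injective e) (r : κ × ℕ) :
    Function.Injective (regAt e r) := fun i j h => by
  have := he h
  simpa using this

/-- The wires that hold the plaintexts. -/
def PlainWire (i : ℕ) (q : Loc) : Prop :=
  ∃ j, q = .pirate (.len, i, j) ∨ ∃ c, q = .pirate (.plain c, i, j)

theorem readPlaintexts_congr {i : ℕ} {S T : Finset Loc}
    (h : ∀ q, PlainWire i q → (q ∈ S ↔ q ∈ T)) : readPlaintexts i S = readPlaintexts i T := by
  have h1 : readLen (regAt pirateLoc (.len, i)) S = readLen (regAt pirateLoc (.len, i)) T :=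
    readLen_congr (regAt_injective pirateLoc_injective _) (regAt_injective pirateLoc_injective _)
      fun j => h _ ⟨j, Or.inl rfl⟩
  unfold readPlaintexts
  rw [h1]
  refine Prod.ext ?_ ?_
  · exact readBits_congr fun j _ => h _ ⟨j, Or.inr ⟨false, rfl⟩⟩
  · exact readBits_congr fun j _ => h _ ⟨j, Or.inr ⟨true, rfl⟩⟩

/-! ### Preparation of a challenge in the reduction -/

/-- A bank of correct samples. -/
def BankOK (ℓ M : ℕ) (f : List Bool → Bool) (β anc : Finset Loc) (R A : ℕ → Loc) : Prop :=
  (∀ x < M * ℓ, (R x ∈ anc ↔ R x ∈ β)) ∧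
    ∀ a < M, (A a ∈ anc ↔ f (readBits (fun t => R (a * ℓ + t)) ℓ β) = true)

/-- The wires with the random bits for a challenge. -/
def effWire (p ℓ : ℕ) (D : ℕ → Bool) (x : ℕ) : Loc :=
  if D (x / ℓ) then .party p (.work 1, x / ℓ, x % ℓ) else .party p (.state 2, 0, x)

/-- The wires with the random bits for a challenge with given plaintexts. -/
def chalWire (p ℓ : ℕ) (P : List Bool × List Bool) : ℕ → Loc :=
  effWire p ℓ (differ P.1.length (P.1.getD · false) (P.2.getD · false))

theorem writeStr_eq {α : Type} [DecidableEq α] (len data : ℕ → α) (s : List Bool) (S : Finset α) :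
    writeStr len data s S = S ∆ (ones len (List.replicate s.length true) ∆ ones data s) :=
  symmDiff_assoc _ _ _

theorem mapDomain_writeStr {α : Type} [DecidableEq α] (len data : ℕ → α) (s : List Bool)
    (ψ : State α) : Finsupp.mapDomain (writeStr len data s) ψ =
      flip (ones len (List.replicate s.length true) ∆ ones data s) ψ :=
  mapDomain_eq_flip fun S _ => writeStr_eq len data s S

/-- In a block where the plaintexts differ, the bit of the chosen plaintext is `m₀ j` XOR `b`;
adding `m₀ j` to the answer `f r` XOR `b` of the oracle thus encrypts it, although `b` is unknown.
In the other blocks the common bit is encrypted with a sample of the bank. The random bits of the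
ciphertext are found on the wires `chalWire`, and all that remains besides are the oracle answers
and the flags, in scratch registers. -/
theorem exec_prepare {s i ℓ m M : ℕ} {f : List Bool → Bool} {b : Bool} {β anc γ : Finset Loc}
    (hmM : m ≤ M) (hanc : ∀ q, moveLoc s q ∉ anc)
    (hscr : ∀ c < 6, ∀ x j, Loc.party (i + s) (.work c, x, j) ∉ anc)
    (hbank : BankOK ℓ M f β anc (fun x => .party (i + s) (.state 2, 0, x))
      fun a => .party (i + s) (.state 3, 0, a))
    (hγ : γ ⊆ flipWires (i + s) ℓ m) (hβ : ∀ x j, Loc.party (i + s) (.work 1, x, j) ∉ β)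
    {ψ : State Loc} {P : List Bool × List Bool} (hP : ∀ S ∈ ψ.support, readPlaintexts i S = P)
    (hPl : P.1.length = P.2.length) (hPm : P.1.length ≤ m) :
    exec (Loc.party (i + s)) ([.gate (.X (.work 2, 0, 0))] ++
        ((List.range m).flatMap blockFlags ++ (List.range m).flatMap (blockData ℓ)))
      (flip (sampleSet (i + s) ℓ f b γ m) (emb (moveLoc s) anc ψ)) =
    emb (moveLoc s) (anc ∆ (sampleSet (i + s) ℓ f b γ m ∆
        flagSet (i + s) P.1.length (P.1.getD · false) (P.2.getD · false) m))
      (Finsupp.mapDomain (writeStr (regAt (Loc.party i) (.chalLen, 0))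
        (regAt (Loc.party i) (.chalData, 0)) (encBits (bitEnc f) ℓ (if b then P.2 else P.1)
          (readBits (chalWire (i + s) ℓ P) ((if b then P.2 else P.1).length * ℓ) (β ∪ γ)))) ψ) := by
  set p := i + s with hp
  set L := P.1.length with hL
  set m₀ : ℕ → Bool := (P.1.getD · false) with hm₀
  set m₁ : ℕ → Bool := (P.2.getD · false) with hm₁
  set sam := sampleSet p ℓ f b γ m with hsam
  set msg := if b then P.2 else P.1 with hmsg
  have hmsgL : msg.length = L := by rw [hmsg]; cases b; exacts [rfl, hPl.symm]
  set bits := encBits (bitEnc f) ℓ msg (readBits (chalWire p ℓ P) (msg.length * ℓ) (β ∪ γ)) with hbits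
  set br : ℕ → List Bool := fun j =>
    readBits (fun t => Loc.party p (.state 2, 0, j * ℓ + t)) ℓ β with hbr
  set fr : ℕ → List Bool := flipString p ℓ γ with hfr
  have hout : bits = (List.range L).flatMap (blockBits L m₀ m₁ fr (fun j => xor (f (fr j)) b) br
      fun j => f (br j)) := by
    rw [hbits, encBits_readBits, hmsgL]
    refine List.flatMap_congr fun j hj => ?_
    have hj' := List.mem_range.1 hj
    have hread : readBits (fun t => chalWire p ℓ P (j * ℓ + t)) ℓ (β ∪ γ) =
        if differ L m₀ m₁ j then fr j else br j := by
      -- A position in the random bits of the whole challenge determines the block, by division by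
      -- `ℓ`, and the place in the block.
      have hdm : ∀ t < ℓ, (j * ℓ + t) / ℓ = j ∧ (j * ℓ + t) % ℓ = t := by
        intro t ht
        have hpos : 0 < ℓ := by omega
        rw [Nat.add_comm, Nat.add_mul_div_right _ _ hpos, Nat.add_mul_mod_self_right,
          Nat.div_eq_of_lt ht, Nat.mod_eq_of_lt ht, Nat.zero_add]
        exact ⟨rfl, rfl⟩
      split_ifs with hd
      · refine readBits_congr fun t ht => ?_
        have : chalWire p ℓ P (j * ℓ + t) = Loc.party p (.work 1, j, t) := by
          unfold chalWire effWire
          rw [(hdm t ht).1, (hdm t ht).2, if_pos hd]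
        rw [this, Finset.mem_union, or_iff_right (hβ j t)]
      · refine readBits_congr fun t ht => ?_
        have : chalWire p ℓ P (j * ℓ + t) = Loc.party p (.state 2, 0, j * ℓ + t) := by
          unfold chalWire effWire
          rw [(hdm t ht).1, if_neg hd]
        rw [this, Finset.mem_union, or_iff_left]
        intro h
        obtain ⟨_, _, _, _, h'⟩ := mem_flipWires.1 (hγ h)
        simp at h'
    rw [hread, blockBits]
    have hmj : msg.getD j false = if b then m₁ j else m₀ j := by
      rw [hmsg]; cases b <;> rfl
    rw [hmj]
    have hh : hasBit L j = true := by simp [hasBit, hj']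
    cases hd : differ L m₀ m₁ j
    · have : m₀ j = m₁ j := by
        rw [differ, hh, Bool.true_and] at hd
        cases h0 : m₀ j <;> cases h1 : m₁ j <;> simp_all
      simp only [Bool.false_eq_true, if_false, ← this, ite_self]
      rw [Bool.xor_comm]
    -- The plaintexts differ here, so choosing between them by `b` is the same as adding `b` to the
    -- first.
    · have : m₁ j = !m₀ j := by
        rw [differ, hh, Bool.true_and] at hd
        cases h0 : m₀ j <;> cases h1 : m₁ j <;> simp_all
      simp only [if_true, this]
      congr 2
      cases b <;> cases m₀ j <;> cases f (fr j) <;> rfl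
  have hbl : bits.length = L * (ℓ + 1) := by
    rw [hout]
    refine length_flatMap_range _ _ _ fun j _ => ?_
    unfold blockBits
    split_ifs <;> simp [hfr, hbr, flipString, length_readBits]
  rw [flip_emb, mapDomain_writeStr, emb_flip (moveLoc_injective s),
    Finset.image_symmDiff _ _ (moveLoc_injective s), image_ones, image_ones, hbl]
  rw [exec_eq_flip (X := flagSet p L m₀ m₁ m ∆ (ones (fun j => Loc.party p (.chalLen, 0, j))
    (List.replicate (L * (ℓ + 1)) true) ∆ ones (fun j => Loc.party p (.chalData, 0, j)) bits)),
    flip_emb]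
  · congr 1
    simp only [symmDiff_assoc]
    rfl
  · intro T hT
    obtain ⟨S, hS, rfl⟩ := mem_support_emb hT
    have hRP := hP S hS
    have hLen : readLen (regAt pirateLoc (.len, i)) S = L := by
      rw [hL, ← hRP]; simp [readPlaintexts, length_readBits]
    obtain ⟨hl1, hl2⟩ := readLen_spec (regAt_injective pirateLoc_injective (.len, i)) S
    rw [hLen] at hl1 hl2
    have hns : ∀ q, moveLoc s q ∉ anc ∆ sam := by
      intro q hq
      rcases Finset.mem_symmDiff.1 hq with h | h
      · exact hanc q h.1
      · obtain ⟨j, t, h'⟩ := mem_sampleSet h.1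
        exact party_ne_moveLoc (by simp) q h'.symm
    have hphi : ∀ q, mb (moveLoc s q) (S.image (moveLoc s) ∆ (anc ∆ sam)) = mb q S := fun q =>
      decide_eq_decide.2 (mem_emb (moveLoc_injective s) (hns q))
    have hoth : ∀ w : Wire PartyReg, (match w.1 with | .state c => c < 4 | .work c => c < 6 | _ => False) →
        mb (Loc.party p w) (S.image (moveLoc s) ∆ (anc ∆ sam)) =
          xor (mb (Loc.party p w) anc) (mb (Loc.party p w) sam) := fun w hw => by
      rw [← mb_symmDiff]
      exact decide_eq_decide.2 (mem_emb' fun q => party_ne_moveLoc hw q)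
    have hsam0 : ∀ k x j, k ≠ .work 1 → mb (Loc.party p (k, x, j)) sam = false := by
      intro k x j hk
      rw [mb, decide_eq_false_iff_not]
      intro h
      obtain ⟨j, t, h'⟩ := mem_sampleSet h
      simp only [Loc.party.injEq, Prod.mk.injEq] at h'
      exact hk h'.2.1
    have hanc0 : ∀ c < 6, ∀ x j, mb (Loc.party p (.work c, x, j)) anc = false := by
      intro c hc x j
      rw [mb, decide_eq_false_iff_not]
      exact hscr c hc x j
    set T := S.image (moveLoc s) ∆ (anc ∆ sam) with hTdef
    have hw : ∀ c < 6, c ≠ 1 → ∀ j, mb (Loc.party p (.work c, 0, j)) T = false := by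
      intro c hc hc1 j
      rw [hoth _ (by simpa using hc), hanc0 c hc, hsam0 _ _ _ (by simpa using hc1)]
      rfl
    have h4 : ∀ j ≤ L, mb (Loc.party p (.state 4, 0, j)) T = decide (j < L) := by
      intro j hj
      have : Loc.party p (.state 4, 0, j) = moveLoc s (.pirate (.len, i, j)) := rfl
      rw [this, hphi]
      rcases hj.lt_or_eq with h | h
      · exact decide_eq_decide.2 (iff_of_true (hl1 j h) h)
      · rw [h]
        exact decide_eq_decide.2 (iff_of_false hl2 (lt_irrefl _))
    have hpl : ∀ c, ∀ j < L, mb (.pirate (.plain c, i, j)) S =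
        (if c then P.2 else P.1).getD j false := by
      intro c j hj
      have : (if c then P.2 else P.1) = readBits (regAt pirateLoc (.plain c, i)) L S := by
        rw [← hRP, ← hLen]; cases c <;> rfl
      rw [this]
      simp [readBits, List.getD, hj, mb, regAt, pirateLoc]
    have h5 : ∀ j < L, mb (Loc.party p (.state 5, 0, j)) T = m₀ j := by
      intro j hj
      have : Loc.party p (.state 5, 0, j) = moveLoc s (.pirate (.plain false, i, j)) := rfl
      rw [this, hphi, hpl false j hj]; rfl
    have h6 : ∀ j < L, mb (Loc.party p (.state 6, 0, j)) T = m₁ j := by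
      intro j hj
      have : Loc.party p (.state 6, 0, j) = moveLoc s (.pirate (.plain true, i, j)) := rfl
      rw [this, hphi, hpl true j hj]; rfl
    rw [← List.append_assoc, exec_append, exec_flags h4 h5 h6 (hw 2 (by omega) (by omega))
      (hw 4 (by omega) (by omega)), exec_data (fr := fr) (br := br)
      (fa := fun j => xor (f (fr j)) b) (ba := fun j => f (br j)) (L := L) (m₀ := m₀) (m₁ := m₁)
      (m := m) _ _ _ _ _ _ _ _ _ le_rfl]
    · rw [Nat.min_eq_right hPm, ← hout, symmDiff_assoc]
    · intro j; simp [hfr, flipString, length_readBits]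
    · intro j; simp [hbr, length_readBits]
    · intro j hj
      rw [mb_symmDiff, h5 j hj, mb_flagSet_of_ne _ _ _ _ _ (by simp), Bool.xor_false]
    · intro j hj
      rw [mb_symmDiff, hw 2 (by omega) (by omega), mb_flagSet_two, Bool.false_xor, hasBit]
      simp [hj]
    · intro j hj
      rw [mb_symmDiff, hw 4 (by omega) (by omega), mb_flagSet_four, Bool.false_xor]
      simp [hj]
    · intro j hj
      rw [mb_symmDiff, hw 5 (by omega) (by omega), mb_flagSet_five, Bool.false_xor]
      simp [hj]
    · intro j hj t ht
      rw [mb_symmDiff, hoth _ (by simp), hanc0 1 (by omega), hsam, mb_sampleSet f b γ hj]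
      have : mb (Loc.party p (.work 1, j, t)) (flagSet p L m₀ m₁ m) = false := by
        rw [flagSet, mb_symmDiff, mb_symmDiff, mb_ones_of_ne (by simp), mb_ones_of_ne (by simp),
          mb_ones_of_ne (by simp)]
        rfl
      rw [this]
      simp [hfr]
    · intro j hj t ht
      have hlt : j * ℓ + t < M * ℓ := by
        have : (j + 1) * ℓ ≤ M * ℓ := Nat.mul_le_mul_right _ (by omega)
        have h' : (j + 1) * ℓ = j * ℓ + ℓ := by ring
        omega
      rw [mb_symmDiff, hoth _ (by simp), hsam0 _ _ _ (by simp), mb_flagSet_of_ne _ _ _ _ _ (by simp)]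
      simp only [Bool.xor_false, hbr, readBits, List.getD, mb]
      simp only [List.getElem?_map, List.getElem?_range ht, Option.map_some, Option.getD_some]
      exact decide_eq_decide.2 (hbank.1 _ hlt)
    · intro j hj
      rw [mb_symmDiff, hoth _ (by simp), hsam0 _ _ _ (by simp), mb_flagSet_of_ne _ _ _ _ _ (by simp)]
      simp only [Bool.xor_false]
      rw [Bool.eq_iff_iff, mb_eq_true]
      exact hbank.2 j (by omega)

/-! ### Registers written by the circuits of the reduction -/

section
variable {α β κ κ' : Type} [DecidableEq α] [DecidableEq β]

theorem Dec.emb {D : α → Prop} {D' : β → Prop} {K : State β → ℝ} (h : Dec D' K) {φ : α → β}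
    (hφ : Function.Injective φ) {A : Finset β} (hD : ∀ q, D q → D' (φ q) ∧ φ q ∉ A) :
    Dec D fun ψ => K (emb φ A ψ) := by
  intro ψ ψ' hd
  have h1 : QCrypto.emb φ A (ψ + ψ') = QCrypto.emb φ A ψ + QCrypto.emb φ A ψ' :=
    Finsupp.mapDomain_add
  simp only [h1]
  refine h _ _ fun S hS T hT => ?_
  obtain ⟨S', hS', rfl⟩ := mem_support_emb hS
  obtain ⟨T', hT', rfl⟩ := mem_support_emb hT
  obtain ⟨q, hq, hne⟩ := hd S' hS' T' hT'
  refine ⟨φ q, (hD q hq).1, ?_⟩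
  rwa [mem_emb hφ (hD q hq).2, mem_emb hφ (hD q hq).2]

theorem Circuit.mem_subst {G : ℕ → Op κ → Circuit κ'} {k : ℕ} {C : Circuit κ} {o : Op κ'}
    (h : o ∈ Circuit.subst G k C) : ∃ i, ∃ o' ∈ C, o ∈ G i o' := by
  induction C generalizing k with
  | nil => simp [Circuit.subst] at h
  | cons o' C ih =>
    rw [Circuit.subst, List.mem_append] at h
    rcases h with h | h
    · exact ⟨k, o', List.mem_cons_self .., h⟩
    · obtain ⟨i, o'', h1, h2⟩ := ih h
      exact ⟨i, o'', List.mem_cons_of_mem _ h1, h2⟩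

theorem Circuit.Writes.subst {G : ℕ → Op κ → Circuit κ'} {P : Wire κ' → Prop}
    {C : Circuit κ} (h : ∀ i, ∀ o ∈ C, (G i o).Writes P) (k : ℕ) :
    (Circuit.subst G k C).Writes P := by
  constructor
  · intro g hg
    obtain ⟨i, o, ho, h'⟩ := Circuit.mem_subst hg
    exact (h i o ho).1 g h'
  · intro x src tgt hg
    obtain ⟨i, o, ho, h'⟩ := Circuit.mem_subst hg
    exact (h i o ho).2 x src tgt h'

theorem simOp_writes [DecidableEq κ] (rk : κ → κ') (sh : κ → ℕ) (kr ka : κ') (ℓ V k : ℕ) {P : Wire κ' → Prop}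
    (hP : ∀ w, P (shiftWire rk sh w)) (o : Op κ) : (simOp rk sh kr ka ℓ V k o).Writes P := by
  rcases o with g | ⟨len, src, tgt⟩
  · refine Circuit.Writes.gate ?_
    rw [Gate.target_map]
    exact hP _
  · rw [simOp]
    split_ifs
    · exact ⟨fun g h => by simp at h, fun _ _ _ h => by simp at h⟩
    · refine Circuit.Writes.flatMap fun j _ => Circuit.Writes.append (Circuit.Writes.flatMap fun t _ =>
        Circuit.Writes.gate (hP (tgt.1, tgt.2, _))) (Circuit.Writes.append (Circuit.Writes.gate (hP (tgt.1, tgt.2, _)))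
          (Circuit.Writes.gate (hP (tgt.1, tgt.2, _))))

theorem simOp_noQuery (rk : κ → κ') (sh : κ → ℕ) (kr ka : κ') (ℓ V k : ℕ) (o : Op κ) :
    (simOp rk sh kr ka ℓ V k o).NoQuery := by
  rcases o with g | ⟨len, src, tgt⟩
  · exact Circuit.NoQuery.gate _
  · rw [simOp]
    split_ifs
    · exact fun _ _ _ h => by simp at h
    · exact Circuit.NoQuery.flatMap fun j _ => Circuit.NoQuery.append
        (Circuit.NoQuery.flatMap fun t _ => Circuit.NoQuery.gate _)
          (Circuit.NoQuery.append (Circuit.NoQuery.gate _) (Circuit.NoQuery.gate _))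

theorem Circuit.NoQuery.subst {G : ℕ → Op κ → Circuit κ'} {C : Circuit κ}
    (h : ∀ i, ∀ o ∈ C, (G i o).NoQuery) (k : ℕ) : (Circuit.subst G k C).NoQuery := by
  intro x src tgt hg
  obtain ⟨i, o, ho, h'⟩ := Circuit.mem_subst hg
  exact h i o ho x src tgt h'

end

/-! ### The parties of the reduction -/

/-- The registers that are not changed by the parties of the reduction. -/
def KeptReg (q : Loc) : Prop :=
  (∃ p c w, c ≤ 6 ∧ q = .party p (.state c, w)) ∨ ∀ p w, q ≠ .party p w

theorem flipQueries_writes {P : Wire PartyReg → Prop} (hP : ∀ j t, P (.work 1, j, t)) (m : ℕ) :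
    (flipQueries m).Writes P :=
  Circuit.Writes.flatMap fun j _ => Circuit.Writes.query fun t => hP j t

theorem prepare_writes {P : Wire PartyReg → Prop} (hw : ∀ c w, P (.work c, w))
    (hl : ∀ w, P (.chalLen, w)) (hd : ∀ w, P (.chalData, w)) (ℓ m : ℕ) :
    Circuit.Writes P ([.gate (.X (.work 2, 0, 0))] ++
        ((List.range m).flatMap blockFlags ++ (List.range m).flatMap (blockData ℓ))) := by
  refine Circuit.Writes.append (Circuit.Writes.gate (hw _ _)) (Circuit.Writes.append
    (Circuit.Writes.flatMap fun j _ => ?_) (Circuit.Writes.flatMap fun j _ => ?_))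
  · exact Circuit.Writes.append (.gate (hw _ _)) (Circuit.Writes.append (.gate (hw _ _))
      (Circuit.Writes.append (.gate (hw _ _)) (Circuit.Writes.append (.gate (hw _ _))
        (.gate (hw _ _)))))
  · exact Circuit.Writes.append (.flatMap fun t _ => .gate (hl _)) (Circuit.Writes.append
      (.flatMap fun t _ => .gate (hd _)) (Circuit.Writes.append (.flatMap fun t _ => .gate (hd _))
        (Circuit.Writes.append (.gate (hd _)) (.gate (hd _)))))

theorem prepare_noQuery (ℓ m : ℕ) : Circuit.NoQuery ([.gate (.X (.work 2, 0, 0))] ++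
    ((List.range m).flatMap blockFlags ++ (List.range m).flatMap (blockData ℓ))) := by
  intro x src tgt h
  simp [blockFlags, blockData] at h

theorem simParty_writes (ℓ V : ℕ) (C : Circuit PartyReg) {P : Wire PartyReg → Prop}
    (hP : ∀ w, P (shiftWire partyKind (fun _ => 0) w)) : (simParty ℓ V C).Writes P :=
  Circuit.Writes.subst (fun _ o _ => simOp_writes _ _ _ _ _ _ _ hP o) 0

theorem simParty_noQuery (ℓ V : ℕ) (C : Circuit PartyReg) : (simParty ℓ V C).NoQuery :=
  Circuit.NoQuery.subst (fun _ o _ => simOp_noQuery _ _ _ _ _ _ _ o) 0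

theorem partyKind_ne_plain {c : ℕ} (hc : c ≤ 6) (k : PartyReg) : partyKind k ≠ .state c := by
  cases k <;> simp [partyKind]; omega

theorem not_keptReg {p : ℕ} {w : Wire PartyReg} (h : ∀ c, c ≤ 6 → w.1 ≠ .state c) :
    ¬ KeptReg (.party p w) := by
  rintro (⟨p', c, w', hc, h'⟩ | h')
  · simp only [Loc.party.injEq] at h'
    exact h c hc (by rw [h'.2])
  · exact h' p w rfl

/-- Banks, plaintexts and everything outside the parties serve at most as controls. Thus coherence
between different contents of these registers stays irrelevant through the runs of all parties. -/
theorem flipParty_writes (ℓ V m p : ℕ) (C : Circuit PartyReg) :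
    (flipParty ℓ V m C).Writes fun w => ¬ KeptReg (.party p w) := by
  refine Circuit.Writes.append (Circuit.Writes.append ?_ ?_) ?_
  · exact flipQueries_writes (fun j t => not_keptReg (by simp)) m
  · exact prepare_writes (fun c w => not_keptReg (by simp)) (fun w => not_keptReg (by simp))
      (fun w => not_keptReg (by simp)) ℓ m
  · exact simParty_writes ℓ V C fun w => not_keptReg fun c hc => partyKind_ne_plain hc _

/-- The parties of the reduction, and a continuation. -/
noncomputable def flipFold (s ℓ V m : ℕ) (f : List Bool → Bool) {N : ℕ} (b : Fin N → Bool)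
    (C : ℕ → Circuit PartyReg) (L : List (Fin N)) (K : State Loc → ℝ) : State Loc → ℝ :=
  L.foldr (fun (i : Fin N) K' => execWith (flipSamples ℓ f (b i)) (Loc.party (i + s))
    (flipParty ℓ V m (C i)) K') K

/-- The tape of random strings in a bank. -/
def bankTape (ℓ V : ℕ) (R : ℕ → Loc) (β : Finset Loc) (k len : ℕ) : List Bool :=
  readBits (fun t => R (k * V * ℓ + t)) (len * ℓ) β

/-- The challenge for a distinguisher, with random bits from a bank. -/
noncomputable def tapeChallenge (s ℓ : ℕ) (f : List Bool → Bool) (i : ℕ) (b : Bool)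
    (δ : Finset Loc) (P : List Bool × List Bool) (φ : State Loc) : State Loc :=
  Finsupp.mapDomain (writeStr (regAt (Loc.party i) (.chalLen, 0))
    (regAt (Loc.party i) (.chalData, 0)) (encBits (bitEnc f) ℓ (if b then P.2 else P.1)
      (readBits (chalWire (i + s) ℓ P) ((if b then P.2 else P.1).length * ℓ) δ))) φ

/-- The challenge and the run of a distinguisher, with random bits from the banks. -/
noncomputable def tapeStep (s ℓ V m : ℕ) (f : List Bool → Bool) (i : ℕ) (b : Bool)
    (C : Circuit PartyReg) (β : Finset Loc) (K : State Loc → ℝ) (ψ : State Loc) : ℝ :=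
  setAvg (flipWires (i + s) ℓ m) fun γ => measure (readPlaintexts i) (fun P φ =>
    K (execTape (Loc.party i) (encBits (bitEnc f) ℓ)
      (bankTape ℓ V (fun p => .party (i + s) (.state 0, 0, p)) β) 0 C
      (tapeChallenge s ℓ f i b (β ∪ γ) P φ))) ψ

/-- The counterpart of `flipFold` in the memory of the simulated game, for a fixed content `β` of
the banks. -/
noncomputable def tapeFold (s ℓ V m : ℕ) (f : List Bool → Bool) {N : ℕ} (b : Fin N → Bool)
    (C : ℕ → Circuit PartyReg) (β : Finset Loc) (L : List (Fin N)) (K : State Loc → ℝ) :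
    State Loc → ℝ :=
  L.foldr (fun (i : Fin N) K' => tapeStep s ℓ V m f i (b i) (C i) β K') K

/-- The banks of a party are in order. -/
def PartyOK (s ℓ M : ℕ) (f : List Bool → Bool) (β anc : Finset Loc) (i : ℕ) : Prop :=
  BankOK ℓ M f β anc (fun x => .party (i + s) (.state 0, 0, x))
    (fun a => .party (i + s) (.state 1, 0, a)) ∧
  BankOK ℓ M f β anc (fun x => .party (i + s) (.state 2, 0, x))
    (fun a => .party (i + s) (.state 3, 0, a)) ∧
  ∀ c < 6, ∀ x j, Loc.party (i + s) (.work c, x, j) ∉ anc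

/-- The plaintexts in the support of the state have less than `m` bits. -/
def ShortPlain (m : ℕ) (ψ : State Loc) : Prop :=
  ∀ S ∈ ψ.support, ∀ i j, m ≤ j → Loc.pirate (.len, i, j) ∉ S

theorem ShortPlain.length_le {m i : ℕ} {ψ : State Loc} (h : ShortPlain m ψ) {S : Finset Loc}
    (hS : S ∈ ψ.support) : (readPlaintexts i S).1.length ≤ m ∧
      (readPlaintexts i S).1.length = (readPlaintexts i S).2.length := by
  refine ⟨?_, by simp [readPlaintexts, length_readBits]⟩
  simp only [readPlaintexts, length_readBits]
  by_contra hlt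
  have := (readLen_spec (regAt_injective pirateLoc_injective (.len, i)) S).1 m (not_le.1 hlt)
  exact h S hS i m le_rfl this

theorem ShortPlain.of_support {m p : ℕ} {ψ ψ' : State Loc} (h : ShortPlain m ψ)
    (h' : ∀ T ∈ ψ'.support, ∃ S ∈ ψ.support, ∀ q, (∀ w, q ≠ .party p w) → (q ∈ T ↔ q ∈ S)) :
    ShortPlain m ψ' := by
  intro T hT i j hj
  obtain ⟨S, hS, hTS⟩ := h' T hT
  rw [hTS _ (by simp)]
  exact h S hS i j hj

theorem support_challenge {s ℓ i : ℕ} {f : List Bool → Bool} {b : Bool} {δ : Finset Loc}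
    {P : List Bool × List Bool} {φ : State Loc} {T : Finset Loc}
    (hT : T ∈ (tapeChallenge s ℓ f i b δ P φ).support) :
    ∃ S ∈ φ.support, ∀ q, (∀ w, q ≠ .party i w) → (q ∈ T ↔ q ∈ S) := by
  rw [tapeChallenge, mapDomain_writeStr, mem_support_flip] at hT
  refine ⟨_, hT, fun q hq => ?_⟩
  rw [Finset.mem_symmDiff, Finset.mem_symmDiff]
  have h1 : ∀ k s, q ∉ ones (regAt (Loc.party i) (k, 0)) s := fun k s h => by
    obtain ⟨j, hj⟩ := ones_subset _ _ h
    exact hq _ hj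
  simp only [h1, not_false_eq_true, and_true, false_and, or_self, or_false]

theorem support_party_run {i : ℕ} {F : List Bool → List Bool → List Bool}
    {R : ℕ → ℕ → List Bool} {C : Circuit PartyReg} {φ : State Loc} {T : Finset Loc}
    (hT : T ∈ (execTape (Loc.party i) F R 0 C φ).support) :
    ∃ S ∈ φ.support, ∀ q, (∀ w, q ≠ .party i w) → (q ∈ T ↔ q ∈ S) := by
  obtain ⟨S, hS, h⟩ := support_execTape (P := fun q => ∃ w, q = .party i w) (fun g _ => ⟨_, rfl⟩)
    (fun len src tgt _ k m _ q hq => by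
      obtain ⟨j, hj⟩ := ones_subset _ _ hq
      exact ⟨_, hj⟩) hT
  exact ⟨S, hS, fun q hq => h q fun ⟨w, hw⟩ => hq w hw⟩

/-- In the encryption game the plaintexts are measured, in the reduction they only control gates. By
decoherence the measurement can be inserted free of charge. For a given outcome the challenge is
correct by `exec_prepare`, and the run of the distinguisher is simulated by `exec_sim` with the
first bank as its tape. Outside the simulated memory only scratch registers of this party have
changed, and this is all that `hK` demands of the new ancillas. -/
theorem flipParty_eq_tapeStep {s ℓ V m M i : ℕ} {f : List Bool → Bool} {b : Bool}
    {β anc : Finset Loc} {C : Circuit PartyReg} {Kf Ku : State Loc → ℝ} {ψ : State Loc}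
    (hmM : m ≤ M) (hVM : V * V ≤ M) (hC : C.Bounded V) (hanc : ∀ q, moveLoc s q ∉ anc)
    (hok : PartyOK s ℓ M f β anc i) (hβ : ∀ p x j, Loc.party p (.work 1, x, j) ∉ β)
    (hψ : ShortPlain m ψ) (hdec : Dec KeptReg Kf) (hquad : Quad Kf)
    (hK : ∀ anc' ψ', (∀ q, (∀ c < 6, ∀ w, q ≠ .party (i + s) (.work c, w)) → (q ∈ anc' ↔ q ∈ anc)) →
      ShortPlain m ψ' → Kf (emb (moveLoc s) anc' ψ') = Ku ψ') :
    execWith (flipSamples ℓ f b) (Loc.party (i + s)) (flipParty ℓ V m C) Kf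
      (emb (moveLoc s) anc ψ) = tapeStep s ℓ V m f i b C β Ku ψ := by
  have hφ := moveLoc_injective s
  rw [flipParty, prepare, execWith_append, execWith_append, execWith_flipQueries,
    execWith_noQuery _ _ (simParty_noQuery _ _ _), execWith_noQuery _ _ (prepare_noQuery ℓ m),
    tapeStep]
  refine setAvg_congr fun γ hγ => ?_
  have hd1 : Dec KeptReg fun φ => Kf (exec (Loc.party (i + s)) (simParty ℓ V C) φ) :=
    Dec.exec hdec (simParty_writes ℓ V C fun w => not_keptReg fun c hc => partyKind_ne_plain hc _)
  have hd2 : Dec KeptReg fun φ => Kf (exec (Loc.party (i + s)) (simParty ℓ V C)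
      (exec (Loc.party (i + s)) ([.gate (.X (.work 2, 0, 0))] ++
        ((List.range m).flatMap blockFlags ++ (List.range m).flatMap (blockData ℓ))) φ)) :=
    Dec.exec hd1 (prepare_writes (fun c w => not_keptReg (by simp))
      (fun w => not_keptReg (by simp)) (fun w => not_keptReg (by simp)) ℓ m)
  have hsamφ : ∀ q, moveLoc s q ∉ sampleSet (i + s) ℓ f b γ m := by
    intro q h
    obtain ⟨j, t, h'⟩ := mem_sampleSet h
    exact party_ne_moveLoc (by simp) q h'.symm
  simp only [flip_emb]
  -- The measurement of the plaintexts is inserted. They lie in `state 4` to `state 6` of the party,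
  -- which belong to the registers that are kept.
  refine (measure_const (R := readPlaintexts i) (Dec.emb (D := PlainWire i) hd2 hφ ?_) ?_ ?_ ψ).symm.trans ?_
  · rintro q ⟨j, rfl | ⟨c, rfl⟩⟩
    · have hp : KeptReg (moveLoc s (.pirate (.len, i, j))) := Or.inl ⟨i + s, 4, (0, j), by omega, rfl⟩
      refine ⟨hp, fun h => ?_⟩
      rcases Finset.mem_symmDiff.1 h with h | h
      exacts [hanc _ h.1, hsamφ _ h.1]
    · have hp : KeptReg (moveLoc s (.pirate (.plain c, i, j))) := by
        cases c
        · exact Or.inl ⟨i + s, 5, (0, j), by omega, rfl⟩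
        · exact Or.inl ⟨i + s, 6, (0, j), by omega, rfl⟩
      refine ⟨hp, fun h => ?_⟩
      rcases Finset.mem_symmDiff.1 h with h | h
      exacts [hanc _ h.1, hsamφ _ h.1]
  · have : emb (moveLoc s) (anc ∆ sampleSet (i + s) ℓ f b γ m) 0 = 0 := Finsupp.mapDomain_zero
    rw [this, exec_zero, exec_zero, hquad.zero]
  · intro S T h
    exact readPlaintexts_congr h
  · refine measure_congr fun S₀ hS₀ φ hφS => ?_
    obtain ⟨hlen, hlen'⟩ := hψ.length_le (i := i) hS₀
    rw [← flip_emb, exec_prepare (P := readPlaintexts i S₀) hmM hanc hok.2.2 hok.2.1 hγ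
      (fun x j => hβ _ x j) (fun S hS => (hφS S hS).1) hlen' hlen]
    set anc' := anc ∆ (sampleSet (i + s) ℓ f b γ m ∆
        flagSet (i + s) (readPlaintexts i S₀).1.length ((readPlaintexts i S₀).1.getD · false)
          ((readPlaintexts i S₀).2.getD · false) m) with hanc'
    have hsame : ∀ q, (∀ c < 6, ∀ w, q ≠ .party (i + s) (.work c, w)) → (q ∈ anc' ↔ q ∈ anc) := by
      intro q hq
      have h1 : q ∉ sampleSet (i + s) ℓ f b γ m := fun h => by
        obtain ⟨j, t, h'⟩ := mem_sampleSet h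
        exact hq 1 (by omega) _ h'
      have h2 : q ∉ flagSet (i + s) (readPlaintexts i S₀).1.length
          ((readPlaintexts i S₀).1.getD · false) ((readPlaintexts i S₀).2.getD · false) m := fun h => by
        obtain ⟨c, hc, j, h'⟩ := mem_flagSet h
        exact hq c hc _ h'
      simp only [hanc', Finset.mem_symmDiff, h1, h2, not_false_eq_true, and_true, false_and,
        or_self, or_false]
    have hanc'φ : ∀ q, moveLoc s q ∉ anc' := fun q => by
      rw [hsame _ fun c hc w h => party_ne_moveLoc (by simpa using hc) q h.symm]
      exact hanc q
    rw [simParty, exec_sim hφ (eu := Loc.party i) (bt := β) (f := f) (party_injective _)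
      (fun w => rfl) (party_injective _) (fun p w => party_ne_moveLoc (by simp) _)
      (fun p w => party_ne_moveLoc (by simp) _) hanc'φ ?_ ?_ (by simpa using hC.1) hC.2]
    · rw [hK _ _ hsame]
      · rfl
      · exact ShortPlain.of_support (p := i) (ShortPlain.of_support (p := i) (ψ := φ)
          (ψ' := tapeChallenge s ℓ f i b (β ∪ γ) (readPlaintexts i S₀) φ)
          (fun S hS => hψ S (hφS S hS).2) fun T hT => support_challenge hT)
          fun T hT => support_party_run hT
    · intro p hp
      rw [hsame _ (by simp)]
      exact hok.1.1 p (lt_of_lt_of_le hp (Nat.mul_le_mul_right _ hVM))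
    · intro a ha
      rw [hsame _ (by simp)]
      exact hok.1.2 a (ha.trans_le hVM)

theorem flipFold_dec {s ℓ V m N : ℕ} {f : List Bool → Bool} {b : Fin N → Bool}
    {C : ℕ → Circuit PartyReg} {K : State Loc → ℝ} (hdec : Dec KeptReg K) (L : List (Fin N)) :
    Dec KeptReg (flipFold s ℓ V m f b C L K) := by
  induction L with
  | nil => exact hdec
  | cons i L ih => exact Dec.execWith ih _ (flipParty_writes _ _ _ _ _)

theorem flipFold_quad {s ℓ V m N : ℕ} {f : List Bool → Bool} {b : Fin N → Bool}
    {C : ℕ → Circuit PartyReg} {K : State Loc → ℝ} (hquad : Quad K) (L : List (Fin N)) :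
    Quad (flipFold s ℓ V m f b C L K) := by
  induction L with
  | nil => exact hquad
  | cons i L ih => exact Quad.execWith ih _ _ _

/-- Induction on the parties. Each of them changes no ancillas but its own scratch registers, so the
banks and the scratch space of those to come are still in order. -/
theorem flipFold_emb {s ℓ V m M N : ℕ} {f : List Bool → Bool} {b : Fin N → Bool}
    {β : Finset Loc} {C : ℕ → Circuit PartyReg} {Kf Ku : State Loc → ℝ}
    (hmM : m ≤ M) (hVM : V * V ≤ M) {L : List (Fin N)} (hL : L.Nodup)
    (hC : ∀ i ∈ L, (C i).Bounded V) (hβ : ∀ p x j, Loc.party p (.work 1, x, j) ∉ β)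
    (hdec : Dec KeptReg Kf) (hquad : Quad Kf) {anc : Finset Loc} {ψ : State Loc}
    (hanc : ∀ q, moveLoc s q ∉ anc) (hok : ∀ i ∈ L, PartyOK s ℓ M f β anc i)
    (hψ : ShortPlain m ψ)
    (hK : ∀ anc' ψ', (∀ q, (∀ p, ∀ c < 6, ∀ w, q ≠ .party p (.work c, w)) →
      (q ∈ anc' ↔ q ∈ anc)) → Kf (emb (moveLoc s) anc' ψ') = Ku ψ') :
    flipFold s ℓ V m f b C L Kf (emb (moveLoc s) anc ψ) = tapeFold s ℓ V m f b C β L Ku ψ := by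
  induction L generalizing anc ψ with
  | nil => exact hK _ _ fun _ _ => Iff.rfl
  | cons i L ih =>
    rw [List.nodup_cons] at hL
    refine flipParty_eq_tapeStep hmM hVM (hC i (List.mem_cons_self ..)) hanc
      (hok i (List.mem_cons_self ..)) hβ hψ (flipFold_dec hdec L) (flipFold_quad hquad L) ?_
    intro anc' ψ' hsame hψ'
    refine ih hL.2 (fun j hj => hC j (List.mem_cons_of_mem _ hj)) ?_ ?_ hψ' ?_
    · intro q
      rw [hsame _ fun c hc w h => party_ne_moveLoc (by simpa using hc) q h.symm]
      exact hanc q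
    · intro j hj
      have hji : (j : ℕ) ≠ i := fun h => hL.1 (Fin.ext h ▸ hj)
      obtain ⟨h1, h2, h3⟩ := hok j (List.mem_cons_of_mem _ hj)
      refine ⟨⟨fun x hx => ?_, fun a ha => ?_⟩, ⟨fun x hx => ?_, fun a ha => ?_⟩, fun c hc x t => ?_⟩
      · rw [hsame _ (by simp)]; exact h1.1 x hx
      · rw [hsame _ (by simp)]; exact h1.2 a ha
      · rw [hsame _ (by simp)]; exact h2.1 x hx
      · rw [hsame _ (by simp)]; exact h2.2 a ha
      · rw [hsame _ (fun c' _ w h => hji (Nat.add_right_cancel (Loc.party.inj h).1))]; exact h3 c hc x t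
    · intro anc'' ψ'' h
      refine hK _ _ fun q hq => (h q hq).trans (hsame q fun c hc w => hq _ c hc w)

/-! ### Locality of runs, and projections to outcomes of measurements -/

section
variable {α κ : Type} [DecidableEq α] [DecidableEq κ]

theorem execWith_congr_support {P : α → Prop} {O : Oracle} {e : Wire κ → α} {C : Circuit κ}
    (hg : ∀ g, Op.gate g ∈ C → P (e g.target))
    (hq : ∀ len src tgt, Op.query len src tgt ∈ C → ∀ m r, m.length = len →
      ∀ q ∈ ones (regAt e tgt) (O.fn m r), P q)
    {K K' : State α → ℝ} {ψ : State α}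
    (h : ∀ φ : State α, (∀ T ∈ φ.support, ∃ S ∈ ψ.support, ∀ q, ¬ P q → (q ∈ T ↔ q ∈ S)) →
      K φ = K' φ) : execWith O e C K ψ = execWith O e C K' ψ := by
  induction C generalizing ψ with
  | nil => exact h ψ fun T hT => ⟨T, hT, fun _ _ => Iff.rfl⟩
  | cons o C ih =>
    have ih' := fun {ψ} => ih (fun g h => hg g (List.mem_cons_of_mem _ h))
      (fun len src tgt h => hq len src tgt (List.mem_cons_of_mem _ h)) (ψ := ψ)
    rcases o with g | ⟨len, src, tgt⟩
    · refine ih' fun φ hφ => h φ fun T hT => ?_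
      obtain ⟨S', hS', h1⟩ := hφ T hT
      obtain ⟨S, hS, h2⟩ := Gate.support_apply _ _ hS'
      refine ⟨S, hS, fun q hq => (h1 q hq).trans (h2 q fun h => hq ?_)⟩
      rw [h, Gate.target_map]
      exact hg g (List.mem_cons_self ..)
    · simp only [execWith]
      congr 1
      funext r
      refine ih' fun φ hφ => h φ fun T hT => ?_
      obtain ⟨S', hS', h1⟩ := hφ T hT
      obtain ⟨S, hS, rfl⟩ := Finset.mem_image.1 (Finsupp.mapDomain_support hS')
      refine ⟨S, hS, fun q hq' => (h1 q hq').trans ?_⟩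
      unfold queryMap
      split_ifs
      · rfl
      · have : q ∉ ones (regAt e tgt) (O.fn (readBits (regAt e src) len S) r) := fun h =>
          hq' (hq len src tgt (List.mem_cons_self ..) _ r (length_readBits _ _ _) q h)
        simp [xorBits, Finset.mem_symmDiff, this]

theorem avgBits_comm (m n : ℕ) (F : List Bool → List Bool → ℝ) :
    (avgBits m fun r => avgBits n (F r)) = avgBits n fun s => avgBits m fun r => F r s := by
  simp only [avgBits, ← Finset.sum_div, div_right_comm]
  rw [Finset.sum_comm]

theorem filter_mapDomain {β : Type} [DecidableEq β] {R : Finset α → β} {J : Finset α → Finset α}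
    (hJ : ∀ S, R (J S) = R S) (y : β) (ψ : State α) :
    (Finsupp.mapDomain J ψ).filter (fun S => R S = y) =
      Finsupp.mapDomain J (ψ.filter fun S => R S = y) := by
  induction ψ using Finsupp.induction_linear with
  | zero =>
    rw [Finsupp.mapDomain_zero]
    exact (Finsupp.filter_zero _).trans (by rw [show (0 : State α).filter (fun S => R S = y) = 0 from Finsupp.filter_zero _, Finsupp.mapDomain_zero])
  | add f g hf hg =>
    rw [Finsupp.mapDomain_add, Finsupp.filter_add, hf, hg, Finsupp.filter_add, Finsupp.mapDomain_add]
  | single S a =>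
    have h1 : (Finsupp.single (J S) a).filter (fun S => R S = y) =
        if R S = y then Finsupp.single (J S) a else 0 := by
      split_ifs with h
      · exact Finsupp.filter_single_of_pos _ (by rwa [hJ])
      · exact Finsupp.filter_single_of_neg _ (by rwa [hJ])
    have h2 : (Finsupp.single S a).filter (fun S => R S = y) =
        if R S = y then Finsupp.single S a else 0 := by
      split_ifs with h
      · exact Finsupp.filter_single_of_pos _ h
      · exact Finsupp.filter_single_of_neg _ h
    rw [Finsupp.mapDomain_single, h1, h2]
    split_ifs
    · rw [Finsupp.mapDomain_single]
    · rw [Finsupp.mapDomain_zero]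

theorem filter_exec {β : Type} [DecidableEq β] {R : Finset α → β} {e : Wire κ → α}
    (hR : ∀ S w, R (S ∆ {e w}) = R S) (C : Circuit κ) (y : β) (ψ : State α) :
    (exec e C ψ).filter (fun S => R S = y) = exec e C (ψ.filter fun S => R S = y) := by
  classical
  have h : Carries id (fun q => ∃ w, q = e w) (id : Finset α → Finset α)
      (fun S => if R S = y then (1 : ℂ) else 0) :=
    ⟨fun _ _ _ _ h => h, fun _ _ _ => Iff.rfl, fun _ _ _ => rfl, by
      rintro S _ ⟨w, rfl⟩; simp only [hR]⟩
  have := h.exec e (C := C) (fun g _ q _ => ⟨q, rfl⟩) ψ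
  rw [filter_eq_weigh, filter_eq_weigh]
  have he : id ∘ e = e := rfl
  rw [he] at this
  convert this

end

/-! ### Averaging over the banks -/

/-- The encryption oracle. -/
def encSamples (ℓ : ℕ) (f : List Bool → Bool) : Oracle where
  coins := fun L => L * ℓ
  fn := encBits (bitEnc f) ℓ

/-- The challenge for a distinguisher. -/
noncomputable def challengeWith (ℓ : ℕ) (f : List Bool → Bool) (i : ℕ) (b : Bool)
    (K : State Loc → ℝ) : State Loc → ℝ :=
  measure (readPlaintexts i) fun P φ => avgBits ((if b then P.2 else P.1).length * ℓ) fun r =>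
    K (Finsupp.mapDomain (writeStr (regAt (Loc.party i) (.chalLen, 0))
      (regAt (Loc.party i) (.chalData, 0))
        (encBits (bitEnc f) ℓ (if b then P.2 else P.1) r)) φ)

/-- The challenge and the run of the distinguishers, one after the other. -/
noncomputable def encFold (ℓ : ℕ) (f : List Bool → Bool) {N : ℕ} (b : Fin N → Bool)
    (C : ℕ → Circuit PartyReg) (L : List (Fin N)) (K : State Loc → ℝ) : State Loc → ℝ :=
  L.foldr (fun (i : Fin N) K' => challengeWith ℓ f i (b i)
    (execWith (encSamples ℓ f) (Loc.party i) (C i) K')) K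

theorem chalWire_cases (p ℓ : ℕ) (P : List Bool × List Bool) (x : ℕ) :
    chalWire p ℓ P x = .party p (.work 1, x / ℓ, x % ℓ) ∨
      chalWire p ℓ P x = .party p (.state 2, 0, x) := by
  unfold chalWire effWire
  split_ifs
  exacts [Or.inl rfl, Or.inr rfl]

theorem chalWire_injective (p ℓ : ℕ) (P : List Bool × List Bool) :
    Function.Injective (chalWire p ℓ P) := by
  intro x y h
  rcases chalWire_cases p ℓ P x with hx | hx <;> rcases chalWire_cases p ℓ P y with hy | hy <;>
    rw [hx, hy] at h <;> simp at h
  · rw [← Nat.div_add_mod x ℓ, ← Nat.div_add_mod y ℓ, h.1, h.2]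
  · exact h

theorem bankTape_congr {ℓ V : ℕ} {R : ℕ → Loc} {β β' : Finset Loc}
    (h : ∀ x, R x ∈ β ↔ R x ∈ β') : bankTape ℓ V R β = bankTape ℓ V R β' := by
  funext k len
  exact readBits_congr fun j _ => h _

theorem readBits_chalWire_congr {p ℓ n : ℕ} {P : List Bool × List Bool} {β β' : Finset Loc}
    (h : ∀ w, Loc.party p w ∈ β ↔ Loc.party p w ∈ β') :
    readBits (chalWire p ℓ P) n β = readBits (chalWire p ℓ P) n β' := by
  refine readBits_congr fun j _ => ?_
  rcases chalWire_cases p ℓ P j with h' | h'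
  · rw [h']; exact h _
  · rw [h']; exact h _

/-- The bits used for the challenge and those used for the queries lie on different wires, and the
continuation `K` depends on neither. They are therefore replaced by fresh coins one after the other.
Which wires supply the bits of the challenge depends on the plaintexts, so the replacement takes
place after the measurement, for each outcome separately. -/
theorem setAvg_tapeStep {s ℓ V m M i : ℕ} {f : List Bool → Bool} {b : Bool}
    {C : Circuit PartyReg} {X : Finset Loc} {K : Finset Loc → State Loc → ℝ} {ψ : State Loc}
    (hmM : m ≤ M) (hVM : V * V ≤ M) (hC : C.Bounded V) (hψ : ShortPlain m ψ)
    (hX0 : ∀ x < M * ℓ, Loc.party (i + s) (.state 0, 0, x) ∈ X)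
    (hX2 : ∀ x < M * ℓ, Loc.party (i + s) (.state 2, 0, x) ∈ X)
    (hXw : ∀ p x j, Loc.party p (.work 1, x, j) ∉ X)
    (hK : Insens (fun q => ∃ w, q = .party (i + s) w) K) :
    (setAvg X fun β => tapeStep s ℓ V m f i b C β (K β) ψ) =
      challengeWith ℓ f i b (execWith (encSamples ℓ f) (Loc.party i) C fun φ =>
        setAvg X fun β => K β φ) ψ := by
  set Γ := flipWires (i + s) ℓ m with hΓ
  have hΓw : ∀ q ∈ Γ, ∃ x j, q = .party (i + s) (.work 1, x, j) := by
    intro q hq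
    obtain ⟨j, -, t, -, rfl⟩ := mem_flipWires.1 hq
    exact ⟨j, t, rfl⟩
  have hdisj : Disjoint X Γ := by
    rw [Finset.disjoint_right]
    intro q hq
    obtain ⟨x, j, rfl⟩ := hΓw q hq
    exact hXw _ _ _
  have hoff : ∀ β γ : Finset Loc, γ ⊆ Γ → ∀ q, (∀ x j, q ≠ .party (i + s) (.work 1, x, j)) →
      (q ∈ β ∪ γ ↔ q ∈ β) := by
    intro β γ hγ q hq
    rw [Finset.mem_union, or_iff_left]
    intro h
    obtain ⟨x, j, h'⟩ := hΓw q (hγ h)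
    exact hq _ _ h'
  have hKu : ∀ β γ : Finset Loc, γ ⊆ Γ → K (β ∪ γ) = K β := fun β γ hγ =>
    hK _ _ fun q hq => hoff β γ hγ q fun x j h => hq ⟨_, h⟩
  have htape : ∀ β β' : Finset Loc, (∀ x, Loc.party (i + s) (.state 0, 0, x) ∈ β ↔
      Loc.party (i + s) (.state 0, 0, x) ∈ β') →
      bankTape ℓ V (fun p => .party (i + s) (.state 0, 0, p)) β =
        bankTape ℓ V (fun p => .party (i + s) (.state 0, 0, p)) β' := fun β β' h =>
    bankTape_congr h
  unfold tapeStep challengeWith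
  rw [← hΓ]
  simp only [measure_setAvg]
  refine measure_congr fun S₀ hS₀ φ hφ => ?_
  obtain ⟨hlen, hlen'⟩ := hψ.length_le (i := i) hS₀
  set P := readPlaintexts i S₀ with hP
  set msg := if b then P.2 else P.1 with hmsg
  have hml : msg.length ≤ m := by
    rw [hmsg]; cases b
    · exact hlen
    · exact hlen' ▸ hlen
  set χ : List Bool → State Loc := fun r => Finsupp.mapDomain
    (writeStr (regAt (Loc.party i) (.chalLen, 0)) (regAt (Loc.party i) (.chalData, 0))
      (encBits (bitEnc f) ℓ msg r)) φ with hχ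
  set tp := bankTape ℓ V (fun p => .party (i + s) (.state 0, 0, p)) with htp
  -- The challenge draws bits both from the bank and from the oracle. Contents of the banks and
  -- strings of the oracle are combined into one uniformly random subset of `X ∪ Γ`.
  have e1 : (setAvg X fun β => setAvg Γ fun γ => K β (execTape (Loc.party i) (encBits (bitEnc f) ℓ)
      (tp β) 0 C (tapeChallenge s ℓ f i b (β ∪ γ) P φ))) =
      setAvg (X ∪ Γ) fun δ => (fun δ r => K δ (execTape (Loc.party i) (encBits (bitEnc f) ℓ)
        (tp δ) 0 C (χ r))) δ (readBits (chalWire (i + s) ℓ P) (msg.length * ℓ) δ) := by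
    rw [setAvg_union hdisj]
    refine setAvg_congr fun β _ => setAvg_congr fun γ hγ => ?_
    beta_reduce
    rw [hKu β γ hγ, htape (β ∪ γ) β fun x => hoff β γ hγ _ (by simp)]
    rfl
  -- The bits of the challenge are replaced first; those on the tape of the distinguisher follow in
  -- `e2`.
  rw [e1, setAvg_resample (r := chalWire (i + s) ℓ P) (G := fun δ r => K δ
    (execTape (Loc.party i) (encBits (bitEnc f) ℓ) (tp δ) 0 C (χ r)))
    fun x _ y _ h => chalWire_injective _ _ _ h]
  · rw [setAvg_avgBits]
    congr 1
    funext r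
    have e2 := setAvg_execTape (X := X ∪ Γ) (R := fun p => .party (i + s) (.state 0, 0, p))
      (V := V) (ℓ := ℓ) (K := K) (k := 0) (C := C)
      (fun p _ p' _ h => by simpa using h)
      (fun p hp => Finset.mem_union_left _ (hX0 p (hp.trans_le (Nat.mul_le_mul_right _ hVM))))
      (Loc.party i) (encBits (bitEnc f) ℓ) (by simpa using hC.1) hC.2
      (fun β β' h => hK β β' fun q hq => h q fun ⟨p, _, hp⟩ => hq ⟨_, hp⟩) (χ r)
    refine Eq.trans e2 ?_
    rw [setAvg_union hdisj, execWith_setAvg]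
    refine setAvg_congr fun β _ => ?_
    refine Eq.trans (setAvg_congr fun γ hγ => ?_) (setAvg_const Γ _)
    rw [hKu β γ hγ]
    rfl
  · intro x hx
    have hxm : x < m * ℓ := hx.trans_le (Nat.mul_le_mul_right _ hml)
    rcases chalWire_cases (i + s) ℓ P x with h | h <;> rw [h]
    · refine Finset.mem_union_right _ (mem_flipWires.2 ⟨x / ℓ, ?_, x % ℓ, ?_, rfl⟩)
      · exact Nat.div_lt_of_lt_mul (by rwa [Nat.mul_comm] at hxm)
      · exact Nat.mod_lt _ (Nat.pos_of_ne_zero fun h0 => by simp [h0] at hxm)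
    · exact Finset.mem_union_left _ (hX2 x (hxm.trans_le (Nat.mul_le_mul_right _ hmM)))
  · intro β β' h
    funext r
    beta_reduce
    rw [hK β β' fun q hq => h q ?_, htape β β' fun x => h _ ?_]
    · rintro ⟨y, -, hy⟩
      rcases chalWire_cases (i + s) ℓ P y with h | h <;> rw [h] at hy <;> simp at hy
    · rintro ⟨y, -, hy⟩
      rcases chalWire_cases (i + s) ℓ P y with h | h <;> exact hq ⟨_, hy.trans h⟩

theorem tapeStep_congr {s ℓ V m i : ℕ} {f : List Bool → Bool} {b : Bool} {C : Circuit PartyReg}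
    {β β' : Finset Loc} (h : ∀ w, Loc.party (i + s) w ∈ β ↔ Loc.party (i + s) w ∈ β')
    (K : State Loc → ℝ) : tapeStep s ℓ V m f i b C β K = tapeStep s ℓ V m f i b C β' K := by
  funext ψ
  unfold tapeStep tapeChallenge
  rw [bankTape_congr (β := β) (β' := β') fun x => h _]
  have h1 : ∀ (γ : Finset Loc) (P : List Bool × List Bool) (n : ℕ),
      readBits (chalWire (i + s) ℓ P) n (β ∪ γ) = readBits (chalWire (i + s) ℓ P) n (β' ∪ γ) :=
    fun γ P n => readBits_chalWire_congr fun w => by rw [Finset.mem_union, Finset.mem_union, h w]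
  simp only [h1]

theorem tapeFold_cons {s ℓ V m N : ℕ} {f : List Bool → Bool} {b : Fin N → Bool}
    {C : ℕ → Circuit PartyReg} {β : Finset Loc} {i : Fin N} {L : List (Fin N)}
    {K : State Loc → ℝ} : tapeFold s ℓ V m f b C β (i :: L) K =
      tapeStep s ℓ V m f i (b i) (C i) β (tapeFold s ℓ V m f b C β L K) := by
  unfold tapeFold
  rw [List.foldr_cons]

theorem tapeFold_congr {s ℓ V m N : ℕ} {f : List Bool → Bool} {b : Fin N → Bool}
    {C : ℕ → Circuit PartyReg} {L : List (Fin N)} {K : State Loc → ℝ} {β β' : Finset Loc}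
    (h : ∀ i ∈ L, ∀ w, Loc.party (i + s) w ∈ β ↔ Loc.party (i + s) w ∈ β') :
    tapeFold s ℓ V m f b C β L K = tapeFold s ℓ V m f b C β' L K := by
  induction L with
  | nil => unfold tapeFold; rw [List.foldr_nil, List.foldr_nil]
  | cons i L ih =>
    rw [tapeFold_cons, tapeFold_cons, ih fun j hj => h j (List.mem_cons_of_mem _ hj),
      tapeStep_congr (h i (List.mem_cons_self ..))]

/-- Each party reads only its own banks, so the continuation formed by the later parties does not
depend on the banks of the present one; the average passes through the parties one at a time. -/
theorem setAvg_tapeFold {s ℓ V m M N : ℕ} {f : List Bool → Bool} {b : Fin N → Bool}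
    {C : ℕ → Circuit PartyReg} {X : Finset Loc} (hmM : m ≤ M) (hVM : V * V ≤ M)
    {L : List (Fin N)} (hL : L.Nodup) (hC : ∀ i ∈ L, (C i).Bounded V)
    (hX0 : ∀ i ∈ L, ∀ x < M * ℓ, Loc.party (i + s) (.state 0, 0, x) ∈ X)
    (hX2 : ∀ i ∈ L, ∀ x < M * ℓ, Loc.party (i + s) (.state 2, 0, x) ∈ X)
    (hXw : ∀ p x j, Loc.party p (.work 1, x, j) ∉ X) (K : State Loc → ℝ)
    {ψ : State Loc} (hψ : ShortPlain m ψ) :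
    (setAvg X fun β => tapeFold s ℓ V m f b C β L K ψ) = encFold ℓ f b C L K ψ := by
  induction L generalizing ψ with
  | nil => exact setAvg_const _ _
  | cons i L ih =>
    rw [List.nodup_cons] at hL
    have hi := List.mem_cons_self (a := i) (l := L)
    have h1 := setAvg_tapeStep (f := f) (b := b i) (K := fun β => tapeFold s ℓ V m f b C β L K)
      hmM hVM (hC i hi) hψ (hX0 i hi) (hX2 i hi) hXw (fun β β' h => tapeFold_congr fun j hj w => h _ (by
        rintro ⟨w', hw⟩
        have := (Loc.party.inj hw).1
        exact hL.1 (Fin.ext (Nat.add_right_cancel this) ▸ hj)))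
    refine Eq.trans h1 ?_
    change _ = challengeWith ℓ f i (b i) (execWith (encSamples ℓ f) (Loc.party i) (C i)
      (encFold ℓ f b C L K)) ψ
    unfold challengeWith
    refine measure_congr fun S₀ _ φ hφ => ?_
    congr 1
    funext r
    refine execWith_congr_support (P := fun q => ∃ w, q = .party i w) (fun g _ => ⟨_, rfl⟩)
      (fun len src tgt _ _ _ _ q hq => ?_) ?_
    · obtain ⟨t, ht⟩ := ones_subset _ _ hq
      exact ⟨_, ht⟩
    intro φ' hφ'
    refine ih hL.2 (fun j hj => hC j (List.mem_cons_of_mem _ hj))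
      (fun j hj => hX0 j (List.mem_cons_of_mem _ hj))
      (fun j hj => hX2 j (List.mem_cons_of_mem _ hj)) ?_
    have h2 : ShortPlain m φ := fun S hS => hψ S (hφ S hS).2
    refine ShortPlain.of_support (p := i) (ShortPlain.of_support (p := i) (ψ := φ)
      (ψ' := Finsupp.mapDomain (writeStr (regAt (Loc.party i) (.chalLen, 0))
        (regAt (Loc.party i) (.chalData, 0)) (encBits (bitEnc f) ℓ
          (if b i then (readPlaintexts i S₀).2 else (readPlaintexts i S₀).1) r)) φ) h2 ?_)
      fun T hT => ?_
    · intro T hT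
      rw [mapDomain_writeStr, mem_support_flip] at hT
      refine ⟨_, hT, fun q hq => ?_⟩
      rw [Finset.mem_symmDiff, Finset.mem_symmDiff]
      have h1 : ∀ k s, q ∉ ones (regAt (Loc.party i) (k, 0)) s := fun k s h => by
        obtain ⟨j, hj⟩ := ones_subset _ _ h
        exact hq _ hj
      simp only [h1, not_false_eq_true, and_true, false_and, or_self, or_false]
    · obtain ⟨S, hS, h⟩ := hφ' T hT
      exact ⟨S, hS, fun q hq => h q fun ⟨w, hw⟩ => hq w hw⟩

/-! ### The order of challenges and runs -/

theorem challengeWith_comp {ℓ j : ℕ} {f : List Bool → Bool} {b : Bool} {K : State Loc → ℝ}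
    (hK : K 0 = 0) {T : State Loc → State Loc} (hT0 : T 0 = 0)
    (hf : ∀ y ψ, (T ψ).filter (fun S => readPlaintexts j S = y) =
      T (ψ.filter fun S => readPlaintexts j S = y))
    (hw : ∀ s s' ψ, flip (ones (regAt (Loc.party j) (.chalLen, 0)) s ∆
      ones (regAt (Loc.party j) (.chalData, 0)) s') (T ψ) =
        T (flip (ones (regAt (Loc.party j) (.chalLen, 0)) s ∆
          ones (regAt (Loc.party j) (.chalData, 0)) s') ψ)) (ψ : State Loc) :
    challengeWith ℓ f j b K (T ψ) = challengeWith ℓ f j b (fun φ => K (T φ)) ψ := by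
  have h0 : ∀ X : Finset Loc, flip X (0 : State Loc) = 0 := fun X => Finsupp.mapDomain_zero
  unfold challengeWith
  simp only [mapDomain_writeStr]
  rw [measure_eq_sum (Y := (T ψ).support.image (readPlaintexts j) ∪
      ψ.support.image (readPlaintexts j)), measure_eq_sum (Y := (T ψ).support.image (readPlaintexts j) ∪
      ψ.support.image (readPlaintexts j))]
  · simp only [hf, hw]
  · simp only [h0, hT0, hK, avgBits_const, implies_true]
  · exact fun S hS => Finset.mem_union_right _ (Finset.mem_image_of_mem _ hS)
  · simp only [h0, hK, avgBits_const, implies_true]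
  · exact fun S hS => Finset.mem_union_left _ (Finset.mem_image_of_mem _ hS)

/-- The circuit of party `i` acts on wires of party `i` only. It affects neither the plaintexts for
`j` nor the registers into which the challenge for `j` is written. -/
theorem execWith_challengeWith {ℓ i j : ℕ} (hij : i ≠ j) {f : List Bool → Bool} {b : Bool}
    {K : State Loc → ℝ} (hK : Quad K) (O : Oracle) (C : Circuit PartyReg) :
    execWith O (Loc.party i) C (challengeWith ℓ f j b K) =
      challengeWith ℓ f j b (execWith O (Loc.party i) C K) := by
  have hX : ∀ w s s', Loc.party i w ∉ ones (regAt (Loc.party j) (.chalLen, 0)) s ∆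
      ones (regAt (Loc.party j) (.chalData, 0)) s' := by
    intro w s s' h
    rcases Finset.mem_symmDiff.1 h with h | h <;> obtain ⟨t, ht⟩ := ones_subset _ _ h.1 <;>
      exact hij (Loc.party.inj ht).1
  have hR : ∀ S T : Finset Loc, (∀ q, (∀ w, q ≠ .party i w) → (q ∈ S ↔ q ∈ T)) →
      readPlaintexts j S = readPlaintexts j T := fun S T h => readPlaintexts_congr fun q hq => by
    obtain ⟨t, rfl | ⟨c, rfl⟩⟩ := hq <;> exact h _ (by simp)
  induction C with
  | nil => rfl
  | cons o C ih =>
    funext ψ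
    have h0 := (hK.execWith O (Loc.party i) C).zero
    rcases o with g | ⟨len, src, tgt⟩
    · simp only [execWith, ih]
      refine challengeWith_comp h0 (T := fun φ => (g.map (Loc.party i)).apply φ) (map_zero _) ?_ ?_ ψ
      · intro y φ
        refine filter_exec (e := Loc.party i) (fun S w => hR _ _ fun q hq => ?_) [.gate g] y φ
        simp [Finset.mem_symmDiff, hq w]
      · intro s s' φ
        exact (flip_exec (Loc.party i) (C := [.gate g]) (fun _ _ _ _ => hX _ _ _) φ).symm
    · simp only [execWith, ih]
      have h1 : ∀ r, challengeWith ℓ f j b (execWith O (Loc.party i) C K)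
          (Finsupp.mapDomain (queryMap (Loc.party i) len src tgt fun m => O.fn m r) ψ) =
          challengeWith ℓ f j b (fun φ => execWith O (Loc.party i) C K
            (Finsupp.mapDomain (queryMap (Loc.party i) len src tgt fun m => O.fn m r) φ)) ψ := by
        intro r
        refine challengeWith_comp h0 Finsupp.mapDomain_zero ?_ ?_ ψ
        · exact fun y φ => filter_mapDomain (fun S => hR _ _ fun q hq => mem_queryMap fun t => hq _) y φ
        · intro s s' φ
          unfold flip
          rw [← Finsupp.mapDomain_comp, ← Finsupp.mapDomain_comp]
          congr 1
          funext S
          simp only [Function.comp, queryMap, xorBits]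
          have : readBits (regAt (Loc.party i) src) len (S ∆ (ones (regAt (Loc.party j) (.chalLen, 0)) s ∆
              ones (regAt (Loc.party j) (.chalData, 0)) s')) =
              readBits (regAt (Loc.party i) src) len S := readBits_congr fun t _ => by
            rw [Finset.mem_symmDiff]
            simp only [regAt, hX, not_false_eq_true, and_true, false_and, or_false]
          rw [this]
          split_ifs
          · rfl
          · exact symmDiff_right_comm _ _ _
      simp only [h1]
      unfold challengeWith
      rw [measure_avgBits]
      simp only [avgBits_comm (O.coins len)]

theorem challengeWith_quad {ℓ j : ℕ} {f : List Bool → Bool} {b : Bool} {K : State Loc → ℝ}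
    (hK : Quad K) : Quad (challengeWith ℓ f j b K) := by
  intro c ψ
  have h0 := hK.zero
  unfold challengeWith
  rw [measure_eq_sum (Y := ψ.support.image (readPlaintexts j)),
    measure_eq_sum (Y := ψ.support.image (readPlaintexts j)), Finset.mul_sum]
  · refine Finset.sum_congr rfl fun y _ => ?_
    rw [← avgBits_mul]
    simp only [Finsupp.filter_smul, Finsupp.mapDomain_smul, hK c]
  · simp only [Finsupp.mapDomain_zero, h0, avgBits_const, implies_true]
  · exact fun S hS => Finset.mem_image_of_mem _ hS
  · simp only [Finsupp.mapDomain_zero, h0, avgBits_const, implies_true]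
  · exact fun S hS => Finset.mem_image_of_mem _ (Finsupp.support_smul hS)

/-- In the reduction a party prepares its challenge when its turn comes, whereas the game hands out
all challenges before the first run. The later challenges are moved past the earlier runs by
commutation. -/
theorem encFold_eq {ℓ N : ℕ} {f : List Bool → Bool} {b : Fin N → Bool}
    {C : ℕ → Circuit PartyReg} {L : List (Fin N)} (hL : L.Nodup) {K : State Loc → ℝ}
    (hK : Quad K) : encFold ℓ f b C L K =
      L.foldr (fun (i : Fin N) K' => challengeWith ℓ f i (b i) K')
        (L.foldr (fun (i : Fin N) K' => execWith (encSamples ℓ f) (Loc.party i) (C i) K') K) := by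
  have hq : ∀ L : List (Fin N), Quad (L.foldr (fun (i : Fin N) K' =>
      execWith (encSamples ℓ f) (Loc.party i) (C i) K') K) := by
    intro L
    induction L with
    | nil => exact hK
    | cons i L ih => exact ih.execWith _ _ _
  have hcomm : ∀ (i : Fin N) (L : List (Fin N)), i ∉ L → ∀ K : State Loc → ℝ, Quad K →
      execWith (encSamples ℓ f) (Loc.party i) (C i)
        (L.foldr (fun (i : Fin N) K' => challengeWith ℓ f i (b i) K') K) =
      L.foldr (fun (i : Fin N) K' => challengeWith ℓ f i (b i) K')
        (execWith (encSamples ℓ f) (Loc.party i) (C i) K) := by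
    intro i L
    induction L with
    | nil => exact fun _ K _ => rfl
    | cons j L ih =>
      intro hi K hK
      rw [List.mem_cons, not_or] at hi
      have hq' : Quad (L.foldr (fun (i : Fin N) K' => challengeWith ℓ f i (b i) K') K) := by
        clear ih hi
        induction L with
        | nil => exact hK
        | cons i L ih => exact challengeWith_quad ih
      simp only [List.foldr_cons]
      rw [execWith_challengeWith (fun h => hi.1 (Fin.ext h)) hq', ih hi.2 K hK]
  induction L with
  | nil => rfl
  | cons i L ih =>
    rw [List.nodup_cons] at hL
    have h1 : encFold ℓ f b C (i :: L) K = challengeWith ℓ f i (b i)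
      (execWith (encSamples ℓ f) (Loc.party i) (C i) (encFold ℓ f b C L K)) := rfl
    rw [h1, ih hL.2, hcomm i L hL.1 _ (hq L)]
    rfl

/-! ### The banks of samples -/

/-- The wires with the random strings of a bank. -/
def bankR (ρ : Bank) (p : ℕ) : Loc := pirateLoc (ρ.1, ρ.2.2, p)

/-- The wires with the values of the function at the strings of a bank. -/
def bankA (ρ : Bank) (a : ℕ) : Loc := pirateLoc (ρ.2.1, ρ.2.2, a)

theorem mem_banks {N s : ℕ} {ρ : Bank} : ρ ∈ banks N s ↔ ρ = (.work 0, .work 1, 0) ∨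
    ∃ i < N, ρ = (.state 0, .state 1, i + s) ∨ ρ = (.state 2, .state 3, i + s) := by
  simp [banks]

theorem nodup_banks (N s : ℕ) : (banks N s).Nodup := by
  rw [banks, List.singleton_append, List.nodup_cons, List.nodup_flatMap]
  refine ⟨by simp, fun i _ => by simp, ?_⟩
  refine List.Pairwise.imp_of_mem ?_ List.nodup_range
  intro i j _ _ hij
  simp [Function.onFun, hij.symm]

/-- The wires of the banks. -/
def BankWire (s : ℕ) (q : Loc) : Prop :=
  (∃ c < 2, ∃ w, q = .pirate (.work c, w)) ∨
    ∃ p, s ≤ p ∧ ∃ c < 4, ∃ w, q = .party p (.state c, w)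

theorem bankWire_bankR {N s : ℕ} {ρ : Bank} (h : ρ ∈ banks N s) (p : ℕ) :
    BankWire s (bankR ρ p) := by
  obtain rfl | ⟨i, -, rfl | rfl⟩ := mem_banks.1 h
  · exact Or.inl ⟨0, by omega, _, rfl⟩
  · exact Or.inr ⟨i + s, by omega, 0, by omega, _, rfl⟩
  · exact Or.inr ⟨i + s, by omega, 2, by omega, _, rfl⟩

theorem bankWire_bankA {N s : ℕ} {ρ : Bank} (h : ρ ∈ banks N s) (a : ℕ) :
    BankWire s (bankA ρ a) := by
  obtain rfl | ⟨i, -, rfl | rfl⟩ := mem_banks.1 h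
  · exact Or.inl ⟨1, by omega, _, rfl⟩
  · exact Or.inr ⟨i + s, by omega, 1, by omega, _, rfl⟩
  · exact Or.inr ⟨i + s, by omega, 3, by omega, _, rfl⟩

theorem bankR_inj {N s : ℕ} {ρ ρ' : Bank} (h : ρ ∈ banks N s) (h' : ρ' ∈ banks N s) {p p' : ℕ}
    (he : bankR ρ p = bankR ρ' p') : ρ = ρ' ∧ p = p' := by
  have he' := pirateLoc_injective he
  obtain rfl | ⟨i, -, rfl | rfl⟩ := mem_banks.1 h <;>
    obtain rfl | ⟨i', -, rfl | rfl⟩ := mem_banks.1 h' <;> simp_all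

theorem bankA_inj {N s : ℕ} {ρ ρ' : Bank} (h : ρ ∈ banks N s) (h' : ρ' ∈ banks N s) {a a' : ℕ}
    (he : bankA ρ a = bankA ρ' a') : ρ = ρ' ∧ a = a' := by
  have he' := pirateLoc_injective he
  obtain rfl | ⟨i, -, rfl | rfl⟩ := mem_banks.1 h <;>
    obtain rfl | ⟨i', -, rfl | rfl⟩ := mem_banks.1 h' <;> simp_all

theorem bankR_ne_bankA {N s : ℕ} {ρ ρ' : Bank} (h : ρ ∈ banks N s) (h' : ρ' ∈ banks N s)
    (p a : ℕ) : bankR ρ p ≠ bankA ρ' a := by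
  intro he
  have he' := pirateLoc_injective he
  obtain rfl | ⟨i, -, rfl | rfl⟩ := mem_banks.1 h <;>
    obtain rfl | ⟨i', -, rfl | rfl⟩ := mem_banks.1 h' <;> simp_all

/-- The wires with the random strings of all banks. -/
def bankWires (N s ℓ M : ℕ) : Finset Loc :=
  (((banks N s).flatMap fun ρ => (List.range (M * ℓ)).map fun p =>
    ((ρ.1, ρ.2.2, p) : Wire PirateReg)).map pirateLoc).toFinset

theorem mem_bankWires {N s ℓ M : ℕ} {q : Loc} :
    q ∈ bankWires N s ℓ M ↔ ∃ ρ ∈ banks N s, ∃ p < M * ℓ, q = bankR ρ p := by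
  simp only [bankWires, List.mem_toFinset, List.mem_map, List.mem_flatMap, List.mem_range]
  constructor
  · rintro ⟨_, ⟨ρ, hρ, p, hp, rfl⟩, rfl⟩; exact ⟨ρ, hρ, p, hp, rfl⟩
  · rintro ⟨ρ, hρ, p, hp, rfl⟩; exact ⟨_, ⟨ρ, hρ, p, hp, rfl⟩, rfl⟩

theorem exec_randomBanks {N s ℓ M : ℕ} {K : State Loc → ℝ} {D : Loc → Prop} (hK : Dec D K)
    (hQ : Quad K) (hD : ∀ q ∈ bankWires N s ℓ M, D q) {χ : State Loc}
    (hχ : ∀ S ∈ χ.support, ∀ q ∈ S, ¬ BankWire s q) :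
    K (exec pirateLoc ((banks N s).flatMap (randomBank ℓ M)) χ) =
      setAvg (bankWires N s ℓ M) fun β => K (flip β χ) := by
  have h1 : (banks N s).flatMap (randomBank ℓ M) = ((banks N s).flatMap fun ρ =>
      (List.range (M * ℓ)).map fun p => ((ρ.1, ρ.2.2, p) : Wire PirateReg)).map
        fun q => Op.gate (.H q) := by
    rw [List.map_flatMap]
    refine List.flatMap_congr fun ρ _ => ?_
    rw [randomBank, List.map_map]
    exact (List.map_eq_flatMap ..).symm
  rw [h1, hadamards _ _ ?_ hK hQ ?_ χ ?_]
  · rfl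
  · refine List.Nodup.map pirateLoc_injective ?_
    rw [List.nodup_flatMap]
    refine ⟨fun ρ _ => List.Nodup.map (fun p p' h => by simpa using h) List.nodup_range, ?_⟩
    refine List.Pairwise.imp_of_mem ?_ (nodup_banks N s)
    intro ρ ρ' hρ hρ' hne q hq hq'
    obtain ⟨p, -, rfl⟩ := List.mem_map.1 hq
    obtain ⟨p', -, h⟩ := List.mem_map.1 hq'
    exact hne (bankR_inj hρ hρ' (congrArg pirateLoc h.symm)).1
  · intro q hq
    exact hD _ (List.mem_toFinset.2 (List.mem_map_of_mem hq))
  · intro S hS q hq hqS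
    obtain ⟨ρ, hρ, p, -, h⟩ := mem_bankWires.1 (List.mem_toFinset.2 (List.mem_map_of_mem hq))
    exact hχ S hS _ hqS (h ▸ bankWire_bankR hρ p)

/-- The values of the function at the random strings. -/
def answerSet (ℓ : ℕ) (f : List Bool → Bool) (β : Finset Loc) (T : Finset (Bank × ℕ)) :
    Finset Loc :=
  (T.filter fun t => f (readBits (fun x => bankR t.1 (t.2 * ℓ + x)) ℓ β) = true).image
    fun t => bankA t.1 t.2

theorem mem_answerSet {ℓ : ℕ} {f : List Bool → Bool} {β : Finset Loc} {T : Finset (Bank × ℕ)}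
    {q : Loc} (h : q ∈ answerSet ℓ f β T) : ∃ t ∈ T, q = bankA t.1 t.2 := by
  obtain ⟨t, ht, rfl⟩ := Finset.mem_image.1 h
  exact ⟨t, (Finset.mem_filter.1 ht).1, rfl⟩

theorem bankA_mem_answerSet {N s ℓ : ℕ} {f : List Bool → Bool} {β : Finset Loc}
    {T : Finset (Bank × ℕ)} (hT : ∀ t ∈ T, t.1 ∈ banks N s) {t : Bank × ℕ} (ht : t.1 ∈ banks N s) :
    bankA t.1 t.2 ∈ answerSet ℓ f β T ↔
      t ∈ T ∧ f (readBits (fun x => bankR t.1 (t.2 * ℓ + x)) ℓ β) = true := by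
  rw [answerSet, Finset.mem_image]
  constructor
  · rintro ⟨t', h, h'⟩
    rw [Finset.mem_filter] at h
    obtain ⟨h1, h2⟩ := bankA_inj (hT _ h.1) ht h'
    have : t' = t := Prod.ext h1 h2
    exact this ▸ h
  · exact fun h => ⟨t, Finset.mem_filter.2 h, rfl⟩

/-- For fixed random strings each evaluation gives its value with certainty and is undone
completely, so its only effect is a flip of the answer qubit. The copy that occurs in `χ` is the
same afterwards and serves for all samples. Certainty is assumed for every content `Z` of the banks
because the banks fill up in the course of the induction. -/
theorem exec_evalSamples {N s ℓ : ℕ} {f : List Bool → Bool} {β : Finset Loc}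
    (hβ : ∀ q ∈ β, BankWire s q) {χ : State Loc} (hχ : ∀ S ∈ χ.support, ∀ q ∈ S, ¬ BankWire s q)
    {E : Circuit ProgReg}
    (hcert : ∀ Z : Finset Loc, (∀ q ∈ Z, BankWire s q) →
      Certain pirateLoc (Circuit.relabel (evalWire N) E) (fun j => Loc.pirate (.work 2, 0, j))
        (.pirate (.work 3, 0, 0)) ℓ f (flip Z χ))
    {T : List (Bank × ℕ)} (hT : T.Nodup) (hTb : ∀ t ∈ T, t.1 ∈ banks N s) :
    exec pirateLoc (T.flatMap fun t => evalSample N ℓ E t.1 t.2) (flip β χ) =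
      flip (β ∆ answerSet ℓ f β T.toFinset) χ := by
  -- Samples are split off at the end, since the last evaluation is applied to the result of all
  -- earlier ones.
  induction T using List.reverseRecOn with
  | nil => simp [exec, answerSet, symmDiff_none]
  | append_singleton T t ih =>
    have hT' := List.nodup_append.1 hT
    have hTb' : ∀ t ∈ T, t.1 ∈ banks N s := fun t' h => hTb t' (List.mem_append_left _ h)
    have ht := hTb t (by simp)
    have htT : t ∉ T := fun h => hT'.2.2 t h t (by simp) rfl
    rw [List.flatMap_append, exec_append, ih hT'.1 hTb', List.flatMap_singleton]
    obtain ⟨ρ, a⟩ := t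
    set x := readBits (fun t => bankR ρ (a * ℓ + t)) ℓ β with hx
    have hYb : ∀ q ∈ β ∆ answerSet ℓ f β T.toFinset, BankWire s q := by
      intro q hq
      rcases Finset.mem_symmDiff.1 hq with h | h
      · exact hβ q h.1
      · obtain ⟨t, ht, rfl⟩ := mem_answerSet h.1
        exact bankWire_bankA (hTb' t (List.mem_toFinset.1 ht)) _
    have hnb : ∀ c w, 2 ≤ c → ¬ BankWire s (.pirate (.work c, w)) := by
      rintro c w hc (⟨c', hc', w', h⟩ | ⟨p, -, c', -, w', h⟩)
      · simp at h; omega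
      · simp at h
    have hread : ∀ S ∈ (flip (β ∆ answerSet ℓ f β T.toFinset) χ).support,
        readBits (fun t => bankR ρ (a * ℓ + t)) ℓ S = x := by
      intro S hS
      rw [mem_support_flip] at hS
      refine readBits_congr fun j _ => ?_
      have h1 := bankWire_bankR ht (a * ℓ + j)
      have h2 : bankR ρ (a * ℓ + j) ∉ S ∆ (β ∆ answerSet ℓ f β T.toFinset) :=
        fun h => hχ _ hS _ h h1
      have h3 : bankR ρ (a * ℓ + j) ∉ answerSet ℓ f β T.toFinset := fun h => by
        obtain ⟨t, ht', h'⟩ := mem_answerSet h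
        exact bankR_ne_bankA ht (hTb' t (List.mem_toFinset.1 ht')) _ _ h'
      rw [Finset.mem_symmDiff, Finset.mem_symmDiff] at h2
      tauto
    have hne2 : ∀ i j, bankR ρ (a * ℓ + i) ≠ .pirate (.work 2, 0, j) := fun i j h =>
      hnb 2 _ le_rfl (h ▸ bankWire_bankR ht _)
    have hne3 : Loc.pirate (.work 3, 0, 0) ≠ bankA ρ a := fun h =>
      hnb 3 (0, 0) (by omega) (h ▸ bankWire_bankA ht _)
    rw [evalSample, exec_compute pirateLoc (o := (.work 3, 0, 0)) (ans := (ρ.2.1, ρ.2.2, a))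
      (src := fun t => bankR ρ (a * ℓ + t)) (X := ones (fun j => Loc.pirate (.work 2, 0, j)) x)
      (b := f x) (n := ℓ) (x := x) ?_ hread ?_ ?_ ?_ ?_ ?_, flip_flip]
    · congr 1
      rw [symmDiff_assoc]
      congr 1
      ext q
      by_cases hq : ∃ t : Bank × ℕ, t.1 ∈ banks N s ∧ q = bankA t.1 t.2
      · obtain ⟨t, ht1, rfl⟩ := hq
        have e1 := bankA_mem_answerSet (ℓ := ℓ) (f := f) (β := β) (T := T.toFinset)
          (fun t h => hTb' t (List.mem_toFinset.1 h)) ht1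
        have e2 := bankA_mem_answerSet (ℓ := ℓ) (f := f) (β := β) (T := (T ++ [(ρ, a)]).toFinset)
          (fun t h => hTb t (List.mem_toFinset.1 h)) ht1
        rw [Finset.mem_symmDiff, e1, e2]
        by_cases hta : t = (ρ, a)
        · subst hta
          have h3 : pirateLoc (ρ.2.1, ρ.2.2, a) = bankA ρ a := rfl
          rw [h3]
          cases hfx : f x <;> simp [htT, hfx, hx.symm]
        · have h3 : bankA t.1 t.2 ∉ (if f x then {pirateLoc (ρ.2.1, ρ.2.2, a)} else ∅ : Finset Loc) := by
            intro h
            split_ifs at h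
            · rw [Finset.mem_singleton] at h
              exact hta (Prod.ext (bankA_inj ht1 ht h).1 (bankA_inj ht1 ht h).2)
            · simp at h
          simp [h3, hta]
      · have h1 : ∀ T' : List (Bank × ℕ), (∀ t ∈ T', t.1 ∈ banks N s) →
            q ∉ answerSet ℓ f β T'.toFinset := fun T' hT' h => by
          obtain ⟨t, ht', h'⟩ := mem_answerSet h
          exact hq ⟨t, hT' t (List.mem_toFinset.1 ht'), h'⟩
        have h2 : q ∉ (if f x then {pirateLoc (ρ.2.1, ρ.2.2, a)} else ∅ : Finset Loc) := by
          intro h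
          split_ifs at h
          · rw [Finset.mem_singleton] at h
            exact hq ⟨(ρ, a), ht, h⟩
          · simp at h
        have h3 := h1 _ hTb'
        have h4 := h1 _ hTb
        exact iff_of_false (fun h => (Finset.mem_symmDiff.1 h).elim (fun h => h3 h.1) fun h => h2 h.1) h4
    · intro φ hφ
      rw [copyInput, exec_copy pirateLoc (fun t => (ρ.1, ρ.2.2, a * ℓ + t)) (fun t => (.work 2, 0, t))
        (fun i j h => by simpa using pirateLoc_injective h) fun i j => hne2 i j]
      refine mapDomain_eq_flip fun S hS => ?_
      rw [show readBits (fun t => pirateLoc (ρ.1, ρ.2.2, a * ℓ + t)) ℓ S = x from hφ S hS]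
      rfl
    · exact hcert _ hYb x (length_readBits _ _ _)
    · refine Circuit.On.relabel fun g _ q _ h => ?_
      have h1 : BankWire s (pirateLoc (evalWire N q)) := h ▸ bankWire_bankA ht a
      rcases q with ⟨_ | _ | _ | c, x, j⟩
      · rcases h1 with ⟨_, _, _, h1⟩ | ⟨_, _, _, _, _, h1⟩ <;> simp [evalWire, placeWire, evalKind, pirateLoc] at h1
      · exact hnb 2 _ le_rfl h1
      · exact hnb 3 _ (by omega) h1
      · exact hnb (2 * c + 4) _ (by omega) h1
    · exact hne3
    · exact fun j => bankR_ne_bankA ht ht _ _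
    · intro j h
      obtain ⟨t, ht'⟩ := ones_subset _ _ h
      exact hne2 j t ht'

/-- The values of the function at the random strings of all banks. -/
def answers (N s ℓ M : ℕ) (f : List Bool → Bool) (β : Finset Loc) : Finset Loc :=
  answerSet ℓ f β (banks N s ×ˢ List.range M).toFinset

theorem mem_answers {N s ℓ M : ℕ} {f : List Bool → Bool} {β : Finset Loc} {q : Loc}
    (h : q ∈ answers N s ℓ M f β) : ∃ ρ ∈ banks N s, ∃ a, q = bankA ρ a := by
  obtain ⟨t, ht, rfl⟩ := mem_answerSet h
  rw [List.mem_toFinset, List.mem_product] at ht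
  exact ⟨t.1, ht.1, t.2, rfl⟩

theorem exec_evalBanks {N s ℓ M : ℕ} {f : List Bool → Bool} {β : Finset Loc}
    (hβ : ∀ q ∈ β, BankWire s q) {χ : State Loc} (hχ : ∀ S ∈ χ.support, ∀ q ∈ S, ¬ BankWire s q)
    {E : Circuit ProgReg}
    (hcert : ∀ Z : Finset Loc, (∀ q ∈ Z, BankWire s q) →
      Certain pirateLoc (Circuit.relabel (evalWire N) E) (fun j => Loc.pirate (.work 2, 0, j))
        (.pirate (.work 3, 0, 0)) ℓ f (flip Z χ)) :
    exec pirateLoc ((banks N s).flatMap (evalBank N ℓ M E)) (flip β χ) =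
      flip (β ∆ answers N s ℓ M f β) χ := by
  have h1 : (banks N s).flatMap (evalBank N ℓ M E) =
      (banks N s ×ˢ List.range M).flatMap fun t => evalSample N ℓ E t.1 t.2 := by
    change _ = ((banks N s).flatMap fun ρ => (List.range M).map (Prod.mk ρ)).flatMap _
    rw [List.flatMap_assoc]
    refine List.flatMap_congr fun ρ _ => ?_
    rw [List.flatMap_map]
    rfl
  rw [h1]
  refine exec_evalSamples hβ hχ hcert ((nodup_banks N s).product List.nodup_range) ?_
  intro t ht
  exact (List.mem_product.1 ht).1

/-- Wires for strings and wires for values are disjoint, so adding the answers does not alter the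
strings, and the answer qubits are not set by `β`. -/
theorem bankOK_answers {N s ℓ M : ℕ} {f : List Bool → Bool} {β anc : Finset Loc}
    (hβ : β ⊆ bankWires N s ℓ M)
    (hanc : ∀ q, BankWire s q → (q ∈ anc ↔ q ∈ β ∆ answers N s ℓ M f β)) {ρ : Bank}
    (hρ : ρ ∈ banks N s) : BankOK ℓ M f β anc (bankR ρ) (bankA ρ) := by
  constructor
  · intro x _
    rw [hanc _ (bankWire_bankR hρ x), Finset.mem_symmDiff]
    have : bankR ρ x ∉ answers N s ℓ M f β := fun h => by
      obtain ⟨ρ', hρ', a, h'⟩ := mem_answers h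
      exact bankR_ne_bankA hρ hρ' _ _ h'
    simp [this]
  · intro a ha
    rw [hanc _ (bankWire_bankA hρ a), Finset.mem_symmDiff]
    have h1 : bankA ρ a ∉ β := fun h => by
      obtain ⟨ρ', hρ', p, -, h'⟩ := mem_bankWires.1 (hβ h)
      exact bankR_ne_bankA hρ' hρ _ _ h'.symm
    have h2 := bankA_mem_answerSet (ℓ := ℓ) (f := f) (β := β)
      (T := (banks N s ×ˢ List.range M).toFinset) (t := (ρ, a))
      (fun t ht => (List.mem_product.1 (List.mem_toFinset.1 ht)).1) hρ
    have h3 : (ρ, a) ∈ (banks N s ×ˢ List.range M).toFinset :=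
      List.mem_toFinset.2 (List.mem_product.2 ⟨hρ, List.mem_range.2 ha⟩)
    simp only [h1, not_false_eq_true, and_true, false_and, false_or]
    exact h2.trans (and_iff_right h3)

/-! ### The simulation of the game -/

theorem length_encBits_le (f : List Bool → Bool) (ℓ : ℕ) (m r : List Bool) :
    (encBits (bitEnc f) ℓ m r).length ≤ m.length * (ℓ + 1) := by
  induction m generalizing r with
  | nil => simp [encBits]
  | cons b m ih =>
    rw [encBits, List.length_append, List.length_cons, Nat.add_mul, Nat.add_comm, Nat.one_mul]
    refine Nat.add_le_add (ih _) ?_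
    simp only [bitEnc, List.length_append, List.length_take, List.length_singleton]
    omega

/-- The wires that a circuit of the pirate may change. -/
def PirateTarget (m : ℕ) (q : Loc) : Prop := ∀ i j, m ≤ j → q ≠ .pirate (.len, i, j)

/-- A bound for the length of the plaintexts: gates of the pirate reach positions up to `V` only,
and answers to its queries have at most `V * (ℓ + 1)` bits. A fixed number of oracle calls by each
freeloader therefore suffices for every challenge. -/
theorem pirateTarget_gate {V m : ℕ} (hm : V < m) {C : Circuit PirateReg} (hC : C.Bounded V) :
    ∀ g, Op.gate g ∈ C → PirateTarget m (pirateLoc g.target) := by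
  intro g hg i j hj h
  have h1 := (hC.2 _ hg) _ g.target_mem_wires
  have h2 : pirateLoc g.target = pirateLoc (.len, i, j) := h
  rw [pirateLoc_injective h2] at h1
  have := h1.2
  simp only at this
  omega

theorem pirateTarget_query {V m ℓ : ℕ} (hm : V * (ℓ + 1) ≤ m) (f : List Bool → Bool)
    {C : Circuit PirateReg} (hC : C.Bounded V) : ∀ len src tgt, Op.query len src tgt ∈ C →
      ∀ x r, x.length = len → ∀ q ∈ ones (regAt pirateLoc tgt) (encBits (bitEnc f) ℓ x r),
        PirateTarget m q := by
  intro len src tgt hq x r hx q hq' i j hj h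
  have h1 : len ≤ V := (hC.2 _ hq).1
  have h2 := length_encBits_le f ℓ x r
  obtain ⟨t, ht, rfl⟩ := Finset.mem_image.1 hq'
  rw [Finset.mem_filter, Finset.mem_range] at ht
  have h3 : pirateLoc (tgt.1, tgt.2, t) = pirateLoc (.len, i, j) := h
  have h4 := pirateLoc_injective h3
  simp only [Prod.mk.injEq] at h4
  have h5 : x.length * (ℓ + 1) ≤ V * (ℓ + 1) := Nat.mul_le_mul_right _ (hx ▸ h1)
  omega

theorem shortPlain_of_pirate {m : ℕ} {ψ ψ' : State Loc}
    (hψ : ∀ S ∈ ψ.support, ∀ i j, Loc.pirate (.len, i, j) ∉ S)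
    (h : ∀ T ∈ ψ'.support, ∃ S ∈ ψ.support, ∀ q, ¬ PirateTarget m q → (q ∈ T ↔ q ∈ S)) :
    ShortPlain m ψ' := by
  intro T hT i j hj
  obtain ⟨S, hS, h'⟩ := h T hT
  rw [h' _ fun h => h i j hj rfl]
  exact hψ S hS i j

section
variable {s ℓ V m M N Np : ℕ} {f : List Bool → Bool} {b : Fin N → Bool}
  {C : Circuit PirateReg} {Cs : ℕ → Circuit PartyReg} {Kf Ku : State Loc → ℝ} {ψ : State Loc}

theorem not_mem_bankWires_work {N s ℓ M : ℕ} (p x j : ℕ) :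
    Loc.party p (.work 1, x, j) ∉ bankWires N s ℓ M := by
  intro h
  obtain ⟨ρ, hρ, t, -, h'⟩ := mem_bankWires.1 h
  rcases h' ▸ bankWire_bankR hρ t with ⟨_, _, _, h1⟩ | ⟨_, _, _, _, _, h1⟩ <;> simp at h1

/-- For fixed contents of the banks the whole reduction is a run of the simulated game, in which the
random strings come from tapes; what the banks and flags contain is carried along as ancillas. -/
theorem flipFold_simPirate (hNp : N ≤ Np) (hmV : V < m) (hmq : V * (ℓ + 1) ≤ m) (hmM : m ≤ M)
    (hVM : V * V ≤ M) (hC : C.Bounded V) (hCs : ∀ i < N, (Cs i).Bounded V) {β : Finset Loc}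
    (hβ : β ⊆ bankWires Np s ℓ M) {anc : Finset Loc}
    (hanc : ∀ q, BankWire s q → (q ∈ anc ↔ q ∈ β ∆ answers Np s ℓ M f β))
    (hancφ : ∀ q, moveLoc s q ∉ anc)
    (hancw : ∀ i < N, ∀ c < 6, ∀ x j, Loc.party (i + s) (.work c, x, j) ∉ anc)
    (hψ : ∀ S ∈ ψ.support, ∀ i j, Loc.pirate (.len, i, j) ∉ S)
    (hdec : Dec KeptReg Kf) (hquad : Quad Kf)
    (hK : ∀ anc' ψ', (∀ q, (∀ p, ∀ c < 6, ∀ w, q ≠ .party p (.work c, w)) →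
      (q ∈ anc' ↔ q ∈ anc)) → Kf (emb (moveLoc s) anc' ψ') = Ku ψ') :
    flipFold s ℓ V m f b Cs (List.finRange N) Kf
      (exec pirateLoc (simPirate s ℓ V C) (emb (moveLoc s) anc ψ)) =
    tapeFold s ℓ V m f b Cs β (List.finRange N) Ku
      (execTape pirateLoc (encBits (bitEnc f) ℓ)
        (bankTape ℓ V (fun p => .pirate (.work 0, 0, p)) β) 0 C ψ) := by
  have hb0 := bankOK_answers hβ hanc (ρ := (.work 0, .work 1, 0)) (mem_banks.2 (Or.inl rfl))
  have h1 := exec_sim (moveLoc_injective s) (eu := pirateLoc) (ef := pirateLoc) (rk := pirateKind)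
    (sh := pirateShift s) (kr := .work 0) (ka := .work 1) (bt := β) (f := f)
    pirateLoc_injective (moveLoc_pirateLoc s) pirateLoc_injective
    (fun p w => pirate_ne_moveLoc (c := 0) (by omega) _ _)
    (fun p w => pirate_ne_moveLoc (c := 1) (by omega) _ _)
    hancφ (fun p hp => hb0.1 p (hp.trans_le (Nat.mul_le_mul_right _ hVM)))
    (fun a ha => hb0.2 a (ha.trans_le hVM)) (k := 0) (by simpa using hC.1) hC.2 ψ
  rw [simPirate, h1]
  refine flipFold_emb hmM hVM (List.nodup_finRange N) (fun i _ => hCs i i.2)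
    (fun p x j h => not_mem_bankWires_work _ _ _ (hβ h)) hdec hquad hancφ ?_ ?_ hK
  · intro i _
    have hi : (i : ℕ) < Np := i.2.trans_le hNp
    exact ⟨bankOK_answers hβ hanc (ρ := (.state 0, .state 1, i + s))
      (mem_banks.2 (Or.inr ⟨i, hi, Or.inl rfl⟩)),
      bankOK_answers hβ hanc (ρ := (.state 2, .state 3, i + s))
      (mem_banks.2 (Or.inr ⟨i, hi, Or.inr rfl⟩)), fun c hc x j => hancw i i.2 c hc x j⟩
  · refine shortPlain_of_pirate hψ fun T hT => ?_
    exact support_execTape (pirateTarget_gate hmV hC)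
      (fun len src tgt hq k x hx => pirateTarget_query hmq f hC len src tgt hq x _ hx) hT

/-- The bits in the bank of the pirate are turned into coins of its oracle first; the banks of the
parties follow inside the continuation. -/
theorem setAvg_pirate (hNp : N ≤ Np) (hmV : V < m) (hmq : V * (ℓ + 1) ≤ m) (hmM : m ≤ M)
    (hVM : V * V ≤ M) (hC : C.Bounded V) (hCs : ∀ i < N, (Cs i).Bounded V)
    (hψ : ∀ S ∈ ψ.support, ∀ i j, Loc.pirate (.len, i, j) ∉ S) :
    (setAvg (bankWires Np s ℓ M) fun β => tapeFold s ℓ V m f b Cs β (List.finRange N) Ku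
      (execTape pirateLoc (encBits (bitEnc f) ℓ)
        (bankTape ℓ V (fun p => .pirate (.work 0, 0, p)) β) 0 C ψ)) =
    execWith (encSamples ℓ f) pirateLoc C (encFold ℓ f b Cs (List.finRange N) Ku) ψ := by
  have hX : ∀ ρ ∈ banks Np s, ∀ p < M * ℓ, bankR ρ p ∈ bankWires Np s ℓ M := fun ρ hρ p hp =>
    mem_bankWires.2 ⟨ρ, hρ, p, hp, rfl⟩
  -- The parties read wires of parties only, so the continuation does not depend on the bank of the
  -- pirate, and each bit of that bank is used at most once.
  have e1 := setAvg_execTape (X := bankWires Np s ℓ M) (R := fun p => .pirate (.work 0, 0, p))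
    (V := V) (ℓ := ℓ) (K := fun β => tapeFold s ℓ V m f b Cs β (List.finRange N) Ku) (k := 0)
    (C := C) (fun p _ p' _ h => by simpa using h)
    (fun p hp => hX (.work 0, .work 1, 0) (mem_banks.2 (Or.inl rfl)) p
      (hp.trans_le (Nat.mul_le_mul_right _ hVM)))
    pirateLoc (encBits (bitEnc f) ℓ) (by simpa using hC.1) hC.2
    (fun β β' h => tapeFold_congr fun i _ w => h _ (by simp)) ψ
  have e2 := execWith_setAvg (encSamples ℓ f) pirateLoc C (bankWires Np s ℓ M)
    (fun β => tapeFold s ℓ V m f b Cs β (List.finRange N) Ku) ψ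
  have e3 : execWith (encSamples ℓ f) pirateLoc C (fun φ => setAvg (bankWires Np s ℓ M) fun β =>
      tapeFold s ℓ V m f b Cs β (List.finRange N) Ku φ) ψ =
      execWith (encSamples ℓ f) pirateLoc C (encFold ℓ f b Cs (List.finRange N) Ku) ψ := by
    have hq : ∀ len src tgt, Op.query len src tgt ∈ C → ∀ x r, x.length = len →
        ∀ q ∈ ones (regAt pirateLoc tgt) ((encSamples ℓ f).fn x r), PirateTarget m q := by
      intro len src tgt h x r hx q hq
      rw [encSamples] at hq
      exact pirateTarget_query hmq f hC len src tgt h x r hx q hq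
    refine execWith_congr_support (pirateTarget_gate hmV hC) hq fun φ hφ => ?_
    refine setAvg_tapeFold hmM hVM (List.nodup_finRange N) (fun i _ => hCs i i.2) ?_ ?_
      (fun p x j => not_mem_bankWires_work _ _ _) Ku (shortPlain_of_pirate hψ hφ)
    · intro i _ x hx
      exact mem_bankWires.2 ⟨(.state 0, .state 1, i + s), mem_banks.2 (Or.inr ⟨i, i.2.trans_le hNp,
        Or.inl rfl⟩), x, hx, rfl⟩
    · intro i _ x hx
      exact mem_bankWires.2 ⟨(.state 2, .state 3, i + s), mem_banks.2 (Or.inr ⟨i, i.2.trans_le hNp,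
        Or.inr rfl⟩), x, hx, rfl⟩
  exact e1.trans (e2.symm.trans e3)

end

/-! ### The protected program -/

section
variable {α β γ κ : Type} [DecidableEq α] [DecidableEq β] [DecidableEq γ]

/-- A basis state in the support that violates `P` would carry positive weight, and the probability
would be less than the total weight. -/
theorem of_prob_eq_one {ψ : State α} {P : Finset α → Prop} (hn : normSq ψ = 1)
    (h : prob ψ P = 1) : ∀ S ∈ ψ.support, P S := by
  classical
  intro S hS
  by_contra hP
  have h1 : prob ψ P < normSq ψ := by
    unfold prob normSq Finsupp.sum
    refine Finset.sum_lt_sum (fun T _ => ?_) ⟨S, hS, ?_⟩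
    · beta_reduce
      split_ifs
      · exact le_rfl
      · positivity
    · beta_reduce
      rw [if_neg hP]
      have : 0 < ‖ψ S‖ := norm_pos_iff.2 (Finsupp.mem_support_iff.1 hS)
      positivity
  rw [h, hn] at h1
  exact lt_irrefl _ h1

theorem spread_emb {κ' : α → β} {ι : β → γ} (hι : Function.Injective ι) (W : γ → Prop)
    (π : State α) : spread ι W (emb κ' ∅ π) = spread (ι ∘ κ') W π := by
  unfold spread
  have h : ∀ S : Finset γ, emb ι S (emb κ' ∅ π) = emb (ι ∘ κ') S π := fun S => by
    rw [emb_emb _ _ hι, Finset.image_empty]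
    congr 1
    exact bot_symmDiff S
  simp only [h]

theorem mem_support_spread {ι : α → β} {W : β → Prop} {π : State α} {ψ : State β}
    (hψ : ψ ∈ spread ι W π) {S : Finset β} (hS : S ∈ ψ.support) {q : β} (hq : q ∈ S) :
    (∃ w, q = ι w) ∨ ¬ W q := by
  have key : ∀ S ∈ ψ.support, ∀ q ∈ S, (∃ w, q = ι w) ∨ ¬ W q := by
    refine Submodule.span_induction (p := fun ψ _ => ∀ S ∈ ψ.support, ∀ q ∈ S,
      (∃ w, q = ι w) ∨ ¬ W q) ?_ ?_ ?_ ?_ hψ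
    · rintro _ ⟨S, hS, rfl⟩ T hT q hq
      obtain ⟨A, -, rfl⟩ := mem_support_emb hT
      rcases Finset.mem_symmDiff.1 hq with h | h
      · obtain ⟨w, -, hw⟩ := Finset.mem_image.1 h.1
        exact Or.inl ⟨w, hw.symm⟩
      · exact Or.inr (hS q h.1)
    · simp
    · intro x y _ _ hx hy S hS
      rcases Finset.mem_union.1 (Finsupp.support_add hS) with h | h
      exacts [hx S h, hy S h]
    · exact fun a x _ hx S hS => hx S (Finsupp.support_smul hS)
  exact key S hS q hq

/-- The product of the state `π` of the qubits in the range of `ι`, and the state `ψ`. -/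
noncomputable def attach (ι : α → β) (π : State α) (ψ : State β) : State β :=
  π.sum fun A a => a • flip (A.image ι) ψ

theorem attach_eq_sum (ι : α → β) (π : State α) (ψ : State β) :
    attach ι π ψ = ψ.sum fun S a => a • emb ι S π := by
  unfold attach
  simp only [emb_eq_sum]
  have h : ∀ A : Finset α, flip (A.image ι) ψ = ψ.sum fun S a => a • flip (A.image ι) (ket S) := by
    intro A
    unfold flip Finsupp.mapDomain
    simp [ket]
  simp only [h]
  simp only [Finsupp.sum, Finset.smul_sum]
  rw [Finset.sum_comm]
  exact Finset.sum_congr rfl fun S _ => Finset.sum_congr rfl fun A _ => smul_comm _ _ _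

theorem attach_mem_spread {ι : α → β} {W : β → Prop} {π : State α} {ψ : State β}
    (h : ∀ S ∈ ψ.support, ∀ q ∈ S, ¬ W q) : attach ι π ψ ∈ spread ι W π := by
  rw [attach_eq_sum]
  exact Submodule.sum_mem _ fun S hS => Submodule.smul_mem _ _
    (Submodule.subset_span ⟨S, h S hS, rfl⟩)

theorem Certain.relabel {κ' : Type} {e : Wire κ' → α} {r : Wire κ → Wire κ'} {U : Circuit κ}
    {inp : ℕ → α} {o : α} {l : ℕ} {f : List Bool → Bool} {ψ : State α}
    (h : Certain (e ∘ r) U inp o l f ψ) : Certain e (Circuit.relabel r U) inp o l f ψ := by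
  intro x hx S hS
  rw [exec_relabel] at hS
  exact h x hx S hS

theorem writeKey_image {e : Wire ProtReg → α} (he : Function.Injective e) (f : List Bool) :
    (writeKey id f ∅).image e = writeKey e f ∅ := by
  simp only [writeKey, writeStr_eq, Finset.image_symmDiff _ _ he, image_ones, Finset.image_empty]
  rfl

end

/-- The state that is output by the protection procedure. -/
noncomputable def protState (P : Circuit ProtReg) (f : List Bool) : State (Wire ProtReg) :=
  exec id P (ket (writeKey id f ∅))

theorem normSq_protState (P : Circuit ProtReg) (f : List Bool) : normSq (protState P f) = 1 := by
  rw [protState, normSq_exec, normSq_ket]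

/-- The memory of the `i`-th protection procedure is still empty. The circuit thus runs in a
separate factor, with the same result `protState` for every basis state of the rest. -/
theorem exec_protect {i : ℕ} (P : Circuit ProtReg) (f : List Bool) {ψ : State Loc}
    (hψ : ∀ S ∈ ψ.support, ∀ w, Loc.prot i w ∉ S) :
    exec (Loc.prot i) P (Finsupp.mapDomain (writeKey (Loc.prot i) f) ψ) =
      attach (Loc.prot i) (protState P f) ψ := by
  have hinj : Function.Injective (Loc.prot i) := fun w w' h => by simpa using h
  rw [attach_eq_sum]
  unfold Finsupp.mapDomain
  rw [← execL_apply, map_finsuppSum]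
  refine Finset.sum_congr rfl fun S hS => ?_
  have h1 : Finsupp.single (writeKey (Loc.prot i) f S) (ψ S) =
      ψ S • emb (Loc.prot i) S (ket (writeKey id f ∅)) := by
    rw [emb_ket, writeKey_image hinj, ket, Finsupp.smul_single, smul_eq_mul, mul_one]
    congr 1
    simp only [writeKey, writeStr_eq]
    rw [symmDiff_comm S, show (∅ : Finset Loc) = ⊥ from rfl, bot_symmDiff]
  simp only
  rw [h1, map_smul, execL_apply, protState,
    ← emb_exec hinj (e := id) (fun g _ q _ => hψ S hS _)]
  rfl

theorem Certain.of_correct {B : BBF} (Q : CopyProtection B) {l : ℕ} {f : List Bool}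
    (hf : IsOutput (B.sample l) f) : Certain programWire (Q.evalC l)
      (regAt programWire (.input, 0)) (programWire (.output, 0, 0)) (B.len l) (B.fn l f)
      (emb Sum.inl ∅ (protState (Q.protect l) f)) := by
  intro x hx S hS
  have h1 : emb Sum.inl ∅ (protState (Q.protect l) f) =
      exec (Sum.inl : Wire ProtReg → Wire ProtReg ⊕ Wire ProgReg) (Q.protect l)
        (ket (writeKey Sum.inl f ∅)) := by
    rw [protState, ← emb_exec Sum.inl_injective (fun _ _ _ _ => by simp), emb_ket,
      writeKey_image Sum.inl_injective, symmDiff_none]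
    rfl
  rw [h1] at hS
  have h2 := of_prob_eq_one ?_ (Q.correct l f x hf hx) S hS
  · rw [Bool.eq_iff_iff, decide_eq_true_iff] at h2
    exact h2
  · have hinj : Function.Injective (xorBits (regAt programWire (ProgReg.input, 0)) x) :=
      symmDiff_left_injective _
    rw [normSq_exec, normSq_mapDomain hinj, normSq_exec, normSq_ket]

/-- The qubits of a protected program and of its evaluation by the pirate. -/
def progLoc (N : ℕ) : Wire ProtReg ⊕ Wire ProgReg → Loc
  | .inl w => .prot 0 w
  | .inr (.state, 0, j) => .pirate (.copy, 0, j)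
  | .inr w => pirateLoc (evalWire N w)

theorem progLoc_programWire (N : ℕ) (q : Wire ProgReg) :
    pirateLoc (evalWire N q) = progLoc N (programWire q) := by
  rcases q with ⟨_ | _ | _ | c, _ | x, j⟩ <;> rfl

theorem progLoc_cases (N : ℕ) (w : Wire ProtReg ⊕ Wire ProgReg) :
    (∃ v, progLoc N w = .prot 0 v) ∨ (∃ j, progLoc N w = .pirate (.copy, 0, j)) ∨
      (∃ i v, N < i ∧ progLoc N w = .prot i v) ∨
        ∃ c v, (c = 2 ∨ c = 3 ∨ ∃ d, c = 2 * d + 4) ∧ progLoc N w = .pirate (.work c, v) := by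
  rcases w with w | ⟨_ | _ | _ | c, _ | x, j⟩
  · exact Or.inl ⟨w, rfl⟩
  · exact Or.inr (Or.inl ⟨j, rfl⟩)
  · refine Or.inr (Or.inr (Or.inl ⟨_, _, ?_, rfl⟩))
    have : 1 - (1 - (x + 1)) = 1 := by omega
    simp only [decide_true, if_true, this]
    omega
  all_goals exact Or.inr (Or.inr (Or.inr ⟨_, _, by simp, rfl⟩))

theorem progLoc_injective (N : ℕ) : Function.Injective (progLoc N) := by
  have h1 : ∀ x, 1 - (1 - (x + 1)) = 1 := by omega
  rintro (w | ⟨_ | _ | _ | c, _ | x, j⟩) (w' | ⟨_ | _ | _ | c', _ | x', j'⟩) h <;>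
    simp_all [progLoc, pirateLoc, evalWire, placeWire, evalKind] <;> omega

/-- The qubits that are in state zero, apart from the first copy, when copies have been dealt. -/
def Fresh (n : ℕ) : Loc → Prop
  | .gen _ => False
  | .prot i _ => i = 0 ∨ n ≤ i
  | _ => True

/-- The only delicate wires are the auxiliary `state` registers of positive index, which could
collide with the other copies. `evalWire` shifts them by `N`, beyond all copies that have been
dealt, to memory that is still empty. -/
theorem fresh_progLoc {n N : ℕ} (h : n ≤ N) (w : Wire ProtReg ⊕ Wire ProgReg) :
    Fresh n (progLoc N w) := by
  rcases progLoc_cases N w with ⟨v, h'⟩ | ⟨j, h'⟩ | ⟨i, v, hi, h'⟩ | ⟨c, v, -, h'⟩ <;> rw [h'] <;>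
    simp [Fresh]
  omega

theorem exec_protects_mem_spread {n : ℕ} {P : Circuit ProtReg} {f : List Bool} {π : State (Wire ProtReg)}
    {L : List ℕ} (hL : ∀ i ∈ L, 1 ≤ i ∧ i < n) {ψ : State Loc}
    (hψ : ψ ∈ spread (Loc.prot 0) (Fresh n) π) :
    L.foldl (fun φ i => exec (Loc.prot i) P (Finsupp.mapDomain (writeKey (Loc.prot i) f) φ)) ψ ∈
      spread (Loc.prot 0) (Fresh n) π := by
  induction L generalizing ψ with
  | nil => exact hψ
  | cons i L ih =>
    rw [List.foldl_cons]
    have hi := hL i (List.mem_cons_self ..)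
    have hnf : ∀ w, ¬ Fresh n (.prot i w) := fun w h => by simp only [Fresh] at h; omega
    refine ih (fun j hj => hL j (List.mem_cons_of_mem _ hj)) ?_
    refine exec_mem_spread (fun g _ q _ => ⟨fun w h => ?_, hnf _⟩) ?_
    · simp only [Loc.prot.injEq] at h; omega
    · unfold writeKey
      rw [mapDomain_writeStr]
      refine flip_mem_spread (fun q hq => ?_) hψ
      rcases Finset.mem_symmDiff.1 hq with h | h <;> obtain ⟨j, rfl⟩ := ones_subset _ _ h.1 <;>
        exact hnf _

/-- The first copy is in a product state with everything else, and the later copies are made in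
memory of their own. The procedure that makes them does not matter; that there is a first copy does,
hence the condition on `n`. -/
theorem dealt_mem_spread {n : ℕ} (hn : 1 ≤ n) (P : Circuit ProtReg) (f : List Bool)
    {ψ : State Loc} (hψ : ∀ S ∈ ψ.support, ∀ q ∈ S, ∃ w, q = .gen w) :
    (List.range n).foldl (fun φ i => exec (Loc.prot i) P
      (Finsupp.mapDomain (writeKey (Loc.prot i) f) φ)) ψ ∈
        spread (Loc.prot 0) (Fresh n) (protState P f) := by
  obtain ⟨n, rfl⟩ := Nat.exists_eq_add_of_le' hn
  rw [List.range_succ_eq_map, List.foldl_cons]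
  refine exec_protects_mem_spread (fun i hi => ?_) ?_
  · obtain ⟨j, hj, rfl⟩ := List.mem_map.1 hi
    have := List.mem_range.1 hj
    omega
  · rw [exec_protect P f fun S hS w hw => by obtain ⟨w', h⟩ := hψ S hS _ hw; simp at h]
    refine attach_mem_spread fun S hS q hq => ?_
    obtain ⟨w, rfl⟩ := hψ S hS q hq
    simp [Fresh]

theorem Certain.of_dealt {B : BBF} (Q : CopyProtection B) {l n N : ℕ} {f : List Bool}
    (hf : IsOutput (B.sample l) f) (hN : n ≤ N) {χ : State Loc}
    (hχ : χ ∈ spread (Loc.prot 0) (Fresh n) (protState (Q.protect l) f)) {s : ℕ} {Z : Finset Loc}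
    (hZ : ∀ q ∈ Z, BankWire s q) :
    Certain pirateLoc (Circuit.relabel (evalWire N) (Q.evalC l))
      (fun j => Loc.pirate (.work 2, 0, j)) (.pirate (.work 3, 0, 0)) (B.len l) (B.fn l f)
      (flip Z χ) := by
  have hι := progLoc_injective N
  have h1 : χ ∈ spread (progLoc N) (fun q => ∃ w, q = progLoc N w)
      (emb Sum.inl ∅ (protState (Q.protect l) f)) := by
    rw [spread_emb hι]
    exact spread_mono (by rintro _ ⟨w, rfl⟩; exact fresh_progLoc hN w) hχ
  have h2 : flip Z χ ∈ spread (progLoc N) (fun q => ∃ w, q = progLoc N w)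
      (emb Sum.inl ∅ (protState (Q.protect l) f)) := by
    refine flip_mem_spread ?_ h1
    rintro _ hq ⟨w, rfl⟩
    rcases progLoc_cases N w with ⟨v, h'⟩ | ⟨j, h'⟩ | ⟨i, v, hi, h'⟩ | ⟨c, v, hc, h'⟩ <;>
      rcases hZ _ hq with ⟨c', hc', w', h⟩ | ⟨p, -, c', -, w', h⟩ <;> rw [h'] at h <;> simp at h
    omega
  exact Certain.relabel (Certain.of_mem_spread hι (fun w => ⟨w, rfl⟩)
    (Certain.of_correct Q hf) (e' := pirateLoc ∘ evalWire N)
    (fun g _ q _ => progLoc_programWire N q) h2)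

/-! ### Auxiliary facts on decoherence, circuits and scores -/

section
variable {α β κ κ' : Type} [DecidableEq α] [DecidableEq β]

theorem Dec.mono {D D' : α → Prop} {K : State α → ℝ} (h : Dec D K) (hD : ∀ q, D' q → D q) :
    Dec D' K := fun ψ φ h' => h ψ φ fun S hS T hT => by
  obtain ⟨q, hq, hne⟩ := h' S hS T hT
  exact ⟨q, hD q hq, hne⟩

theorem Dec.of_sum (D : α → Prop) {h : Finset α → ℂ → ℝ} :
    Dec D fun ψ => ψ.sum h := by
  intro ψ φ hd
  refine Finsupp.sum_add_index_of_disjoint (Finset.disjoint_left.2 fun S hS hS' => ?_) h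
  obtain ⟨q, -, hq⟩ := hd S hS S hS'
  exact hq Iff.rfl

theorem emb_eq_self {φ : α → α} {ψ : State α} (h : ∀ S ∈ ψ.support, ∀ q ∈ S, φ q = q) :
    emb φ ∅ ψ = ψ := by
  unfold emb
  conv_rhs => rw [← Finsupp.mapDomain_id (v := ψ)]
  refine Finsupp.mapDomain_congr fun S hS => ?_
  rw [symmDiff_none]
  exact (Finset.image_congr fun q hq => h S hS q hq).trans Finset.image_id

theorem Circuit.relabel_noQuery (e : Wire κ → Wire κ') (C : Circuit κ) :
    (Circuit.relabel e C).NoQuery := by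
  intro x src tgt h
  simp only [Circuit.relabel, List.mem_filterMap] at h
  obtain ⟨o, -, ho⟩ := h
  rcases o with g | _ <;> simp at ho

theorem Circuit.NoQuery.inv {C : Circuit κ} (h : C.NoQuery) : C.inv.NoQuery := by
  intro x src tgt h'
  simp only [Circuit.inv, List.mem_reverse, List.mem_map] at h'
  obtain ⟨o, ho, ho'⟩ := h'
  rcases o with g | ⟨x', src', tgt'⟩
  · simp at ho'
  · exact h x' src' tgt' ho

theorem simOp_on [DecidableEq κ] (rk : κ → κ') (sh : κ → ℕ) (kr ka : κ') (ℓ V k : ℕ) {P : Wire κ' → Prop}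
    (hP : ∀ w, P (shiftWire rk sh w)) (hr : ∀ w, P (kr, w)) (ha : ∀ w, P (ka, w)) (o : Op κ) :
    (simOp rk sh kr ka ℓ V k o).On P := by
  have cx : ∀ c t, P c → P t → Circuit.On P [Op.gate (.CX c t)] := fun c t hc ht =>
    Circuit.On.single fun q hq => by
      simp only [Gate.wires, List.mem_cons, List.not_mem_nil, or_false] at hq
      rcases hq with rfl | rfl <;> assumption
  rcases o with g | ⟨len, src, tgt⟩
  · refine Circuit.On.single fun q hq => ?_
    rw [Gate.wires_map, List.mem_map] at hq
    obtain ⟨w, -, rfl⟩ := hq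
    exact hP w
  · rw [simOp]
    split_ifs
    · exact fun g h => by simp at h
    · exact Circuit.On.flatMap fun j _ => Circuit.On.append (Circuit.On.flatMap fun t _ =>
        cx _ _ (hr _) (hP (tgt.1, tgt.2, _))) (Circuit.On.append (cx _ _ (ha _) (hP (tgt.1, tgt.2, _)))
          (cx _ _ (hP (src.1, src.2, _)) (hP (tgt.1, tgt.2, _))))

theorem Circuit.On.subst {G : ℕ → Op κ → Circuit κ'} {P : Wire κ' → Prop}
    {C : Circuit κ} (h : ∀ i, ∀ o ∈ C, (G i o).On P) (k : ℕ) : (Circuit.subst G k C).On P := by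
  intro g hg
  obtain ⟨i, o, ho, h'⟩ := Circuit.mem_subst hg
  exact h i o ho g h'

end

theorem score_dec {N : ℕ} (D : Loc → Prop) (b : Fin N → Bool) : Dec D (score b) :=
  Dec.of_sum D

theorem score_quad {N : ℕ} (b : Fin N → Bool) : Quad (score b) := by
  intro c ψ
  unfold score
  rw [Finsupp.sum_smul_index (by simp), Finsupp.mul_sum]
  refine Finset.sum_congr rfl fun S _ => ?_
  simp only [norm_mul]
  ring

theorem normSq_quad {α : Type} : Quad (normSq : State α → ℝ) := by
  intro c ψ
  unfold normSq
  rw [Finsupp.sum_smul_index (by simp), Finsupp.mul_sum]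
  refine Finset.sum_congr rfl fun S _ => ?_
  simp only [norm_mul]
  ring

/-! ### The run of the reduction -/

theorem not_bankWire_moveLoc (s s' : ℕ) (q : Loc) : ¬ BankWire s (moveLoc s' q) := by
  rintro (⟨c, hc, w, h⟩ | ⟨p, -, c, hc, w, h⟩)
  · exact pirate_ne_moveLoc (by omega) w q h.symm
  · exact party_ne_moveLoc (w := (.state c, w)) hc q h.symm

theorem not_bankWire_work {s c : ℕ} (hc : 2 ≤ c) (w : ℕ × ℕ) : ¬ BankWire s (.pirate (.work c, w)) := by
  rintro (⟨c', hc', w', h⟩ | ⟨p, -, c', -, w', h⟩)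
  · simp at h; omega
  · simp at h

theorem not_bankWire_prot {s i : ℕ} (w : Wire ProtReg) : ¬ BankWire s (.prot i w) := by
  rintro (⟨c', hc', w', h⟩ | ⟨p, -, c', -, w', h⟩) <;> simp at h

theorem not_bankWire_gen {s : ℕ} (w : Wire SampleReg) : ¬ BankWire s (.gen w) := by
  rintro (⟨c', hc', w', h⟩ | ⟨p, -, c', -, w', h⟩) <;> simp at h

theorem not_bankWire_evalWire (s N : ℕ) (q : Wire ProgReg) :
    ¬ BankWire s (pirateLoc (evalWire N q)) := by
  rcases q with ⟨_ | _ | _ | c, x, j⟩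
  · exact not_bankWire_prot _
  · exact not_bankWire_work le_rfl _
  · exact not_bankWire_work (by omega) _
  · exact not_bankWire_work (c := 2 * c + 4) (by omega) _

theorem bankWire_of_mem {N s ℓ M : ℕ} {q : Loc} (h : q ∈ bankWires N s ℓ M) : BankWire s q := by
  obtain ⟨ρ, hρ, p, -, rfl⟩ := mem_bankWires.1 h
  exact bankWire_bankR hρ p

theorem bankWire_of_mem_symmDiff {N s ℓ M : ℕ} {f : List Bool → Bool} {β : Finset Loc}
    (hβ : β ⊆ bankWires N s ℓ M) {q : Loc} (h : q ∈ β ∆ answers N s ℓ M f β) : BankWire s q := by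
  rcases Finset.mem_symmDiff.1 h with h | h
  · exact bankWire_of_mem (hβ h.1)
  · obtain ⟨ρ, hρ, a, rfl⟩ := mem_answers h.1
    exact bankWire_bankA hρ a

theorem evalBanks_writes (N s ℓ M : ℕ) (E : Circuit ProgReg) :
    Circuit.Writes (fun w => pirateLoc w ∉ bankWires N s ℓ M)
      ((banks N s).flatMap (evalBank N ℓ M E)) := by
  have h1 : ∀ w, ¬ BankWire s (pirateLoc w) → pirateLoc w ∉ bankWires N s ℓ M := fun w h h' =>
    h (bankWire_of_mem h')
  have hU : (Circuit.relabel (evalWire N) E).On fun w => pirateLoc w ∉ bankWires N s ℓ M :=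
    Circuit.On.relabel fun g _ q _ => h1 _ (not_bankWire_evalWire s N q)
  have hcp : ∀ ρ a, (copyInput ℓ ρ a).Writes fun w => pirateLoc w ∉ bankWires N s ℓ M :=
    fun ρ a => Circuit.Writes.flatMap fun t _ => Circuit.Writes.gate
      (h1 _ (not_bankWire_work le_rfl _))
  refine Circuit.Writes.flatMap fun ρ hρ => Circuit.Writes.flatMap fun a _ =>
    (hcp ρ a).append (Circuit.Writes.append (hU.writes (Circuit.relabel_noQuery _ _))
      (Circuit.Writes.append (Circuit.Writes.gate ?_) (Circuit.Writes.append
        (hU.inv.writes (Circuit.relabel_noQuery _ _).inv) (hcp ρ a))))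
  intro h
  obtain ⟨ρ', hρ', p, -, h'⟩ := mem_bankWires.1 h
  exact bankR_ne_bankA hρ' hρ p a h'.symm

theorem simPirate_writes (s ℓ V N M : ℕ) (C : Circuit PirateReg) :
    (simPirate s ℓ V C).Writes fun w => pirateLoc w ∉ bankWires N s ℓ M :=
  Circuit.Writes.subst (fun _ o _ => simOp_writes _ _ _ _ _ _ _ (fun w h =>
    not_bankWire_moveLoc s s _ (moveLoc_pirateLoc s w ▸ bankWire_of_mem h)) o) 0

/-- After the Hadamard gates the strings of the banks are controls only, so the superposition
becomes an average over their contents `β`. For each `β` the evaluation amounts to adding the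
answers. The circuit `D` comes in between because the second reduction hands over the copy at this
point. -/
theorem exec_flipPirate {s N ℓ V M : ℕ} {f : List Bool → Bool} {E : Circuit ProgReg}
    {D C : Circuit PirateReg} {K : State Loc → ℝ}
    (hK : Dec (fun q => q ∈ bankWires N s ℓ M) K) (hQ : Quad K)
    (hD : D.Writes fun w => pirateLoc w ∉ bankWires N s ℓ M) {χ : State Loc}
    (hχ : ∀ S ∈ χ.support, ∀ q ∈ S, ¬ BankWire s q)
    (hcert : ∀ Z : Finset Loc, (∀ q ∈ Z, BankWire s q) →
      Certain pirateLoc (Circuit.relabel (evalWire N) E) (fun j => Loc.pirate (.work 2, 0, j))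
        (.pirate (.work 3, 0, 0)) ℓ f (flip Z χ)) :
    K (exec pirateLoc (flipPirate s N ℓ V M E D C) χ) =
      setAvg (bankWires N s ℓ M) fun β => K (exec pirateLoc (simPirate s ℓ V C)
        (exec pirateLoc D (flip (β ∆ answers N s ℓ M f β) χ))) := by
  rw [flipPirate, exec_append]
  refine (exec_randomBanks (N := N) (s := s) (ℓ := ℓ) (M := M) (K := fun χ => K (exec pirateLoc
    ((banks N s).flatMap (evalBank N ℓ M E) ++ (D ++ simPirate s ℓ V C)) χ))
    (hK.exec ((evalBanks_writes N s ℓ M E).append (hD.append (simPirate_writes s ℓ V N M C))))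
    (hQ.exec _ _) (fun q h => h) hχ).trans ?_
  refine setAvg_congr fun β hβ => ?_
  rw [exec_append, exec_append,
    exec_evalBanks (fun q hq => bankWire_of_mem (hβ hq)) hχ hcert]

theorem score_emb {N : ℕ} (b : Fin N → Bool) {φ : Loc → Loc} (hφ : Function.Injective φ)
    (A : Finset Loc) (ψ : State Loc) : score b (emb φ A ψ) = ψ.sum fun S a => ‖a‖ ^ 2 *
      ((Finset.univ.filter fun i : Fin N =>
        decide (Loc.party i (.out, 0, 0) ∈ S.image φ ∆ A) = b i).card : ℝ) :=
  Finsupp.sum_mapDomain_index_inj (emb_injective hφ A)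

/-- Key and hidden bits are fixed. The randomness of the banks, once averaged, is that of the
encryption oracle and of the challenges; `N ≤ Np` holds because banks are made for a polynomial
bound of the number of parties. -/
theorem flip_value_zero {B : BBF} (Q : CopyProtection B) {l n N Np V m M : ℕ} {f : List Bool}
    (hf : IsOutput (B.sample l) f) (hn : n ≤ Np) (hNp : N ≤ Np) (hmV : V < m)
    (hmq : V * (B.len l + 1) ≤ m) (hmM : m ≤ M) (hVM : V * V ≤ M) {C : Circuit PirateReg}
    {Cs : ℕ → Circuit PartyReg} (hC : C.Bounded V) (hCs : ∀ i < N, (Cs i).Bounded V)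
    (b : Fin N → Bool) {χ : State Loc}
    (hχ : χ ∈ spread (Loc.prot 0) (Fresh n) (protState (Q.protect l) f)) :
    flipFold 0 (B.len l) V m (B.fn l f) b Cs (List.finRange N) (score b)
      (exec pirateLoc (flipPirate 0 Np (B.len l) V M (Q.evalC l) [] C) χ) =
    execWith (encSamples (B.len l) (B.fn l f)) pirateLoc C
      (encFold (B.len l) (B.fn l f) b Cs (List.finRange N) (score b)) χ := by
  have hsupp : ∀ S ∈ χ.support, ∀ q ∈ S, (∃ w, q = .gen w) ∨ ∃ i w, q = .prot i w := by
    intro S hS q hq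
    rcases mem_support_spread hχ hS hq with ⟨w, rfl⟩ | h
    · exact Or.inr ⟨0, w, rfl⟩
    · rcases q with w | ⟨i, w⟩ | w | ⟨i, w⟩
      · exact Or.inl ⟨w, rfl⟩
      · exact Or.inr ⟨i, w, rfl⟩
      · exact absurd trivial h
      · exact absurd trivial h
  -- Without a shift the embedding leaves the memories of the key and of the copies in place, and
  -- nothing else is occupied yet.
  have hfix : emb (moveLoc 0) ∅ χ = χ := emb_eq_self fun S hS q hq => by
    rcases hsupp S hS q hq with ⟨w, rfl⟩ | ⟨i, w, rfl⟩ <;> rfl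
  have hbank : ∀ S ∈ χ.support, ∀ q ∈ S, ¬ BankWire 0 q := fun S hS q hq => by
    rcases hsupp S hS q hq with ⟨w, rfl⟩ | ⟨i, w, rfl⟩
    exacts [not_bankWire_gen _, not_bankWire_prot _]
  have hKdec := flipFold_dec (s := 0) (ℓ := B.len l) (V := V) (m := m) (f := B.fn l f) (b := b)
    (C := Cs) (score_dec KeptReg b) (List.finRange N)
  rw [exec_flipPirate (f := B.fn l f) (hKdec.mono fun q hq => ?_) (flipFold_quad (score_quad b) _)
    ⟨fun g h => by simp at h, fun _ _ _ h => by simp at h⟩ hbank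
    (fun Z hZ => Certain.of_dealt Q hf hn hχ hZ), ← setAvg_pirate (s := 0) hNp hmV hmq hmM hVM hC hCs]
  · refine setAvg_congr fun β hβ => ?_
    have hall := fun q => bankWire_of_mem_symmDiff (q := q) (f := B.fn l f) hβ
    have hφn : ∀ q, moveLoc 0 q ∉ β ∆ answers Np 0 (B.len l) M (B.fn l f) β := fun q h =>
      not_bankWire_moveLoc 0 0 q (hall _ h)
    have e1 : flip (β ∆ answers Np 0 (B.len l) M (B.fn l f) β) χ =
        emb (moveLoc 0) (β ∆ answers Np 0 (B.len l) M (B.fn l f) β) χ := by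
      conv_lhs => rw [← hfix, flip_emb, show (∅ : Finset Loc) = ⊥ from rfl, bot_symmDiff]
    change flipFold 0 _ _ _ _ _ _ _ _ (exec pirateLoc (simPirate 0 (B.len l) V C) (flip _ χ)) = _
    rw [e1, flipFold_simPirate hNp hmV hmq hmM hVM hC hCs hβ (fun q _ => Iff.rfl) hφn ?_ ?_
      (score_dec _ b) (score_quad b) (Ku := score b) ?_]
    · intro i _ c _ x j h
      rcases hall _ h with ⟨_, _, _, h'⟩ | ⟨_, _, _, _, _, h'⟩ <;> simp at h'
    · intro S hS i j h
      rcases hsupp S hS _ h with ⟨w, h'⟩ | ⟨i, w, h'⟩ <;> simp at h'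
    -- The `out` qubits are fixed by the embedding, and no ancilla is set there; so the score is the
    -- same before and after embedding.
    · intro anc' ψ' h
      rw [score_emb b (moveLoc_injective 0), score]
      refine Finset.sum_congr rfl fun S _ => ?_
      have h1 : ∀ i : ℕ, decide (Loc.party i (.out, 0, 0) ∈ S.image (moveLoc 0) ∆ anc') =
          decide (Loc.party i (.out, 0, 0) ∈ S) := fun i => decide_eq_decide.2 (by
        have h2 : Loc.party i (.out, 0, 0) = moveLoc 0 (.party i (.out, 0, 0)) := rfl
        rw [h2]
        refine mem_emb (moveLoc_injective 0) ?_
        rw [h _ fun p c hc w h' => party_ne_moveLoc (by simpa using hc) _ h'.symm]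
        exact hφn _)
      simp only [h1]
  · intro S hS i j h
    rcases hsupp S hS _ h with ⟨w, h'⟩ | ⟨i, w, h'⟩ <;> simp at h'
  · rcases bankWire_of_mem hq with ⟨c, _, w, rfl⟩ | ⟨p, _, c, hc, w, rfl⟩
    · exact Or.inr (by simp)
    · exact Or.inl ⟨p, c, w, by omega, rfl⟩

/-! ### The party that gets a copy -/

/-- The qubits of the protected program after it has been handed over. -/
def copyLoc (V : ℕ) : Wire ProtReg → Loc
  | (.out, 0, j) => if j < V then .party 0 (.state 0, 0, j) else .prot 0 (.out, 0, j)
  | w => .prot 0 w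

/-- The qubits of the protected program and of its evaluation by the first party. -/
def ownLoc (V : ℕ) : Wire ProtReg ⊕ Wire ProgReg → Loc
  | .inl w => copyLoc V w
  | .inr (.state, 0, j) => .party 0 (.work 0, 0, j)
  | .inr w => .party 0 (placeWire ownerKind (fun _ => false) 0 w)

theorem copyLoc_cases (V : ℕ) (w : Wire ProtReg) :
    copyLoc V w = .prot 0 w ∨ ∃ j < V, w = (.out, 0, j) ∧ copyLoc V w = .party 0 (.state 0, 0, j) := by
  rcases w with ⟨_ | _ | _ | c, _ | x, j⟩
  case out.zero =>
    by_cases h : j < V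
    · exact Or.inr ⟨j, h, rfl, if_pos h⟩
    · exact Or.inl (if_neg h)
  all_goals exact Or.inl rfl

theorem copyLoc_injective (V : ℕ) : Function.Injective (copyLoc V) := by
  intro w w' h
  rcases copyLoc_cases V w with h1 | ⟨j, hj, hw, h1⟩ <;>
    rcases copyLoc_cases V w' with h2 | ⟨j', hj', hw', h2⟩ <;> rw [h1, h2] at h <;> simp at h
  · exact h
  · rw [hw, hw', h]

theorem ownLoc_inr (V : ℕ) (w : Wire ProgReg) : ∃ k v, ownLoc V (.inr w) = .party 0 (k, v) ∧
    k ≠ .work 1 ∧ k ≠ .out ∧ (k = .state 0 → v.1 ≠ 0) := by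
  rcases w with ⟨_ | _ | _ | c, _ | x, j⟩ <;>
    exact ⟨_, _, rfl, by simp [ownerKind], by simp [ownerKind], by simp [ownerKind]⟩

/-- On `.inr (.state, 0, j)` the map `ownLoc` takes a value that plays no role, because
`programWire` sends this wire to the protected program; an otherwise unused register has been chosen
for the sake of injectivity. -/
theorem ownLoc_injective (V : ℕ) : Function.Injective (ownLoc V) := by
  have h1 : ∀ w w', ownLoc V (.inl w) ≠ ownLoc V (.inr w') := by
    intro w w' h
    obtain ⟨k, v, h2, -, -, h3⟩ := ownLoc_inr V w'
    rw [h2] at h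
    rcases copyLoc_cases V w with h4 | ⟨j, -, -, h4⟩ <;> simp only [ownLoc, h4] at h <;> simp at h
    exact h3 h.1.symm (by rw [← h.2])
  rintro (w | w) (w' | w') h
  · exact congrArg _ (copyLoc_injective V h)
  · exact absurd h (h1 _ _)
  · exact absurd h.symm (h1 _ _)
  · let g : PartyReg → ProgReg := fun k => match k with
      | .work 2 => .input | .work 3 => .output | .work (c + 4) => .work c | _ => .state
    have h2 : ∀ w, ∃ k, ownLoc V (.inr w) = .party 0 (k, w.2) ∧ g k = w.1 := by
      rintro ⟨_ | _ | _ | c, _ | x, j⟩ <;> exact ⟨_, rfl, rfl⟩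
    obtain ⟨k, h3, h4⟩ := h2 w
    obtain ⟨k', h5, h6⟩ := h2 w'
    rw [h3, h5, Loc.party.injEq, Prod.mk.injEq] at h
    exact congrArg _ (Prod.ext (h4.symm.trans ((congrArg g h.2.1).trans h6)) h.2.2)

/-- The qubits that are neither used by the protected program nor by its evaluation. -/
theorem not_ownLoc {V : ℕ} {q : Loc} (hp : ∀ w, q ≠ .prot 0 w)
    (hq : ∀ k v, q = .party 0 (k, v) → k = .work 1 ∨ k = .out) (w : Wire ProtReg ⊕ Wire ProgReg) :
    q ≠ ownLoc V w := by
  intro h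
  rcases w with w | w
  · rcases copyLoc_cases V w with h4 | ⟨j, -, -, h4⟩
    · exact hp w (h.trans h4)
    · have := hq _ _ (h.trans h4)
      simp at this
  · obtain ⟨k, v, h2, h3, h4, -⟩ := ownLoc_inr V w
    rcases hq _ _ (h.trans h2) with h | h
    exacts [h3 h, h4 h]

/-- Only the first `V` qubits of the copy are handed over. They are all that the evaluation circuit
acts on, which is what the bound on the position expresses. -/
theorem ownLoc_programWire {V : ℕ} {q : Wire ProgReg} (hq : q.2.2 < V) :
    Loc.party 0 (placeWire ownerKind (fun _ => false) 0 q) = ownLoc V (programWire q) := by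
  rcases q with ⟨_ | _ | _ | c, _ | x, j⟩
  · exact (if_pos hq : copyLoc V (.out, 0, j) = _).symm
  all_goals rfl

/-- The receiving register is empty, so the first layer of controlled flips copies the basis state
and the second one erases the original: together they move the qubits. By linearity this holds for
the superposition `π`. -/
theorem exec_handOver (V : ℕ) (π : State (Wire ProtReg)) {ψ : State Loc}
    (hψ : ∀ S ∈ ψ.support, ∀ q ∈ S, ∃ w, q = .gen w) :
    exec pirateLoc (handOver V) (attach (Loc.prot 0) π ψ) = attach (copyLoc V) π ψ := by
  have hA : ∀ A : Finset (Wire ProtReg), exec pirateLoc (handOver V) (flip (A.image (Loc.prot 0)) ψ) =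
      flip (A.image (copyLoc V)) ψ := by
    intro A
    have hc : Function.Injective fun t => pirateLoc (.copy, 0, t) := fun t t' h => by
      simpa using pirateLoc_injective h
    have hs : Function.Injective fun t => pirateLoc (.state 0, 0, t) := fun t t' h => by
      simpa using pirateLoc_injective h
    have hne : ∀ i j, pirateLoc (.copy, 0, i) ≠ pirateLoc (.state 0, 0, j) := by
      intro i j h; simpa using pirateLoc_injective h
    set bits := readBits (fun t => ((.out, 0, t) : Wire ProtReg)) V A with hbits
    have hget : ∀ j, bits.getD j false = true ↔ j < V ∧ ((.out, 0, j) : Wire ProtReg) ∈ A := by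
      intro j
      by_cases hj : j < V <;> simp [hbits, readBits, List.getD, hj]
    have hi : ∀ w, (Loc.prot 0 w ∈ A.image (Loc.prot 0)) ↔ w ∈ A := fun w =>
      Finset.mem_image.trans ⟨fun ⟨v, hv, h⟩ => by rw [Loc.prot.injEq] at h; exact h.2 ▸ hv,
        fun h => ⟨w, h, rfl⟩⟩
    have hg : ∀ S ∈ ψ.support, ∀ q, (∀ w, q ≠ .gen w) → q ∉ S := fun S hS q hq h => by
      obtain ⟨w, rfl⟩ := hψ S hS q h
      exact hq w rfl
    rw [handOver, exec_append, exec_copy pirateLoc _ _ hs hne, mapDomain_eq_flip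
      (X := ones (fun t => pirateLoc (.state 0, 0, t)) bits), flip_flip,
      exec_copy pirateLoc _ _ hc fun i j => (hne j i).symm, mapDomain_eq_flip
      (X := ones (fun t => pirateLoc (.copy, 0, t)) bits), flip_flip]
    · congr 1
      ext q
      have e2 : ∀ j, (Loc.party 0 (.state 0, 0, j) ∈
          ones (fun t => pirateLoc (.state 0, 0, t)) bits) ↔ _ := fun j => (mem_ones hs).trans (hget j)
      have e3 : ∀ j, (Loc.prot 0 (.out, 0, j) ∈
          ones (fun t => pirateLoc (.copy, 0, t)) bits) ↔ _ := fun j => (mem_ones hc).trans (hget j)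
      by_cases h1 : ∃ j, q = Loc.party 0 (.state 0, 0, j)
      · obtain ⟨j, rfl⟩ := h1
        have e1 : Loc.party 0 (.state 0, 0, j) ∉ A.image (Loc.prot 0) := by simp
        have e4 : Loc.party 0 (.state 0, 0, j) ∉ ones (fun t => pirateLoc (.copy, 0, t)) bits :=
          fun h => by obtain ⟨t, h⟩ := ones_subset _ _ h; simp [pirateLoc] at h
        simp only [Finset.mem_symmDiff, e1, e2, e4, Finset.mem_image]
        constructor
        · rintro (⟨⟨h, -⟩ | h, -⟩ | h)
          · exact absurd h (by simp)
          · exact ⟨_, h.1.2, if_pos h.1.1⟩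
          · exact absurd h.1 (by simp)
        · rintro ⟨w, hw, h⟩
          rcases copyLoc_cases V w with h4 | ⟨j', hj', rfl, h4⟩ <;> rw [h4] at h <;> simp at h
          subst h
          simp [hj', hw]
      · have e1 : q ∉ ones (fun t => pirateLoc (.state 0, 0, t)) bits := fun h => by
          obtain ⟨t, h⟩ := ones_subset _ _ h
          exact h1 ⟨t, h⟩
        have e5 : q ∈ A.image (copyLoc V) ↔ ∃ w ∈ A, q = .prot 0 w ∧ ∀ j < V, w ≠ (.out, 0, j) := by
          rw [Finset.mem_image]
          constructor
          · rintro ⟨w, hw, rfl⟩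
            rcases copyLoc_cases V w with h4 | ⟨j', hj', rfl, h4⟩
            · refine ⟨w, hw, h4, fun j hj h => h1 ⟨j, ?_⟩⟩
              rw [h]; exact if_pos hj
            · exact absurd ⟨j', h4⟩ h1
          · rintro ⟨w, hw, rfl, h⟩
            rcases copyLoc_cases V w with h4 | ⟨j', hj', h5, h4⟩
            · exact ⟨w, hw, h4⟩
            · exact absurd h5 (h j' hj')
        rw [e5]
        simp only [Finset.mem_symmDiff, e1]
        by_cases h2 : ∃ w, q = .prot 0 w
        · obtain ⟨w, rfl⟩ := h2
          rw [hi]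
          by_cases h3 : ∃ j, w = (.out, 0, j)
          · obtain ⟨j, rfl⟩ := h3
            rw [e3]
            by_cases h6 : j < V <;> simp [h6]
            exact fun _ j' hj' h => h6 (h ▸ hj')
          · have e6 : Loc.prot 0 w ∉ ones (fun t => pirateLoc (.copy, 0, t)) bits := fun h => by
              obtain ⟨t, h⟩ := ones_subset _ _ h
              exact h3 ⟨t, by simpa [pirateLoc] using h⟩
            have e7 : ∀ j < V, w ≠ (.out, 0, j) := fun j _ h => h3 ⟨j, h⟩
            simp only [e6, Loc.prot.injEq, true_and]
            constructor
            · exact fun h => ⟨w, by tauto, rfl, e7⟩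
            · rintro ⟨_, h, rfl, -⟩; tauto
        · have e6 : q ∉ ones (fun t => pirateLoc (.copy, 0, t)) bits := fun h => by
            obtain ⟨t, h⟩ := ones_subset _ _ h
            exact h2 ⟨_, h⟩
          have e7 : q ∉ A.image (Loc.prot 0) := fun h => by
            obtain ⟨w, -, h⟩ := Finset.mem_image.1 h
            exact h2 ⟨w, h.symm⟩
          simp only [e6, e7]
          simp
          rintro a x y _ rfl
          exact absurd ⟨_, rfl⟩ h2
    · intro T hT
      rw [mem_support_flip] at hT
      congr 2
      rw [hbits]
      refine List.map_congr_left fun j hj => decide_eq_decide.2 ?_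
      replace hj := List.mem_range.1 hj
      have e0 := hg _ hT (Loc.party 0 (.state 0, 0, j)) (by simp)
      have e1 : Loc.party 0 (.state 0, 0, j) ∉ A.image (Loc.prot 0) := by simp
      have e2 : Loc.party 0 (.state 0, 0, j) ∈ ones (fun t => pirateLoc (.state 0, 0, t)) bits ↔ _ :=
        (mem_ones hs).trans (hget j)
      change Loc.party 0 (.state 0, 0, j) ∈ T ↔ ((.out, 0, j) : Wire ProtReg) ∈ A
      simp only [Finset.mem_symmDiff, e1, e2, hj] at e0
      by_cases h1 : Loc.party 0 (.state 0, 0, j) ∈ T <;> by_cases h2 : ((.out, 0, j) : Wire ProtReg) ∈ A <;>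
        simp_all
    · intro T hT
      rw [mem_support_flip] at hT
      congr 2
      rw [hbits]
      refine List.map_congr_left fun j hj => decide_eq_decide.2 ?_
      replace hj := List.mem_range.1 hj
      have e0 := hg _ hT (Loc.prot 0 (.out, 0, j)) (by simp)
      rw [Finset.mem_symmDiff, hi] at e0
      change Loc.prot 0 (.out, 0, j) ∈ T ↔ ((.out, 0, j) : Wire ProtReg) ∈ A
      tauto
  unfold attach
  rw [← execL_apply, map_finsuppSum]
  exact Finset.sum_congr rfl fun A _ => by
    simp only [map_smul, execL_apply, hA]

/-- The evaluation adds `f x` to the qubit `out`, the last bit of the oracle answer adds `f x` XOR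
`b`, and what remains is `b`. As the evaluation is undone, nothing else changes apart from the
register with the oracle answer. -/
theorem exec_owner {ℓ : ℕ} {E : Circuit ProgReg} {f : List Bool → Bool} {b : Bool}
    {K : State Loc → ℝ} {X : State Loc} (hX : ∀ S ∈ X.support, ∀ t, Loc.party 0 (.work 1, 0, t) ∉ S)
    (hcert : ∀ Z : Finset Loc, (∀ q ∈ Z, ∃ t, q = .party 0 (.work 1, 0, t)) →
      Certain (Loc.party 0) (Circuit.relabel (placeWire ownerKind (fun _ => false) 0) E)
        (fun t => Loc.party 0 (.work 2, 0, t)) (.party 0 (.work 3, 0, 0)) ℓ f (flip Z X)) :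
    execWith (flipSamples ℓ f b) (Loc.party 0) (owner ℓ E) K X =
      setAvg (flipWires 0 ℓ 1) fun γ =>
        K (flip (sampleSet 0 ℓ f b γ 1 ∆ tog b (.party 0 (.out, 0, 0))) X) := by
  have hU := Circuit.relabel_noQuery (placeWire ownerKind (fun _ => false) 0) E
  have hN : ∀ {C : Circuit PartyReg}, (∀ x src tgt, Op.query x src tgt ∉ C) → C.NoQuery := fun h => h
  have hcp : Circuit.NoQuery ((List.range ℓ).flatMap fun t =>
      [Op.gate (.CX (PartyReg.work 1, 0, t) (PartyReg.work 2, 0, t))]) := hN (by simp)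
  have h0 : ([.query 0 (.work 0, 0) (.work 1, 0)] : Circuit PartyReg) = flipQueries 1 := rfl
  rw [owner, h0, execWith_append, execWith_flipQueries, execWith_noQuery _ _
    (hcp.append (hU.append (Circuit.NoQuery.append (hN (by simp)) (hU.inv.append
      (hcp.append (hN (by simp)))))))]
  refine setAvg_congr fun γ _ => congrArg K ?_
  have hinj : ∀ k, Function.Injective fun t => Loc.party 0 (k, 0, t) := fun k t t' h => by
    simpa using h
  set x := flipString 0 ℓ γ 0 with hx
  have hxl : x.length = ℓ := length_readBits _ _ _
  set Z := sampleSet 0 ℓ f b γ 1 with hZ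
  have hZm : ∀ q ∈ Z, ∃ t, q = .party 0 (.work 1, 0, t) := fun q hq => by
    rw [hZ, sampleSet, sampleSet, show (∅ : Finset Loc) = ⊥ from rfl, bot_symmDiff] at hq
    exact ones_subset _ _ hq
  have hmem : ∀ S ∈ (flip Z X).support, ∀ t, (Loc.party 0 (.work 1, 0, t) ∈ S ↔
      (x ++ [xor (f x) b]).getD t false = true) := by
    intro S hS t
    rw [mem_support_flip] at hS
    have h1 := hX _ hS t
    rw [← mb_sampleSet (p := 0) f b γ (Nat.zero_lt_one) t, mb_eq_true, ← hZ]
    rw [Finset.mem_symmDiff] at h1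
    tauto
  have hread : ∀ S ∈ (flip Z X).support,
      readBits (fun t => Loc.party 0 (.work 1, 0, t)) ℓ S = x := by
    intro S hS
    refine List.ext_getElem (by simp [readBits, hxl]) fun i h1 h2 => ?_
    have h3 : (x ++ [xor (f x) b]).getD i false = x[i] := by
      rw [List.getD_append _ _ _ _ h2, List.getD_eq_getElem _ _ h2]
    rw [Bool.eq_iff_iff, ← h3, ← hmem S hS i]
    simp [readBits]
  have hC := exec_compute (Loc.party 0)
    (cp := (List.range ℓ).flatMap fun t => [Op.gate (.CX (.work 1, 0, t) (.work 2, 0, t))])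
    (U := Circuit.relabel (placeWire ownerKind (fun _ => false) 0) E) (o := (.work 3, 0, 0))
    (ans := (.out, 0, 0)) (src := fun t => Loc.party 0 (.work 1, 0, t))
    (X := ones (fun t => Loc.party 0 (.work 2, 0, t)) x) (b := f x) (n := ℓ) (x := x)
    (ψ := flip Z X) (fun φ hφ => by
      rw [exec_copy (Loc.party 0) _ _ (hinj _) (by simp)]
      exact mapDomain_eq_flip fun S hS => by rw [hφ S hS]) hread
    (hcert Z hZm x hxl) (Circuit.On.relabel fun g _ q _ h => by
      rcases q with ⟨_ | _ | _ | c, v⟩ <;> simp [placeWire, ownerKind] at h) (by simp) (by simp)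
    (fun j h => by obtain ⟨t, h⟩ := ones_subset _ _ h; simp at h)
  rw [← List.append_assoc _ _ [_], ← List.append_assoc _ _ [_], ← List.append_assoc _ _ [_],
    ← List.append_assoc _ _ [_], exec_append, hC]
  simp only [exec, Gate.map]
  rw [CX_apply_known (b := xor (f x) b) (by simp), flip_flip, flip_flip]
  · congr 1
    congr 1
    cases f x <;> cases b <;> simp [tog]
  · intro S hS
    rw [mem_support_flip] at hS
    have h1 := hmem _ hS ℓ
    have h2 : (x ++ [xor (f x) b]).getD ℓ false = xor (f x) b := by
      rw [List.getD_append_right _ _ _ _ hxl.le, hxl, Nat.sub_self]; rfl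
    rw [h2] at h1
    rw [← h1, Finset.mem_symmDiff]
    have : Loc.party 0 (.work 1, 0, ℓ) ∉ (if f x then {Loc.party 0 (.out, 0, 0)} else ∅ : Finset Loc) := by
      cases f x <;> simp
    simp [this]

/-! ### The value of the second reduction -/

theorem measure_add {α β : Type} [DecidableEq α] (R : Finset α → β) (K K' : β → State α → ℝ) (ψ : State α) :
    measure R (fun y φ => K y φ + K' y φ) ψ = measure R K ψ + measure R K' ψ :=
  Finset.sum_add_distrib

theorem challengeWith_add (ℓ : ℕ) (f : List Bool → Bool) (i : ℕ) (b : Bool) (K K' : State Loc → ℝ) :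
    challengeWith ℓ f i b (fun φ => K φ + K' φ) =
      fun φ => challengeWith ℓ f i b K φ + challengeWith ℓ f i b K' φ := by
  funext ψ
  simp only [challengeWith, avgBits_add, measure_add]

theorem encFold_add {ℓ N : ℕ} {f : List Bool → Bool} {b : Fin N → Bool} {C : ℕ → Circuit PartyReg}
    (L : List (Fin N)) (K K' : State Loc → ℝ) : encFold ℓ f b C L (fun φ => K φ + K' φ) =
      fun φ => encFold ℓ f b C L K φ + encFold ℓ f b C L K' φ := by
  induction L with
  | nil => rfl
  | cons i L ih =>
    have h1 : ∀ K, encFold ℓ f b C (i :: L) K = challengeWith ℓ f i (b i)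
      (execWith (encSamples ℓ f) (Loc.party i) (C i) (encFold ℓ f b C L K)) := fun _ => rfl
    have h2 : ∀ K K' : State Loc → ℝ, execWith (encSamples ℓ f) (Loc.party i) (C i)
        (fun φ => K φ + K' φ) = fun φ => execWith (encSamples ℓ f) (Loc.party i) (C i) K φ +
          execWith (encSamples ℓ f) (Loc.party i) (C i) K' φ :=
      fun K K' => funext fun ψ => execWith_add _ _ _ K K' ψ
    rw [h1, h1, h1, ih, h2, challengeWith_add]

theorem normSq_dec {α : Type} [DecidableEq α] (D : α → Prop) : Dec D (normSq : State α → ℝ) := Dec.of_sum D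

theorem measure_normSq {α β : Type} [DecidableEq α] (R : Finset α → β) (ψ : State α) :
    measure R (fun _ => normSq) ψ = normSq ψ :=
  measure_const (normSq_dec fun _ => True) normSq_quad.zero
    (fun S T h => by rw [Finset.ext fun q => h q trivial]) ψ

theorem challengeWith_normSq (ℓ : ℕ) (f : List Bool → Bool) (i : ℕ) (b : Bool) :
    challengeWith ℓ f i b normSq = normSq := by
  funext ψ
  have h : ∀ (s : List Bool) (φ : State Loc), normSq (Finsupp.mapDomain (writeStr
      (regAt (Loc.party i) (.chalLen, 0)) (regAt (Loc.party i) (.chalData, 0)) s) φ) = normSq φ := by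
    intro s φ
    rw [mapDomain_writeStr]
    exact normSq_mapDomain (symmDiff_left_injective _) φ
  simp only [challengeWith, h, avgBits_const, measure_normSq]

/-- A party that always succeeds contributes the squared norm of the final state to the score.
Measuring plaintexts, writing challenges and running circuits preserve it on average, so this
contribution comes through as a constant. -/
theorem encFold_normSq {ℓ N : ℕ} {f : List Bool → Bool} {b : Fin N → Bool}
    {C : ℕ → Circuit PartyReg} (L : List (Fin N)) : encFold ℓ f b C L normSq = normSq := by
  induction L with
  | nil => rfl
  | cons i L ih =>
    have h1 : encFold ℓ f b C (i :: L) normSq = challengeWith ℓ f i (b i)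
      (execWith (encSamples ℓ f) (Loc.party i) (C i) (encFold ℓ f b C L normSq)) := rfl
    have h2 : execWith (encSamples ℓ f) (Loc.party i) (C i) normSq = normSq :=
      funext fun ψ => execWith_normSq _ _ (fun w w' h => by simpa using h) _ ψ
    rw [h1, ih, h2, challengeWith_normSq]

theorem party_zero_ne_moveLoc (w : Wire PartyReg) (q : Loc) : Loc.party 0 w ≠ moveLoc 1 q := by
  rcases q with w' | ⟨i', w'⟩ | ⟨(_ | c' | _ | (_ | _) | c'), i', j'⟩ | ⟨i', w'⟩ <;>
    simp [moveLoc, pirateLoc, shiftWire, pirateKind, pirateShift]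

theorem prot_zero_ne_moveLoc (w : Wire ProtReg) (q : Loc) : Loc.prot 0 w ≠ moveLoc 1 q := by
  rcases q with w' | ⟨i', w'⟩ | ⟨(_ | c' | _ | (_ | _) | c'), i', j'⟩ | ⟨i', w'⟩ <;>
    simp [moveLoc, pirateLoc, shiftWire, pirateKind, pirateShift]

theorem Certain.of_owner {B : BBF} (Q : CopyProtection B) {l V : ℕ} {f : List Bool}
    (hf : IsOutput (B.sample l) f) (hV : ∀ g, Op.gate g ∈ Q.evalC l → ∀ q ∈ g.wires, q.2.2 < V)
    {X : State Loc} (hX : X ∈ spread (copyLoc V) (fun q => ∃ w, q = ownLoc V w)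
      (protState (Q.protect l) f)) {Z : Finset Loc}
    (hZ : ∀ q ∈ Z, ∃ t, q = .party 0 (.work 1, 0, t)) :
    Certain (Loc.party 0) (Circuit.relabel (placeWire ownerKind (fun _ => false) 0) (Q.evalC l))
      (fun t => Loc.party 0 (.work 2, 0, t)) (.party 0 (.work 3, 0, 0)) (B.len l) (B.fn l f)
      (flip Z X) := by
  have h1 : X ∈ spread (ownLoc V) (fun q => ∃ w, q = ownLoc V w)
      (emb Sum.inl ∅ (protState (Q.protect l) f)) := by
    rw [spread_emb (ownLoc_injective V)]
    exact hX
  refine Certain.relabel (Certain.of_mem_spread (ownLoc_injective V) (fun w => ⟨w, rfl⟩)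
    (Certain.of_correct Q hf) (fun g hg q hq => ownLoc_programWire (hV g hg q hq))
    (flip_mem_spread ?_ h1))
  rintro q hq ⟨w, h⟩
  obtain ⟨t, rfl⟩ := hZ q hq
  exact not_ownLoc (by simp) (fun k v h => Or.inl (by simp at h; exact h.1.symm)) w h

/-- Party 0 of the reduction lies outside the range of `moveLoc 1`, so its output is determined by
`A` alone and is always right. The other parties are those of the simulated game, with index raised
by one. -/
theorem score_emb_succ {N : ℕ} (b : Fin (N + 1) → Bool) {A : Finset Loc}
    (hA : Loc.party 0 (.out, 0, 0) ∈ A ↔ b 0 = true) (hA' : ∀ i, Loc.party (i + 1) (.out, 0, 0) ∉ A)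
    (ψ : State Loc) : score b (emb (moveLoc 1) A ψ) = score (fun i => b i.succ) ψ + normSq ψ := by
  rw [score_emb b (moveLoc_injective 1), score, normSq, ← Finsupp.sum_add]
  refine Finset.sum_congr rfl fun S _ => ?_
  have h0 : decide (Loc.party 0 (.out, 0, 0) ∈ S.image (moveLoc 1) ∆ A) = b 0 := by
    rw [Bool.eq_iff_iff, ← hA, decide_eq_true_iff]
    exact mem_emb' fun q => party_zero_ne_moveLoc _ q
  have h1 : ∀ i : ℕ, decide (Loc.party (i + 1) (.out, 0, 0) ∈ S.image (moveLoc 1) ∆ A) =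
      decide (Loc.party i (.out, 0, 0) ∈ S) := fun i => decide_eq_decide.2 (by
    have h2 : Loc.party (i + 1) (.out, 0, 0) = moveLoc 1 (.party i (.out, 0, 0)) := rfl
    rw [h2]
    exact mem_emb (moveLoc_injective 1) (hA' i))
  have h2 : (Finset.univ.filter fun i : Fin (N + 1) =>
      decide (Loc.party i (.out, 0, 0) ∈ S.image (moveLoc 1) ∆ A) = b i).card =
      (Finset.univ.filter fun i : Fin N => decide (Loc.party i (.out, 0, 0) ∈ S) = b i.succ).card
        + 1 := by
    rw [Fin.card_filter_univ_succ, if_pos (by exact h0)]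
    simp only [Fin.val_succ, h1]
  beta_reduce
  rw [h2]
  push_cast
  ring

/-- After the banks have been filled and the copy has been handed over, the copy is never disturbed
again: the additional party undoes its evaluation, and nobody else touches these qubits. By
decoherence the value is a sum over the basis states of the copy, in which the weights add up to one
and all of them multiply the same value. The additional party accounts for `normSq ψ`. -/
theorem flip_value_one {B : BBF} (Q : CopyProtection B) {l N Np V m M : ℕ} {f : List Bool}
    (hf : IsOutput (B.sample l) f) (hp : 1 ≤ Np) (hNp : N ≤ Np) (hmV : V < m)
    (hmq : V * (B.len l + 1) ≤ m) (hmM : m ≤ M) (hVM : V * V ≤ M) {C : Circuit PirateReg}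
    {Cs : ℕ → Circuit PartyReg} (hC : C.Bounded V) (hCs : ∀ i < N, (Cs i).Bounded V)
    (hV : ∀ g, Op.gate g ∈ Q.evalC l → ∀ q ∈ g.wires, q.2.2 < V)
    (b : Fin (N + 1) → Bool) {ψ : State Loc} (hψ : ∀ S ∈ ψ.support, ∀ q ∈ S, ∃ w, q = .gen w) :
    execWith (flipSamples (B.len l) (B.fn l f) (b 0)) (Loc.party 0) (owner (B.len l) (Q.evalC l))
      (flipFold 1 (B.len l) V m (B.fn l f) (fun i => b i.succ) Cs (List.finRange N) (score b))
      (exec pirateLoc (flipPirate 1 Np (B.len l) V M (Q.evalC l) (handOver V) C)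
        (attach (Loc.prot 0) (protState (Q.protect l) f) ψ)) =
    execWith (encSamples (B.len l) (B.fn l f)) pirateLoc C
      (encFold (B.len l) (B.fn l f) (fun i => b i.succ) Cs (List.finRange N)
        (score fun i => b i.succ)) ψ + normSq ψ := by
  set ℓ := B.len l
  set F := B.fn l f
  set π := protState (Q.protect l) f with hπ
  set Kf := flipFold 1 ℓ V m F (fun i => b i.succ) Cs (List.finRange N) (score b) with hKf
  have hKdec : Dec KeptReg Kf := flipFold_dec (score_dec KeptReg b) (List.finRange N)
  have hKq : Quad Kf := flipFold_quad (score_quad b) _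
  have hχ : attach (Loc.prot 0) π ψ ∈ spread (Loc.prot 0) (Fresh 1) π :=
    attach_mem_spread fun S hS q hq => by obtain ⟨w, rfl⟩ := hψ S hS q hq; simp [Fresh]
  have hbank : ∀ S ∈ (attach (Loc.prot 0) π ψ).support, ∀ q ∈ S, ¬ BankWire 1 q := by
    intro S hS q hq
    rcases mem_support_spread hχ hS hq with ⟨w, rfl⟩ | h
    · exact not_bankWire_prot w
    · rcases q with w | ⟨i, w⟩ | w | ⟨i, w⟩
      exacts [not_bankWire_gen w, not_bankWire_prot w, absurd trivial h, absurd trivial h]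
  have hb0 : ∀ w, ¬ BankWire 1 (.party 0 w) := by
    rintro w (⟨c, _, v, h⟩ | ⟨p, hp, c, _, v, h⟩) <;> simp at h
    omega
  have hgen : emb (moveLoc 1) ∅ ψ = ψ := emb_eq_self fun S hS q hq => by
    obtain ⟨w, rfl⟩ := hψ S hS q hq; rfl
  have hcopyBank : ∀ w, ¬ BankWire 1 (copyLoc V w) := fun w => by
    rcases copyLoc_cases V w with h | ⟨j, -, -, h⟩ <;> rw [h]
    exacts [not_bankWire_prot w, hb0 _]
  have hmoveOwn : ∀ q w, moveLoc 1 q ≠ ownLoc V w := fun q => not_ownLoc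
    (fun w h => prot_zero_ne_moveLoc w q h.symm) fun k v h => absurd h.symm (party_zero_ne_moveLoc _ q)
  have hworkOwn : ∀ v w, Loc.pirate v ≠ ownLoc V w := fun v => not_ownLoc (by simp) (by simp)
  have hbankOwn : ∀ q, BankWire 1 q → ∀ w, q ≠ ownLoc V w := fun q hq => not_ownLoc
    (fun w h => not_bankWire_prot w (h ▸ hq)) fun k v h => absurd (h ▸ hq) (hb0 _)
  have hsimOn : ∀ P : Loc → Prop, (∀ q, P (moveLoc 1 q)) → (∀ v, P (.pirate v)) →
      (simPirate 1 ℓ V C).On fun q => P (pirateLoc q) := fun P h1 h2 =>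
    Circuit.On.subst (fun i o _ => simOp_on _ _ _ _ _ _ _
      (fun w => by rw [moveLoc_pirateLoc]; exact h1 _) (fun w => h2 _) (fun w => h2 _) o) 0
  have hsimNQ : (simPirate 1 ℓ V C).NoQuery := Circuit.NoQuery.subst
    (fun i o _ => simOp_noQuery _ _ _ _ _ _ _ o) 0
  have hDon : ∀ P : Loc → Prop, (∀ w, P (.prot 0 w)) → (∀ w, P (.party 0 w)) →
      (handOver V).On fun q => P (pirateLoc q) := fun P h1 h2 =>
    Circuit.On.append
      (Circuit.On.flatMap fun j _ => Circuit.On.single fun q hq => by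
        simp only [Gate.wires, List.mem_cons, List.not_mem_nil, or_false] at hq
        rcases hq with rfl | rfl
        exacts [h1 _, h2 _])
      (Circuit.On.flatMap fun j _ => Circuit.On.single fun q hq => by
        simp only [Gate.wires, List.mem_cons, List.not_mem_nil, or_false] at hq
        rcases hq with rfl | rfl
        exacts [h2 _, h1 _])
  have hDNQ : (handOver V).NoQuery := fun x src tgt h => by simp [handOver] at h
  have hownW : (owner ℓ (Q.evalC l)).Writes fun q => ¬ BankWire 1 (Loc.party 0 q) :=
    ⟨fun g _ => hb0 _, fun _ _ _ _ j => hb0 _⟩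
  have hbk : ∀ q, BankWire 1 q → KeptReg q := by
    rintro q (⟨c, _, w, rfl⟩ | ⟨p, _, c, hc, w, rfl⟩)
    · exact Or.inr (by simp)
    · exact Or.inl ⟨p, c, w, by omega, rfl⟩
  have hstep : ∀ β ⊆ bankWires Np 1 ℓ M, execWith (flipSamples ℓ F (b 0)) (Loc.party 0)
      (owner ℓ (Q.evalC l)) Kf (exec pirateLoc (simPirate 1 ℓ V C) (exec pirateLoc (handOver V)
        (flip (β ∆ answers Np 1 ℓ M F β) (attach (Loc.prot 0) π ψ)))) =
      tapeFold 1 ℓ V m F (fun i => b i.succ) Cs β (List.finRange N)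
        (fun φ => score (fun i => b i.succ) φ + normSq φ)
        (execTape pirateLoc (encBits (bitEnc F) ℓ)
          (bankTape ℓ V (fun p => .pirate (.work 0, 0, p)) β) 0 C ψ) := by
    intro β hβ
    set Z := β ∆ answers Np 1 ℓ M F β with hZ
    have hZb : ∀ q ∈ Z, BankWire 1 q := fun q hq => bankWire_of_mem_symmDiff hβ hq
    have hZ1 : ∀ q, ¬ BankWire 1 q → q ∉ Z := fun q h h' => h (hZb q h')
    rw [flip_exec pirateLoc (hDon (· ∉ Z) (fun w => hZ1 _ (not_bankWire_prot w))
      fun w => hZ1 _ (hb0 w)), exec_handOver V π hψ]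
    set X := exec pirateLoc (simPirate 1 ℓ V C) (flip Z (attach (copyLoc V) π ψ)) with hX
    -- The simulated pirate acts neither on the copy nor on the memory for its evaluation. So the
    -- copy is still in a product state with the rest, and the evaluation by the additional party is
    -- certain.
    have hXs : X ∈ spread (copyLoc V) (fun q => ∃ w, q = ownLoc V w) π := by
      refine exec_mem_spread (hsimOn (fun q => (∀ w, q ≠ copyLoc V w) ∧ ¬ ∃ w, q = ownLoc V w)
        (fun q => ⟨fun w => hmoveOwn q (.inl w), fun ⟨w, h⟩ => hmoveOwn q w h⟩)
        fun v => ⟨fun w => hworkOwn v (.inl w), fun ⟨w, h⟩ => hworkOwn v w h⟩)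
        (flip_mem_spread (fun q hq ⟨w, h⟩ => hbankOwn q (hZb q hq) w h) (attach_mem_spread ?_))
      rintro S hS q hq ⟨w, h⟩
      obtain ⟨v, rfl⟩ := hψ S hS q hq
      exact not_ownLoc (by simp) (by simp) w h
    have hXw : ∀ S ∈ X.support, ∀ t, Loc.party 0 (.work 1, 0, t) ∉ S := by
      intro S hS t h
      obtain ⟨T, hT, hTS⟩ := support_exec (P := fun q => q ≠ Loc.party 0 (.work 1, 0, t))
        (fun g hg => hsimOn (· ≠ Loc.party 0 (.work 1, 0, t))
          (fun q h => party_zero_ne_moveLoc _ q h.symm) (by simp) g hg _ g.target_mem_wires) hS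
      rw [hTS _ (by simp)] at h
      have h2 : attach (copyLoc V) π ψ ∈ spread (copyLoc V)
          (fun q => q = Loc.party 0 (.work 1, 0, t)) π := attach_mem_spread fun S hS q hq h => by
        obtain ⟨v, rfl⟩ := hψ S hS q hq
        simp at h
      rcases mem_support_spread (flip_mem_spread (fun q hq h => hZ1 _ (hb0 _) (h ▸ hq)) h2) hT h with
        ⟨w, h⟩ | h
      · rcases copyLoc_cases V w with h' | ⟨_, -, -, h'⟩ <;> rw [h'] at h <;> simp at h
      · exact h rfl
    rw [exec_owner hXw fun Y hY => Certain.of_owner Q hf hV hXs hY]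
    refine (setAvg_congr fun γ hγ => ?_).trans (setAvg_const (flipWires 0 ℓ 1) _)
    set T := sampleSet 0 ℓ F (b 0) γ 1 ∆ tog (b 0) (.party 0 (.out, 0, 0)) with hT
    have hTm : ∀ q ∈ T, (∃ j t, q = Loc.party 0 (.work 1, j, t)) ∨ q = .party 0 (.out, 0, 0) := by
      intro q hq
      rcases Finset.mem_symmDiff.1 hq with h | h
      · exact Or.inl (mem_sampleSet h.1)
      · refine Or.inr ?_
        have := h.1
        unfold tog at this
        split_ifs at this <;> simpa using this
    have hTp : ∀ q ∈ T, ∃ w, q = Loc.party 0 w := fun q hq => by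
      rcases hTm q hq with ⟨j, t, rfl⟩ | rfl <;> exact ⟨_, rfl⟩
    -- All that the additional party has changed are qubits `T` of its own. The simulated pirate
    -- does not act on them, so this change may as well precede its run.
    rw [hX, ← flip_exec pirateLoc (hsimOn (· ∉ T)
      (fun q h => by obtain ⟨w, h⟩ := hTp _ h; exact party_zero_ne_moveLoc w q h.symm)
      fun v h => by obtain ⟨w, h⟩ := hTp _ h; simp at h), flip_flip]
    have hsum : flip (Z ∆ T) (attach (copyLoc V) π ψ) = ∑ A ∈ π.support,
        π A • emb (moveLoc 1) (A.image (copyLoc V) ∆ (Z ∆ T)) ψ := by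
      have h1 : ∀ φ : State Loc, flip (Z ∆ T) φ = Finsupp.lmapDomain ℂ ℂ (· ∆ (Z ∆ T)) φ :=
        fun _ => rfl
      have h2 : ∀ A : Finset (Wire ProtReg), emb (moveLoc 1) (A.image (copyLoc V) ∆ (Z ∆ T)) ψ =
          flip (Z ∆ T) (flip (A.image (copyLoc V)) ψ) := fun A => by
        conv_rhs => rw [← hgen, flip_emb, flip_emb, show (∅ : Finset Loc) = ⊥ from rfl, bot_symmDiff]
      rw [attach, Finsupp.sum, h1, map_sum]
      exact Finset.sum_congr rfl fun A _ => by rw [map_smul, h2, ← h1]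
    -- From here on no circuit writes to the qubits of the copy, so that its basis states contribute
    -- separately.
    have hdec : Dec (fun q => ∃ w, q = copyLoc V w)
        fun φ => Kf (exec pirateLoc (simPirate 1 ℓ V C) φ) := by
      refine Dec.exec (hKdec.mono ?_) (Circuit.On.writes (hsimOn (fun q => ¬ ∃ w, q = copyLoc V w)
        (fun q ⟨w, h⟩ => hmoveOwn q (.inl w) h) fun v ⟨w, h⟩ => hworkOwn v (.inl w) h) hsimNQ)
      rintro q ⟨w, rfl⟩
      rcases copyLoc_cases V w with h | ⟨j, -, -, h⟩ <;> rw [h]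
      · exact Or.inr (by simp)
      · exact Or.inl ⟨0, 0, _, by omega, rfl⟩
    have hmem : ∀ (A : Finset (Wire ProtReg)) q, (∀ w, q ≠ copyLoc V w) →
        (q ∈ A.image (copyLoc V) ∆ (Z ∆ T) ↔ q ∈ Z ∆ T) := fun A q h => mem_emb' h
    have hcopy : ∀ (A : Finset (Wire ProtReg)) w, copyLoc V w ∈ A.image (copyLoc V) ∆ (Z ∆ T) ↔
        w ∈ A := fun A w => mem_emb (copyLoc_injective V) fun h => by
      rcases Finset.mem_symmDiff.1 h with h | h
      · exact hZ1 _ (hcopyBank w) h.1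
      · rcases hTm _ h.1 with ⟨j, t, h⟩ | h <;>
          rcases copyLoc_cases V w with h' | ⟨_, -, -, h'⟩ <;> rw [h'] at h <;> simp at h
    rw [hsum, hdec.sum ((hKq.exec pirateLoc _).zero)]
    -- The weights of the basis states of the copy form a probability distribution, and the value is
    -- the same for each of them.
    · have hone : ∑ A ∈ π.support, ‖π A‖ ^ 2 = 1 := normSq_protState (Q.protect l) f
      rw [← one_mul (tapeFold _ _ _ _ _ _ _ _ _ _ _), ← hone, Finset.sum_mul]
      refine Finset.sum_congr rfl fun A _ => ?_
      refine ((hKq.exec pirateLoc _) (π A) _).trans (congrArg _ ?_)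
      have hp0 : ∀ k v, k ≠ .state 0 → (Loc.party 0 (k, v) ∈ A.image (copyLoc V) ∆ (Z ∆ T) ↔
          Loc.party 0 (k, v) ∈ T) := fun k v hk => by
        rw [hmem A _ fun w h => by
          rcases copyLoc_cases V w with h' | ⟨_, -, -, h'⟩ <;> rw [h'] at h <;> simp at h
          exact hk h.1]
        simp [Finset.mem_symmDiff, hZ1 _ (hb0 (k, v))]
      have hp1 : ∀ i w, (Loc.party (i + 1) w ∈ A.image (copyLoc V) ∆ (Z ∆ T) ↔
          Loc.party (i + 1) w ∈ Z) := fun i w => by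
        have h1 : Loc.party (i + 1) w ∉ T := fun h => by obtain ⟨v, h⟩ := hTp _ h; simp at h
        rw [hmem A _ fun w h => by
          rcases copyLoc_cases V w with h' | ⟨_, -, -, h'⟩ <;> rw [h'] at h <;> simp at h]
        simp [Finset.mem_symmDiff, h1]
      have hmv : ∀ q, moveLoc 1 q ∉ A.image (copyLoc V) ∆ (Z ∆ T) := fun q => by
        rw [hmem A _ fun w => hmoveOwn q (.inl w), Finset.mem_symmDiff]
        rintro (h | h)
        · exact hZ1 _ (not_bankWire_moveLoc 1 1 q) h.1
        · obtain ⟨w, h⟩ := hTp _ h.1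
          exact party_zero_ne_moveLoc w q h.symm
      refine flipFold_simPirate hNp hmV hmq hmM hVM hC hCs hβ (fun q hq => ?_) hmv ?_ ?_ (score_dec _ b) (score_quad b) ?_
      · rw [hmem A q fun w h => hcopyBank w (h ▸ hq), Finset.mem_symmDiff]
        have h1 : q ∉ T := fun h => by obtain ⟨w, rfl⟩ := hTp _ h; exact hb0 w hq
        simp [h1, hZ]
      · intro i _ c _ x j h
        rw [hp1] at h
        rcases hZb _ h with ⟨_, _, _, h'⟩ | ⟨_, _, _, _, _, h'⟩ <;> simp at h'
      · intro S hS i j h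
        obtain ⟨w, h⟩ := hψ S hS _ h
        simp at h
      · intro anc' ψ' h
        have h' : ∀ p, Loc.party p (.out, 0, 0) ∈ anc' ↔ _ := fun p => h _ (by simp)
        refine score_emb_succ b ?_ ?_ ψ'
        · rw [h', hp0 _ _ (by simp), hT, Finset.mem_symmDiff]
          have h1 : Loc.party 0 (.out, 0, 0) ∉ sampleSet 0 ℓ F (b 0) γ 1 := fun h => by
            obtain ⟨j, t, h⟩ := mem_sampleSet h; simp at h
          generalize b 0 = c at h1 ⊢
          cases c <;> simp [h1, tog]
        · intro i
          rw [h', hp1]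
          exact hZ1 _ fun h => by
            rcases h with ⟨_, _, _, h'⟩ | ⟨_, _, _, _, _, h'⟩ <;> simp at h'
    · intro A _ A' _ hA S hS S' hS'
      have h1 : ∃ w, ¬ (w ∈ A ↔ w ∈ A') := by
        by_contra h
        push Not at h
        exact hA (Finset.ext h)
      obtain ⟨w, hw⟩ := h1
      refine ⟨_, ⟨w, rfl⟩, fun h => hw ?_⟩
      have h2 : ∀ (A : Finset (Wire ProtReg)) S, S ∈ (π A •
          emb (moveLoc 1) (A.image (copyLoc V) ∆ (Z ∆ T)) ψ).support →
          (copyLoc V w ∈ S ↔ w ∈ A) := fun A S hS => by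
        obtain ⟨S₀, -, rfl⟩ := mem_support_emb (Finsupp.support_smul hS)
        exact (mem_emb' fun q h => hmoveOwn q (.inl w) h.symm).trans (hcopy A w)
      rw [← h2 A S hS, ← h2 A' S' hS', h]
  rw [exec_flipPirate (f := F) ((hKdec.mono fun q hq => hbk q (bankWire_of_mem hq)).execWith _
      (hownW.mono fun q h h' => h (bankWire_of_mem h'))) (hKq.execWith _ _ _)
    (Circuit.On.writes (hDon (· ∉ bankWires Np 1 ℓ M)
      (fun w h => not_bankWire_prot w (bankWire_of_mem h)) fun w h => hb0 w (bankWire_of_mem h)) hDNQ)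
    hbank (fun Z hZ => Certain.of_dealt Q hf hp hχ hZ), setAvg_congr hstep,
    setAvg_pirate hNp hmV hmq hmM hVM hC hCs]
  · rw [encFold_add, execWith_add, encFold_normSq, execWith_normSq _ _ pirateLoc_injective]
  · intro S hS i j h
    obtain ⟨w, h⟩ := hψ S hS _ h
    simp at h

/-! ### The games -/

theorem readKey_image {e : Wire SampleReg → Loc} (he : Function.Injective e)
    (S : Finset (Wire SampleReg)) : readKey e (S.image e) = readKey id S := by
  have h : ∀ w, e w ∈ S.image e ↔ w ∈ S := fun w => by simp [he.eq_iff]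
  rw [readKey, readKey, readStr, readStr, readLen_congr (regAt_injective he _)
    (regAt_injective Function.injective_id _) fun j => h _]
  exact List.map_congr_left fun j _ => decide_eq_decide.2 (h _)

/-- Both games begin with the same generation of a key. Its measurement yields only possible outputs
of the sampler, and leaves states in which nothing but the memory of the sampler is occupied; so the
games may be compared one key at a time. The numbers of copies are allowed to differ because the
second reduction is given one copy more. -/
theorem deal_congr {G : Circuit SampleReg} {P : Circuit ProtReg} {n n' : ℕ}
    {K K' : List Bool → State Loc → ℝ}
    (h : ∀ f φ, IsOutput G f → (∀ S ∈ φ.support, ∀ q ∈ S, ∃ w, q = Loc.gen w) →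
      K f ((List.range n).foldl (fun φ i => exec (Loc.prot i) P
        (Finsupp.mapDomain (writeKey (Loc.prot i) f) φ)) φ) =
      K' f ((List.range n').foldl (fun φ i => exec (Loc.prot i) P
        (Finsupp.mapDomain (writeKey (Loc.prot i) f) φ)) φ)) :
    deal G P n K = deal G P n' K' := by
  have hinj : Function.Injective Loc.gen := fun w w' h => by simpa using h
  have h1 : exec Loc.gen G (ket ∅) = emb Loc.gen ∅ (sampleState G) := by
    rw [sampleState, ← emb_exec hinj (fun _ _ _ _ => by simp), emb_ket, Finset.image_empty,
      symmDiff_none]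
    rfl
  unfold deal
  refine measure_congr fun S₀ hS₀ φ hφ => ?_
  have h2 : ∀ S ∈ (exec Loc.gen G (ket ∅)).support, ∃ T ∈ (sampleState G).support,
      S = T.image Loc.gen := fun S hS => by
    rw [h1] at hS
    obtain ⟨T, hT, rfl⟩ := mem_support_emb hS
    exact ⟨T, hT, symmDiff_none _⟩
  refine h _ φ ?_ fun S hS q hq => ?_
  · obtain ⟨T, hT, rfl⟩ := h2 S₀ hS₀
    exact ⟨T, hT, (readKey_image hinj T).symm⟩
  · obtain ⟨T, -, rfl⟩ := h2 S (hφ S hS).2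
    obtain ⟨w, -, rfl⟩ := Finset.mem_image.1 hq
    exact ⟨w, rfl⟩

theorem deal_add_normSq (G : Circuit SampleReg) (P : Circuit ProtReg)
    (K : List Bool → State Loc → ℝ) :
    deal G P 0 (fun f ψ => K f ψ + normSq ψ) = deal G P 0 K + 1 := by
  have h : measure (readKey Loc.gen) (fun _ => normSq) (exec Loc.gen G (ket ∅)) = 1 := by
    rw [measure_normSq, normSq_exec, normSq_ket]
  rw [← h]
  exact measure_add _ _ _ _

theorem avgChoice_add (N : ℕ) (K : (Fin N → Bool) → ℝ) (c : ℝ) :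
    avgChoice N (fun b => K b + c) = avgChoice N K + c := by
  unfold avgChoice
  rw [Finset.sum_add_distrib, add_div]
  simp

theorem avgChoice_succ (N : ℕ) (K : (Fin N → Bool) → ℝ) :
    avgChoice (N + 1) (fun b => K fun i => b i.succ) = avgChoice N K := by
  unfold avgChoice
  rw [← (Fin.consEquiv fun _ => Bool).sum_comp, Fintype.sum_prod_type]
  simp only [Fin.consEquiv, Equiv.coe_fn_mk, Fin.cons_succ]
  simp [pow_succ, ← two_mul]
  field_simp

/-! ### The two reductions: uniformity and exact values -/

section
variable {B : BBF} (Q : CopyProtection B) (A : Adversary) (l N : ℕ)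

/-- The oracle of the bit-by-bit extension is `encSamples` by definition; the two sides differ only
in the order of challenges and runs, which `encFold_eq` takes care of. -/
theorem qcpaGame_eq (n k : ℕ) : (oneBitScheme B Q).ext.qcpaGame n k A l =
    deal (B.sample l) (Q.protect l) n fun f ψ => avgChoice (n + k) fun b =>
      execWith (encSamples (B.len l) (B.fn l f)) pirateLoc (A.pirate l)
        (encFold (B.len l) (B.fn l f) b (A.party l) (List.finRange (n + k)) (score b)) ψ := by
  unfold UDScheme.qcpaGame
  simp only [encFold_eq (List.nodup_finRange _) (score_quad _)]
  rfl

/-- The number of blocks in a challenge, given a bound on the adversary. -/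
def blocks (B : BBF) (V : Polynomial ℕ) (l : ℕ) : ℕ :=
  V.eval l * (B.len l + 1) + V.eval l + 1

/-- The reduction that evaluates the function with a copy that nobody receives. -/
noncomputable def simulator (p V : Polynomial ℕ) : Adversary where
  pirate l := flipPirate 0 (p.eval l) (B.len l) (V.eval l) (blocks B V l + V.eval l * V.eval l)
    (Q.evalC l) [] (A.pirate l)
  party l i := flipParty (B.len l) (V.eval l) (blocks B V l) (A.party l i)

/-- The reduction whose first party receives the only copy. -/
noncomputable def ownerSimulator (p V : Polynomial ℕ) : Adversary where
  pirate l := flipPirate 1 (p.eval l) (B.len l) (V.eval l) (blocks B V l + V.eval l * V.eval l)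
    (Q.evalC l) (handOver (V.eval l)) (A.pirate l)
  party l i := if i = 0 then owner (B.len l) (Q.evalC l) else
    flipParty (B.len l) (V.eval l) (blocks B V l) (A.party l (i - 1))

theorem Comp.blocks {κ Γ : Type} {xs : List (Γ → ℕ)} {f : Γ → ℕ} (hf : Comp κ xs f) (B : BBF)
    (V : Polynomial ℕ) : Comp κ xs fun γ => QCrypto.blocks B V (f γ) :=
  (((hf.polynomial V).mul ((Comp.of_polyTimeLength B.len_poly hf).add (.const _ _))).add
    (hf.polynomial V)).add (.const _ _)

variable {A}

/-- The numbers of copies and parties do not enter the circuits: banks are made for `p.eval l`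
parties, whether or not so many exist. Therefore `n` and `k` only have to be polynomially bounded
and need not be computable. -/
theorem simulator_isQPT (hA : A.IsQPT) (p V : Polynomial ℕ) : (simulator Q A p V).IsQPT := by
  have h0 : Comp PirateReg [id] id := .var (by simp)
  have h1 : Comp PartyReg [(Prod.fst : ℕ × ℕ → ℕ), Prod.snd] Prod.fst := .var (by simp)
  have h2 : Comp PartyReg [(Prod.fst : ℕ × ℕ → ℕ), Prod.snd] Prod.snd := .var (by simp)
  constructor
  · exact Emits.qpt (Emits.flipPirate 0 (h0.polynomial p) (.of_polyTimeLength B.len_poly h0)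
      (h0.polynomial V) ((h0.blocks B V).add ((h0.polynomial V).mul (h0.polynomial V))) h0
      Q.eval_qpt hA.1 (Emits.nil _))
  · exact Emits.indexedQPT (Emits.flipParty (.of_polyTimeLength B.len_poly h1) (h1.polynomial V)
      (h1.blocks B V) h1 h2 hA.2)

theorem ownerSimulator_isQPT (hA : A.IsQPT) (p V : Polynomial ℕ) :
    (ownerSimulator Q A p V).IsQPT := by
  have h0 : Comp PirateReg [id] id := .var (by simp)
  have h1 : Comp PartyReg [(Prod.fst : ℕ × ℕ → ℕ), Prod.snd] Prod.fst := .var (by simp)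
  have h2 : Comp PartyReg [(Prod.fst : ℕ × ℕ → ℕ), Prod.snd] Prod.snd := .var (by simp)
  constructor
  · exact Emits.qpt (Emits.flipPirate 1 (h0.polynomial p) (.of_polyTimeLength B.len_poly h0)
      (h0.polynomial V) ((h0.blocks B V).add ((h0.polynomial V).mul (h0.polynomial V))) h0
      Q.eval_qpt hA.1 (Emits.handOver (h0.polynomial V)))
  · exact Emits.indexedQPT ((Does.ite (f := fun _ => 0) (g := fun _ => 0) h2
      (Emits.owner (.of_polyTimeLength B.len_poly h1) h1 Q.eval_qpt)
      (Emits.flipParty (.of_polyTimeLength B.len_poly h1) (h1.polynomial V)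
      (h1.blocks B V) h1 (h2.sub (.const _ 1)) hA.2)).congr (fun _ => by simp) fun _ => rfl)

theorem exists_bounds (hA : A.IsQPT) {N : ℕ → ℕ} (hN : PolyBounded N) :
    ∃ p V : Polynomial ℕ, ∀ l, N l ≤ p.eval l ∧ 1 ≤ p.eval l ∧ (A.pirate l).Bounded (V.eval l) ∧
      (∀ i < N l, (A.party l i).Bounded (V.eval l)) ∧
      ∀ g, Op.gate g ∈ Q.evalC l → ∀ q ∈ g.wires, q.2.2 < V.eval l := by
  obtain ⟨p, hp⟩ := hN
  obtain ⟨V₁, h1⟩ := hA.1.bounded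
  obtain ⟨V₂, h2⟩ := hA.2.bounded
  obtain ⟨V₃, h3⟩ := Q.eval_qpt.bounded
  -- The first summand 1 keeps the number of banks positive even when there are no parties. Parties
  -- of index below `N l` are covered by the value of `V₂` at `l` plus the bound for the index. The
  -- last summand 1 makes the bound for positions in the evaluation circuit strict.
  refine ⟨p + 1, V₁ + V₂.comp (.X + p) + V₃ + 1, fun l => ⟨?_, ?_, ?_, fun i hi => ?_, ?_⟩⟩
  · have := hp l
    simp; omega
  · simp
  · exact (h1 l).mono (by simp; omega)
  · refine (h2 l i).mono ?_
    have := eval_le_eval V₂ (Nat.add_le_add_left (hi.le.trans (hp l)) l)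
    simp; omega
  · intro g hg q hq
    have : q.2.2 ≤ V₃.eval l := ((h3 l).2 _ hg q hq).2
    simp; omega

variable {l} {p V : Polynomial ℕ}

/-- The values are compared for each key and each choice of hidden bits. The copy used for the
evaluations is the first of the `n`, which exists by `hn`. -/
theorem flipGame_simulator {n k : ℕ} (hn : 1 ≤ n) (hN : n + k ≤ p.eval l)
    (hC : (A.pirate l).Bounded (V.eval l))
    (hCs : ∀ i < n + k, (A.party l i).Bounded (V.eval l)) :
    flipGame Q n k (simulator Q A p V) l = (oneBitScheme B Q).ext.qcpaGame n k A l := by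
  rw [qcpaGame_eq, flipGame]
  refine deal_congr fun f φ hf hφ => congrArg _ (funext fun b => ?_)
  exact flip_value_zero Q hf ((Nat.le_add_right n k).trans hN) hN (V := V.eval l)
    (m := blocks B V l) (by unfold blocks; omega) (by unfold blocks; omega)
    (Nat.le_add_right _ _) (Nat.le_add_left _ _) hC hCs b (dealt_mem_spread hn _ _ hφ)

/-- Freeloader 0 is the owner of the copy, and freeloader `i + 1` simulates distinguisher `i`. The
encryption game has no copies here, so its pirate starts with nothing. The bit of the owner is
averaged out because the value does not depend on it. -/
theorem flipGame_ownerSimulator {k : ℕ} (hN : k ≤ p.eval l) (hp : 1 ≤ p.eval l)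
    (hC : (A.pirate l).Bounded (V.eval l)) (hCs : ∀ i < k, (A.party l i).Bounded (V.eval l))
    (hV : ∀ g, Op.gate g ∈ Q.evalC l → ∀ q ∈ g.wires, q.2.2 < V.eval l) :
    flipGame Q 1 k (ownerSimulator Q A p V) l = (oneBitScheme B Q).ext.qcpaGame 0 k A l + 1 := by
  rw [qcpaGame_eq, flipGame, ← deal_add_normSq, Nat.zero_add, Nat.add_comm 1 k]
  refine deal_congr fun f φ hf hφ => ?_
  rw [← avgChoice_add]
  refine Eq.trans (congrArg (avgChoice (k + 1)) (funext fun b => ?_)) (avgChoice_succ k _)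
  have h1 : runParties (ownerSimulator Q A p V) l (k + 1) (fun i => flipOracle B l f (b i))
      (score b) = execWith (flipSamples (B.len l) (B.fn l f) (b 0)) (Loc.party 0)
        (owner (B.len l) (Q.evalC l)) (flipFold 1 (B.len l) (V.eval l) (blocks B V l) (B.fn l f)
          (fun i => b i.succ) (A.party l) (List.finRange k) (score b)) := by
    rw [runParties, List.finRange_succ, List.foldr_cons, List.foldr_map]
    rfl
  have h2 : (List.range 1).foldl (fun φ i => exec (Loc.prot i) (Q.protect l)
      (Finsupp.mapDomain (writeKey (Loc.prot i) f) φ)) φ =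
        attach (Loc.prot 0) (protState (Q.protect l) f) φ :=
    exec_protect (Q.protect l) f fun S hS w hw => by
      obtain ⟨v, h⟩ := hφ S hS _ hw
      simp at h
  rw [h1, h2]
  exact flip_value_one Q hf hp hN (V := V.eval l)
    (m := blocks B V l) (by unfold blocks; omega) (by unfold blocks; omega)
    (Nat.le_add_right _ _) (Nat.le_add_left _ _) hC hCs hV b hφ

end

theorem Negligible.max_abs {f g : ℕ → ℝ} (hf : Negligible f) (hg : Negligible g) :
    Negligible fun l => max |f l| |g l| := by
  intro c hc
  filter_upwards [hf c hc, hg c hc] with l h1 h2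
  rw [abs_of_nonneg (le_max_of_le_left (abs_nonneg _))]
  exact max_lt h1 h2

theorem PolyBounded.add {f g : ℕ → ℕ} (hf : PolyBounded f) (hg : PolyBounded g) :
    PolyBounded fun l => f l + g l := by
  obtain ⟨p, hp⟩ := hf
  obtain ⟨q, hq⟩ := hg
  exact ⟨p + q, fun l => by simpa using Nat.add_le_add (hp l) (hq l)⟩

end QCrypto

theorem mainTheorem2 (B : QCrypto.BBF) (Q : QCrypto.CopyProtection B) :
    (∀ n k : ℕ → ℕ, QCrypto.PolyBounded n → QCrypto.PolyBounded k → (∀ l, 1 ≤ n l) →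
      Q.FlipSecureFor n k → (QCrypto.oneBitScheme B Q).ext.QCPASecureFor n k) ∧
    (Q.FlipSecure → (QCrypto.oneBitScheme B Q).ext.QCPASecure) := by
  refine ⟨fun n k hn hk h1 h A hA => ?_, fun h n k hn hk A hA => ?_⟩
  · obtain ⟨p, V, hb⟩ := QCrypto.exists_bounds Q hA (hn.add hk)
    obtain ⟨ν, hν, h⟩ := h _ (QCrypto.simulator_isQPT Q hA p V)
    refine ⟨ν, hν, fun l => ?_⟩
    obtain ⟨h2, -, h3, h4, -⟩ := hb l
    simp only [← QCrypto.flipGame_simulator Q (h1 l) h2 h3 h4]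
    exact h l
  -- The number of copies may be zero for some parameters and positive for others, so both
  -- reductions are carried out for all parameters.
  · obtain ⟨p, V, hb⟩ := QCrypto.exists_bounds Q hA (hn.add hk)
    -- Security is invoked for the maximum of `n` and 1, which equals `n` at the parameters where
    -- the first reduction is used.
    have hn' : QCrypto.PolyBounded fun l => max (n l) 1 := by
      obtain ⟨q, hq⟩ := hn
      refine ⟨q + 1, fun l => ?_⟩
      have := hq l
      simp; omega
    obtain ⟨ν, hν, hs⟩ := h _ k hn' hk _ (QCrypto.simulator_isQPT Q hA p V)
    obtain ⟨ν', hν', hs'⟩ := h (fun _ => 1) k ⟨1, by simp⟩ hk _ (QCrypto.ownerSimulator_isQPT Q hA p V)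
    refine ⟨_, hν.max_abs hν', fun l => ?_⟩
    obtain ⟨h2, hp, h3, h4, h5⟩ := hb l
    have e1 := (le_abs_self (ν l)).trans (le_max_left _ |ν' l|)
    have e2 := (le_abs_self (ν' l)).trans (le_max_right |ν l| _)
    -- With no copies, the second reduction gives the bound for one copy, and the certain success of
    -- the owner cancels the 1. Otherwise the first reduction applies with `n l` copies.
    rcases Nat.eq_zero_or_pos (n l) with h0 | h0
    · have e3 := hs' l
      beta_reduce at h2 h4 e3 ⊢
      rw [h0, Nat.zero_add] at h2 h4
      rw [QCrypto.flipGame_ownerSimulator Q h2 hp h3 h4 h5] at e3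
      rw [h0]
      push_cast at e3 ⊢
      linarith
    · have e3 := hs l
      beta_reduce at e3 ⊢
      rw [max_eq_left h0, QCrypto.flipGame_simulator Q h0 h2 h3 h4] at e3
      linarith
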